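/- **Conventions.** Let $\mathscr F$ be the Duskin nerve of the strict $(2,1)$-category of finite groupoids (finitely many objects and morphisms), functors and natural transformations, and let $\mathscr F_\dagger\subset\mathscr F$ be spanned by all objects and the faithful functors. For a quasi-category with two classes of morphisms ("ingressive" and "egressive"), an $n$-simplex of the effective Burnside category $A^{\rm eff}$ is a diagram $X$ with objects $X_{ij}$ ($0\le i\le j\le n$) and maps $X_{ij}\to X_{kl}$ for $i\le k\le l\le j$, in which all maps $X_{ij}\to X_{kj}$ are ingressive, all maps $X_{ij}\to X_{il}$ are egressive, and all the squares with corners $X_{ij},X_{kj},X_{il},X_{kl}$ are homotopy pullbacks. The *global effective Burnside category* is $A_{\rm gl}:=A^{\rm eff}(\mathscr F,\mathscr F_\dagger,\mathscr F)$ (spans of finite groupoids with faithful forward, i.e. ingressive, leg); reading spans backwards gives $(A_{\rm gl})^{\rm op}\cong A^{\rm eff}(\mathscr F,\mathscr F,\mathscr F_\dagger)$ (faithful backward leg). For a finite groupoid $G$ let ${\rm h}\mathbb F_G$ be the homotopy category of the full sub-$2$-category of the $2$-slice over $G$ on the functors $X\to G$ with $X$ a finite essentially discrete groupoid: its morphisms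 are the isomorphism classes of pairs of a functor $\alpha\colon X\to Y$ and a natural isomorphism filling the triangle over $G$. Then $\psi(G)={\rm h}\mathbb F_G$, $\psi(f)=f_!$ (postcomposition) is a strict $2$-functor to the $2$-category $\mathbf{Cat}^{\amalg}$ of categories with finite coproducts, finite-coproduct-preserving functors and natural transformations. $\mathbf{Cat}^{\amalg}_{(2,1)}$ and $\mathbf{SymMonCat}_{(2,1)}$ (symmetric monoidal categories, strong symmetric monoidal functors, symmetric monoidal transformations) denote the $(2,1)$-categories obtained by keeping only the invertible $2$-cells, ${\rm N}_\Delta$ is their nerve, and ${\rm core}\colon\mathbf{Cat}^\amalg_{(2,1)}\to\mathbf{SymMonCat}_{(2,1)}$ takes the maximal subgroupoid, with the cocartesian symmetric monoidal structure. For a finite group $H$, $\mathfrak F_H=\coprod_{n\ge0}B(\Sigma_n\wr H)$ is the permutative category with $\oplus$ given by addition of natural numbers and block sum. **Theorem.** For every faithful functor $i$ of finite groupoids, $i_!$ has a right adjoint $i^*$ in $\mathbf{Cat}^\amalg$. For every choice of such adjunctions $i_!\dashv i^*$ that is normalized by ${\rm id}^*={\rm id}$ (with the identity adjunction), there is a unique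 functor $$\Psi\colon (A_{\rm gl})^{\rm op}\cong A^{\rm eff}(\mathscr F,\mathscr F,\mathscr F_\dagger)\longrightarrow {\rm N}_\Delta(\mathbf{Cat}^\amalg_{(2,1)})$$ with $\Psi(G)={\rm h}\mathbb F_G$ that sends a span $H\xleftarrow{\,i\,}X\xrightarrow{\,f\,}G$ with $i$ faithful to $f_!\,i^*$, and a $2$-simplex $X$, with backward legs $j_{ab}\colon X_{ab}\to X_{aa}$ and forward legs $g_{ab}\colon X_{ab}\to X_{bb}$ and with $p\colon X_{02}\to X_{01}$, $q\colon X_{02}\to X_{12}$, to the pasting $$g_{02!}\,j_{02}^*\;\cong\; g_{12!}\,q_!\,p^*\,j_{01}^*\;\cong\; g_{12!}\,j_{12}^*\,g_{01!}\,j_{01}^*$$ of the image under $\psi$ of the $2$-cell $g_{02}\cong g_{12}q$, the mate of the image of the $2$-cell $j_{02}\cong j_{01}p$, and the Beck–Chevalley mate $q_!p^*\cong j_{12}^*g_{01!}$ of the image of the $2$-cell of the homotopy pullback square. The composite $${\rm core}\circ\Psi\colon (A_{\rm gl})^{\rm op}\longrightarrow {\rm N}_\Delta(\mathbf{SymMonCat}_{(2,1)})$$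 is fully faithful, i.e. induces homotopy equivalences on all mapping spaces ${\rm Hom}^{\rm R}$. Its essential image consists precisely of those symmetric monoidal categories that are equivalent, by a strong symmetric monoidal equivalence, to a finite product $\prod_{i=1}^n{\rm core}\,{\rm h}\mathbb F_{BH_i}$ for some $n\ge0$ and finite groups $H_1,\dots,H_n$; equivalently, to a finite product $\prod_{i=1}^n\mathfrak F_{H_i}$. Moreover, ${\rm core}\,{\rm h}\mathbb F_{BH}$ and $\mathfrak F_H$ are equivalent as symmetric monoidal categories for every finite group $H$. -/

import Mathlib

open CategoryTheory Bicategory Opposite Simplicial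

universe t w v u

namespace GlobalBurnside

/-! ### Normal functors from a preorder to a bicategory, and the Duskin nerve -/

/-- The data underlying a normal functor from a preorder `P` to a bicategory `B`: objects,
`1`-cells, and `2`-cells from the `1`-cell of a composite to the composite of the `1`-cells. -/
@[ext]
structure NormalData (P : Type) [Preorder P] (B : Type u) [Bicategory.{w, v} B] where
  obj : P → B
  map : ∀ {i j : P}, i ≤ j → (obj i ⟶ obj j)
  cell : ∀ {i j k : P} (hij : i ≤ j) (hjk : j ≤ k), map (hij.trans hjk) ⟶ map hij ≫ map hjk

/-- A strictly unitary functor from the preorder `P` to the `(2,1)`-category underlying `B`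
(all structure `2`-cells are invertible).  For `P = {0 < ⋯ < n}` these are the `n`-simplices of
the Duskin nerve of the `(2,1)`-category underlying `B`, and for general `P` they are the maps of
simplicial sets from the nerve of `P` to this Duskin nerve. -/
@[ext]
structure NormalFunctor (P : Type) [Preorder P] (B : Type u) [Bicategory.{w, v} B]
    extends NormalData P B where
  map_refl : ∀ i : P, map (le_refl i) = 𝟙 (obj i)
  cell_refl_left : ∀ {i j : P} (h : i ≤ j),
    cell (le_refl i) h ≫ eqToHom (map_refl i) ▷ map h ≫ (λ_ (map h)).hom = 𝟙 (map h)
  cell_refl_right : ∀ {i j : P} (h : i ≤ j),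
    cell h (le_refl j) ≫ map h ◁ eqToHom (map_refl j) ≫ (ρ_ (map h)).hom = 𝟙 (map h)
  cocycle : ∀ {i j k l : P} (hij : i ≤ j) (hjk : j ≤ k) (hkl : k ≤ l),
    cell (hij.trans hjk) hkl ≫ cell hij hjk ▷ map hkl ≫ (α_ _ _ _).hom =
      cell hij (hjk.trans hkl) ≫ map hij ◁ cell hjk hkl
  cell_isIso : ∀ {i j k : P} (hij : i ≤ j) (hjk : j ≤ k), IsIso (cell hij hjk)

namespace NormalFunctor

variable {P Q R : Type} [Preorder P] [Preorder Q] [Preorder R] {B : Type u} [Bicategory.{w, v} B]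

/-- Restriction of a normal functor along a monotone map. -/
def comap (f : P →o Q) (X : NormalFunctor Q B) : NormalFunctor P B where
  obj i := X.obj (f i)
  map h := X.map (f.monotone h)
  cell hij hjk := X.cell (f.monotone hij) (f.monotone hjk)
  map_refl i := X.map_refl (f i)
  cell_refl_left h := X.cell_refl_left (f.monotone h)
  cell_refl_right h := X.cell_refl_right (f.monotone h)
  cocycle hij hjk hkl := X.cocycle (f.monotone hij) (f.monotone hjk) (f.monotone hkl)
  cell_isIso hij hjk := X.cell_isIso (f.monotone hij) (f.monotone hjk)

end NormalFunctor

/-- The Duskin nerve of the `(2,1)`-category underlying the bicategory `B` (i.e. of `B` with all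
non-invertible `2`-cells discarded). -/
def duskinNerve (B : Type u) [Bicategory.{w, v} B] : SSet.{max w v u} where
  obj n := NormalFunctor (Fin (n.unop.len + 1)) B
  map θ := ↾ fun X => X.comap θ.unop.toOrderHom
  map_id _ := rfl
  map_comp _ _ := rfl

/-! ### The twisted arrow poset, homotopy pullbacks, effective Burnside categories -/

/-- The opposite of the twisted arrow category of the preorder `P`: its elements are the pairs
`i ≤ j`, and there is a (unique) morphism from `(i ≤ j)` to `(k ≤ l)` iff `i ≤ k ≤ l ≤ j`. -/
@[ext]
structure TwArr (P : Type) [Preorder P] where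
  src : P
  tgt : P
  le : src ≤ tgt

namespace TwArr

variable {P Q : Type} [Preorder P] [Preorder Q]

instance : Preorder (TwArr P) where
  le a b := a.src ≤ b.src ∧ b.tgt ≤ a.tgt
  le_refl a := ⟨le_rfl, le_rfl⟩
  le_trans _ _ _ h h' := ⟨h.1.trans h'.1, h'.2.trans h.2⟩

/-- Functoriality of the twisted arrow category. -/
def mapHom (f : P →o Q) : TwArr P →o TwArr Q where
  toFun a := ⟨f a.src, f a.tgt, f.monotone a.le⟩
  monotone' _ _ h := ⟨f.monotone h.1, f.monotone h.2⟩

/-- The morphism `(i ≤ j) → (k ≤ j)` for `i ≤ k ≤ j`. -/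
lemma le_fwd {i k j : P} (hik : i ≤ k) (hkj : k ≤ j) :
    (⟨i, j, hik.trans hkj⟩ : TwArr P) ≤ ⟨k, j, hkj⟩ := ⟨hik, le_rfl⟩

/-- The morphism `(i ≤ j) → (i ≤ l)` for `i ≤ l ≤ j`. -/
lemma le_bwd {i l j : P} (hil : i ≤ l) (hlj : l ≤ j) :
    (⟨i, j, hil.trans hlj⟩ : TwArr P) ≤ ⟨i, l, hil⟩ := ⟨le_rfl, hlj⟩

end TwArr

/-- The square
```
  a  ⟶  b      (g on top)
  ↓     ↓      (j on the left, i on the right)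
  c  ⟶  d      (f at the bottom)
```
commuting up to the invertible `2`-cell `σ : g ≫ i ⟶ j ≫ f` is a homotopy pullback in the
`(2,1)`-category underlying `B`: for every `t`, the functor from the groupoid of `1`-cells `t ⟶ a`
to the homotopy pullback of the groupoids of `1`-cells is essentially surjective
and fully faithful. -/
structure IsHomotopyPullback {B : Type u} [Bicategory.{w, v} B] {a b c d : B}
    (g : a ⟶ b) (j : a ⟶ c) (i : b ⟶ d) (f : c ⟶ d) (σ : g ≫ i ≅ j ≫ f) : Prop where
  essSurj : ∀ (t : B) (x : t ⟶ b) (y : t ⟶ c) (θ : x ≫ i ≅ y ≫ f),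
    ∃ (z : t ⟶ a) (β : z ≫ g ≅ x) (γ : z ≫ j ≅ y),
      β.hom ▷ i ≫ θ.hom = (α_ z g i).hom ≫ z ◁ σ.hom ≫ (α_ z j f).inv ≫ γ.hom ▷ f
  full_faithful : ∀ (t : B) (z z' : t ⟶ a) (β : z ≫ g ≅ z' ≫ g) (γ : z ≫ j ≅ z' ≫ j),
    β.hom ▷ i ≫ (α_ z' g i).hom ≫ z' ◁ σ.hom ≫ (α_ z' j f).inv =
        (α_ z g i).hom ≫ z ◁ σ.hom ≫ (α_ z j f).inv ≫ γ.hom ▷ f →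
      ∃! φ : z ≅ z', φ.hom ▷ g = β.hom ∧ φ.hom ▷ j = γ.hom

lemma IsHomotopyPullback.symm {B : Type u} [Bicategory.{w, v} B] {a b c d : B}
    {g : a ⟶ b} {j : a ⟶ c} {i : b ⟶ d} {f : c ⟶ d} {σ : g ≫ i ≅ j ≫ f}
    (h : IsHomotopyPullback g j i f σ) : IsHomotopyPullback j g f i σ.symm where
  essSurj t x y θ := by
    obtain ⟨z, β, γ, e⟩ := h.essSurj t y x θ.symm
    refine ⟨z, γ, β, ?_⟩
    rw [← cancel_mono θ.inv]
    simp only [Category.assoc, Iso.hom_inv_id, Category.comp_id, Iso.symm_hom] at e ⊢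
    rw [e]
    simp
  full_faithful t z z' β γ e := by
    obtain ⟨φ, ⟨h₁, h₂⟩, h₃⟩ := h.full_faithful t z z' γ β (by
      have := congrArg (fun q => z ◁ σ.hom ≫ (α_ _ _ _).inv ≫ q ≫ (α_ _ _ _).hom ≫ z' ◁ σ.hom) e
      simp only [Iso.symm_hom, Category.assoc, Iso.inv_hom_id_assoc,
        whiskerLeft_inv_hom, whiskerLeft_hom_inv_assoc, Category.comp_id] at this
      rw [← cancel_epi (α_ z g i).inv, ← cancel_mono (α_ z' j f).hom]
      simp only [Category.assoc, Iso.inv_hom_id_assoc, Iso.inv_hom_id, Category.comp_id]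
      exact this.symm)
    exact ⟨φ, ⟨h₂, h₁⟩, fun ψ hψ => h₃ ψ ⟨hψ.2, hψ.1⟩⟩

namespace NormalFunctor

variable {n : ℕ} {B : Type u} [Bicategory.{w, v} B]

/-- The invertible `2`-cell filling the square of `X` attached to `i ≤ k ≤ l ≤ j`, with corners
`X (i, j)`, `X (k, j)`, `X (i, l)`, `X (k, l)`; it is obtained by pasting the two triangles along
the diagonal `X (i, j) ⟶ X (k, l)`. -/
noncomputable def squareIso {P : Type} [Preorder P] (X : NormalFunctor (TwArr P) B) {i k l j : P}
    (hik : i ≤ k) (hkl : k ≤ l) (hlj : l ≤ j) :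
    X.map (TwArr.le_fwd hik (hkl.trans hlj)) ≫ X.map (TwArr.le_bwd hkl hlj) ≅
      X.map (TwArr.le_bwd (hik.trans hkl) hlj) ≫ X.map (TwArr.le_fwd hik hkl) :=
  haveI := X.cell_isIso (TwArr.le_fwd hik (hkl.trans hlj)) (TwArr.le_bwd hkl hlj)
  haveI := X.cell_isIso (TwArr.le_bwd (hik.trans hkl) hlj) (TwArr.le_fwd hik hkl)
  (asIso (X.cell (TwArr.le_fwd hik (hkl.trans hlj)) (TwArr.le_bwd hkl hlj))).symm ≪≫
    asIso (X.cell (TwArr.le_bwd (hik.trans hkl) hlj) (TwArr.le_fwd hik hkl))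

end NormalFunctor

/-- An `n`-simplex of the effective Burnside category of (the `(2,1)`-category underlying) `B`
with respect to classes `ingr` of ingressive (forward) and `egr` of egressive (backward) morphisms.
The universe parameter `t` only serves to place the simplices into a larger universe. -/
@[ext]
structure AeffSimplex (B : Type u) [Bicategory.{w, v} B]
    (ingr egr : ∀ ⦃a b : B⦄, (a ⟶ b) → Prop) (n : ℕ) : Type (max t w v u) where
  toFunctor : NormalFunctor (TwArr (Fin (n + 1))) B
  ingressive : ∀ {i k j : Fin (n + 1)} (hik : i ≤ k) (hkj : k ≤ j),
    ingr (toFunctor.map (TwArr.le_fwd hik hkj))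
  egressive : ∀ {i l j : Fin (n + 1)} (hil : i ≤ l) (hlj : l ≤ j),
    egr (toFunctor.map (TwArr.le_bwd hil hlj))
  isPullback : ∀ {i k l j : Fin (n + 1)} (hik : i ≤ k) (hkl : k ≤ l) (hlj : l ≤ j),
    IsHomotopyPullback (toFunctor.map (TwArr.le_fwd hik (hkl.trans hlj)))
      (toFunctor.map (TwArr.le_bwd (hik.trans hkl) hlj))
      (toFunctor.map (TwArr.le_bwd hkl hlj)) (toFunctor.map (TwArr.le_fwd hik hkl))
      (toFunctor.squareIso hik hkl hlj)

namespace AeffSimplex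

variable {B : Type u} [Bicategory.{w, v} B] {ingr egr : ∀ ⦃a b : B⦄, (a ⟶ b) → Prop}

/-- Restriction of simplices along monotone maps. -/
def comap {m n : ℕ} (f : Fin (m + 1) →o Fin (n + 1)) (X : AeffSimplex.{t} B ingr egr n) :
    AeffSimplex.{t} B ingr egr m where
  toFunctor := X.toFunctor.comap (TwArr.mapHom f)
  ingressive hik hkj := X.ingressive (f.monotone hik) (f.monotone hkj)
  egressive hil hlj := X.egressive (f.monotone hil) (f.monotone hlj)
  isPullback hik hkl hlj := X.isPullback (f.monotone hik) (f.monotone hkl) (f.monotone hlj)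

end AeffSimplex

/-- The order reversal `(i ≤ j) ↦ (n - j ≤ n - i)` of the twisted arrow category. -/
def TwArr.rev (n : ℕ) : TwArr (Fin (n + 1)) →o TwArr (Fin (n + 1)) where
  toFun a := ⟨a.tgt.rev, a.src.rev, Fin.rev_le_rev.2 a.le⟩
  monotone' _ _ h := ⟨Fin.rev_le_rev.2 h.2, Fin.rev_le_rev.2 h.1⟩

/-- Reading an `n`-simplex backwards interchanges ingressive and egressive morphisms. -/
def AeffSimplex.rev {B : Type u} [Bicategory.{w, v} B] {ingr egr : ∀ ⦃a b : B⦄, (a ⟶ b) → Prop}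
    {n : ℕ} (X : AeffSimplex.{t} B ingr egr n) : AeffSimplex.{t} B egr ingr n where
  toFunctor := X.toFunctor.comap (TwArr.rev n)
  ingressive hik hkj := X.egressive (Fin.rev_le_rev.2 hkj) (Fin.rev_le_rev.2 hik)
  egressive hil hlj := X.ingressive (Fin.rev_le_rev.2 hlj) (Fin.rev_le_rev.2 hil)
  isPullback hik hkl hlj := by
    have := (X.isPullback (Fin.rev_le_rev.2 hlj) (Fin.rev_le_rev.2 hkl)
      (Fin.rev_le_rev.2 hik)).symm
    have e : (X.toFunctor.comap (TwArr.rev n)).squareIso hik hkl hlj =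
        (X.toFunctor.squareIso (Fin.rev_le_rev.2 hlj) (Fin.rev_le_rev.2 hkl)
          (Fin.rev_le_rev.2 hik)).symm :=
      Iso.ext (by simp [NormalFunctor.squareIso]; rfl)
    rw [e]
    exact this

/-- The effective Burnside category of (the `(2,1)`-category underlying) `B` as a simplicial set:
its vertices are the objects of `B`, its edges from `a` to `b` are the spans `a ⟵ x ⟶ b` whose
backward leg is egressive and whose forward leg is ingressive, and its higher simplices are
diagrams of spans composed by homotopy pullbacks. -/
def effBurnside (B : Type u) [Bicategory.{w, v} B]
    (ingr egr : ∀ ⦃a b : B⦄, (a ⟶ b) → Prop) : SSet.{max t w v u} where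
  obj n := AeffSimplex.{t} B ingr egr n.unop.len
  map θ := ↾ fun X => X.comap θ.unop.toOrderHom
  map_id _ := rfl
  map_comp _ _ := rfl

lemma AeffSimplex.rev_rev {B : Type u} [Bicategory.{w, v} B]
    {ingr egr : ∀ ⦃a b : B⦄, (a ⟶ b) → Prop} {n : ℕ} (X : AeffSimplex.{t} B ingr egr n) :
    X.rev.rev = X := by
  have h : (TwArr.rev n).comp (TwArr.rev n) = OrderHom.id :=
    OrderHom.ext _ _ (funext fun _ => TwArr.ext (Fin.rev_rev _) (Fin.rev_rev _))
  have h' := congrArg (fun f => X.toFunctor.comap f) h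
  exact AeffSimplex.ext h'

/-- The canonical isomorphism between the opposite of the effective Burnside category and the
effective Burnside category for the interchanged classes of morphisms, reading spans backwards. -/
def effBurnsideOpIso (B : Type u) [Bicategory.{w, v} B]
    (ingr egr : ∀ ⦃a b : B⦄, (a ⟶ b) → Prop) :
    (effBurnside.{t} B ingr egr).op ≅ effBurnside.{t} B egr ingr :=
  NatIso.ofComponents
    (fun n => 
      { hom := ↾ fun X => AeffSimplex.rev (SSet.opObjEquiv X)
        inv := ↾ fun X => SSet.opObjEquiv.symm (AeffSimplex.rev X)
        hom_inv_id := by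
          ext X
          exact AeffSimplex.rev_rev (SSet.opObjEquiv X)
        inv_hom_id := by
          ext X
          exact AeffSimplex.rev_rev X })
    (fun {m n} θ => by
      ext X
      have h : (TwArr.mapHom (SimplexCategory.rev.map θ.unop).toOrderHom).comp
          (TwArr.rev n.unop.len) =
          (TwArr.rev m.unop.len).comp (TwArr.mapHom θ.unop.toOrderHom) :=
        OrderHom.ext _ _ (funext fun a => TwArr.ext
          (congrArg (fun q => (θ.unop.toOrderHom q).rev) (Fin.rev_rev a.tgt))
          (congrArg (fun q => (θ.unop.toOrderHom q).rev) (Fin.rev_rev a.src)))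
      exact AeffSimplex.ext
        (congrArg (fun f => (SSet.opObjEquiv X : AeffSimplex B ingr egr _).toFunctor.comap f) h))

/-! ### Mapping spaces, fully faithful functors and essential images -/

/-- The extension `[m + 1] → [n + 1]` of `θ : [m] → [n]` preserving the last vertex. -/
def joinLast {m n : SimplexCategory} (θ : m ⟶ n) : ⦋m.len + 1⦌ ⟶ ⦋n.len + 1⦌ :=
  SimplexCategory.Hom.mk
    { toFun := Fin.lastCases (Fin.last (n.len + 1)) (fun i => (θ.toOrderHom i).castSucc)
      monotone' := by
        intro i j h
        induction j using Fin.lastCases with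
        | last => simpa using Fin.le_last _
        | cast j =>
          induction i using Fin.lastCases with
          | last => exact absurd h (not_le.2 (Fin.castSucc_lt_last j))
          | cast i => simpa using θ.toOrderHom.monotone (by simpa using h) }

lemma joinLast_castSucc {m n : SimplexCategory} (θ : m ⟶ n) (i : Fin (m.len + 1)) :
    (joinLast θ).toOrderHom i.castSucc = (θ.toOrderHom i).castSucc :=
  Fin.lastCases_castSucc (motive := fun _ => Fin (n.len + 1 + 1)) (last := Fin.last (n.len + 1))
    (cast := fun i => (θ.toOrderHom i).castSucc) i

lemma joinLast_last {m n : SimplexCategory} (θ : m ⟶ n) :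
    (joinLast θ).toOrderHom (Fin.last (m.len + 1)) = Fin.last (n.len + 1) :=
  Fin.lastCases_last (motive := fun _ => Fin (n.len + 1 + 1)) (last := Fin.last (n.len + 1))
    (cast := fun i => (θ.toOrderHom i).castSucc)

/-- The inclusion `[n] → [n + 1]` omitting the last vertex. -/
def initFace (n : SimplexCategory) : n ⟶ ⦋n.len + 1⦌ :=
  SimplexCategory.Hom.mk Fin.castSuccOrderEmb.toOrderHom

/-- The last vertex of `[n + 1]`. -/
def lastVertex (n : SimplexCategory) : ⦋0⦌ ⟶ ⦋n.len + 1⦌ :=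
  SimplexCategory.const _ _ (Fin.last (n.len + 1))

/-- The unique map `[n] → [0]`. -/
def toPoint (n : SimplexCategory) : n ⟶ ⦋0⦌ := SimplexCategory.const _ _ 0

lemma hom_ext_fun {m n : SimplexCategory} {f g : m ⟶ n}
    (h : ∀ i, f.toOrderHom i = g.toOrderHom i) : f = g :=
  SimplexCategory.Hom.ext _ _ (OrderHom.ext _ _ (funext h))

lemma initFace_joinLast {m n : SimplexCategory} (θ : m ⟶ n) :
    initFace m ≫ joinLast θ = θ ≫ initFace n :=
  hom_ext_fun fun i => joinLast_castSucc θ i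

lemma lastVertex_joinLast {m n : SimplexCategory} (θ : m ⟶ n) :
    lastVertex m ≫ joinLast θ = lastVertex n :=
  hom_ext_fun fun _ => joinLast_last θ

/-- The right mapping space of the simplicial set `X` from `x` to `y`: its `n`-simplices are the
`(n + 1)`-simplices of `X` whose face opposite to the last vertex is constant at `x` and whose
last vertex is `y`. -/
def homRight (X : SSet.{u}) (x y : X _⦋0⦌) : SSet.{u} where
  obj n := { σ : X _⦋n.unop.len + 1⦌ //
    X.map (initFace n.unop).op σ = X.map (toPoint n.unop).op x ∧
      X.map (lastVertex n.unop).op σ = y }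
  map {n m} θ := ↾ fun σ => ⟨X.map (joinLast θ.unop).op σ.1, by
    constructor
    · rw [← Functor.map_comp_apply, ← op_comp, initFace_joinLast, op_comp,
        Functor.map_comp_apply, σ.2.1, ← Functor.map_comp_apply, ← op_comp]
      rfl
    · rw [← Functor.map_comp_apply, ← op_comp, lastVertex_joinLast, σ.2.2]⟩
  map_id n := by
    ext σ
    have : joinLast (𝟙 n.unop) = 𝟙 _ := hom_ext_fun fun i => by
      induction i using Fin.lastCases with
      | last => exact joinLast_last _
      | cast i => exact joinLast_castSucc _ i
    change X.map (joinLast (𝟙 n.unop)).op σ.1 = σ.1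
    rw [this, op_id, Functor.map_id_apply]
  map_comp {n m k} θ η := by
    ext σ
    have : joinLast (η.unop ≫ θ.unop) = joinLast η.unop ≫ joinLast θ.unop :=
      hom_ext_fun fun i => by
        induction i using Fin.lastCases with
        | last =>
          exact (joinLast_last _).trans ((joinLast_last θ.unop).symm.trans
            (congrArg (joinLast θ.unop).toOrderHom (joinLast_last η.unop).symm))
        | cast i =>
          exact (joinLast_castSucc _ i).trans ((joinLast_castSucc θ.unop _).symm.trans
            (congrArg (joinLast θ.unop).toOrderHom (joinLast_castSucc η.unop i).symm))
    change X.map (joinLast (η.unop ≫ θ.unop)).op σ.1 = _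
    rw [this, op_comp, Functor.map_comp_apply]
    rfl

/-- The map induced by a map of simplicial sets on right mapping spaces. -/
def homRightMap {X Y : SSet.{u}} (f : X ⟶ Y) (x y : X _⦋0⦌) :
    homRight X x y ⟶ homRight Y (f.app _ x) (f.app _ y) where
  app n := ↾ fun σ => ⟨f.app _ σ.1, by
    rw [← NatTrans.naturality_apply, σ.2.1, NatTrans.naturality_apply], by
    rw [← NatTrans.naturality_apply, σ.2.2]⟩
  naturality n m θ := by
    ext ⟨σ, hσ⟩
    have h : f.app _ (X.map (joinLast θ.unop).op σ) = Y.map (joinLast θ.unop).op (f.app _ σ) :=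
      NatTrans.naturality_apply f _ _
    exact Subtype.ext h

/-- A map of simplicial sets is a (simplicial) homotopy equivalence if it has an inverse up to
simplicial homotopy.  Between Kan complexes these are precisely the weak homotopy equivalences. -/
def IsHomotopyEquivalence {K L : SSet.{u}} (f : K ⟶ L) : Prop :=
  ∃ g : L ⟶ K, Nonempty (SSet.Homotopy (f ≫ g) (𝟙 K)) ∧ Nonempty (SSet.Homotopy (g ≫ f) (𝟙 L))

/-- A functor of quasi-categories is fully faithful if it induces homotopy equivalences on all
mapping spaces. -/
def IsFullyFaithful {X Y : SSet.{u}} (f : X ⟶ Y) : Prop :=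
  ∀ x y : X _⦋0⦌, IsHomotopyEquivalence (homRightMap f x y)

/-- A vertex `y` of the quasi-category `Y` lies in the essential image of `f : X ⟶ Y` if there is
an invertible edge from `f x` to `y` for some vertex `x` of `X`. -/
def InEssImage {X Y : SSet.{u}} (f : X ⟶ Y) (y : Y _⦋0⦌) : Prop :=
  ∃ (x : X _⦋0⦌) (e : SSet.Edge (f.app _ x) y), Nonempty e.InvStruct

/-! ### Finite groupoids -/

/-- A finite groupoid: finitely many objects and finitely many morphisms. -/
structure FinGrpd : Type (u + 1) where
  carrier : Type u
  [cat : Category.{u} carrier]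
  [isGroupoid : IsGroupoid carrier]
  [finite_obj : Finite carrier]
  [finite_hom : ∀ x y : carrier, Finite (x ⟶ y)]

attribute [instance] FinGrpd.cat FinGrpd.isGroupoid FinGrpd.finite_obj FinGrpd.finite_hom

/-- The strict `(2,1)`-category of finite groupoids, functors and natural transformations. -/
instance : Bicategory FinGrpd.{u} where
  Hom A B := A.carrier ⥤ B.carrier
  id A := 𝟭 A.carrier
  comp F G := F ⋙ G
  homCategory A B := inferInstanceAs (Category (A.carrier ⥤ B.carrier))
  whiskerLeft F _ _ η := Functor.whiskerLeft F η
  whiskerRight η H := Functor.whiskerRight η H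
  associator F G H := Functor.associator F G H
  leftUnitor F := Functor.leftUnitor F
  rightUnitor F := Functor.rightUnitor F
  whiskerLeft_id _ _ := rfl
  whiskerLeft_comp _ _ _ _ _ _ := rfl
  id_whiskerLeft η := by ext; simp
  comp_whiskerLeft _ _ _ _ _ := by ext; simp
  id_whiskerRight F G := Functor.whiskerRight_id' G
  comp_whiskerRight η θ H := Functor.whiskerRight_comp η θ H
  whiskerRight_id η := by ext; simp
  whiskerRight_comp _ _ _ := by ext; simp
  whisker_assoc _ _ _ _ _ := by ext; simp
  whisker_exchange η θ := NatTrans.ext (funext fun x => (θ.naturality (η.app x)).symm)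
  pentagon _ _ _ _ := by ext; simp
  triangle _ _ := by ext; simp

/-- An object of the slice `2`-category `𝔽_G`: a functor `proj : total ⥤ G` of finite groupoids
such that `total ⥤ *` is faithful, i.e. such that `total` is essentially discrete. -/
structure FinCover (G : FinGrpd.{u}) : Type (u + 1) where
  total : FinGrpd.{u}
  proj : total.carrier ⥤ G.carrier
  thin : ∀ x y : total.carrier, Subsingleton (x ⟶ y)

namespace FinCover

variable {G : FinGrpd.{u}}

/-- A `1`-cell of `𝔽_G`: a functor together with a `2`-cell filling the triangle over `G`. -/
structure OneCell (X Y : FinCover G) : Type u where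
  functor : X.total.carrier ⥤ Y.total.carrier
  cell : X.proj ≅ functor ⋙ Y.proj

/-- Two `1`-cells of `𝔽_G` are identified in the homotopy category if they are related by an
invertible `2`-cell of `𝔽_G`. -/
instance OneCell.setoid (X Y : FinCover G) : Setoid (OneCell X Y) where
  r α β := ∃ φ : α.functor ≅ β.functor, ∀ x : X.total.carrier,
    α.cell.hom.app x ≫ Y.proj.map (φ.hom.app x) = β.cell.hom.app x
  iseqv :=
    { refl := fun α => ⟨Iso.refl _, by simp⟩
      symm := by
        rintro α β ⟨φ, h⟩
        exact ⟨φ.symm, fun x => by simp [← h x, ← Functor.map_comp]⟩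
      trans := by
        rintro α β γ ⟨φ, h⟩ ⟨ψ, h'⟩
        exact ⟨φ ≪≫ ψ, fun x => by simp [← h' x, ← h x]⟩ }

/-- The identity `1`-cell. -/
def OneCell.id (X : FinCover G) : OneCell X X where
  functor := 𝟭 _
  cell := Iso.refl X.proj

/-- Composition of `1`-cells. -/
def OneCell.comp {X Y Z : FinCover G} (α : OneCell X Y) (β : OneCell Y Z) : OneCell X Z where
  functor := α.functor ⋙ β.functor
  cell := α.cell ≪≫ Functor.isoWhiskerLeft α.functor β.cell

/-- Morphisms in the homotopy category of `𝔽_G`. -/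
def HomClass (X Y : FinCover G) : Type u := _root_.Quotient (OneCell.setoid X Y)

/-- The class of a `1`-cell. -/
def OneCell.toHom {X Y : FinCover G} (α : OneCell X Y) : HomClass X Y := Quotient.mk _ α

lemma OneCell.comp_congr {X Y Z : FinCover G} {α α' : OneCell X Y} {β β' : OneCell Y Z}
    (h : α ≈ α') (h' : β ≈ β') : α.comp β ≈ α'.comp β' := by
  obtain ⟨φ, h⟩ := h
  obtain ⟨ψ, h'⟩ := h'
  refine ⟨Functor.isoWhiskerRight φ _ ≪≫ Functor.isoWhiskerLeft _ ψ, fun x => ?_⟩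
  have e := β.cell.hom.naturality (φ.hom.app x)
  simp only [Functor.comp_obj, Functor.comp_map] at e
  simp only [OneCell.comp, Iso.trans_hom, NatTrans.comp_app, Functor.isoWhiskerLeft_hom,
    Functor.isoWhiskerRight_hom, Functor.whiskerLeft_app, Functor.whiskerRight_app,
    Functor.map_comp, Category.assoc, ← h x, ← h' (α'.functor.obj x), Functor.comp_obj]
  rw [← reassoc_of% e]

/-- The homotopy category `h𝔽_G`. -/
instance : Category.{u} (FinCover G) where
  Hom X Y := HomClass X Y
  id X := (OneCell.id X).toHom
  comp := Quotient.map₂ OneCell.comp (fun _ _ h _ _ h' => OneCell.comp_congr h h')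
  id_comp := by
    rintro X Y ⟨α⟩
    exact Quotient.sound ⟨Functor.leftUnitor _, by simp [OneCell.comp, OneCell.id]⟩
  comp_id := by
    rintro X Y ⟨α⟩
    exact Quotient.sound ⟨Functor.rightUnitor _, by simp [OneCell.comp, OneCell.id]⟩
  assoc := by
    rintro X Y Z W ⟨α⟩ ⟨β⟩ ⟨γ⟩
    exact Quotient.sound ⟨Functor.associator _ _ _, by simp [OneCell.comp]⟩

/-- The morphism of `h𝔽_G` represented by a `1`-cell. -/
def homMk {X Y : FinCover G} (α : OneCell X Y) : X ⟶ Y := α.toHom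

lemma homMk_surjective {X Y : FinCover G} (f : X ⟶ Y) : ∃ α : OneCell X Y, homMk α = f :=
  Quotient.exists_rep f

lemma homMk_comp {X Y Z : FinCover G} (α : OneCell X Y) (β : OneCell Y Z) :
    homMk α ≫ homMk β = homMk (α.comp β) := rfl

lemma homMk_eq {X Y : FinCover G} {α β : OneCell X Y} (φ : α.functor ≅ β.functor)
    (h : ∀ x : X.total.carrier,
      α.cell.hom.app x ≫ Y.proj.map (φ.hom.app x) = β.cell.hom.app x) :
    homMk α = homMk β := Quotient.sound ⟨φ, h⟩

lemma exists_of_homMk_eq {X Y : FinCover G} {α β : OneCell X Y} (h : homMk α = homMk β) :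
    ∃ φ : α.functor ≅ β.functor, ∀ x : X.total.carrier,
      α.cell.hom.app x ≫ Y.proj.map (φ.hom.app x) = β.cell.hom.app x := Quotient.exact h

end FinCover

/-! ### The functoriality of `h𝔽` -/

namespace FinCover

variable {G H K : FinGrpd.{u}}

/-- Postcomposition with a functor `f : G ⥤ H` on objects. -/
def pushObj (f : G.carrier ⥤ H.carrier) (X : FinCover G) : FinCover H where
  total := X.total
  proj := X.proj ⋙ f
  thin := X.thin

/-- Postcomposition with a functor `f : G ⥤ H` on `1`-cells. -/
def OneCell.push (f : G.carrier ⥤ H.carrier) {X Y : FinCover G} (α : OneCell X Y) :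
    OneCell (pushObj f X) (pushObj f Y) where
  functor := α.functor
  cell := Functor.isoWhiskerRight α.cell f

/-- The functor `f_! : h𝔽_G ⥤ h𝔽_H` given by postcomposition with `f`. -/
def push (f : G.carrier ⥤ H.carrier) : FinCover G ⥤ FinCover H where
  obj := pushObj f
  map {X Y} := Quotient.map (OneCell.push f) (by
    rintro α β ⟨φ, h⟩
    exact ⟨φ, fun (x : X.total.carrier) =>
      (f.map_comp _ _).symm.trans (congrArg f.map (h x))⟩)
  map_id X := homMk_eq (X := pushObj f X) (Y := pushObj f X)
    (α := (OneCell.id X).push f) (β := OneCell.id _) (Iso.refl (𝟭 X.total.carrier))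
    fun (x : X.total.carrier) => by
      change f.map (𝟙 _) ≫ f.map (X.proj.map (𝟙 _)) = 𝟙 (f.obj (X.proj.obj x))
      simp
  map_comp := by
    rintro X Y Z ⟨α⟩ ⟨β⟩
    exact homMk_eq (X := pushObj f X) (Y := pushObj f Z)
      (α := (α.comp β).push f) (β := (α.push f).comp (β.push f))
      (Iso.refl (α.functor ⋙ β.functor))
      fun (x : X.total.carrier) => by
        change f.map (α.cell.hom.app x ≫ β.cell.hom.app (α.functor.obj x)) ≫
          f.map (Z.proj.map (𝟙 _)) = f.map (α.cell.hom.app x) ≫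
            f.map (β.cell.hom.app (α.functor.obj x))
        simp

lemma push_map_homMk (f : G.carrier ⥤ H.carrier) {X Y : FinCover G} (α : OneCell X Y) :
    (push f).map (homMk α) = homMk (α.push f) := rfl

/-- The `1`-cell from `f_! X` to `g_! X` given by the identity of the total groupoid and a natural
transformation `σ : f ⟶ g`. -/
noncomputable def transCell {f g : G.carrier ⥤ H.carrier} (σ : f ⟶ g) (X : FinCover G) :
    OneCell (pushObj f X) (pushObj g X) where
  functor := 𝟭 X.total.carrier
  cell := haveI : IsIso σ := NatIso.isIso_of_isIso_app σ
    Functor.isoWhiskerLeft X.proj (asIso σ)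

lemma transCell_app {f g : G.carrier ⥤ H.carrier} (σ : f ⟶ g) (X : FinCover G)
    (x : X.total.carrier) : (transCell σ X).cell.hom.app x = σ.app (X.proj.obj x) := rfl

/-- The natural transformation `f_! ⟶ g_!` induced by `σ : f ⟶ g`. -/
noncomputable def pushTrans {f g : G.carrier ⥤ H.carrier} (σ : f ⟶ g) : push f ⟶ push g where
  app X := homMk (transCell σ X)
  naturality := by
    rintro X Y ⟨α⟩
    exact homMk_eq (X := pushObj f X) (Y := pushObj g Y)
      (α := (α.push f).comp (transCell σ Y)) (β := (transCell σ X).comp (α.push g))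
      (Iso.refl α.functor)
      fun (x : X.total.carrier) => by
        change (f.map (α.cell.hom.app x) ≫ σ.app (Y.proj.obj (α.functor.obj x))) ≫
          g.map (Y.proj.map (𝟙 _)) = σ.app (X.proj.obj x) ≫ g.map (α.cell.hom.app x)
        simp

lemma push_id_obj (X : FinCover G) : pushObj (𝟭 _) X = X := rfl

lemma push_comp_obj (f : G.carrier ⥤ H.carrier) (g : H.carrier ⥤ K.carrier) (X : FinCover G) :
    pushObj (f ⋙ g) X = pushObj g (pushObj f X) := rfl

lemma push_id : push (𝟭 G.carrier) = 𝟭 (FinCover G) :=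
  CategoryTheory.Functor.hext (fun _ => rfl) (by
    rintro X Y ⟨α⟩
    rfl)

lemma push_comp (f : G.carrier ⥤ H.carrier) (g : H.carrier ⥤ K.carrier) :
    push (f ⋙ g) = push f ⋙ push g :=
  CategoryTheory.Functor.hext (fun _ => rfl) (by
    rintro X Y ⟨α⟩
    rfl)

end FinCover

/-! ### Finite coproducts in `h𝔽_G` -/

/-- The disjoint union of two finite groupoids. -/
def FinGrpd.sum (A B : FinGrpd.{u}) : FinGrpd.{u} where
  carrier := A.carrier ⊕ B.carrier
  isGroupoid :=
    { all_isIso := by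
        rintro (x | x) (y | y) f
        · exact inferInstanceAs (IsIso ((Sum.inl_ A.carrier B.carrier).map (ULift.down f)))
        · exact PEmpty.elim f
        · exact PEmpty.elim f
        · exact inferInstanceAs (IsIso ((Sum.inr_ A.carrier B.carrier).map (ULift.down f))) }
  finite_hom := by
    rintro (x | x) (y | y)
    · exact inferInstanceAs (Finite (ULift (x ⟶ y)))
    · exact inferInstanceAs (Finite PEmpty)
    · exact inferInstanceAs (Finite PEmpty)
    · exact inferInstanceAs (Finite (ULift (x ⟶ y)))

/-- The empty groupoid. -/
def FinGrpd.empty : FinGrpd.{u} where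
  carrier := Discrete PEmpty.{u + 1}
  finite_obj := inferInstance

namespace FinCover

open Limits

variable {G H K : FinGrpd.{u}}

/-- The coproduct of two objects of `h𝔽_G`, for any functor `P` to `G` defined on the disjoint
union of their total groupoids. -/
def sumMk (X Y : FinCover G) (P : X.total.carrier ⊕ Y.total.carrier ⥤ G.carrier) : FinCover G where
  total := X.total.sum Y.total
  proj := P
  thin := by
    have := X.thin
    have := Y.thin
    rintro (x | x) (y | y)
    · exact inferInstanceAs (Subsingleton (ULift (x ⟶ y)))
    · exact inferInstanceAs (Subsingleton PEmpty)
    · exact inferInstanceAs (Subsingleton PEmpty)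
    · exact inferInstanceAs (Subsingleton (ULift (x ⟶ y)))

section

variable {X Y : FinCover G} {P : X.total.carrier ⊕ Y.total.carrier ⥤ G.carrier}
  (a : X.proj ≅ Sum.inl_ X.total.carrier Y.total.carrier ⋙ P)
  (b : Y.proj ≅ Sum.inr_ X.total.carrier Y.total.carrier ⋙ P)

/-- The first coprojection. -/
def inlCell : OneCell X (sumMk X Y P) where
  functor := Sum.inl_ X.total.carrier Y.total.carrier
  cell := a

/-- The second coprojection. -/
def inrCell : OneCell Y (sumMk X Y P) where
  functor := Sum.inr_ X.total.carrier Y.total.carrier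
  cell := b

/-- The `1`-cell out of a coproduct determined by two `1`-cells. -/
def descCell {Z : FinCover G} (α : OneCell X Z) (β : OneCell Y Z) : OneCell (sumMk X Y P) Z where
  functor := Functor.sum' α.functor β.functor
  cell := Functor.sumIsoExt
    (F := P) (G := Functor.sum' α.functor β.functor ⋙ Z.proj) (a.symm ≪≫ α.cell)
    (b.symm ≪≫ β.cell)

lemma hom_ext_sum {Z : FinCover G} {f g : sumMk X Y P ⟶ Z}
    (h₁ : homMk (inlCell a) ≫ f = homMk (inlCell a) ≫ g)
    (h₂ : homMk (inrCell b) ≫ f = homMk (inrCell b) ≫ g) : f = g := by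
  obtain ⟨α, rfl⟩ := homMk_surjective f
  obtain ⟨β, rfl⟩ := homMk_surjective g
  obtain ⟨φ, h₁⟩ := exists_of_homMk_eq h₁
  obtain ⟨ψ, h₂⟩ := exists_of_homMk_eq h₂
  refine homMk_eq (Functor.sumIsoExt φ ψ) ?_
  rintro (x | x)
  · have := h₁ x
    change (a.hom.app x ≫ α.cell.hom.app (Sum.inl x)) ≫ _ =
      a.hom.app x ≫ β.cell.hom.app (Sum.inl x) at this
    exact (cancel_epi (a.hom.app x)).1 ((Category.assoc _ _ _).symm.trans this)
  · have := h₂ x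
    change (b.hom.app x ≫ α.cell.hom.app (Sum.inr x)) ≫ _ =
      b.hom.app x ≫ β.cell.hom.app (Sum.inr x) at this
    exact (cancel_epi (b.hom.app x)).1 ((Category.assoc _ _ _).symm.trans this)

lemma inl_desc {Z : FinCover G} (α : OneCell X Z) (β : OneCell Y Z) :
    homMk (inlCell a) ≫ homMk (descCell a b α β) = homMk α :=
  homMk_eq (α := (inlCell a).comp (descCell a b α β)) (β := α) (Iso.refl α.functor) fun x => by
    change (a.hom.app x ≫ a.inv.app x ≫ α.cell.hom.app x) ≫ Z.proj.map (𝟙 _) = α.cell.hom.app x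
    simp

lemma inr_desc {Z : FinCover G} (α : OneCell X Z) (β : OneCell Y Z) :
    homMk (inrCell b) ≫ homMk (descCell a b α β) = homMk β :=
  homMk_eq (α := (inrCell b).comp (descCell a b α β)) (β := β) (Iso.refl β.functor) fun x => by
    change (b.hom.app x ≫ b.inv.app x ≫ β.cell.hom.app x) ≫ Z.proj.map (𝟙 _) = β.cell.hom.app x
    simp

/-- The universal property of the disjoint union. -/
noncomputable def isColimitSum :
    IsColimit (BinaryCofan.mk (homMk (inlCell a)) (homMk (inrCell b))) :=
  BinaryCofan.IsColimit.mk _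
    (fun f g => homMk (descCell a b (homMk_surjective f).choose (homMk_surjective g).choose))
    (fun f _ => (inl_desc a b _ _).trans (homMk_surjective f).choose_spec)
    (fun _ g => (inr_desc a b _ _).trans (homMk_surjective g).choose_spec)
    (fun f g _ h₁ h₂ => hom_ext_sum a b
      (h₁.trans ((inl_desc a b _ _).trans (homMk_surjective f).choose_spec).symm)
      (h₂.trans ((inr_desc a b _ _).trans (homMk_surjective g).choose_spec).symm))

end

/-- The initial object of `h𝔽_G`, for any functor `P` from the empty groupoid to `G`. -/
def emptyMk (P : FinGrpd.empty.{u}.carrier ⥤ G.carrier) : FinCover G where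
  total := FinGrpd.empty
  proj := P
  thin x := x.as.elim

/-- The universal property of the empty groupoid. -/
def isInitialEmpty (P : FinGrpd.empty.{u}.carrier ⥤ G.carrier) : IsInitial (emptyMk P) :=
  IsInitial.ofUniqueHom
    (fun Z => homMk (X := emptyMk P) (Y := Z)
      { functor := Discrete.functor PEmpty.elim
        cell := NatIso.ofComponents (fun x => x.as.elim) (fun {x} => x.as.elim) })
    (by
      rintro Z f
      obtain ⟨α, rfl⟩ := homMk_surjective f
      exact homMk_eq (NatIso.ofComponents (fun x => x.as.elim) (fun {x} => x.as.elim))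
        (fun x => x.as.elim))

instance hasFiniteCoproducts : HasFiniteCoproducts (FinCover G) :=
  haveI : HasInitial (FinCover G) :=
    (isInitialEmpty (Discrete.functor (PEmpty.elim.{u + 1}))).hasInitial
  haveI : ∀ X Y : FinCover G, HasColimit (pair X Y) := fun X Y =>
    ⟨⟨⟨_, isColimitSum (P := Functor.sum' X.proj Y.proj)
      (Functor.inlCompSum' _ _).symm (Functor.inrCompSum' _ _).symm⟩⟩⟩
  haveI : HasBinaryCoproducts (FinCover G) := hasBinaryCoproducts_of_hasColimit_pair _
  hasFiniteCoproducts_of_has_binary_and_initial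

instance push_preserves (f : G.carrier ⥤ H.carrier) : PreservesFiniteCoproducts (push f) :=
  haveI : PreservesColimit (Functor.empty.{0} (FinCover G)) (push f) :=
    preservesColimit_of_preserves_colimit_cocone
      (isInitialEmpty (Discrete.functor (PEmpty.elim.{u + 1})))
      ((isColimitMapCoconeEmptyCoconeEquiv _ _).symm
        (isInitialEmpty (Discrete.functor (PEmpty.elim.{u + 1}) ⋙ f)))
  haveI : PreservesColimitsOfShape (Discrete.{0} PEmpty) (push f) :=
    preservesColimitsOfShape_pempty_of_preservesInitial _
  haveI : ∀ X Y : FinCover G, PreservesColimit (pair X Y) (push f) := fun X Y => by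
    let a : X.proj ≅ Sum.inl_ X.total.carrier Y.total.carrier ⋙ Functor.sum' X.proj Y.proj :=
      (Functor.inlCompSum' _ _).symm
    let b : Y.proj ≅ Sum.inr_ X.total.carrier Y.total.carrier ⋙ Functor.sum' X.proj Y.proj :=
      (Functor.inrCompSum' _ _).symm
    refine preservesColimit_of_preserves_colimit_cocone (isColimitSum a b)
      ((isColimitMapCoconeBinaryCofanEquiv _ _ _).symm ?_)
    exact isColimitSum (X := pushObj f X) (Y := pushObj f Y)
      (P := Functor.sum' X.proj Y.proj ⋙ f)
      (Functor.isoWhiskerRight a f) (Functor.isoWhiskerRight b f)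
  haveI : PreservesColimitsOfShape (Discrete WalkingPair) (push f) :=
    ⟨fun {K} => preservesColimit_of_iso_diagram _ (diagramIsoPair K).symm⟩
  ⟨fun _ => PreservesFiniteCoproducts.of_preserves_binary_and_initial _ _⟩

end FinCover

/-! ### Categories with finite coproducts, and the functor `h𝔽` -/

set_option linter.checkUnivs false in
/-- A category with finite coproducts. -/
structure CatCop : Type (max (u + 1) (v + 1)) where
  carrier : Type u
  [cat : Category.{v} carrier]
  [hasFiniteCoproducts : Limits.HasFiniteCoproducts carrier]

attribute [instance] CatCop.cat CatCop.hasFiniteCoproducts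

namespace CatCop

/-- A functor preserving finite coproducts. -/
structure Fun (C D : CatCop.{v, u}) : Type (max u v) where
  functor : C.carrier ⥤ D.carrier
  [preserves : Limits.PreservesFiniteCoproducts functor]

attribute [instance] Fun.preserves

instance (C D : CatCop.{v, u}) : Category (Fun C D) where
  Hom F G := F.functor ⟶ G.functor
  id F := 𝟙 F.functor
  comp η θ := NatTrans.vcomp η θ
  id_comp η := Category.id_comp (obj := C.carrier ⥤ D.carrier) η
  comp_id η := Category.comp_id (obj := C.carrier ⥤ D.carrier) η
  assoc η θ ζ := Category.assoc (obj := C.carrier ⥤ D.carrier) η θ ζ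

/-- A natural isomorphism between coproduct-preserving functors. -/
def Fun.mkIso {C D : CatCop.{v, u}} {F G : Fun C D} (e : F.functor ≅ G.functor) : F ≅ G where
  hom := e.hom
  inv := e.inv
  hom_inv_id := e.hom_inv_id
  inv_hom_id := e.inv_hom_id

/-- The strict `2`-category of categories with finite coproducts, functors preserving finite
coproducts, and natural transformations. -/
instance : Bicategory CatCop.{v, u} where
  Hom C D := Fun C D
  id C := ⟨𝟭 C.carrier⟩
  comp F G := ⟨F.functor ⋙ G.functor⟩
  homCategory C D := inferInstanceAs (Category (Fun C D))
  whiskerLeft F _ _ η := Functor.whiskerLeft F.functor η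
  whiskerRight η H := Functor.whiskerRight η H.functor
  associator F G H := Fun.mkIso (Functor.associator F.functor G.functor H.functor)
  leftUnitor F := Fun.mkIso (Functor.leftUnitor F.functor)
  rightUnitor F := Fun.mkIso (Functor.rightUnitor F.functor)
  whiskerLeft_id _ _ := rfl
  whiskerLeft_comp _ _ _ _ _ _ := rfl
  id_whiskerLeft _ := NatTrans.ext (funext fun _ =>
    ((Category.id_comp _).trans (Category.comp_id _)).symm)
  comp_whiskerLeft _ _ _ _ _ := NatTrans.ext (funext fun _ =>
    ((Category.id_comp _).trans (Category.comp_id _)).symm)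
  id_whiskerRight _ G := Functor.whiskerRight_id' G.functor
  comp_whiskerRight η θ H := Functor.whiskerRight_comp η θ H.functor
  whiskerRight_id _ := NatTrans.ext (funext fun _ =>
    ((Category.id_comp _).trans (Category.comp_id _)).symm)
  whiskerRight_comp _ _ _ := NatTrans.ext (funext fun _ =>
    ((Category.id_comp _).trans (Category.comp_id _)).symm)
  whisker_assoc _ _ _ _ _ := NatTrans.ext (funext fun _ =>
    ((Category.id_comp _).trans (Category.comp_id _)).symm)
  whisker_exchange _ θ := NatTrans.ext (funext fun _ => (NatTrans.naturality θ _).symm)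
  pentagon F G H K := Functor.pentagon F.functor G.functor H.functor K.functor
  triangle F G := Functor.triangle F.functor G.functor

end CatCop

/-- The category `h𝔽_G` as a category with finite coproducts. -/
def hF (G : FinGrpd.{u}) : CatCop.{u, u + 1} where
  carrier := FinCover G

/-- The coproduct-preserving functor `f_! : h𝔽_G ⥤ h𝔽_H`. -/
def hFmap {G H : FinGrpd.{u}} (f : G ⟶ H) : CatCop.Fun (hF G) (hF H) where
  functor := FinCover.push (G := G) (H := H) f
  preserves := FinCover.push_preserves (G := G) (H := H) f

/-- The identification `id_! = id`. -/
def hFid (G : FinGrpd.{u}) : FinCover.push (𝟭 G.carrier) ≅ 𝟭 (FinCover G) :=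
  NatIso.ofComponents (fun X => Iso.refl X) (by
    rintro X Y f
    obtain ⟨α, rfl⟩ := FinCover.homMk_surjective f
    exact (Category.comp_id _).trans (Category.id_comp (FinCover.homMk α)).symm)

/-- The identification `(g ∘ f)_! = g_! ∘ f_!`. -/
def hFcomp {G H K : FinGrpd.{u}} (f : G.carrier ⥤ H.carrier) (g : H.carrier ⥤ K.carrier) :
    FinCover.push (f ⋙ g) ≅ FinCover.push f ⋙ FinCover.push g :=
  NatIso.ofComponents (fun X => Iso.refl (FinCover.pushObj g (FinCover.pushObj f X))) (by
    rintro X Y φ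
    obtain ⟨α, rfl⟩ := FinCover.homMk_surjective φ
    exact (Category.comp_id (FinCover.homMk (α.push (f ⋙ g)))).trans
      (Category.id_comp (FinCover.homMk ((α.push f).push g))).symm)

lemma FinCover.homMk_trans_id {G H : FinGrpd.{u}} {f : G.carrier ⥤ H.carrier} (X : FinCover G)
    (σ : f ⟶ f) (h : ∀ x, σ.app x = 𝟙 _) :
    homMk (transCell σ X) = 𝟙 (pushObj f X) :=
  homMk_eq (α := transCell σ X) (β := OneCell.id (pushObj f X)) (Iso.refl (𝟭 X.total.carrier))
    fun (x : X.total.carrier) => by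
      change σ.app (X.proj.obj x) ≫ f.map (X.proj.map (𝟙 _)) = 𝟙 (f.obj (X.proj.obj x))
      simp [h]

lemma FinCover.homMk_trans_comp {G H : FinGrpd.{u}} {f g h : G.carrier ⥤ H.carrier}
    (X : FinCover G) (σ : f ⟶ g) (τ : g ⟶ h) :
    homMk (transCell (σ ≫ τ) X) = homMk (transCell σ X) ≫ homMk (transCell τ X) :=
  homMk_eq (α := transCell (σ ≫ τ) X) (β := (transCell σ X).comp (transCell τ X))
    (Iso.refl (𝟭 X.total.carrier)) fun (x : X.total.carrier) => by
      change (σ.app (X.proj.obj x) ≫ τ.app (X.proj.obj x)) ≫ h.map (X.proj.map (𝟙 _)) =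
        σ.app (X.proj.obj x) ≫ τ.app (X.proj.obj x)
      simp

lemma FinCover.homMk_trans_whiskerLeft {G H K : FinGrpd.{u}} {g h : H.carrier ⥤ K.carrier}
    (X : FinCover G) (f : G.carrier ⥤ H.carrier) (σ : g ⟶ h) :
    homMk (transCell (Functor.whiskerLeft f σ) X) = homMk (transCell σ (pushObj f X)) :=
  homMk_eq (α := transCell (Functor.whiskerLeft f σ) X) (β := transCell σ (pushObj f X))
    (Iso.refl (𝟭 X.total.carrier)) fun (x : X.total.carrier) => by
      change σ.app (f.obj (X.proj.obj x)) ≫ h.map (f.map (X.proj.map (𝟙 _))) =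
        σ.app (f.obj (X.proj.obj x))
      simp

lemma FinCover.homMk_trans_whiskerRight {G H K : FinGrpd.{u}} {f g : G.carrier ⥤ H.carrier}
    (X : FinCover G) (σ : f ⟶ g) (h : H.carrier ⥤ K.carrier) :
    homMk (transCell (Functor.whiskerRight σ h) X) = (push h).map (homMk (transCell σ X)) :=
  homMk_eq (α := transCell (Functor.whiskerRight σ h) X) (β := (transCell σ X).push h)
    (Iso.refl (𝟭 X.total.carrier)) fun (x : X.total.carrier) => by
      change h.map (σ.app (X.proj.obj x)) ≫ h.map (g.map (X.proj.map (𝟙 _))) =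
        h.map (σ.app (X.proj.obj x))
      simp

/-- The strict `2`-functor `G ↦ h𝔽_G`, `f ↦ f_!`. -/
noncomputable def psi : FinGrpd.{u} ⥤ᵖ CatCop.{u, u + 1} where
  obj := hF
  map f := hFmap f
  map₂ {G H f g} σ := FinCover.pushTrans (G := G) (H := H) σ
  map₂_id {G H} f := NatTrans.ext (funext fun X =>
    FinCover.homMk_trans_id (G := G) (H := H) X _ fun _ => rfl)
  map₂_comp {G H _ _ _} σ τ := NatTrans.ext (funext fun X =>
    FinCover.homMk_trans_comp (G := G) (H := H) X σ τ)
  mapId G := CatCop.Fun.mkIso (hFid G)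
  mapComp {G H K} f g := CatCop.Fun.mkIso (hFcomp (G := G) (H := H) (K := K) f g)
  map₂_whisker_left {G H K} f _ _ η := NatTrans.ext (funext fun X =>
    (FinCover.homMk_trans_whiskerLeft (G := G) (H := H) (K := K) X f η).trans
      ((Category.id_comp _).trans (Category.comp_id (FinCover.homMk (FinCover.transCell
      (G := H) (H := K) η (FinCover.pushObj (G := G) (H := H) f X))))).symm)
  map₂_whisker_right {G H K _ _} η h := NatTrans.ext (funext fun X =>
    (FinCover.homMk_trans_whiskerRight (G := G) (H := H) (K := K) X η h).trans
      ((Category.id_comp _).trans (Category.comp_id _)).symm)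
  map₂_associator {G _ _ L} f g h := NatTrans.ext (funext fun X =>
    (FinCover.homMk_trans_id (G := G) (H := L) X _ fun _ => rfl).trans (by
      symm
      change 𝟙 _ ≫ (FinCover.push h).map (𝟙 _) ≫ 𝟙 _ ≫ 𝟙 _ ≫ 𝟙 _ = 𝟙 _
      rw [CategoryTheory.Functor.map_id]
      simp only [Category.comp_id]))
  map₂_left_unitor {G H} f := NatTrans.ext (funext fun X =>
    (FinCover.homMk_trans_id (G := G) (H := H) X _ fun _ => rfl).trans (by
      symm
      change 𝟙 _ ≫ (FinCover.push f).map (𝟙 _) ≫ 𝟙 _ = 𝟙 _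
      rw [CategoryTheory.Functor.map_id]
      simp only [Category.comp_id]))
  map₂_right_unitor {G H} f := NatTrans.ext (funext fun X =>
    (FinCover.homMk_trans_id (G := G) (H := H) X _ fun _ => rfl).trans (by
      symm
      change 𝟙 _ ≫ 𝟙 _ ≫ 𝟙 _ = 𝟙 _
      simp only [Category.comp_id]))

/-! ### Unfurling -/

section Unfurling

universe w' v' u'

variable {I : Type u} [Bicategory.{w, v} I] {C : Type u'} [Bicategory.{w', v'} C]

lemma leftZigzag_of_iso {B : Type u} [Bicategory.{w, v} B] {a : B} {f : a ⟶ a} (e : f ≅ 𝟙 a) :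
    leftZigzag (f := f) (g := 𝟙 a) (e.inv ≫ (ρ_ _).inv) ((λ_ _).hom ≫ e.hom) =
      (λ_ _).hom ≫ (ρ_ _).inv := by
  calc
    _ = 𝟙 _ ⊗≫ (e.inv ▷ f ≫ f ◁ e.hom) ⊗≫ 𝟙 _ := by
      dsimp only [leftZigzag]; bicategory
    _ = 𝟙 _ ⊗≫ (e.hom ≫ e.inv) ⊗≫ 𝟙 _ := by
      rw [← whisker_exchange]; bicategory
    _ = _ := by
      rw [e.hom_inv_id]; bicategory

lemma rightZigzag_of_iso {B : Type u} [Bicategory.{w, v} B] {a : B} {f : a ⟶ a} (e : f ≅ 𝟙 a) :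
    rightZigzag (f := f) (g := 𝟙 a) (e.inv ≫ (ρ_ _).inv) ((λ_ _).hom ≫ e.hom) =
      (ρ_ _).hom ≫ (λ_ _).inv := by
  calc
    _ = 𝟙 _ ⊗≫ (e.inv ≫ e.hom) ⊗≫ 𝟙 _ := by
      dsimp only [rightZigzag]; bicategory
    _ = _ := by
      rw [e.inv_hom_id]; bicategory
/-- The right adjoint `𝟙` of `φ (𝟙 a) ≅ 𝟙`. -/
def idRightAdjoint (φ : I ⥤ᵖ C) (a : I) : RightAdjoint (φ.map (𝟙 a)) where
  right := 𝟙 (φ.obj a)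
  adj :=
    { unit := (φ.mapId a).inv ≫ (ρ_ _).inv
      counit := (λ_ _).hom ≫ (φ.mapId a).hom
      left_triangle := leftZigzag_of_iso (φ.mapId a)
      right_triangle := rightZigzag_of_iso (φ.mapId a) }

/-- A choice of right adjoints `i^*` of the `1`-cells `i_! := φ i`, for `i` egressive, such that
`id^* = id`. -/
structure RightAdjointChoice (φ : I ⥤ᵖ C) (egr : ∀ ⦃a b : I⦄, (a ⟶ b) → Prop) where
  adjoint : ∀ {a b : I} (i : a ⟶ b), egr i → RightAdjoint (φ.map i)
  adjoint_id : ∀ (a : I) (h : egr (𝟙 a)), adjoint (𝟙 a) h = idRightAdjoint φ a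

namespace RightAdjointChoice

variable {φ : I ⥤ᵖ C} {egr : ∀ ⦃a b : I⦄, (a ⟶ b) → Prop} (R : RightAdjointChoice φ egr)

/-- The chosen right adjoint `i^*`. -/
def pull {a b : I} (i : a ⟶ b) (hi : egr i) : φ.obj b ⟶ φ.obj a := (R.adjoint i hi).right

/-- The chosen adjunction `i_! ⊣ i^*`. -/
def adj {a b : I} (i : a ⟶ b) (hi : egr i) : φ.map i ⊣ R.pull i hi := (R.adjoint i hi).adj

/-- The `2`-cell `k^* ⟶ j^* ≫ i^*` conjugate to the `2`-cell `i_! ≫ j_! ⟶ k_!` induced by the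
inverse of an invertible `2`-cell `ρ : k ⟶ i ≫ j`. -/
def pullComp {a b c : I} {i : a ⟶ b} {j : b ⟶ c} {k : a ⟶ c} (hi : egr i) (hj : egr j)
    (hk : egr k) (ρ : k ≅ i ≫ j) : R.pull k hk ⟶ R.pull j hj ≫ R.pull i hi :=
  conjugateEquiv (R.adj k hk) ((R.adj i hi).comp (R.adj j hj))
    ((φ.mapComp i j).inv ≫ φ.map₂ ρ.inv)

/-- The base change `2`-cell `j^* ≫ g_! ⟶ f_! ≫ i^*` attached to a square
`σ : g ≫ i ≅ j ≫ f` whose sides `i` and `j` are egressive. -/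
def baseChange {a b c d : I} {g : a ⟶ b} {j : a ⟶ c} {i : b ⟶ d} {f : c ⟶ d}
    (hj : egr j) (hi : egr i) (σ : g ≫ i ≅ j ≫ f) :
    R.pull j hj ≫ φ.map g ⟶ φ.map f ≫ R.pull i hi :=
  mateEquiv (R.adj j hj) (R.adj i hi)
    ((φ.mapComp g i).inv ≫ φ.map₂ σ.hom ≫ (φ.mapComp j f).hom)

end RightAdjointChoice

/-- The value of the unfurling of `φ` on an `n`-simplex of the effective Burnside category.
A vertex `a` is sent to `φ a`, and a span `a ⟵ x ⟶ b` with backward leg `i` and forward leg `f`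
to `i^* ≫ f_!`.  The `2`-cell attached to a composite of two spans
```
      x₀₂ ⟶ x₁₂ ⟶ x₂
       ↓     ↓
      x₀₁ ⟶ x₁
       ↓
       x₀
```
with `p : x₀₂ ⟶ x₀₁`, `q : x₀₂ ⟶ x₁₂`, `jₐᵦ : xₐᵦ ⟶ xₐ` and `gₐᵦ : xₐᵦ ⟶ xᵦ`
is the pasting of the `2`-cell `j₀₂^* ⟶ j₀₁^* ≫ p^*`, the `2`-cell `(g₀₂)_! ⟶ q_! ≫ (g₁₂)_!` and
the base change `2`-cell `p^* ≫ q_! ⟶ (g₀₁)_! ≫ j₁₂^*` of the square. -/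
noncomputable def unfurlData {φ : I ⥤ᵖ C} {ingr egr : ∀ ⦃a b : I⦄, (a ⟶ b) → Prop}
    (R : RightAdjointChoice φ egr) {n : ℕ} (s : AeffSimplex.{t} I ingr egr n) :
    NormalData (Fin (n + 1)) C where
  obj i := φ.obj (s.toFunctor.obj ⟨i, i, le_refl i⟩)
  map {i j} h := R.pull _ (s.egressive (le_refl i) h) ≫
    φ.map (s.toFunctor.map (TwArr.le_fwd h (le_refl j)))
  cell {i j k} hij hjk :=
    let j₀₁ := R.pull _ (s.egressive (le_refl i) hij)
    let p := R.pull _ (s.egressive hij hjk)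
    let j₁₂ := R.pull _ (s.egressive (le_refl j) hjk)
    let g₀₁ := φ.map (s.toFunctor.map (TwArr.le_fwd hij (le_refl j)))
    let q := φ.map (s.toFunctor.map (TwArr.le_fwd hij hjk))
    let g₁₂ := φ.map (s.toFunctor.map (TwArr.le_fwd hjk (le_refl k)))
    haveI := s.toFunctor.cell_isIso (TwArr.le_bwd hij hjk) (TwArr.le_bwd (le_refl i) hij)
    ((R.pullComp (s.egressive hij hjk) (s.egressive (le_refl i) hij)
        (s.egressive (le_refl i) (hij.trans hjk))
        (asIso (s.toFunctor.cell (TwArr.le_bwd hij hjk) (TwArr.le_bwd (le_refl i) hij)))) ▷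
        φ.map (s.toFunctor.map (TwArr.le_fwd (hij.trans hjk) (le_refl k)))) ≫
      (j₀₁ ≫ p) ◁ (φ.map₂ (s.toFunctor.cell (TwArr.le_fwd hij hjk) (TwArr.le_fwd hjk (le_refl k))) ≫
        (φ.mapComp _ _).hom) ≫
      (α_ j₀₁ p (q ≫ g₁₂)).hom ≫
      j₀₁ ◁ ((α_ p q g₁₂).inv ≫
        R.baseChange (s.egressive hij hjk) (s.egressive (le_refl j) hjk)
          (s.toFunctor.squareIso hij (le_refl j) hjk) ▷ g₁₂ ≫
        (α_ g₀₁ j₁₂ g₁₂).hom) ≫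
      (α_ j₀₁ g₀₁ (j₁₂ ≫ g₁₂)).inv

end Unfurling

/-! ### Symmetric monoidal categories -/

set_option linter.checkUnivs false in
/-- A symmetric monoidal category. -/
structure SymMonCat : Type (max (u + 1) (v + 1)) where
  carrier : Type u
  [cat : Category.{v} carrier]
  [monoidal : MonoidalCategory carrier]
  [symmetric : SymmetricCategory carrier]

attribute [instance] SymMonCat.cat SymMonCat.monoidal SymMonCat.symmetric

namespace SymMonCat

/-- A (strong) symmetric monoidal functor. -/
structure Fun (C D : SymMonCat.{v, u}) : Type (max u v) where
  functor : C.carrier ⥤ D.carrier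
  [braided : functor.Braided]

attribute [instance] Fun.braided

/-- A monoidal natural transformation. -/
@[ext]
structure Trans {C D : SymMonCat.{v, u}} (F G : Fun C D) : Type (max u v) where
  natTrans : F.functor ⟶ G.functor
  [isMonoidal : NatTrans.IsMonoidal natTrans]

attribute [instance] Trans.isMonoidal

instance (C D : SymMonCat.{v, u}) : Category (Fun C D) where
  Hom F G := Trans F G
  id F := ⟨𝟙 F.functor⟩
  comp η θ := ⟨η.natTrans ≫ θ.natTrans⟩

/-- A monoidal natural isomorphism. -/
def Fun.mkIso {C D : SymMonCat.{v, u}} {F G : Fun C D} (e : F.functor ≅ G.functor)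
    [NatTrans.IsMonoidal e.hom] : F ≅ G where
  hom := ⟨e.hom⟩
  inv := ⟨e.inv⟩
  hom_inv_id := Trans.ext e.hom_inv_id
  inv_hom_id := Trans.ext e.inv_hom_id

lemma Trans.isIso {C D : SymMonCat.{v, u}} {F G : Fun C D} (η : F ⟶ G)
    (h : ∀ x, IsIso ((Trans.natTrans η).app x)) : IsIso η := by
  have : IsIso (Trans.natTrans η) := NatIso.isIso_of_isIso_app _
  have : NatTrans.IsMonoidal (asIso (Trans.natTrans η)).hom := η.isMonoidal
  exact (Fun.mkIso (asIso (Trans.natTrans η))).isIso_hom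

/-- The `2`-category of symmetric monoidal categories, symmetric monoidal functors and monoidal
natural transformations. -/
instance : Bicategory SymMonCat.{v, u} where
  Hom C D := Fun C D
  id C := ⟨𝟭 C.carrier⟩
  comp F G := ⟨F.functor ⋙ G.functor⟩
  homCategory C D := inferInstanceAs (Category (Fun C D))
  whiskerLeft F _ _ η := ⟨Functor.whiskerLeft F.functor η.natTrans⟩
  whiskerRight η H := ⟨Functor.whiskerRight η.natTrans H.functor⟩
  associator F G H := Fun.mkIso (Functor.associator F.functor G.functor H.functor)
  leftUnitor F := Fun.mkIso (Functor.leftUnitor F.functor)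
  rightUnitor F := Fun.mkIso (Functor.rightUnitor F.functor)
  whiskerLeft_id _ _ := rfl
  whiskerLeft_comp _ _ _ _ _ _ := rfl
  id_whiskerLeft _ := Trans.ext (NatTrans.ext (funext fun _ =>
    ((Category.id_comp _).trans (Category.comp_id _)).symm))
  comp_whiskerLeft _ _ _ _ _ := Trans.ext (NatTrans.ext (funext fun _ =>
    ((Category.id_comp _).trans (Category.comp_id _)).symm))
  id_whiskerRight _ G := Trans.ext (Functor.whiskerRight_id' G.functor)
  comp_whiskerRight η θ H :=
    Trans.ext (Functor.whiskerRight_comp η.natTrans θ.natTrans H.functor)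
  whiskerRight_id _ := Trans.ext (NatTrans.ext (funext fun _ =>
    ((Category.id_comp _).trans (Category.comp_id _)).symm))
  whiskerRight_comp _ _ _ := Trans.ext (NatTrans.ext (funext fun _ =>
    ((Category.id_comp _).trans (Category.comp_id _)).symm))
  whisker_assoc _ _ _ _ _ := Trans.ext (NatTrans.ext (funext fun _ =>
    ((Category.id_comp _).trans (Category.comp_id _)).symm))
  whisker_exchange _ θ := Trans.ext (NatTrans.ext (funext fun _ =>
    (NatTrans.naturality θ.natTrans _).symm))
  pentagon F G H K :=
    Trans.ext (Functor.pentagon F.functor G.functor H.functor K.functor)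
  triangle F G := Trans.ext (Functor.triangle F.functor G.functor)

end SymMonCat

/-! ### The core of a symmetric monoidal category -/

section Core

open MonoidalCategory

variable (C : Type u) [Category.{v} C] [MonoidalCategory C]

instance coreMonoidalCategory : MonoidalCategory (Core C) where
  tensorObj X Y := ⟨X.of ⊗ Y.of⟩
  whiskerLeft X _ _ f := ⟨whiskerLeftIso X.of f.iso⟩
  whiskerRight f Y := ⟨whiskerRightIso f.iso Y.of⟩
  tensorHom f g := ⟨f.iso ⊗ᵢ g.iso⟩
  tensorUnit := ⟨𝟙_ C⟩
  associator X Y Z := Core.isoMk (α_ X.of Y.of Z.of)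
  leftUnitor X := Core.isoMk (λ_ X.of)
  rightUnitor X := Core.isoMk (ρ_ X.of)
  tensorHom_def _ _ := Core.hom_ext (MonoidalCategory.tensorHom_def _ _)
  id_tensorHom_id _ _ := Core.hom_ext (MonoidalCategory.id_tensorHom_id _ _)
  tensorHom_comp_tensorHom _ _ _ _ :=
    Core.hom_ext (MonoidalCategory.tensorHom_comp_tensorHom _ _ _ _)
  whiskerLeft_id _ _ := Core.hom_ext (MonoidalCategory.whiskerLeft_id _ _)
  id_whiskerRight _ _ := Core.hom_ext (MonoidalCategory.id_whiskerRight _ _)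
  associator_naturality _ _ _ := Core.hom_ext (MonoidalCategory.associator_naturality _ _ _)
  leftUnitor_naturality _ := Core.hom_ext (MonoidalCategory.leftUnitor_naturality _)
  rightUnitor_naturality _ := Core.hom_ext (MonoidalCategory.rightUnitor_naturality _)
  pentagon _ _ _ _ := Core.hom_ext (MonoidalCategory.pentagon _ _ _ _)
  triangle _ _ := Core.hom_ext (MonoidalCategory.triangle _ _)

instance coreSymmetricCategory [SymmetricCategory C] : SymmetricCategory (Core C) where
  braiding X Y := Core.isoMk (β_ X.of Y.of)
  braiding_naturality_right _ _ _ _ :=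
    Core.hom_ext (BraidedCategory.braiding_naturality_right _ _)
  braiding_naturality_left _ _ := Core.hom_ext (BraidedCategory.braiding_naturality_left _ _)
  hexagon_forward _ _ _ := Core.hom_ext (BraidedCategory.hexagon_forward _ _ _)
  hexagon_reverse _ _ _ := Core.hom_ext (BraidedCategory.hexagon_reverse _ _ _)
  symmetry _ _ := Core.hom_ext (SymmetricCategory.symmetry _ _)

end Core

section

open MonoidalCategory Functor

variable {C D : Type u} [Category.{v} C] [MonoidalCategory C] [SymmetricCategory C]
  [Category.{v} D] [MonoidalCategory D] [SymmetricCategory D]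

instance coreFunctorMonoidal (F : C ⥤ D) [F.Monoidal] : F.core.Monoidal :=
  Functor.CoreMonoidal.toMonoidal
    { εIso := Core.isoMk (Monoidal.εIso F)
      μIso X Y := Core.isoMk (Monoidal.μIso F X.of Y.of)
      μIso_hom_natural_left _ _ := Core.hom_ext (LaxMonoidal.μ_natural_left F _ _)
      μIso_hom_natural_right _ _ := Core.hom_ext (LaxMonoidal.μ_natural_right F _ _)
      associativity _ _ _ := Core.hom_ext (LaxMonoidal.associativity F _ _ _)
      left_unitality _ := Core.hom_ext (LaxMonoidal.left_unitality F _)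
      right_unitality _ := Core.hom_ext (LaxMonoidal.right_unitality F _) }

instance coreFunctorBraided (F : C ⥤ D) [F.Braided] : F.core.Braided where
  braided X Y := Core.hom_ext (LaxBraided.braided (F := F) X.of Y.of)

end

/-! ### The cocartesian symmetric monoidal structure -/

namespace CatCop

open Limits

/-- The symmetric monoidal structure given by binary coproducts and the initial object. -/
noncomputable abbrev monoidal (C : CatCop.{v, u}) : MonoidalCategory C.carrier :=
  monoidalOfHasFiniteCoproducts C.carrier

noncomputable abbrev symmetric (C : CatCop.{v, u}) :
    letI := C.monoidal
    SymmetricCategory C.carrier :=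
  symmetricOfHasFiniteCoproducts C.carrier

attribute [local instance] monoidal symmetric

namespace Fun
variable {C D : CatCop.{v, u}} (F : Fun C D)

open MonoidalCategory

/-- The canonical isomorphisms `⊥ ≅ F ⊥` and `F X ⨿ F Y ≅ F (X ⨿ Y)`. -/
noncomputable def coreMonoidal : F.functor.CoreMonoidal where
  εIso := initialIsInitial.uniqueUpToIso (initialIsInitial.isInitialObj F.functor _)
  μIso X Y := PreservesColimitPair.iso F.functor X Y
  μIso_hom_natural_left f X' := by
    apply coprod.hom_ext <;> simp [← CategoryTheory.Functor.map_comp]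
  μIso_hom_natural_right f X' := by
    apply coprod.hom_ext <;> simp [← CategoryTheory.Functor.map_comp]
  associativity X Y Z := by
    refine coprod.hom_ext (coprod.hom_ext ?_ ?_) ?_ <;>
      simp [← CategoryTheory.Functor.map_comp, monoidalOfHasFiniteCoproducts.associator_hom,
        coprod.inl_desc, coprod.inr_desc]
  left_unitality X := by
    refine coprod.hom_ext (initialIsInitial.hom_ext _ _) ?_
    simp [← CategoryTheory.Functor.map_comp, coprod.inr_desc]
  right_unitality X := by
    refine coprod.hom_ext ?_ (initialIsInitial.hom_ext _ _)
    simp [← CategoryTheory.Functor.map_comp, coprod.inl_desc]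

noncomputable instance : F.functor.Monoidal := F.coreMonoidal.toMonoidal

noncomputable instance : F.functor.Braided where
  braided X Y := by
    change (PreservesColimitPair.iso F.functor X Y).hom ≫ F.functor.map (coprod.braiding X Y).hom =
      (coprod.braiding _ _).hom ≫ (PreservesColimitPair.iso F.functor Y X).hom
    apply coprod.hom_ext <;>
      simp [← CategoryTheory.Functor.map_comp, coprod.inl_desc, coprod.inr_desc]

end Fun

/-- The symmetric monoidal groupoid `core C`, with the cocartesian symmetric monoidal structure. -/
noncomputable def core (C : CatCop.{v, u}) : SymMonCat.{v, u} where
  carrier := Core C.carrier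

/-- The symmetric monoidal functor induced by a coproduct-preserving functor on cores. -/
noncomputable def coreMap {C D : CatCop.{v, u}} (F : C ⟶ D) : C.core ⟶ D.core :=
  { functor := Functor.core (Fun.functor F)
    braided := coreFunctorBraided (Fun.functor F) : SymMonCat.Fun C.core D.core }

lemma core_hom_ext_initial {D : CatCop.{v, u}} {Y : Core D.carrier}
    (f g : MonoidalCategoryStruct.tensorUnit (Core D.carrier) ⟶ Y) : f = g :=
  Core.hom_ext (initialIsInitial.hom_ext _ _)

/-- The natural isomorphism of functors underlying an isomorphism of `1`-cells. -/
def Fun.natIso {C D : CatCop.{v, u}} {F G : C ⟶ D} (e : F ≅ G) :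
    Fun.functor F ≅ Fun.functor G where
  hom := e.hom
  inv := e.inv
  hom_inv_id := e.hom_inv_id
  inv_hom_id := e.inv_hom_id

/-- The monoidal natural transformation on cores induced by a natural isomorphism. -/
noncomputable def coreMap₂ {C D : CatCop.{v, u}} {F G : C ⟶ D} (e : F ≅ G) :
    coreMap F ⟶ coreMap G :=
  { natTrans := (Fun.natIso e).core.hom
    isMonoidal :=
      { unit := core_hom_ext_initial _ _
        tensor := fun X Y => Core.hom_ext (by
          change (PreservesColimitPair.iso (Fun.functor F) X.of Y.of).hom ≫
              (Fun.natIso e).hom.app (X.of ⨿ Y.of) =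
            coprod.map ((Fun.natIso e).hom.app X.of) ((Fun.natIso e).hom.app Y.of) ≫
              (PreservesColimitPair.iso (Fun.functor G) X.of Y.of).hom
          apply coprod.hom_ext <;> simp) } : SymMonCat.Trans (coreMap F) (coreMap G) }

lemma comp_tensor {C D E : CatCop.{v, u}} (F : C.carrier ⥤ D.carrier) (G : D.carrier ⥤ E.carrier)
    [PreservesFiniteCoproducts F] [PreservesFiniteCoproducts G] (X Y : C.carrier) :
    (PreservesColimitPair.iso (F ⋙ G) X Y).hom =
      (PreservesColimitPair.iso G (F.obj X) (F.obj Y)).hom ≫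
        G.map (PreservesColimitPair.iso F X Y).hom := by
  simp only [PreservesColimitPair.iso_hom]
  apply coprod.hom_ext
  · exact (coprodComparison_inl (F ⋙ G)).trans ((coprodComparison_inl_assoc G _).trans
      ((G.map_comp _ _).symm.trans (congrArg G.map (coprodComparison_inl F)))).symm
  · exact (coprodComparison_inr (F ⋙ G)).trans ((coprodComparison_inr_assoc G _).trans
      ((G.map_comp _ _).symm.trans (congrArg G.map (coprodComparison_inr F)))).symm

/-- Forming cores is compatible with composition. -/
noncomputable def coreMapComp {C D E : CatCop.{v, u}} (F : C ⟶ D) (G : D ⟶ E) :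
    coreMap (F ≫ G) ⟶ coreMap F ≫ coreMap G :=
  { natTrans := (Functor.coreComp (Fun.functor F) (Fun.functor G)).hom
    isMonoidal :=
      { unit := core_hom_ext_initial _ _
        tensor := fun X Y => Core.hom_ext (by
          refine (Category.comp_id _).trans ((comp_tensor (Fun.functor F) (Fun.functor G)
            X.of Y.of).trans ?_)
          symm
          refine (congrArg (fun q => q ≫ _) coprod.map_id_id).trans (Category.id_comp _)) } :
    SymMonCat.Trans _ _ }

lemma braided_eq_of_lax {C D : Type*} [Category C] [Category D]
    [MonoidalCategory C] [MonoidalCategory D] [BraidedCategory C] [BraidedCategory D]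
    {F : C ⥤ D} (b b' : F.Braided) (h₁ : b.ε = b'.ε) (h₂ : b.μ = b'.μ) : b = b' := by
  refine Functor.Braided.ext h₁ h₂ ?_ ?_
  · calc b.η = b.η ≫ b'.ε ≫ b'.η := by rw [b'.ε_η, Category.comp_id]
      _ = (b.η ≫ b.ε) ≫ b'.η := by rw [h₁, Category.assoc]
      _ = b'.η := by rw [b.η_ε, Category.id_comp]
  · funext X Y
    calc b.δ X Y = b.δ X Y ≫ b'.μ X Y ≫ b'.δ X Y := by rw [b'.μ_δ, Category.comp_id]
      _ = (b.δ X Y ≫ b.μ X Y) ≫ b'.δ X Y := by rw [h₂, Category.assoc]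
      _ = b'.δ X Y := by rw [b.δ_μ, Category.id_comp]

lemma coreMap_id (C : CatCop.{v, u}) : coreMap (𝟙 C) = 𝟙 C.core := by
  refine congrArg (fun b => (@SymMonCat.Fun.mk C.core C.core (𝟭 (Core C.carrier)) b))
    (braided_eq_of_lax _ _ ?_ ?_)
  · exact core_hom_ext_initial _ _
  · funext X Y
    refine Core.hom_ext ?_
    change (PreservesColimitPair.iso (𝟭 _) X.of Y.of).hom = 𝟙 _
    rw [PreservesColimitPair.iso_hom]
    apply coprod.hom_ext
    · exact (coprodComparison_inl (𝟭 C.carrier)).trans (Category.comp_id _).symm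
    · exact (coprodComparison_inr (𝟭 C.carrier)).trans (Category.comp_id _).symm

lemma eqToHom_natTrans {C D : SymMonCat.{v, u}} {F G : C ⟶ D} (h : F = G) :
    SymMonCat.Trans.natTrans (eqToHom h) = eqToHom (congrArg SymMonCat.Fun.functor h) := by
  subst h; rfl

lemma core_eqToHom_app {C : CatCop.{v, u}} {F : C ⟶ C} (h : F = 𝟙 C) (x : Core C.carrier) :
    ((SymMonCat.Trans.natTrans
      (eqToHom ((congrArg coreMap h).trans (coreMap_id C)))).app x).iso.hom =
    (Fun.natIso (eqToIso h)).hom.app x.of := by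
  subst h
  rw [eqToHom_natTrans]
  rfl

/-- The composite of a normal functor to categories with finite coproducts with `core`. -/
noncomputable def coreNormal {P : Type} [Preorder P] (X : NormalFunctor P CatCop.{v, u}) :
    NormalFunctor P SymMonCat.{v, u} where
  obj i := (X.obj i).core
  map h := coreMap (X.map h)
  cell hij hjk := haveI := X.cell_isIso hij hjk
    coreMap₂ (asIso (X.cell hij hjk)) ≫ coreMapComp _ _
  map_refl i := (congrArg coreMap (X.map_refl i)).trans (coreMap_id _)
  cell_refl_left {i j} h := SymMonCat.Trans.ext (NatTrans.ext (funext fun x => Core.hom_ext (by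
    have e := congrArg (fun (q : X.map h ⟶ X.map h) => NatTrans.app q x.of) (X.cell_refl_left h)
    have e' := congrArg (fun q => (Fun.functor (X.map h)).map q)
      (core_eqToHom_app (X.map_refl i) x)
    refine Eq.trans ?_ e
    refine (congrArg (fun q => q ≫ _) (Category.comp_id _)).trans ?_
    exact congrArg (fun q => _ ≫ q ≫ _) e')))
  cell_refl_right {i j} h := SymMonCat.Trans.ext (NatTrans.ext (funext fun x => Core.hom_ext (by
    have e := congrArg (fun (q : X.map h ⟶ X.map h) => NatTrans.app q x.of) (X.cell_refl_right h)
    have e' := core_eqToHom_app (X.map_refl j) ⟨(Fun.functor (X.map h)).obj x.of⟩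
    refine Eq.trans ?_ e
    refine (congrArg (fun q => q ≫ _) (Category.comp_id _)).trans ?_
    exact congrArg (fun q => _ ≫ q ≫ _) e')))
  cocycle {i j k l} hij hjk hkl :=
    SymMonCat.Trans.ext (NatTrans.ext (funext fun x => Core.hom_ext (by
      have e := congrArg
        (fun (q : X.map (hij.trans (hjk.trans hkl)) ⟶ X.map hij ≫ X.map hjk ≫ X.map hkl) =>
          NatTrans.app q x.of) (X.cocycle hij hjk hkl)
      exact ((congrArg₂ (fun q r => q ≫ r ≫ 𝟙 _) (Category.comp_id _)
        (congrArg (Fun.functor (X.map hkl)).map (Category.comp_id _))).trans e).trans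
          (congrArg₂ (fun q r => q ≫ r) (Category.comp_id _) (Category.comp_id _)).symm)))
  cell_isIso {_ _ k} _ _ :=
    SymMonCat.Trans.isIso _ fun _ => IsIso.of_groupoid (C := Core (X.obj k).carrier) _

end CatCop

/-- The functor `core` from the nerve of the `(2,1)`-category of categories with finite coproducts
to the nerve of the `(2,1)`-category of symmetric monoidal categories. -/
noncomputable def coreNerve : duskinNerve CatCop.{v, u} ⟶ duskinNerve SymMonCat.{v, u} where
  app _ := ↾ fun X => CatCop.coreNormal X
  naturality _ _ _ := rfl

/-! ### The permutative category `𝔉_H` -/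

/-- The objects `𝒏` of the permutative category `𝔉_H = ∐ₙ B(Σₙ ≀ H)`. -/
@[ext]
structure Wreath (H : Type u) : Type where
  card : ℕ

namespace Wreath

variable {H : Type u} [Group H]

/-- The morphisms of `𝔉_H`, i.e. the elements `(σ; g₁, …, gₙ)` of `Σₙ ≀ H`; there are no morphisms
between different objects. -/
@[ext]
structure Hom (m n : Wreath H) : Type u where
  perm : Fin m.card ≃ Fin n.card
  elt : Fin m.card → H

instance : Category.{u} (Wreath H) where
  Hom := Hom
  id _ := ⟨Equiv.refl _, fun _ => 1⟩
  comp α β := ⟨α.perm.trans β.perm, fun i => β.elt (α.perm i) * α.elt i⟩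
  id_comp _ := Hom.ext rfl (funext fun _ => mul_one _)
  comp_id _ := Hom.ext rfl (funext fun _ => one_mul _)
  assoc _ _ _ := Hom.ext rfl (funext fun _ => (mul_assoc _ _ _).symm)

lemma hom_ext {m n : Wreath H} {α β : m ⟶ n} (h : ∀ i, Hom.perm α i = Hom.perm β i)
    (h' : ∀ i, Hom.elt α i = Hom.elt β i) : α = β :=
  Hom.ext (Equiv.ext h) (funext h')

@[simp] lemma id_perm (n : Wreath H) : Hom.perm (𝟙 n) = Equiv.refl _ := rfl
@[simp] lemma id_elt (n : Wreath H) (i) : Hom.elt (𝟙 n) i = 1 := rfl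
@[simp] lemma comp_perm {m n k : Wreath H} (α : m ⟶ n) (β : n ⟶ k) (i) :
    Hom.perm (α ≫ β) i = Hom.perm β (Hom.perm α i) := rfl
@[simp] lemma comp_elt {m n k : Wreath H} (α : m ⟶ n) (β : n ⟶ k) (i) :
    Hom.elt (α ≫ β) i = Hom.elt β (Hom.perm α i) * Hom.elt α i := rfl

/-- The isomorphism given by a bijection and trivial elements of `H`. -/
def ofEquiv {m n : Wreath H} (e : Fin m.card ≃ Fin n.card) : m ≅ n where
  hom := ⟨e, fun _ => 1⟩
  inv := ⟨e.symm, fun _ => 1⟩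
  hom_inv_id := hom_ext (fun i => e.symm_apply_apply i) fun _ => one_mul _
  inv_hom_id := hom_ext (fun i => e.apply_symm_apply i) fun _ => one_mul _

@[simp] lemma ofEquiv_hom_perm {m n : Wreath H} (e : Fin m.card ≃ Fin n.card) :
    Hom.perm (ofEquiv (H := H) e).hom = e := rfl
@[simp] lemma ofEquiv_hom_elt {m n : Wreath H} (e : Fin m.card ≃ Fin n.card) (i) :
    Hom.elt (ofEquiv (H := H) e).hom i = 1 := rfl

/-- The block sum of bijections. -/
def blockSum {a b c d : ℕ} (σ : Fin a ≃ Fin b) (τ : Fin c ≃ Fin d) : Fin (a + c) ≃ Fin (b + d) :=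
  finSumFinEquiv.symm.trans ((Equiv.sumCongr σ τ).trans finSumFinEquiv)

@[simp] lemma blockSum_castAdd {a b c d : ℕ} (σ : Fin a ≃ Fin b) (τ : Fin c ≃ Fin d) (i : Fin a) :
    blockSum σ τ (Fin.castAdd c i) = Fin.castAdd d (σ i) := by
  simp [blockSum]

@[simp] lemma blockSum_natAdd {a b c d : ℕ} (σ : Fin a ≃ Fin b) (τ : Fin c ≃ Fin d) (i : Fin c) :
    blockSum σ τ (Fin.natAdd a i) = Fin.natAdd b (τ i) := by
  simp [blockSum]

/-- The block swap. -/
def blockSwap (a b : ℕ) : Fin (a + b) ≃ Fin (b + a) :=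
  finSumFinEquiv.symm.trans ((Equiv.sumComm _ _).trans finSumFinEquiv)

@[simp] lemma blockSwap_castAdd (a b : ℕ) (i : Fin a) :
    blockSwap a b (Fin.castAdd b i) = Fin.natAdd b i := by
  simp [blockSwap]

@[simp] lemma blockSwap_natAdd (a b : ℕ) (i : Fin b) :
    blockSwap a b (Fin.natAdd a i) = Fin.castAdd a i := by
  simp [blockSwap]

/-- The sum of morphisms. -/
def sumHom {m m' n n' : Wreath H} (α : m ⟶ m') (β : n ⟶ n') :
    (⟨m.card + n.card⟩ : Wreath H) ⟶ ⟨m'.card + n'.card⟩ :=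
  (⟨blockSum (Hom.perm α) (Hom.perm β), Fin.append (Hom.elt α) (Hom.elt β)⟩ : Hom _ _)

@[simp] lemma sumHom_perm {m m' n n' : Wreath H} (α : m ⟶ m') (β : n ⟶ n') :
    Hom.perm (sumHom α β) = blockSum (Hom.perm α) (Hom.perm β) := rfl
@[simp] lemma sumHom_elt {m m' n n' : Wreath H} (α : m ⟶ m') (β : n ⟶ n') :
    Hom.elt (sumHom α β) = Fin.append (Hom.elt α) (Hom.elt β) := rfl

lemma cases_add {a b : ℕ} {p : Fin (a + b) → Prop} (h : ∀ i, p (Fin.castAdd b i))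
    (h' : ∀ i, p (Fin.natAdd a i)) (i) : p i := Fin.addCases h h' i

lemma finCongr_assoc₁ {a b c : ℕ} (i : Fin a) : finCongr (Nat.add_assoc a b c)
    (Fin.castAdd c (Fin.castAdd b i)) = Fin.castAdd (b + c) i := rfl

lemma finCongr_assoc₂ {a b c : ℕ} (i : Fin b) : finCongr (Nat.add_assoc a b c)
    (Fin.castAdd c (Fin.natAdd a i)) = Fin.natAdd a (Fin.castAdd c i) := rfl

lemma finCongr_assoc₃ {a b c : ℕ} (i : Fin c) : finCongr (Nat.add_assoc a b c)
    (Fin.natAdd (a + b) i) = Fin.natAdd a (Fin.natAdd b i) :=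
  Fin.ext (Nat.add_assoc a b i)

lemma blockSum_assoc {a b c a' b' c' : ℕ} (σ : Fin a ≃ Fin a') (τ : Fin b ≃ Fin b')
    (υ : Fin c ≃ Fin c') : ∀ i, finCongr (Nat.add_assoc a' b' c') (blockSum (blockSum σ τ) υ i) =
      blockSum σ (blockSum τ υ) (finCongr (Nat.add_assoc a b c) i) := by
  refine cases_add (cases_add (fun i => ?_) (fun i => ?_)) (fun i => ?_)
  · rw [finCongr_assoc₁]; simp only [blockSum_castAdd, finCongr_assoc₁]
  · rw [finCongr_assoc₂]; simp only [blockSum_castAdd, blockSum_natAdd, finCongr_assoc₂]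
  · rw [finCongr_assoc₃]; simp only [blockSum_natAdd, finCongr_assoc₃]

lemma append_assoc {K : Type u} {a b c : ℕ} (f : Fin a → K) (g : Fin b → K) (h : Fin c → K) :
    ∀ i, Fin.append (Fin.append f g) h i =
      Fin.append f (Fin.append g h) (finCongr (Nat.add_assoc a b c) i) := by
  refine cases_add (cases_add (fun i => ?_) (fun i => ?_)) (fun i => ?_)
  · rw [finCongr_assoc₁]; simp only [Fin.append_left]
  · rw [finCongr_assoc₂]; simp only [Fin.append_left, Fin.append_right]
  · rw [finCongr_assoc₃]; simp only [Fin.append_right]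

lemma hom_ext_add {a b : ℕ} {n : Wreath H} {α β : (⟨a + b⟩ : Wreath H) ⟶ n}
    (h₁ : ∀ i, Hom.perm α (Fin.castAdd b i) = Hom.perm β (Fin.castAdd b i))
    (h₂ : ∀ i, Hom.perm α (Fin.natAdd a i) = Hom.perm β (Fin.natAdd a i))
    (h₃ : ∀ i, Hom.elt α (Fin.castAdd b i) = Hom.elt β (Fin.castAdd b i))
    (h₄ : ∀ i, Hom.elt α (Fin.natAdd a i) = Hom.elt β (Fin.natAdd a i)) : α = β :=
  hom_ext (cases_add h₁ h₂) (cases_add h₃ h₄)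

lemma sumHom_id (m n : Wreath H) : sumHom (𝟙 m) (𝟙 n) = 𝟙 (⟨m.card + n.card⟩ : Wreath H) := by
  apply hom_ext_add <;> simp

lemma sumHom_comp {m m' m'' n n' n'' : Wreath H} (α : m ⟶ m') (α' : m' ⟶ m'') (β : n ⟶ n')
    (β' : n' ⟶ n'') : sumHom α β ≫ sumHom α' β' = sumHom (α ≫ α') (β ≫ β') := by
  apply hom_ext_add <;> intro i
  · change blockSum (Hom.perm α') (Hom.perm β') (blockSum (Hom.perm α) (Hom.perm β) _) = _
    simp
  · change blockSum (Hom.perm α') (Hom.perm β') (blockSum (Hom.perm α) (Hom.perm β) _) = _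
    simp
  · change Fin.append (Hom.elt α') (Hom.elt β') (blockSum (Hom.perm α) (Hom.perm β) _) *
      Fin.append (Hom.elt α) (Hom.elt β) _ = _
    simp
  · change Fin.append (Hom.elt α') (Hom.elt β') (blockSum (Hom.perm α) (Hom.perm β) _) *
      Fin.append (Hom.elt α) (Hom.elt β) _ = _
    simp

instance : MonoidalCategoryStruct (Wreath H) where
  tensorObj m n := ⟨m.card + n.card⟩
  tensorUnit := ⟨0⟩
  tensorHom α β := sumHom α β
  whiskerLeft m _ _ β := sumHom (𝟙 m) β
  whiskerRight α n := sumHom α (𝟙 n)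
  associator m n k := ofEquiv (finCongr (Nat.add_assoc m.card n.card k.card))
  leftUnitor n := ofEquiv (finCongr (Nat.zero_add n.card))
  rightUnitor n := ofEquiv (finCongr (Nat.add_zero n.card))

lemma ofEquiv_naturality {m n m' n' : Wreath H} (e : Fin m.card ≃ Fin n.card)
    (e' : Fin m'.card ≃ Fin n'.card) (α : m ⟶ m') (β : n ⟶ n')
    (h : ∀ i, e' (Hom.perm α i) = Hom.perm β (e i)) (h' : ∀ i, Hom.elt α i = Hom.elt β (e i)) :
    α ≫ (ofEquiv e').hom = (ofEquiv e).hom ≫ β :=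
  hom_ext h fun i => by simp [h']

open MonoidalCategory

lemma hom_ext_val {m n : Wreath H} {α β : m ⟶ n}
    (h : ∀ i, (Hom.perm α i : ℕ) = i) (k : ∀ i, (Hom.perm β i : ℕ) = i)
    (h' : ∀ i, Hom.elt α i = 1) (k' : ∀ i, Hom.elt β i = 1) : α = β :=
  hom_ext (fun i => Fin.ext ((h i).trans (k i).symm)) fun i => (h' i).trans (k' i).symm

/-- The morphism `α` is given by an order-preserving bijection and trivial elements of `H`. -/
def IsCast {m n : Wreath H} (α : m ⟶ n) : Prop :=
  (∀ i, (Hom.perm α i : ℕ) = i) ∧ ∀ i, Hom.elt α i = 1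

lemma IsCast.eq {m n : Wreath H} {α β : m ⟶ n} (h : IsCast α) (k : IsCast β) : α = β :=
  hom_ext_val h.1 k.1 h.2 k.2

lemma IsCast.comp {m n k : Wreath H} {α : m ⟶ n} {β : n ⟶ k} (h : IsCast α) (h' : IsCast β) :
    IsCast (α ≫ β) :=
  ⟨fun i => (h'.1 _).trans (h.1 i), fun i => by simp [h.2, h'.2]⟩

lemma IsCast.id (m : Wreath H) : IsCast (𝟙 m) := ⟨fun _ => rfl, fun _ => rfl⟩

lemma IsCast.card_eq {m n : Wreath H} (α : m ⟶ n) : m.card = n.card :=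
  Fin.equiv_iff_eq.1 ⟨Hom.perm α⟩

lemma IsCast.sumHom {m m' n n' : Wreath H} {α : m ⟶ m'} {β : n ⟶ n'} (h : IsCast α)
    (h' : IsCast β) : IsCast (sumHom α β) := by
  constructor
  · refine cases_add (fun i => ?_) (fun i => ?_)
    · simp [h.1]
    · simp [h'.1, IsCast.card_eq α]
  · refine cases_add (fun i => ?_) (fun i => ?_)
    · simp [h.2]
    · simp [h'.2]

lemma isCast_finCongr {m n : Wreath H} (h : m.card = n.card) :
    IsCast (ofEquiv (H := H) (finCongr h)).hom := ⟨fun _ => rfl, fun _ => rfl⟩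

instance : MonoidalCategory (Wreath H) :=
  .ofTensorHom
    (id_tensorHom_id := sumHom_id)
    (id_tensorHom := fun _ _ _ _ => rfl)
    (tensorHom_id := fun _ _ => rfl)
    (tensorHom_comp_tensorHom := fun α β α' β' => sumHom_comp α α' β β')
    (associator_naturality := fun α β γ => ofEquiv_naturality _ _ _ _
      (blockSum_assoc (Hom.perm α) (Hom.perm β) (Hom.perm γ))
      (append_assoc (Hom.elt α) (Hom.elt β) (Hom.elt γ)))
    (leftUnitor_naturality := fun {m n} α => ofEquiv_naturality _ _ _ _
      (cases_add (fun i => i.elim0) (fun i => by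
        have e (a : ℕ) (i : Fin a) : finCongr (Nat.zero_add a) (Fin.natAdd 0 i) = i :=
          Fin.ext (Nat.zero_add _)
        exact ((congrArg _ (blockSum_natAdd _ _ i)).trans (e _ _)).trans
          (congrArg (Hom.perm α) (e _ i)).symm))
      (cases_add (fun i => i.elim0) (fun i => by
        have e (a : ℕ) (i : Fin a) : finCongr (Nat.zero_add a) (Fin.natAdd 0 i) = i :=
          Fin.ext (Nat.zero_add _)
        exact (Fin.append_right (Hom.elt (𝟙 (𝟙_ (Wreath H)))) (Hom.elt α) i).trans
          (congrArg (Hom.elt α) (e _ i)).symm)))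
    (rightUnitor_naturality := fun α => ofEquiv_naturality _ _ _ _
      (cases_add (fun i => congrArg (finCongr _) (blockSum_castAdd _ _ i)) (fun i => i.elim0))
      (cases_add (fun i => Fin.append_left _ _ i) (fun i => i.elim0)))
    (pentagon := fun _ _ _ _ => IsCast.eq
      ((((isCast_finCongr _).sumHom (.id _)).comp ((isCast_finCongr _).comp
        ((IsCast.id _).sumHom (isCast_finCongr _)))))
      ((isCast_finCongr _).comp (isCast_finCongr _)))
    (triangle := fun _ _ => IsCast.eq
      ((isCast_finCongr _).comp ((IsCast.id _).sumHom (isCast_finCongr _)))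
      ((isCast_finCongr _).sumHom (.id _)))

lemma blockSwap_blockSum {a b c d : ℕ} (σ : Fin a ≃ Fin b) (τ : Fin c ≃ Fin d) :
    ∀ i, blockSwap b d (blockSum σ τ i) = blockSum τ σ (blockSwap a c i) :=
  cases_add (fun i => by simp) (fun i => by simp)

lemma append_blockSwap {K : Type u} {a b : ℕ} (f : Fin a → K) (g : Fin b → K) :
    ∀ i, Fin.append f g i = Fin.append g f (blockSwap a b i) :=
  cases_add (fun i => by simp) (fun i => by simp)

/-- The morphism `α` only involves the unit of `H`. -/
def IsPlain {m n : Wreath H} (α : m ⟶ n) : Prop := ∀ i, Hom.elt α i = 1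

lemma IsPlain.comp {m n k : Wreath H} {α : m ⟶ n} {β : n ⟶ k} (h : IsPlain α) (h' : IsPlain β) :
    IsPlain (α ≫ β) := fun i => by simp [h _, h' _]

lemma IsPlain.sumHom {m m' n n' : Wreath H} {α : m ⟶ m'} {β : n ⟶ n'} (h : IsPlain α)
    (h' : IsPlain β) : IsPlain (sumHom α β) :=
  cases_add (fun i => by simp [h _]) (fun i => by simp [h' _])

lemma isPlain_id (m : Wreath H) : IsPlain (𝟙 m) := fun _ => rfl

lemma isPlain_ofEquiv {m n : Wreath H} (e : Fin m.card ≃ Fin n.card) :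
    IsPlain (ofEquiv (H := H) e).hom := fun _ => rfl

lemma isPlain_ofEquiv_inv {m n : Wreath H} (e : Fin m.card ≃ Fin n.card) :
    IsPlain (ofEquiv (H := H) e).inv := fun _ => rfl

lemma hexagon₁ (a b c : ℕ) : ∀ i : Fin (a + b + c),
    finCongr (Nat.add_assoc b c a) (blockSwap a (b + c) (finCongr (Nat.add_assoc a b c) i)) =
      blockSum (Equiv.refl (Fin b)) (blockSwap a c) (finCongr (Nat.add_assoc b a c)
        (blockSum (blockSwap a b) (Equiv.refl (Fin c)) i)) := by
  refine cases_add (cases_add (fun i => ?_) (fun i => ?_)) (fun i => ?_)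
  · rw [finCongr_assoc₁]
    simp only [blockSum_castAdd, blockSum_natAdd, blockSwap_castAdd, finCongr_assoc₂,
      finCongr_assoc₃]
  · rw [finCongr_assoc₂]
    simp only [blockSum_castAdd, blockSwap_natAdd, finCongr_assoc₁, Equiv.refl_apply]
  · rw [finCongr_assoc₃]
    simp only [blockSum_natAdd, blockSwap_natAdd, finCongr_assoc₂,
      finCongr_assoc₃, Equiv.refl_apply]

lemma hexagon₂ (a b c : ℕ) : ∀ i : Fin (a + (b + c)),
    (finCongr (Nat.add_assoc c a b)).symm (blockSwap (a + b) c
        ((finCongr (Nat.add_assoc a b c)).symm i)) =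
      blockSum (blockSwap a c) (Equiv.refl (Fin b)) ((finCongr (Nat.add_assoc a c b)).symm
        (blockSum (Equiv.refl (Fin a)) (blockSwap b c) i)) := by
  refine (finCongr (Nat.add_assoc a b c)).surjective.forall.2
    (cases_add (cases_add (fun i => ?_) (fun i => ?_)) (fun i => ?_))
  all_goals rw [Equiv.symm_apply_apply, Equiv.symm_apply_eq]
  · rw [finCongr_assoc₁, blockSum_castAdd, ← finCongr_assoc₁, Equiv.symm_apply_apply]
    simp only [blockSum_castAdd, blockSwap_castAdd, finCongr_assoc₂, Equiv.refl_apply]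
  · rw [finCongr_assoc₂, blockSum_natAdd, blockSwap_castAdd, blockSwap_castAdd,
      ← finCongr_assoc₃ (a := a) (b := c), Equiv.symm_apply_apply]
    simp only [blockSum_natAdd, finCongr_assoc₃, Equiv.refl_apply]
  · rw [finCongr_assoc₃, blockSum_natAdd, blockSwap_natAdd, blockSwap_natAdd, ← finCongr_assoc₂,
      Equiv.symm_apply_apply]
    simp only [blockSum_castAdd, blockSwap_natAdd, finCongr_assoc₁]

instance : SymmetricCategory (Wreath H) where
  braiding m n := ofEquiv (blockSwap m.card n.card)
  braiding_naturality_right m _ _ α := ofEquiv_naturality _ _ _ _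
    (blockSwap_blockSum (Hom.perm (𝟙 m)) (Hom.perm α))
    (append_blockSwap (Hom.elt (𝟙 m)) (Hom.elt α))
  braiding_naturality_left α m := ofEquiv_naturality _ _ _ _
    (blockSwap_blockSum (Hom.perm α) (Hom.perm (𝟙 m)))
    (append_blockSwap (Hom.elt α) (Hom.elt (𝟙 m)))
  hexagon_forward m n k := hom_ext (hexagon₁ m.card n.card k.card) fun i =>
    (((isPlain_ofEquiv _).comp ((isPlain_ofEquiv _).comp (isPlain_ofEquiv _))) i).trans
      ((((isPlain_ofEquiv _).sumHom (isPlain_id _)).comp ((isPlain_ofEquiv _).comp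
        ((isPlain_id _).sumHom (isPlain_ofEquiv _)))) i).symm
  hexagon_reverse m n k := hom_ext (hexagon₂ m.card n.card k.card) fun i =>
    (((isPlain_ofEquiv_inv _).comp ((isPlain_ofEquiv _).comp (isPlain_ofEquiv_inv _))) i).trans
      ((((isPlain_id _).sumHom (isPlain_ofEquiv _)).comp ((isPlain_ofEquiv_inv _).comp
        ((isPlain_ofEquiv _).sumHom (isPlain_id _)))) i).symm
  symmetry m n := hom_ext (cases_add (fun i => by
      exact (congrArg (blockSwap _ _) (blockSwap_castAdd _ _ i)).trans (blockSwap_natAdd _ _ i))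
    (fun i => by
      exact (congrArg (blockSwap _ _) (blockSwap_natAdd _ _ i)).trans (blockSwap_castAdd _ _ i)))
    fun i => ((isPlain_ofEquiv _).comp (isPlain_ofEquiv _)) i

end Wreath

/-! ### The global effective Burnside category and its unfurling -/

/-- The one-object groupoid `BH`. -/
structure OneObj (H : Type u) : Type u where

instance (H : Type u) [Group H] : Category.{u} (OneObj H) where
  Hom _ _ := H
  id _ := 1
  comp g h := h * g
  id_comp := mul_one
  comp_id := one_mul
  assoc f g h := (mul_assoc h g f).symm

/-- The finite groupoid `BH` attached to a finite group `H`. -/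
def classifying (H : Type u) [Group H] [Finite H] : FinGrpd.{u} where
  carrier := OneObj H
  isGroupoid := ⟨fun (g : H) => ⟨⟨(g⁻¹ : H), inv_mul_cancel g, mul_inv_cancel g⟩⟩⟩
  finite_obj := Finite.of_injective (fun _ : OneObj H => ()) fun _ _ _ => rfl
  finite_hom _ _ := inferInstanceAs (Finite H)

/-- The class of faithful functors. -/
def faithful ⦃A B : FinGrpd.{u}⦄ (f : A ⟶ B) : Prop :=
  Functor.Faithful (C := A.carrier) (D := B.carrier) f

/-- The class of all functors. -/
def anyFunctor ⦃A B : FinGrpd.{u}⦄ (_ : A ⟶ B) : Prop := True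

/-- The global effective Burnside category `A_gl`: its edges from `G` to `H` are the spans
`G ⟵ X ⟶ H` of finite groupoids with faithful forward leg `X ⟶ H`. -/
def globalBurnside : SSet.{u + 2} := effBurnside.{u + 2} FinGrpd.{u} faithful anyFunctor

/-- The isomorphism between `(A_gl)ᵒᵖ` and the effective Burnside category of spans of finite
groupoids with faithful backward legs. -/
def globalBurnsideOpIso :
    globalBurnside.{u}.op ≅ effBurnside.{u + 2} FinGrpd.{u} anyFunctor faithful :=
  effBurnsideOpIso.{u + 2} FinGrpd.{u} faithful anyFunctor

/-- The functor `Ψ` is the unfurling of `G ↦ h𝔽_G`, `f ↦ f_!` with respect to the chosen right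
adjoints `i^*` of the functors `i_!` for faithful `i`. -/
def IsUnfurling (R : RightAdjointChoice psi.{u} faithful)
    (Ψ : effBurnside.{u + 2} FinGrpd.{u} anyFunctor faithful ⟶ duskinNerve CatCop.{u, u + 1}) :
    Prop :=
  ∀ (n : SimplexCategoryᵒᵖ) (s : AeffSimplex.{u + 2} FinGrpd.{u} anyFunctor faithful n.unop.len),
    NormalFunctor.toNormalData (Ψ.app n s) = unfurlData R s

/-- The composite `core ∘ Ψ`, as a functor defined on `(A_gl)ᵒᵖ`. -/
noncomputable def coreComp
    (Ψ : effBurnside.{u + 2} FinGrpd.{u} anyFunctor faithful ⟶ duskinNerve CatCop.{u, u + 1}) :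
    globalBurnside.{u}.op ⟶ duskinNerve SymMonCat.{u, u + 1} :=
  globalBurnsideOpIso.hom ≫ Ψ ≫ coreNerve

/-- The object corresponding to a vertex of the Duskin nerve. -/
def vertexObj {B : Type u} [Bicategory.{w, v} B] (T : (duskinNerve B) _⦋0⦌) : B :=
  NormalData.obj (NormalFunctor.toNormalData T) 0

/-- The symmetric monoidal categories `C` and `D` are equivalent: there is a strong symmetric
monoidal functor `C ⥤ D` which is an equivalence of categories. -/
def SymMonEquivalent (C : Type*) [Category C] [MonoidalCategory C] [SymmetricCategory C]
    (D : Type*) [Category D] [MonoidalCategory D] [SymmetricCategory D] : Prop :=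
  ∃ F : C ⥤ D, F.IsEquivalence ∧ Nonempty F.Braided

end GlobalBurnside

open GlobalBurnside

namespace GlobalBurnside

/-! Everything is computed on points. Write `pt γ` for the one-point cover at an object `γ` of `G`.
Morphisms `pt γ ⟶ pt γ'` are the morphisms `γ ⟶ γ'`, and since the total groupoid of a cover is
thin, every cover is the colimit of its points; in other words `h𝔽_G` is the free completion of `G`
under finite coproducts. Hence morphisms can be compared, constructed and inverted on points
(`hom_ext_pt`, `exists_desc`, `isIso_of_bijective`).

A point of `q_! A` over `h` is a morphism `h ⟶ q x` together with a point of `A` over `x`, modulo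
the morphisms between the objects `x` (`pel_eq_iff`). For `j` faithful, the homotopy pullback of a
cover along `j` is again a cover, so `j_!` has a right adjoint, and a point of `j^* Z` over `x` is a
point of `Z` over `j x` (`adjPt_bijective`). Thus a span with legs `j : X ⟶ G` and `g : X ⟶ H` sends
`Z` to the cover of `H` whose points over `h` are triples of an object `x` of `X`, a morphism `h ⟶ g
x` and a point of `Z` over `j x`, modulo the morphisms of `X` (`el_eq_iff`). The `2`-cells of the
unfurling are given on triples by an explicit formula (`el_comp_spanCell`). Their invertibility is
the homotopy pullback property read on triples (`spanCell_isIso`), and the unit and cocycle laws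
reduce to those of the diagram of groupoids. Uniqueness of `Ψ` is automatic, because all of its data
are prescribed.

For full faithfulness the first task is to see that symmetric monoidal functors `core h𝔽_G ⟶ core
h𝔽_H` are spans. Such a functor `F` is a priori defined only on isomorphisms, but its tensorator
makes it functorial for inclusions of summands (`SymFun.inc`). Therefore `F Z` is assembled from the
values of `F` at the points of `Z`, and `F` and the transformations out of it are controlled by the
restriction to one-point covers, that is by a functor on `G` (`SymFun.hom_ext_pt`,
`SymFun.exists_extension`). The Grothendieck construction of the total groupoids of the covers `F
(pt γ)` is a finite groupoid which is faithful over `G` and maps to `H`; this span recovers `F`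
(`exists_sym_hom`). Evaluating a transformation on the tautological triples of a span gives an
equivalence of spans (`exists_trans_eq`), and two equivalences give the same transformation exactly
when they are isomorphic (`trans_eq_iff`); the isomorphism is unique because backward legs are
faithful.

It remains to identify the mapping spaces. For a Duskin nerve, simplices of the right mapping space
are chains of invertible `2`-cells (`chainToHomRight_bijective`). For the effective Burnside
category they are diagrams on the twisted arrows of `[n + 1]` which are constant on the arrows not
involving the last vertex; the pullback condition makes the maps between the apexes equivalences,
and the cells between these are forced by faithfulness. So one obtains chains of equivalences of
spans (`spanChainToHomRight_bijective`). Under both identifications `core ∘ Ψ` becomes the map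
sending a span to its functor (`unfurlCore_twNormal`), and a choice of spans and equivalences
representing functors and transformations supplies a homotopy inverse
(`isHomotopyEquivalence_toChainMap`).

For the essential image, invertible edges of the Duskin nerve are matched with symmetric monoidal
equivalences. Choosing representatives of the isomorphism classes of `G` identifies `core h𝔽_G` with
the product of the permutative categories of their automorphism groups
(`Representatives.symMonEquivalent`), and every finite family of finite groups arises from the
disjoint union of the groupoids `BH_i`. -/

/-- The one-point groupoid. -/
def FinGrpd.point : FinGrpd.{u} where
  carrier := Discrete PUnit.{u + 1}
  finite_obj := Finite.of_injective (fun _ => PUnit.unit.{u + 1}) fun _ _ _ => by ext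

/-! ### Points of covers. -/

namespace FinCover

variable {G H K : FinGrpd.{u}}

/-- The one-point cover at `γ`. -/
def pt (γ : G.carrier) : FinCover G where
  total := FinGrpd.point
  proj := (Functor.const (Discrete PUnit.{u + 1})).obj γ
  thin _ _ := inferInstanceAs (Subsingleton (ULift (PLift _)))

instance (γ : G.carrier) : Subsingleton (pt γ).total.carrier :=
  inferInstanceAs (Subsingleton (Discrete PUnit.{u + 1}))

instance (γ : G.carrier) (x y : (pt γ).total.carrier) : Subsingleton (x ⟶ y) := (pt γ).thin x y

/-- The `1`-cell from a one-point cover determined by a point and a morphism. -/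
noncomputable def ptCell {γ : G.carrier} {A : FinCover G} (a : A.total.carrier)
    (m : γ ⟶ A.proj.obj a) : OneCell (pt γ) A where
  functor := (Functor.const (Discrete PUnit.{u + 1})).obj a
  cell := NatIso.ofComponents
    (F := (Functor.const (Discrete PUnit.{u + 1})).obj γ)
    (G := (Functor.const (Discrete PUnit.{u + 1})).obj a ⋙ A.proj)
    (fun _ => asIso m) (by intros; simp)

/-- The morphism from a one-point cover determined by a point and a morphism. -/
noncomputable def ptHom {γ : G.carrier} {A : FinCover G} (a : A.total.carrier)
    (m : γ ⟶ A.proj.obj a) : pt γ ⟶ A := homMk (ptCell a m)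

/-- The unique point of a one-point cover. -/
def star (γ : G.carrier) : (pt γ).total.carrier := (⟨⟨⟩⟩ : Discrete PUnit.{u + 1})

lemma ptHom_surjective {γ : G.carrier} {A : FinCover G} (φ : pt γ ⟶ A) :
    ∃ (a : A.total.carrier) (m : γ ⟶ A.proj.obj a), ptHom a m = φ := by
  obtain ⟨α, rfl⟩ := homMk_surjective φ
  refine ⟨α.functor.obj (star γ), α.cell.hom.app (star γ), homMk_eq
    (NatIso.ofComponents (fun _ => Iso.refl _) ?_) ?_⟩
  · intro x y f
    obtain rfl : x = y := Subsingleton.elim _ _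
    obtain rfl : f = 𝟙 x := Subsingleton.elim _ _
    refine (Category.comp_id _).trans ?_
    rw [α.functor.map_id]
    exact (Category.id_comp _).symm
  · intro x
    exact (congrArg _ (A.proj.map_id _)).trans (Category.comp_id _)

/-- `1`-cells are identified along invertible `2`-cells over `G`, and a `2`-cell out of a one-point
groupoid is a single morphism `k`. -/
lemma ptHom_eq_iff {γ : G.carrier} {A : FinCover G} {a a' : A.total.carrier}
    {m : γ ⟶ A.proj.obj a} {m' : γ ⟶ A.proj.obj a'} :
    ptHom a m = ptHom a' m' ↔ ∃ k : a ⟶ a', m ≫ A.proj.map k = m' := by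
  constructor
  · intro h
    obtain ⟨φ, h⟩ := exists_of_homMk_eq h
    exact ⟨φ.hom.app (star γ), h (star γ)⟩
  · rintro ⟨k, rfl⟩
    exact homMk_eq (α := ptCell a m) (β := ptCell a' (m ≫ A.proj.map k))
      ((Functor.const (Discrete PUnit.{u + 1})).mapIso (asIso k)) fun _ => rfl

/-- Thinness of the total groupoid enters here: the only morphism `a ⟶ a` is the identity. -/
lemma ptHom_injective {γ : G.carrier} {A : FinCover G} {a : A.total.carrier}
    {m m' : γ ⟶ A.proj.obj a} (h : ptHom a m = ptHom a m') : m = m' := by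
  obtain ⟨k, rfl⟩ := ptHom_eq_iff.1 h
  have := A.thin a a
  rw [Subsingleton.elim k (𝟙 a), A.proj.map_id, Category.comp_id]

lemma ptHom_comp_homMk {γ : G.carrier} {A B : FinCover G} (a : A.total.carrier)
    (m : γ ⟶ A.proj.obj a) (α : OneCell A B) :
    ptHom a m ≫ homMk α = ptHom (α.functor.obj a) (m ≫ α.cell.hom.app a) :=
  homMk_eq (α := (ptCell a m).comp α) (β := ptCell (α.functor.obj a) (m ≫ α.cell.hom.app a))
    (Functor.constComp _ _ _) fun _ => by
      refine (congrArg _ (B.proj.map_id _)).trans (Category.comp_id _)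

/-- Equality on each point yields the component of a `2`-cell there; naturality costs nothing
because the total groupoid of `B` is thin. -/
lemma hom_ext_pt {A B : FinCover G} {φ ψ : A ⟶ B}
    (h : ∀ a, ptHom a (𝟙 (A.proj.obj a)) ≫ φ = ptHom a (𝟙 (A.proj.obj a)) ≫ ψ) : φ = ψ := by
  obtain ⟨α, rfl⟩ := homMk_surjective φ
  obtain ⟨β, rfl⟩ := homMk_surjective ψ
  have h' : ∀ a, ∃ k : α.functor.obj a ⟶ β.functor.obj a,
      α.cell.hom.app a ≫ B.proj.map k = β.cell.hom.app a := fun a => by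
    have := h a
    rw [ptHom_comp_homMk, ptHom_comp_homMk, ptHom_eq_iff] at this
    obtain ⟨k, hk⟩ := this
    refine ⟨k, ?_⟩
    rwa [Category.id_comp, Category.id_comp] at hk
  choose k hk using h'
  have := B.thin
  exact homMk_eq (NatIso.ofComponents (fun a => asIso (k a))
    (fun f => Subsingleton.elim _ _)) hk

/-- The morphism of one-point covers induced by a morphism. -/
noncomputable def ptMap {γ γ' : G.carrier} (m : γ ⟶ γ') : pt γ ⟶ pt γ' := ptHom (star γ') m

lemma ptMap_comp_ptHom {γ γ' : G.carrier} (m : γ ⟶ γ') {A : FinCover G} (a : A.total.carrier)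
    (n : γ' ⟶ A.proj.obj a) : ptMap m ≫ ptHom a n = ptHom a (m ≫ n) :=
  ptHom_comp_homMk _ _ _

lemma ptMap_id (γ : G.carrier) : ptMap (𝟙 γ) = 𝟙 (pt γ) :=
  homMk_eq (α := ptCell (star γ) (𝟙 γ)) (β := OneCell.id (pt γ))
    (NatIso.ofComponents (fun _ => Iso.refl _) (fun _ => (pt γ).thin _ _ |>.elim _ _))
    fun _ => Category.comp_id _

lemma ptMap_comp {γ γ' γ'' : G.carrier} (m : γ ⟶ γ') (n : γ' ⟶ γ'') :
    ptMap (m ≫ n) = ptMap m ≫ ptMap n := (ptMap_comp_ptHom _ _ _).symm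

lemma ptMap_surjective {γ γ' : G.carrier} (φ : pt γ ⟶ pt γ') : ∃ m : γ ⟶ γ', ptMap m = φ := by
  obtain ⟨a, m, rfl⟩ := ptHom_surjective φ
  exact ⟨m, rfl⟩

lemma ptMap_injective {γ γ' : G.carrier} {m m' : γ ⟶ γ'} (h : ptMap m = ptMap m') : m = m' :=
  ptHom_injective h

lemma ptHom_eq {γ : G.carrier} {A : FinCover G} (a : A.total.carrier) (m : γ ⟶ A.proj.obj a) :
    ptHom a m = ptMap m ≫ ptHom a (𝟙 _) := by
  rw [ptMap_comp_ptHom, Category.comp_id]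

lemma ptHom_naturality {A : FinCover G} {a a' : A.total.carrier} (k : a ⟶ a') :
    ptMap (A.proj.map k) ≫ ptHom a' (𝟙 _) = ptHom a (𝟙 _) := by
  rw [ptMap_comp_ptHom, Category.comp_id, eq_comm, ptHom_eq_iff]
  exact ⟨k, Category.id_comp _⟩

/-- A cover is the colimit of its points over its total groupoid. Representatives of the given
points are chosen arbitrarily, and the morphisms relating them are functorial since `B` has thin
total groupoid. -/
lemma exists_desc {A B : FinCover G} (φ : ∀ a : A.total.carrier, pt (A.proj.obj a) ⟶ B)
    (h : ∀ {a a' : A.total.carrier} (k : a ⟶ a'), ptMap (A.proj.map k) ≫ φ a' = φ a) :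
    ∃ ψ : A ⟶ B, ∀ a, ptHom a (𝟙 _) ≫ ψ = φ a := by
  choose b m hb using fun a => ptHom_surjective (φ a)
  have h' : ∀ {a a' : A.total.carrier} (k : a ⟶ a'), ∃ l : b a ⟶ b a',
      m a ≫ B.proj.map l = A.proj.map k ≫ m a' := fun {a a'} k => by
    have := h k
    rw [← hb, ← hb, ptMap_comp_ptHom, eq_comm, ptHom_eq_iff] at this
    exact this
  choose l hl using @h'
  have := B.thin
  refine ⟨homMk ⟨⟨b, fun k => l k, fun _ => Subsingleton.elim _ _,
    fun _ _ => Subsingleton.elim _ _⟩,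
    NatIso.ofComponents (fun a => asIso (m a)) fun k => (hl k).symm⟩, fun a => ?_⟩
  rw [ptHom_comp_homMk, ← hb]
  exact congrArg _ (Category.id_comp _)

lemma hom_ext_pt' {A B : FinCover G} {φ ψ : A ⟶ B}
    (h : ∀ {γ : G.carrier} (ξ : pt γ ⟶ A), ξ ≫ φ = ξ ≫ ψ) : φ = ψ := hom_ext_pt fun _ => h _

/-- The preimages of the tautological points of `B` are compatible by injectivity, so they glue to
an inverse. -/
lemma isIso_of_bijective {A B : FinCover G} (φ : A ⟶ B)
    (h : ∀ γ : G.carrier, Function.Bijective fun ξ : pt γ ⟶ A => ξ ≫ φ) : IsIso φ := by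
  choose ξ hξ using fun b : B.total.carrier => (h _).2 (ptHom b (𝟙 (B.proj.obj b)))
  obtain ⟨ψ, hψ⟩ := exists_desc ξ (fun {b b'} k => (h _).1 (by
    have e := hξ b; have e' := hξ b'
    dsimp only at e e' ⊢
    rw [Category.assoc, e', e, ptHom_naturality]))
  have e : ψ ≫ φ = 𝟙 B := hom_ext_pt fun b => by
    have e := hξ b
    dsimp only at e
    rw [← Category.assoc, hψ, e, Category.comp_id]
  refine ⟨ψ, hom_ext_pt' fun η => (h _).1 ?_, e⟩
  simp only [Category.assoc, e, Category.comp_id]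

/-- Injectivity of `j` on points makes the pointwise lifts unique, hence compatible. -/
lemma exists_lift_of_mono {A B C : FinCover G} (φ : A ⟶ C) (j : B ⟶ C)
    (hj : ∀ γ : G.carrier, Function.Injective fun ξ : pt γ ⟶ B => ξ ≫ j)
    (h : ∀ {γ : G.carrier} (ξ : pt γ ⟶ A), ∃ η : pt γ ⟶ B, η ≫ j = ξ ≫ φ) :
    ∃ ψ : A ⟶ B, ψ ≫ j = φ := by
  choose ξ hξ using fun a : A.total.carrier => h (ptHom a (𝟙 (A.proj.obj a)))
  obtain ⟨ψ, hψ⟩ := exists_desc ξ (fun {a a'} k => hj _ (by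
    dsimp only
    rw [Category.assoc, hξ, hξ, ← Category.assoc, ptHom_naturality]))
  exact ⟨ψ, hom_ext_pt fun a => by rw [← Category.assoc, hψ, hξ]⟩

/-! ### Coproducts and points -/

open Limits

lemma isEmpty_pt_of_isInitial {Z : FinCover G} (h : IsInitial Z) (γ : G.carrier) :
    IsEmpty (pt γ ⟶ Z) := ⟨fun ξ => by
  obtain ⟨a, -, -⟩ := ptHom_surjective
    (ξ ≫ h.to (emptyMk (G := G) (Discrete.functor (PEmpty.elim.{u + 1}))))
  exact a.as.elim⟩

/-- A cover without points is initial. -/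
noncomputable def isInitialOfIsEmpty {Z : FinCover G} (h : ∀ γ : G.carrier, IsEmpty (pt γ ⟶ Z)) :
    IsInitial Z :=
  IsInitial.ofUniqueHom (fun _ => (exists_desc (fun a => ((h _).false (ptHom a (𝟙 _))).elim)
    (fun {a _} _ => ((h _).false (ptHom a (𝟙 _))).elim)).choose)
    fun _ _ => hom_ext_pt fun a => ((h _).false (ptHom a (𝟙 _))).elim

/-- The points of `Z` are the disjoint union of those of `A` and `B`. -/
def IsSumOnPoints {A B Z : FinCover G} (i : A ⟶ Z) (j : B ⟶ Z) : Prop :=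
  ∀ γ : G.carrier, Function.Bijective
    (Sum.elim (fun ξ : pt γ ⟶ A => ξ ≫ i) (fun ξ : pt γ ⟶ B => ξ ≫ j))

lemma isSumOnPoints_sumMk {X Y : FinCover G} {P : X.total.carrier ⊕ Y.total.carrier ⥤ G.carrier}
    (a : X.proj ≅ Sum.inl_ X.total.carrier Y.total.carrier ⋙ P)
    (b : Y.proj ≅ Sum.inr_ X.total.carrier Y.total.carrier ⋙ P) :
    IsSumOnPoints (homMk (inlCell a)) (homMk (inrCell b)) := by
  intro γ
  constructor
  · rintro (ξ | ξ) (η | η) h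
    all_goals
      obtain ⟨x, m, rfl⟩ := ptHom_surjective ξ
      obtain ⟨y, n, rfl⟩ := ptHom_surjective η
      simp only [Sum.elim_inl, Sum.elim_inr, ptHom_comp_homMk, ptHom_eq_iff] at h
      obtain ⟨k, hk⟩ := h
    · obtain ⟨l⟩ : Nonempty (x ⟶ y) := ⟨ULift.down k⟩
      refine congrArg _ (ptHom_eq_iff.2 ⟨ULift.down k, ?_⟩)
      have e : X.proj.map (ULift.down k) ≫ a.hom.app y = a.hom.app x ≫ P.map k :=
        a.hom.naturality (ULift.down k)
      rw [← cancel_mono (a.hom.app y), Category.assoc, e]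
      exact (Category.assoc _ _ _).symm.trans hk
    · exact PEmpty.elim k
    · exact PEmpty.elim k
    · refine congrArg _ (ptHom_eq_iff.2 ⟨ULift.down k, ?_⟩)
      have e : Y.proj.map (ULift.down k) ≫ b.hom.app y = b.hom.app x ≫ P.map k :=
        b.hom.naturality (ULift.down k)
      rw [← cancel_mono (b.hom.app y), Category.assoc, e]
      exact (Category.assoc _ _ _).symm.trans hk
  · intro ξ
    obtain ⟨x | x, m, rfl⟩ := ptHom_surjective ξ
    · refine ⟨Sum.inl (ptHom x (m ≫ a.inv.app x)), ?_⟩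
      refine (ptHom_comp_homMk _ _ _).trans (congrArg (ptHom (A := sumMk X Y P) (Sum.inl x)) ?_)
      exact (Category.assoc m _ _).trans
        ((congrArg (m ≫ ·) (a.inv_hom_id_app x)).trans (Category.comp_id m))
    · refine ⟨Sum.inr (ptHom x (m ≫ b.inv.app x)), ?_⟩
      refine (ptHom_comp_homMk _ _ _).trans (congrArg (ptHom (A := sumMk X Y P) (Sum.inr x)) ?_)
      exact (Category.assoc m _ _).trans
        ((congrArg (m ≫ ·) (b.inv_hom_id_app x)).trans (Category.comp_id m))

lemma IsSumOnPoints.comp_iso {A B Z Z' : FinCover G} {i : A ⟶ Z} {j : B ⟶ Z}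
    (h : IsSumOnPoints i j) (e : Z ⟶ Z') [IsIso e] : IsSumOnPoints (i ≫ e) (j ≫ e) := by
  intro γ
  have : (Sum.elim (fun ξ : pt γ ⟶ A => ξ ≫ i ≫ e) (fun ξ : pt γ ⟶ B => ξ ≫ j ≫ e)) =
      (fun η : pt γ ⟶ Z => η ≫ e) ∘
      (Sum.elim (fun ξ : pt γ ⟶ A => ξ ≫ i) (fun ξ : pt γ ⟶ B => ξ ≫ j)) := by
    funext x
    rcases x with x | x <;> simp
  rw [this]
  refine Function.Bijective.comp ⟨fun a b hab => (cancel_mono e).1 hab, fun b =>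
    ⟨b ≫ inv e, by simp⟩⟩ (h γ)

/-- One-point covers are connected objects. By uniqueness of coproducts it is enough to know this
for the disjoint union. -/
lemma isSumOnPoints_of_isColimit {A B Z : FinCover G} {i : A ⟶ Z} {j : B ⟶ Z}
    (h : IsColimit (BinaryCofan.mk i j)) : IsSumOnPoints i j := by
  let a : A.proj ≅ Sum.inl_ A.total.carrier B.total.carrier ⋙ Functor.sum' A.proj B.proj :=
    (Functor.inlCompSum' _ _).symm
  let b : B.proj ≅ Sum.inr_ A.total.carrier B.total.carrier ⋙ Functor.sum' A.proj B.proj :=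
    (Functor.inrCompSum' _ _).symm
  let e : sumMk A B (Functor.sum' A.proj B.proj) ≅ Z :=
    (isColimitSum a b).coconePointUniqueUpToIso h
  have h₁ : homMk (inlCell a) ≫ e.hom = i :=
    (isColimitSum a b).comp_coconePointUniqueUpToIso_hom h ⟨WalkingPair.left⟩
  have h₂ : homMk (inrCell b) ≫ e.hom = j :=
    (isColimitSum a b).comp_coconePointUniqueUpToIso_hom h ⟨WalkingPair.right⟩
  rw [← h₁, ← h₂]
  exact (isSumOnPoints_sumMk a b).comp_iso e.hom

/-- A cofan inducing bijections on points is a coproduct. -/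
noncomputable def IsSumOnPoints.isColimit {A B Z : FinCover G} {i : A ⟶ Z} {j : B ⟶ Z}
    (h : IsSumOnPoints i j) : IsColimit (BinaryCofan.mk i j) := by
  let a : A.proj ≅ Sum.inl_ A.total.carrier B.total.carrier ⋙ Functor.sum' A.proj B.proj :=
    (Functor.inlCompSum' _ _).symm
  let b : B.proj ≅ Sum.inr_ A.total.carrier B.total.carrier ⋙ Functor.sum' A.proj B.proj :=
    (Functor.inrCompSum' _ _).symm
  let d : sumMk A B (Functor.sum' A.proj B.proj) ⟶ Z :=
    (isColimitSum a b).desc (BinaryCofan.mk i j)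
  have h₁ : homMk (inlCell a) ≫ d = i := (isColimitSum a b).fac _ ⟨WalkingPair.left⟩
  have h₂ : homMk (inrCell b) ≫ d = j := (isColimitSum a b).fac _ ⟨WalkingPair.right⟩
  have : IsIso d := isIso_of_bijective d fun γ => by
    have e : (Sum.elim (fun ξ : pt γ ⟶ A => ξ ≫ i) (fun ξ : pt γ ⟶ B => ξ ≫ j)) =
      (fun η => η ≫ d) ∘ (Sum.elim (fun ξ : pt γ ⟶ A => ξ ≫ homMk (inlCell a))
        (fun ξ : pt γ ⟶ B => ξ ≫ homMk (inrCell b))) := by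
      funext x
      rcases x with x | x
      · simp only [Sum.elim_inl, Function.comp_apply, Category.assoc, h₁]
      · simp only [Sum.elim_inr, Function.comp_apply, Category.assoc, h₂]
    -- Two out of three for bijections: the cofan and the disjoint union have the same points.
    exact (Function.Bijective.of_comp_iff _ (isSumOnPoints_sumMk a b γ)).1 (e ▸ h γ)
  let e : sumMk A B (Functor.sum' A.proj B.proj) ≅ Z := asIso d
  exact (isColimitSum a b).ofIsoColimit (BinaryCofan.ext e h₁ h₂)

/-! ### Points of push-forwards -/

section

variable (q : G.carrier ⥤ H.carrier) {h : H.carrier} {x : G.carrier} {A : FinCover G}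

/-- The morphism from a one-point cover to `q_! A` determined by a point and a morphism. -/
noncomputable def pushPtHom (a : A.total.carrier) (m : h ⟶ q.obj (A.proj.obj a)) :
    pt h ⟶ (push q).obj A := ptHom (A := pushObj q A) a m

lemma pushPtHom_surjective (φ : pt h ⟶ (push q).obj A) :
    ∃ (a : A.total.carrier) (m : h ⟶ q.obj (A.proj.obj a)), pushPtHom q a m = φ :=
  ptHom_surjective (A := pushObj q A) φ

variable {q} in
lemma pushPtHom_eq_iff {a a' : A.total.carrier} {m : h ⟶ q.obj (A.proj.obj a)}
    {m' : h ⟶ q.obj (A.proj.obj a')} :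
    pushPtHom q a m = pushPtHom q a' m' ↔ ∃ k : a ⟶ a', m ≫ q.map (A.proj.map k) = m' :=
  ptHom_eq_iff (A := pushObj q A)

lemma ptMap_comp_pushPtHom {h' : H.carrier} (k : h' ⟶ h) (a : A.total.carrier)
    (m : h ⟶ q.obj (A.proj.obj a)) : ptMap k ≫ pushPtHom q a m = pushPtHom q a (k ≫ m) :=
  ptMap_comp_ptHom (A := pushObj q A) _ _ _

/-- The identification of the image of the unique point of a one-point cover. -/
def ptId (x : G.carrier) : x ⟶ (pt x).proj.obj (star x) := 𝟙 x

/-- The canonical point of `f_! [x]`. -/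
noncomputable def pushPt (f : G.carrier ⥤ H.carrier) (x : G.carrier) :
    pt (f.obj x) ⟶ (push f).obj (pt x) :=
  pushPtHom f (A := pt x) (star x) (f.map (ptId x))

/-- The push-forward of a one-point cover is the one-point cover at the image. The two are not
literally equal, so `pushPt` is carried along as the comparison. -/
instance (f : G.carrier ⥤ H.carrier) (x : G.carrier) : IsIso (pushPt f x) := by
  refine isIso_of_bijective _ fun γ => ⟨fun ξ η h => ?_, fun ξ => ?_⟩
  · obtain ⟨m, rfl⟩ := ptMap_surjective ξ
    obtain ⟨n, rfl⟩ := ptMap_surjective η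
    dsimp only [pushPt] at h
    rw [ptMap_comp_pushPtHom, ptMap_comp_pushPtHom] at h
    have := ptHom_injective (A := pushObj f (pt x)) h
    rw [(cancel_mono _).1 this]
  · obtain ⟨a, m, rfl⟩ := pushPtHom_surjective f ξ
    refine ⟨ptMap (m ≫ inv (f.map (ptId x))), (ptMap_comp_pushPtHom _ _ _ _).trans ?_⟩
    rw [Category.assoc]
    exact congrArg (pushPtHom f _) ((congrArg _ (IsIso.inv_hom_id _)).trans (Category.comp_id _))

/-- The point of `q_! A` given by a morphism `m : h ⟶ q x` and a point of `A` over `x`. -/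
noncomputable def pel (m : h ⟶ q.obj x) (ξ : pt x ⟶ A) : pt h ⟶ (push q).obj A :=
  ptMap m ≫ pushPt q x ≫ (push q).map ξ

lemma pel_ptHom (m : h ⟶ q.obj x) (a : A.total.carrier) (n : x ⟶ A.proj.obj a) :
    pel q m (ptHom a n) = pushPtHom q a (m ≫ q.map n) := by
  have : pushPt q x ≫ (push q).map (ptHom a n) = pushPtHom q a (q.map n) :=
    (ptHom_comp_homMk (A := pushObj q (pt x)) _ _ ((ptCell a n).push q)).trans
      (congrArg (pushPtHom q a) ((congrArg (· ≫ q.map n) (q.map_id x)).trans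
        (Category.id_comp (q.map n))))
  rw [pel, this, ptMap_comp_pushPtHom]

lemma pel_surjective (φ : pt h ⟶ (push q).obj A) :
    ∃ (x : G.carrier) (m : h ⟶ q.obj x) (ξ : pt x ⟶ A), pel q m ξ = φ := by
  obtain ⟨a, m, rfl⟩ := pushPtHom_surjective q φ
  refine ⟨A.proj.obj a, m, ptHom a (𝟙 _), ?_⟩
  rw [pel_ptHom, q.map_id, Category.comp_id]

/-- The points of `q_! A` over `h` form the coend over `x` of pairs of a morphism `h ⟶ q x` and a
point of `A` over `x`. Since `G` is a groupoid, one morphism `k` suffices to relate two equivalent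
pairs. -/
lemma pel_eq_iff {x' : G.carrier} {m : h ⟶ q.obj x} {m' : h ⟶ q.obj x'} {ξ : pt x ⟶ A}
    {ξ' : pt x' ⟶ A} :
    pel q m ξ = pel q m' ξ' ↔ ∃ k : x ⟶ x', m ≫ q.map k = m' ∧ ptMap k ≫ ξ' = ξ := by
  obtain ⟨a, n, rfl⟩ := ptHom_surjective ξ
  obtain ⟨a', n', rfl⟩ := ptHom_surjective ξ'
  rw [pel_ptHom, pel_ptHom, pushPtHom_eq_iff]
  constructor
  · rintro ⟨k, hk⟩
    -- The condition on the points of `A` forces this morphism: it passes from `x` to `x'` through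
    -- the objects `a` and `a'` which represent `ξ` and `ξ'`.
    refine ⟨n ≫ A.proj.map k ≫ inv n', ?_, ?_⟩
    · rw [q.map_comp, q.map_comp, ← Category.assoc, ← Category.assoc, hk, Category.assoc,
        ← q.map_comp, IsIso.hom_inv_id, q.map_id, Category.comp_id]
    · rw [ptMap_comp_ptHom, eq_comm, ptHom_eq_iff]
      exact ⟨k, by simp⟩
  · rintro ⟨k, rfl, hk⟩
    rw [ptMap_comp_ptHom, eq_comm, ptHom_eq_iff] at hk
    obtain ⟨l, hl⟩ := hk
    refine ⟨l, ?_⟩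
    rw [Category.assoc, ← q.map_comp, hl, q.map_comp, Category.assoc]

lemma ptMap_comp_pel {h' : H.carrier} (k : h' ⟶ h) (m : h ⟶ q.obj x) (ξ : pt x ⟶ A) :
    ptMap k ≫ pel q m ξ = pel q (k ≫ m) ξ := by
  rw [pel, pel, ptMap_comp, Category.assoc]

lemma pel_comp_map {B : FinCover G} (m : h ⟶ q.obj x) (ξ : pt x ⟶ A) (φ : A ⟶ B) :
    pel q m ξ ≫ (push q).map φ = pel q m (ξ ≫ φ) := by
  rw [pel, pel, (push q).map_comp, Category.assoc, Category.assoc]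

lemma pel_ptMap_comp {x' : G.carrier} (m : h ⟶ q.obj x') (k : x' ⟶ x) (ξ : pt x ⟶ A) :
    pel q m (ptMap k ≫ ξ) = pel q (m ≫ q.map k) ξ :=
  (pel_eq_iff q).2 ⟨k, rfl, rfl⟩

variable {q} in
lemma pel_comp_pushTrans {q' : G.carrier ⥤ H.carrier} (σ : q ⟶ q') (m : h ⟶ q.obj x)
    (ξ : pt x ⟶ A) : pel q m ξ ≫ (pushTrans σ).app A = pel q' (m ≫ σ.app x) ξ := by
  obtain ⟨a, n, rfl⟩ := ptHom_surjective ξ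
  rw [pel_ptHom, pel_ptHom]
  refine (ptHom_comp_homMk (A := pushObj q A) _ _ (transCell σ A)).trans
    (congrArg (pushPtHom q' a) ?_)
  change (m ≫ q.map n) ≫ σ.app _ = _
  rw [Category.assoc, Category.assoc, σ.naturality]

/-- Push-forward is strictly functorial on covers, so a point for the composite may be rewritten as
a nested point. -/
lemma pel_comp (r : H.carrier ⥤ K.carrier) {k : K.carrier} (m : k ⟶ r.obj (q.obj x))
    (ξ : pt x ⟶ A) :
    pel (A := A) (x := x) (q ⋙ r) m ξ = pel (A := (push q).obj A) r m (pel q (𝟙 _) ξ) := by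
  obtain ⟨a, n, rfl⟩ := ptHom_surjective ξ
  rw [pel_ptHom, pel_ptHom]
  refine Eq.trans ?_ (pel_ptHom r (A := pushObj q A) m a (𝟙 _ ≫ q.map n)).symm
  refine congrArg (ptHom (A := pushObj r (pushObj q A)) a) ?_
  change m ≫ r.map (q.map n) = m ≫ r.map (𝟙 _ ≫ q.map n)
  rw [Category.id_comp]

end

end FinCover

end GlobalBurnside

/-! ### Components of adjunctions, conjugates and mates in the `2`-category of categories with
finite coproducts. -/

namespace GlobalBurnside

namespace CatCop

variable {C D E : CatCop.{v, u}}

/-- The coherence isomorphisms of the zigzag are made explicit, so that its components in `CatCop`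
can be read off by unfolding. -/
lemma leftZigzag_eq {B : Type u} [Bicategory.{w, v} B] {a b : B} {f : a ⟶ b} {g : b ⟶ a}
    (η : 𝟙 a ⟶ f ≫ g) (θ : g ≫ f ⟶ 𝟙 b) :
    leftZigzag η θ = η ▷ f ≫ (α_ f g f).hom ≫ f ◁ θ := by
  dsimp only [leftZigzag]; bicategory

lemma rightZigzag_eq {B : Type u} [Bicategory.{w, v} B] {a b : B} {f : a ⟶ b} {g : b ⟶ a}
    (η : 𝟙 a ⟶ f ≫ g) (θ : g ≫ f ⟶ 𝟙 b) :
    rightZigzag η θ = g ◁ η ≫ (α_ g f g).inv ≫ θ ▷ g := by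
  dsimp only [rightZigzag]; bicategory

lemma comp_unit_eq {B : Type u} [Bicategory.{w, v} B] {a b c : B} {f₁ : a ⟶ b} {g₁ : b ⟶ a}
    {f₂ : b ⟶ c} {g₂ : c ⟶ b} (a₁ : f₁ ⊣ g₁) (a₂ : f₂ ⊣ g₂) :
    (a₁.comp a₂).unit = a₁.unit ≫ f₁ ◁ (λ_ _).inv ≫ f₁ ◁ a₂.unit ▷ g₁ ≫ f₁ ◁ (α_ _ _ _).hom ≫
      (α_ _ _ _).inv := by
  dsimp only [Bicategory.Adjunction.comp, Bicategory.Adjunction.compUnit]; bicategory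

/-- The adjunction of functors underlying an adjunction in `CatCop`. -/
def adjunction {L : C ⟶ D} {R : D ⟶ C} (a : L ⊣ R) : Fun.functor L ⊣ Fun.functor R :=
  CategoryTheory.Adjunction.mkOfUnitCounit
    { unit := a.unit
      counit := a.counit
      left_triangle := NatTrans.ext (funext fun X => by
        have e := congrArg (fun q : 𝟙 C ≫ L ⟶ L ≫ 𝟙 D => NatTrans.app q X)
          ((leftZigzag_eq _ _).symm.trans a.left_triangle)
        have e' : (Fun.functor L).map (NatTrans.app a.unit X) ≫ 𝟙 _ ≫
          NatTrans.app a.counit ((Fun.functor L).obj X) = 𝟙 _ ≫ 𝟙 _ := e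
        rw [Category.id_comp, Category.id_comp] at e'
        exact (congrArg (_ ≫ ·) (Category.id_comp _)).trans e')
      right_triangle := NatTrans.ext (funext fun X => by
        have e := congrArg (fun q : R ≫ 𝟙 C ⟶ 𝟙 D ≫ R => NatTrans.app q X)
          ((rightZigzag_eq _ _).symm.trans a.right_triangle)
        have e' : NatTrans.app a.unit ((Fun.functor R).obj X) ≫ 𝟙 _ ≫
          (Fun.functor R).map (NatTrans.app a.counit X) = 𝟙 _ ≫ 𝟙 _ := e
        rw [Category.id_comp, Category.id_comp] at e'
        exact (congrArg (_ ≫ ·) (Category.id_comp _)).trans e') }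

/-- The adjunction in `CatCop` attached to an adjunction of functors. -/
def ofAdjunction {L : C ⟶ D} {R : D ⟶ C} (a : Fun.functor L ⊣ Fun.functor R) : L ⊣ R where
  unit := a.unit
  counit := a.counit
  left_triangle := (leftZigzag_eq _ _).trans (NatTrans.ext (funext fun X => by
    change (Fun.functor L).map (a.unit.app X) ≫ 𝟙 _ ≫ a.counit.app ((Fun.functor L).obj X) =
      𝟙 _ ≫ 𝟙 _
    rw [Category.id_comp, Category.id_comp]
    exact a.left_triangle_components X))
  right_triangle := (rightZigzag_eq _ _).trans (NatTrans.ext (funext fun X => by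
    change a.unit.app ((Fun.functor R).obj X) ≫ 𝟙 _ ≫ (Fun.functor R).map (a.counit.app X) =
      𝟙 _ ≫ 𝟙 _
    rw [Category.id_comp, Category.id_comp]
    exact a.right_triangle_components X))

/-- Together with `mateEquiv_app` this replaces bicategorical mates by transposes under ordinary
adjunctions, which can then be evaluated on points. -/
lemma conjugateEquiv_app {L₁ L₂ : C ⟶ D} {R₁ R₂ : D ⟶ C} (a₁ : L₁ ⊣ R₁) (a₂ : L₂ ⊣ R₂)
    (α : L₂ ⟶ L₁) (Z : D.carrier) :
    NatTrans.app (conjugateEquiv a₁ a₂ α) Z =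
      (adjunction a₂).homEquiv _ _ (NatTrans.app α ((Fun.functor R₁).obj Z) ≫
        (adjunction a₁).counit.app Z) := by
  rw [conjugateEquiv_apply', CategoryTheory.Adjunction.homEquiv_unit]
  change 𝟙 _ ≫ (adjunction a₂).unit.app ((Fun.functor R₁).obj Z) ≫
    (Fun.functor R₂).map (NatTrans.app α ((Fun.functor R₁).obj Z)) ≫ 𝟙 _ ≫
    (Fun.functor R₂).map ((adjunction a₁).counit.app Z) ≫ 𝟙 _ = _
  simp only [Category.id_comp, Category.comp_id, Functor.map_comp]

lemma mateEquiv_app {A B : CatCop.{v, u}} {P : C ⟶ A} {Q : D ⟶ B} {L₁ : C ⟶ D} {R₁ : D ⟶ C}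
    {L₂ : A ⟶ B} {R₂ : B ⟶ A} (a₁ : L₁ ⊣ R₁) (a₂ : L₂ ⊣ R₂) (α : P ≫ L₂ ⟶ L₁ ≫ Q)
    (Z : D.carrier) :
    NatTrans.app (mateEquiv a₁ a₂ α) Z =
      (adjunction a₂).homEquiv ((Fun.functor P).obj ((Fun.functor R₁).obj Z))
        ((Fun.functor Q).obj Z) (NatTrans.app α ((Fun.functor R₁).obj Z) ≫
        (Fun.functor Q).map ((adjunction a₁).counit.app Z)) := by
  have e : mateEquiv a₁ a₂ α = R₁ ◁ ((ρ_ _).inv ≫ P ◁ a₂.unit ≫ (α_ _ _ _).inv ≫ α ▷ R₂ ≫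
      (α_ _ _ _).hom) ≫ (α_ _ _ _).inv ≫ a₁.counit ▷ (Q ≫ R₂) ≫ (λ_ _).hom := by
    rw [mateEquiv_apply']; bicategory
  rw [e, CategoryTheory.Adjunction.homEquiv_unit]
  change (𝟙 _ ≫ (adjunction a₂).unit.app ((Fun.functor P).obj ((Fun.functor R₁).obj Z)) ≫
    𝟙 _ ≫ (Fun.functor R₂).map (NatTrans.app α ((Fun.functor R₁).obj Z)) ≫ 𝟙 _) ≫ 𝟙 _ ≫
    (Fun.functor R₂).map ((Fun.functor Q).map ((adjunction a₁).counit.app Z)) ≫ 𝟙 _ = _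
  simp only [Category.id_comp, Category.comp_id, Functor.map_comp, Category.assoc]

lemma comp_homEquiv {L₁ : C ⟶ D} {R₁ : D ⟶ C} {L₂ : D ⟶ E} {R₂ : E ⟶ D} (a₁ : L₁ ⊣ R₁)
    (a₂ : L₂ ⊣ R₂) (X : C.carrier) (Z : E.carrier)
    (φ : (Fun.functor L₂).obj ((Fun.functor L₁).obj X) ⟶ Z) :
    (adjunction (a₁.comp a₂)).homEquiv X Z φ =
      (adjunction a₁).homEquiv _ _ ((adjunction a₂).homEquiv _ _ φ) := by
  rw [CategoryTheory.Adjunction.homEquiv_unit]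
  have e : NatTrans.app ((a₁.comp a₂).unit) X = _ :=
    congrArg (fun q : 𝟙 C ⟶ (L₁ ≫ L₂) ≫ R₂ ≫ R₁ => NatTrans.app q X) (comp_unit_eq a₁ a₂)
  have e' : (adjunction (a₁.comp a₂)).unit.app X = (adjunction a₁).unit.app X ≫
    𝟙 _ ≫ (Fun.functor R₁).map
      ((adjunction a₂).unit.app ((Fun.functor L₁).obj X)) ≫ 𝟙 _ ≫ 𝟙 _ := e
  rw [e', CategoryTheory.Adjunction.homEquiv_unit, CategoryTheory.Adjunction.homEquiv_unit]
  simp only [Functor.map_comp, Category.comp_id, Category.id_comp]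
  exact Category.assoc ((adjunction a₁).unit.app X) ((Fun.functor R₁).map
    ((adjunction a₂).unit.app ((Fun.functor L₁).obj X)))
    ((Fun.functor R₁).map ((Fun.functor R₂).map φ))

end CatCop

end GlobalBurnside

namespace GlobalBurnside

namespace FinCover

open Limits

variable {X G H : FinGrpd.{u}}

/-! ### Points of pull-backs -/

section

variable {j : X.carrier ⥤ G.carrier} {R : FinCover G ⥤ FinCover X} (adj : push j ⊣ R)

/-- The point of `R Z` over `x` corresponding to a point of `Z` over `j x`. -/
noncomputable def adjPt {x : X.carrier} {Z : FinCover G} (ζ : pt (j.obj x) ⟶ Z) :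
    pt x ⟶ R.obj Z := adj.homEquiv _ _ (inv (pushPt j x) ≫ ζ)

variable {x x' : X.carrier} {Z Z' : FinCover G}

/-- This combines the adjunction with the isomorphism between `j_! (pt x)` and `pt (j x)`. -/
lemma adjPt_bijective : Function.Bijective (adjPt adj : (pt (j.obj x) ⟶ Z) → (pt x ⟶ R.obj Z)) :=
  (adj.homEquiv _ _).bijective.comp ⟨fun _ _ h => (cancel_epi _).1 h,
    fun b => ⟨pushPt j x ≫ b, by simp⟩⟩

lemma adjPt_comp_map (ζ : pt (j.obj x) ⟶ Z) (φ : Z ⟶ Z') :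
    adjPt adj ζ ≫ R.map φ = adjPt adj (ζ ≫ φ) := by
  rw [adjPt, adjPt, ← adj.homEquiv_naturality_right, Category.assoc]

lemma pt_comp_homEquiv {A : FinCover X} (ξ : pt x ⟶ A) (φ : (push j).obj A ⟶ Z) :
    ξ ≫ adj.homEquiv A Z φ = adjPt adj (pel j (𝟙 _) ξ ≫ φ) := by
  rw [adjPt, ← adj.homEquiv_naturality_left, pel, ptMap_id]
  simp

lemma ptMap_comp_adjPt (k : x' ⟶ x) (ζ : pt (j.obj x) ⟶ Z) :
    ptMap k ≫ adjPt adj ζ = adjPt adj (ptMap (j.map k) ≫ ζ) := by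
  have : ζ = pel j (𝟙 _) (𝟙 (pt x)) ≫ inv (pushPt j x) ≫ ζ := by
    rw [pel, ptMap_id]; simp
  conv_lhs => rw [adjPt]
  rw [pt_comp_homEquiv]
  conv_rhs => rw [this, ← Category.assoc, ptMap_comp_pel]
  rw [← Category.comp_id (ptMap k), pel_ptMap_comp, Category.id_comp, Category.comp_id]

/-- On triples the counit is evaluation. All later formulas for `2`-cells that involve a counit
reduce to this one. -/
lemma pel_adjPt_comp_counit {h : G.carrier} (m : h ⟶ j.obj x) (ζ : pt (j.obj x) ⟶ Z) :
    pel j m (adjPt adj ζ) ≫ adj.counit.app Z = ptMap m ≫ ζ := by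
  have e : (push j).map (adjPt adj ζ) ≫ adj.counit.app Z = inv (pushPt j x) ≫ ζ :=
    (adj.homEquiv_counit _ _ _).symm.trans (Equiv.symm_apply_apply _ _)
  rw [pel, Category.assoc, Category.assoc]
  refine (congrArg (fun q => ptMap m ≫ pushPt j x ≫ q) e).trans ?_
  simp

variable (g : X.carrier ⥤ H.carrier) {h : H.carrier}

/-- The point of `g_! (R Z)` given by `x`, a morphism `m : h ⟶ g x` and a point of `Z` over `j x`. -/
noncomputable def el (m : h ⟶ g.obj x) (ζ : pt (j.obj x) ⟶ Z) :
    pt h ⟶ (push g).obj (R.obj Z) := pel g m (adjPt adj ζ)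

lemma el_surjective (φ : pt h ⟶ (push g).obj (R.obj Z)) :
    ∃ (x : X.carrier) (m : h ⟶ g.obj x) (ζ : pt (j.obj x) ⟶ Z), el adj g m ζ = φ := by
  obtain ⟨x, m, ξ, rfl⟩ := pel_surjective g φ
  obtain ⟨ζ, rfl⟩ := (adjPt_bijective adj).2 ξ
  exact ⟨x, m, ζ, rfl⟩

-- This is the main computational device: the points of `g_! j^* Z` are triples modulo the morphisms
-- of the apex. Equality of points becomes the existence of a morphism in the apex with two
-- properties, one for each leg of the span.
variable {g} in
lemma el_eq_iff {m : h ⟶ g.obj x} {m' : h ⟶ g.obj x'} {ζ : pt (j.obj x) ⟶ Z}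
    {ζ' : pt (j.obj x') ⟶ Z} : el adj g m ζ = el adj g m' ζ' ↔
      ∃ k : x ⟶ x', m ≫ g.map k = m' ∧ ptMap (j.map k) ≫ ζ' = ζ := by
  simp only [el, pel_eq_iff, ptMap_comp_adjPt, (adjPt_bijective adj).1.eq_iff]

lemma el_comp_map (m : h ⟶ g.obj x) (ζ : pt (j.obj x) ⟶ Z) (φ : Z ⟶ Z') :
    el adj g m ζ ≫ (push g).map (R.map φ) = el adj g m (ζ ≫ φ) := by
  rw [el, el, pel_comp_map, adjPt_comp_map]

lemma ptMap_comp_el {h' : H.carrier} (k : h' ⟶ h) (m : h ⟶ g.obj x) (ζ : pt (j.obj x) ⟶ Z) :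
    ptMap k ≫ el adj g m ζ = el adj g (k ≫ m) ζ := ptMap_comp_pel _ _ _ _

/-- A right adjoint of a push-forward preserves finite coproducts. -/
lemma preservesFiniteCoproducts_of_adj (adj : push j ⊣ R) : PreservesFiniteCoproducts R :=
  haveI : PreservesColimit (Functor.empty.{0} (FinCover G)) R :=
    preservesColimit_of_preserves_colimit_cocone initialIsInitial
      ((isColimitMapCoconeEmptyCoconeEquiv _ _).symm (isInitialOfIsEmpty fun γ => ⟨fun ξ => by
        obtain ⟨ζ, rfl⟩ := (adjPt_bijective adj).2 ξ
        exact (isEmpty_pt_of_isInitial initialIsInitial _).false ζ⟩))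
  haveI : PreservesColimitsOfShape (Discrete.{0} PEmpty) R :=
    preservesColimitsOfShape_pempty_of_preservesInitial _
  haveI : ∀ A B : FinCover G, PreservesColimit (pair A B) R := fun A B =>
    preservesColimit_of_preserves_colimit_cocone (coprodIsCoprod A B)
      -- A point of `R Z` over `γ` is a point of `Z` over `j γ`, so the decomposition of the points
      -- of a coproduct over `j γ` is simply transported.
      ((isColimitMapCoconeBinaryCofanEquiv _ _ _).symm (IsSumOnPoints.isColimit fun γ => by
        have hs := isSumOnPoints_of_isColimit (coprodIsCoprod A B) (j.obj γ)
        constructor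
        · rintro (ξ | ξ) (η | η) e
          all_goals
            obtain ⟨ζ, rfl⟩ := (adjPt_bijective adj).2 ξ
            obtain ⟨ζ', rfl⟩ := (adjPt_bijective adj).2 η
            simp only [Sum.elim_inl, Sum.elim_inr, adjPt_comp_map] at e
            have e := (adjPt_bijective adj).1 e
          · exact congrArg (Sum.inl ∘ adjPt adj) (Sum.inl_injective (hs.1
              (a₁ := Sum.inl ζ) (a₂ := Sum.inl ζ') e))
          · cases hs.1 (a₁ := Sum.inl ζ) (a₂ := Sum.inr ζ') e
          · cases hs.1 (a₁ := Sum.inr ζ) (a₂ := Sum.inl ζ') e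
          · exact congrArg (Sum.inr ∘ adjPt adj) (Sum.inr_injective (hs.1
              (a₁ := Sum.inr ζ) (a₂ := Sum.inr ζ') e))
        · intro ξ
          obtain ⟨ζ, rfl⟩ := (adjPt_bijective adj).2 ξ
          obtain ⟨η | η, rfl⟩ := hs.2 ζ
          · exact ⟨Sum.inl (adjPt adj η), adjPt_comp_map adj η _⟩
          · exact ⟨Sum.inr (adjPt adj η), adjPt_comp_map adj η _⟩))
  haveI : PreservesColimitsOfShape (Discrete WalkingPair) R :=
    ⟨fun {K} => preservesColimit_of_iso_diagram _ (diagramIsoPair K).symm⟩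
  ⟨fun _ => PreservesFiniteCoproducts.of_preserves_binary_and_initial _ _⟩

end

/-! ### Existence of pull-backs along faithful functors -/

section

variable (i : X.carrier ⥤ G.carrier) (A : FinCover G)

/-- The homotopy pullback of finite groupoids. -/
def FinGrpd.comma {A B C : FinGrpd.{u}} (f : A.carrier ⥤ C.carrier) (g : B.carrier ⥤ C.carrier) :
    FinGrpd.{u} where
  carrier := Comma f g
  isGroupoid := ⟨fun φ => by
    have h : f.map φ.left ≫ _ = _ ≫ g.map φ.right := φ.w
    exact ⟨⟨inv φ.left, inv φ.right, by
      rw [f.map_inv, g.map_inv, IsIso.inv_comp_eq, ← Category.assoc, h, Category.assoc,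
        IsIso.hom_inv_id, Category.comp_id]⟩, by ext <;> simp, by ext <;> simp⟩⟩
  finite_obj := Finite.of_injective
    (fun x : Comma f g => (⟨x.left, x.right, x.hom⟩ : Σ a b, f.obj a ⟶ g.obj b))
    (by rintro ⟨⟩ ⟨⟩ h; cases h; rfl)
  finite_hom x y := Finite.of_injective (fun φ : x ⟶ y => (φ.left, φ.right))
    fun φ ψ h => by ext <;> simp_all

/-- The pull-back of a cover along a faithful functor. -/
def pullObj [i.Faithful] : FinCover X where
  total := FinGrpd.comma i A.proj
  proj := Comma.fst i A.proj
  thin x y := ⟨fun (φ ψ : (x : Comma i A.proj) ⟶ y) => by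
    have := A.thin
    have e : φ.right = ψ.right := Subsingleton.elim _ _
    -- Only here does faithfulness of `i` matter: the image under `i` of the left component is
    -- determined by the right component, which is unique as `A` is thin.
    refine CommaMorphism.ext (i.map_injective ?_) e
    have h := φ.w
    rw [e, ← ψ.w] at h
    exact (cancel_mono _).1 h⟩

/-- The counit of the pull-back. -/
noncomputable def pullCounit [i.Faithful] : (push i).obj (pullObj i A) ⟶ A :=
  homMk (X := pushObj i (pullObj i A))
    { functor := Comma.snd i A.proj
      cell := NatIso.ofComponents (F := Comma.fst i A.proj ⋙ i) (G := Comma.snd i A.proj ⋙ A.proj)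
        (fun x => asIso x.hom) (fun f => f.w) }

variable {A} in
/-- An object of the total groupoid of the pull-back. -/
def pullPt [i.Faithful] (y : X.carrier) (a : A.total.carrier)
    (m : i.obj y ⟶ A.proj.obj a) : (pullObj i A).total.carrier := (⟨y, a, m⟩ : Comma i A.proj)

variable {A} in
/-- The point of the pull-back given by a point of `A` and morphisms. -/
noncomputable def pullEl [i.Faithful] {x y : X.carrier} (n : x ⟶ y) (a : A.total.carrier)
    (m : i.obj y ⟶ A.proj.obj a) : pt x ⟶ pullObj i A :=
  ptHom (pullPt i y a m) n

lemma pullEl_surjective [i.Faithful] {x : X.carrier} (ξ : pt x ⟶ pullObj i A) :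
    ∃ (y : X.carrier) (n : x ⟶ y) (a : A.total.carrier) (m : i.obj y ⟶ A.proj.obj a),
      pullEl i n a m = ξ := by
  obtain ⟨a, m, rfl⟩ := ptHom_surjective ξ
  exact ⟨_, m, Comma.right a, Comma.hom a, rfl⟩

lemma pel_pullEl [i.Faithful] {x y : X.carrier} (n : x ⟶ y) (a : A.total.carrier)
    (m : i.obj y ⟶ A.proj.obj a) :
    pel i (𝟙 _) (pullEl i n a m) ≫ pullCounit i A = ptHom a (i.map n ≫ m) := by
  have e : pel i (𝟙 (i.obj x)) (pullEl i n a m) = pushPtHom i (pullPt i y a m) (𝟙 _ ≫ i.map n) :=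
    pel_ptHom i (𝟙 _) (pullPt i y a m) n
  rw [e]
  exact (ptHom_comp_homMk (A := pushObj i (pullObj i A)) (pullPt i y a m) _ _).trans
    (congrArg (fun q => ptHom a (q ≫ m)) (Category.id_comp (i.map n)))

/-- This is the injectivity half of the statement that the points of the homotopy pullback over `x`
are the points of `A` over `i x`. -/
lemma pullEl_eq [i.Faithful] {x y y' : X.carrier} {n : x ⟶ y} {n' : x ⟶ y'}
    {a a' : A.total.carrier} {m : i.obj y ⟶ A.proj.obj a} {m' : i.obj y' ⟶ A.proj.obj a'}
    (h : ptHom a (i.map n ≫ m) = ptHom a' (i.map n' ≫ m')) :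
    pullEl i n a m = pullEl i n' a' m' := by
  obtain ⟨k, hk⟩ := ptHom_eq_iff.1 h
  refine ptHom_eq_iff.2 ⟨(⟨inv n ≫ n', k, ?_⟩ :
    (⟨y, a, m⟩ : Comma i A.proj) ⟶ (⟨y', a', m'⟩ : Comma i A.proj)), ?_⟩
  · rw [Functor.map_comp, Functor.map_inv, Category.assoc, IsIso.inv_comp_eq]
    simpa using hk.symm
  · exact (IsIso.hom_inv_id_assoc n n')

/-- Evaluation with `pullCounit` is a bijection from the points of the homotopy pullback over `x` to
the points of `A` over `i x` (`key` and `hsurj`). So `φ` prescribes the values of its adjoint on the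
points of `B`, and these glue. -/
lemma existsUnique_pull [i.Faithful] (B : FinCover X) (φ : (push i).obj B ⟶ A) :
    ∃! ψ : B ⟶ pullObj i A, (push i).map ψ ≫ pullCounit i A = φ := by
  have key : ∀ {x : X.carrier} (ξ η : pt x ⟶ pullObj i A),
      pel i (𝟙 _) ξ ≫ pullCounit i A = pel i (𝟙 _) η ≫ pullCounit i A → ξ = η := by
    intro x ξ η h
    obtain ⟨y, n, a, m, rfl⟩ := pullEl_surjective i A ξ
    obtain ⟨y', n', a', m', rfl⟩ := pullEl_surjective i A η
    rw [pel_pullEl, pel_pullEl] at h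
    exact pullEl_eq i A h
  have hsurj : ∀ {x : X.carrier} (ζ : pt (i.obj x) ⟶ A), ∃ ξ : pt x ⟶ pullObj i A,
      pel i (𝟙 _) ξ ≫ pullCounit i A = ζ := by
    intro x ζ
    obtain ⟨a, m, rfl⟩ := ptHom_surjective ζ
    refine ⟨pullEl i (𝟙 x) a m, ?_⟩
    rw [pel_pullEl, i.map_id, Category.id_comp]
  choose ξ hξ using fun b : B.total.carrier => hsurj (pel i (𝟙 _) (ptHom b (𝟙 _)) ≫ φ)
  obtain ⟨ψ, hψ⟩ := exists_desc ξ fun {b b'} k => key _ _ (by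
    rw [hξ, pel_ptMap_comp, Category.id_comp, ← Category.comp_id (i.map _), ← ptMap_comp_pel,
      Category.assoc, hξ, ← Category.assoc, ptMap_comp_pel, Category.comp_id,
      ← Category.id_comp (i.map _), ← pel_ptMap_comp, ptHom_naturality])
  refine ⟨ψ, hom_ext_pt' fun η => ?_, fun ψ' h => hom_ext_pt fun b => ?_⟩
  · obtain ⟨b, m, rfl⟩ := pushPtHom_surjective i η
    have e : pushPtHom i b m = pel i m (ptHom b (𝟙 _)) := by
      rw [pel_ptHom, i.map_id, Category.comp_id]
    rw [e, ← Category.assoc, pel_comp_map, hψ, ← Category.comp_id m, ← ptMap_comp_pel,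
      Category.assoc, hξ, ← ptMap_comp_pel, Category.assoc]
  · rw [hψ]
    apply key
    rw [hξ, ← pel_comp_map, Category.assoc, h]

lemma isLeftAdjoint_push [i.Faithful] : (push i).IsLeftAdjoint :=
  isLeftAdjoint_iff_hasTerminal_costructuredArrow.2 fun A => by
    refine IsTerminal.hasTerminal (X := CostructuredArrow.mk (pullCounit i A))
      (IsTerminal.ofUniqueHom (fun B => CostructuredArrow.homMk
        (existsUnique_pull i A B.left B.hom).choose
        (existsUnique_pull i A B.left B.hom).choose_spec.1) fun B f => ?_)
    ext
    exact (existsUnique_pull i A B.left B.hom).choose_spec.2 _ (CostructuredArrow.w f)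

end

end FinCover

/-- The right adjoint of `i_!` for a faithful functor `i`. -/
lemma nonempty_rightAdjoint {a b : FinGrpd.{u}} (i : a ⟶ b) (hi : faithful i) :
    Nonempty (RightAdjoint (psi.{u}.map i)) := by
  have : Functor.Faithful (C := a.carrier) (D := b.carrier) i := hi
  obtain ⟨⟨R, ⟨adj⟩⟩⟩ := FinCover.isLeftAdjoint_push (X := a) (G := b) i
  have := FinCover.preservesFiniteCoproducts_of_adj adj
  exact ⟨⟨CatCop.Fun.mk (C := hF b) (D := hF a) R (preserves := this),
    CatCop.ofAdjunction adj⟩⟩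

/-- The choice is by cases, since the identity adjunction is prescribed for identities. As `i : a ⟶
b` may have different endpoints, being an identity is expressed as `i = eqToHom h` with `h : a = b`,
and the normalization as a heterogeneous equality. -/
lemma nonempty_rightAdjointChoice :
    Nonempty (RightAdjointChoice psi.{u} faithful) := by
  classical
  have : ∀ {a b : FinGrpd.{u}} (i : a ⟶ b) (hi : faithful i), ∃ r : RightAdjoint (psi.{u}.map i),
      ∀ (h : a = b) (_ : i = eqToHom h), HEq r (idRightAdjoint psi.{u} a) := by
    intro a b i hi
    by_cases h : ∃ h : a = b, i = eqToHom h
    · obtain ⟨rfl, rfl⟩ := h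
      exact ⟨idRightAdjoint psi.{u} a, fun _ _ => HEq.rfl⟩
    · exact ⟨(nonempty_rightAdjoint i hi).some, fun h₁ h₂ => (h ⟨h₁, h₂⟩).elim⟩
  choose r hr using @this
  exact ⟨⟨fun i hi => r i hi, fun a h => eq_of_heq (hr _ h rfl rfl)⟩⟩

end GlobalBurnside

/-! ### Formulas on points for the `2`-cells of the unfurling. -/

namespace GlobalBurnside

open FinCover

/-- The functor of groupoids underlying a `1`-cell. -/
abbrev FinGrpd.fn {a b : FinGrpd.{u}} (f : a ⟶ b) : a.carrier ⥤ b.carrier := f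

/-- The component of a `2`-cell. -/
abbrev FinGrpd.at {a b : FinGrpd.{u}} {f g : a ⟶ b} (σ : f ⟶ g) (x : a.carrier) :
    (FinGrpd.fn f).obj x ⟶ (FinGrpd.fn g).obj x := NatTrans.app σ x

noncomputable section

open FinGrpd

namespace FinCover

variable {a b c d : FinGrpd.{u}}

/-- The morphism `k_! A ⟶ j_! i_! A` induced by a `2`-cell. -/
def pushSplit {i : a ⟶ b} {j : b ⟶ c} {k : a ⟶ c} (σ : k ⟶ i ≫ j) (A : FinCover a) :
    (push (fn k)).obj A ⟶ (push (fn j)).obj ((push (fn i)).obj A) :=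
  (pushTrans (f := fn k) (g := fn i ⋙ fn j) σ).app A

/-- The morphism `j_! i_! A ⟶ k_! A` induced by a `2`-cell. -/
def pushMerge {i : a ⟶ b} {j : b ⟶ c} {k : a ⟶ c} (σ : i ≫ j ⟶ k) (A : FinCover a) :
    (push (fn j)).obj ((push (fn i)).obj A) ⟶ (push (fn k)).obj A :=
  (pushTrans (f := fn i ⋙ fn j) (g := fn k) σ).app A

/-- The morphism `i_! g_! A ⟶ f_! j_! A` induced by a `2`-cell. -/
def pushSquare {g : a ⟶ b} {j : a ⟶ c} {i : b ⟶ d} {f : c ⟶ d} (σ : g ≫ i ⟶ j ≫ f)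
    (A : FinCover a) :
    (push (fn i)).obj ((push (fn g)).obj A) ⟶ (push (fn f)).obj ((push (fn j)).obj A) :=
  (pushTrans (f := fn g ⋙ fn i) (g := fn j ⋙ fn f) σ).app A

lemma pel_comp_pushSplit {i : a ⟶ b} {j : b ⟶ c} {k : a ⟶ c} (σ : k ⟶ i ≫ j) {A : FinCover a}
    {x : a.carrier} {h : c.carrier} (m : h ⟶ (fn k).obj x) (ξ : pt x ⟶ A) :
    pel (fn k) m ξ ≫ pushSplit σ A =
      pel (x := (fn i).obj x) (fn j) (m ≫ FinGrpd.at σ x) (pel (fn i) (𝟙 _) ξ) :=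
  (pel_comp_pushTrans (q := fn k) (q' := fn i ⋙ fn j) σ m ξ).trans
    (pel_comp (fn i) (fn j) (m ≫ FinGrpd.at σ x) ξ)

/-- The inner morphism `n` can be moved outwards along `j`. This normal form is what the induced
transformations of push-forwards act on. -/
lemma pel_pel_one {i : a ⟶ b} {j : b ⟶ c} {A : FinCover a} {x : a.carrier} {y : b.carrier}
    {h : c.carrier} (m : h ⟶ (fn j).obj y) (n : y ⟶ (fn i).obj x) (ξ : pt x ⟶ A) :
    pel (fn j) m (pel (fn i) n ξ) = pel (fn i ⋙ fn j) (m ≫ (fn j).map n) ξ := by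
  rw [← Category.comp_id n, ← ptMap_comp_pel, pel_ptMap_comp, Category.comp_id]
  exact (pel_comp (fn i) (fn j) (m ≫ (fn j).map n) ξ).symm

lemma pel_pel_comp_pushMerge {i : a ⟶ b} {j : b ⟶ c} {k : a ⟶ c} (σ : i ≫ j ⟶ k) {A : FinCover a}
    {x : a.carrier} {y : b.carrier} {h : c.carrier} (m : h ⟶ (fn j).obj y) (n : y ⟶ (fn i).obj x)
    (ξ : pt x ⟶ A) : pel (fn j) m (pel (fn i) n ξ) ≫ pushMerge σ A =
      pel (fn k) ((m ≫ (fn j).map n) ≫ FinGrpd.at σ x) ξ :=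
  (congrArg (· ≫ pushMerge σ A) (pel_pel_one m n ξ)).trans
    (pel_comp_pushTrans (q := fn i ⋙ fn j) (q' := fn k) σ _ ξ)

lemma pel_pel_comp_pushSquare {g : a ⟶ b} {j : a ⟶ c} {i : b ⟶ d} {f : c ⟶ d}
    (σ : g ≫ i ⟶ j ≫ f) {A : FinCover a} {x : a.carrier} {y : b.carrier} {h : d.carrier}
    (m : h ⟶ (fn i).obj y) (n : y ⟶ (fn g).obj x) (ξ : pt x ⟶ A) :
    pel (fn i) m (pel (fn g) n ξ) ≫ pushSquare σ A =
      pel (x := (fn j).obj x) (fn f) ((m ≫ (fn i).map n) ≫ FinGrpd.at σ x)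
        (pel (fn j) (𝟙 _) ξ) :=
  (congrArg (· ≫ pushSquare σ A) (pel_pel_one m n ξ)).trans
    ((pel_comp_pushTrans (q := fn g ⋙ fn i) (q' := fn j ⋙ fn f) σ _ ξ).trans
      (pel_comp (fn j) (fn f) ((m ≫ (fn i).map n) ≫ FinGrpd.at σ x) ξ))

end FinCover

namespace RightAdjointChoice

variable (R : RightAdjointChoice psi.{u} faithful)

/-- The functor underlying the chosen right adjoint `i^*`. -/
def pullF {a b : FinGrpd.{u}} (i : a ⟶ b) (hi : faithful i) : FinCover b ⥤ FinCover a :=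
  CatCop.Fun.functor (R.pull i hi)

/-- The chosen adjunction `i_! ⊣ i^*` of functors. -/
def adjF {a b : FinGrpd.{u}} (i : a ⟶ b) (hi : faithful i) : push (fn i) ⊣ R.pullF i hi :=
  CatCop.adjunction (R.adj i hi)

/-- The component of `pullComp`. -/
def pullCompApp {a b c : FinGrpd.{u}} {i : a ⟶ b} {j : b ⟶ c} {k : a ⟶ c} (hi : faithful i)
    (hj : faithful j) (hk : faithful k) (ρ : k ≅ i ≫ j) (Z : FinCover c) :
    (R.pullF k hk).obj Z ⟶ (R.pullF i hi).obj ((R.pullF j hj).obj Z) :=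
  NatTrans.app (R.pullComp hi hj hk ρ) Z

/-- Transposing twice and evaluating the counit shows that the conjugate cell only reinterprets a
point over `k x` as a point over `j (i x)`, by means of the inverse of `ρ`. -/
lemma adjPt_comp_pullComp {a b c : FinGrpd.{u}} {i : a ⟶ b} {j : b ⟶ c} {k : a ⟶ c}
    (hi : faithful i) (hj : faithful j) (hk : faithful k) (ρ : k ≅ i ≫ j) {Z : FinCover c}
    {x : a.carrier} (ζ : pt ((fn k).obj x) ⟶ Z) :
    adjPt (R.adjF k hk) ζ ≫ R.pullCompApp hi hj hk ρ Z =
      adjPt (R.adjF i hi) (adjPt (R.adjF j hj)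
        (ptMap (γ := (fn j).obj ((fn i).obj x)) (FinGrpd.at ρ.inv x) ≫ ζ)) := by
  have e : R.pullCompApp hi hj hk ρ Z = (R.adjF i hi).homEquiv _ _ ((R.adjF j hj).homEquiv
      ((push (fn i)).obj ((R.pullF k hk).obj Z)) _
      -- The identity is the component of the coherence isomorphism of `psi`, which is strict.
      ((𝟙 ((push (fn j)).obj ((push (fn i)).obj ((R.pullF k hk).obj Z))) ≫
        pushMerge ρ.inv ((R.pullF k hk).obj Z)) ≫ (R.adjF k hk).counit.app Z)) :=
    (CatCop.conjugateEquiv_app (R.adj k hk) ((R.adj i hi).comp (R.adj j hj))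
      ((psi.mapComp i j).inv ≫ psi.map₂ ρ.inv) Z).trans (CatCop.comp_homEquiv _ _ _ _ _)
  rw [e, pt_comp_homEquiv, pt_comp_homEquiv]
  congr 2
  rw [Category.id_comp, ← Category.assoc, pel_pel_comp_pushMerge]
  refine (pel_adjPt_comp_counit _ _ _).trans ?_
  rw [(fn j).map_id, Category.comp_id, Category.id_comp]

/-- The component of `baseChange`. -/
def baseChangeApp {a b c d : FinGrpd.{u}} {g : a ⟶ b} {j : a ⟶ c} {i : b ⟶ d} {f : c ⟶ d}
    (hj : faithful j) (hi : faithful i) (σ : g ≫ i ≅ j ≫ f) (Z : FinCover c) :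
    (push (fn g)).obj ((R.pullF j hj).obj Z) ⟶ (R.pullF i hi).obj ((push (fn f)).obj Z) :=
  NatTrans.app (R.baseChange hj hi σ) Z

/-- The mate is transposition of a push-forward of the counit. On triples the counit evaluates at
`x`, and `σ` at `x` is the only remaining contribution of the square. -/
lemma el_comp_baseChange {a b c d : FinGrpd.{u}} {g : a ⟶ b} {j : a ⟶ c} {i : b ⟶ d} {f : c ⟶ d}
    (hj : faithful j) (hi : faithful i) (σ : g ≫ i ≅ j ≫ f) {Z : FinCover c} {x : a.carrier}
    {h : b.carrier} (m : h ⟶ (fn g).obj x) (ζ : pt ((fn j).obj x) ⟶ Z) :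
    el (R.adjF j hj) (fn g) m ζ ≫ R.baseChangeApp hj hi σ Z =
      adjPt (R.adjF i hi) (pel (x := (fn j).obj x) (fn f)
        ((fn i).map m ≫ FinGrpd.at σ.hom x) ζ) := by
  let A := (R.pullF j hj).obj Z
  have e : R.baseChangeApp hj hi σ Z = (R.adjF i hi).homEquiv ((push (fn g)).obj A)
      ((push (fn f)).obj Z)
      ((𝟙 ((push (fn i)).obj ((push (fn g)).obj A)) ≫
        pushSquare σ.hom A ≫
        𝟙 ((push (fn f)).obj ((push (fn j)).obj A))) ≫
        (push (fn f)).map ((R.adjF j hj).counit.app Z)) :=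
    CatCop.mateEquiv_app (R.adj j hj) (R.adj i hi)
      ((psi.mapComp g i).inv ≫ psi.map₂ σ.hom ≫ (psi.mapComp j f).hom) Z
  rw [e, pt_comp_homEquiv]
  congr 1
  rw [Category.id_comp, Category.comp_id, ← Category.assoc, el, pel_pel_comp_pushSquare,
    pel_comp_map, Category.id_comp]
  refine congrArg (pel (fn f) _) ((pel_adjPt_comp_counit _ _ _).trans ?_)
  rw [ptMap_id, Category.id_comp]

/-- The `2`-cell attached to a composite of two spans. -/
def spanCell {x₀ x₁ x₂ x₀₁ x₁₂ x₀₂ : FinGrpd.{u}} {j₀₁ : x₀₁ ⟶ x₀} {j₁₂ : x₁₂ ⟶ x₁}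
    {j₀₂ : x₀₂ ⟶ x₀} {g₀₁ : x₀₁ ⟶ x₁} {g₁₂ : x₁₂ ⟶ x₂} {g₀₂ : x₀₂ ⟶ x₂} {p : x₀₂ ⟶ x₀₁}
    {q : x₀₂ ⟶ x₁₂} (h₀₁ : faithful j₀₁) (h₁₂ : faithful j₁₂) (h₀₂ : faithful j₀₂)
    (hp : faithful p) (ρ : j₀₂ ≅ p ≫ j₀₁) (τ : g₀₂ ⟶ q ≫ g₁₂) (σ : q ≫ j₁₂ ≅ p ≫ g₀₁) :
    R.pull j₀₂ h₀₂ ≫ psi.map g₀₂ ⟶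
      (R.pull j₀₁ h₀₁ ≫ psi.map g₀₁) ≫ R.pull j₁₂ h₁₂ ≫ psi.map g₁₂ :=
  (R.pullComp hp h₀₁ h₀₂ ρ) ▷ psi.map g₀₂ ≫
    (R.pull j₀₁ h₀₁ ≫ R.pull p hp) ◁ (psi.map₂ τ ≫ (psi.mapComp _ _).hom) ≫
    (α_ (R.pull j₀₁ h₀₁) (R.pull p hp) (psi.map q ≫ psi.map g₁₂)).hom ≫
    R.pull j₀₁ h₀₁ ◁ ((α_ (R.pull p hp) (psi.map q) (psi.map g₁₂)).inv ≫
      R.baseChange hp h₁₂ σ ▷ psi.map g₁₂ ≫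
      (α_ (psi.map g₀₁) (R.pull j₁₂ h₁₂) (psi.map g₁₂)).hom) ≫
    (α_ (R.pull j₀₁ h₀₁) (psi.map g₀₁) (R.pull j₁₂ h₁₂ ≫ psi.map g₁₂)).inv

/-- The functor attached to a span. -/
abbrev spanF {x a b : FinGrpd.{u}} (j : x ⟶ a) (hj : faithful j) (g : x ⟶ b) :
    FinCover a ⥤ FinCover b := R.pullF j hj ⋙ push (fn g)

/-- The component of `spanCell`. -/
def spanCellApp {x₀ x₁ x₂ x₀₁ x₁₂ x₀₂ : FinGrpd.{u}} {j₀₁ : x₀₁ ⟶ x₀} {j₁₂ : x₁₂ ⟶ x₁}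
    {j₀₂ : x₀₂ ⟶ x₀} {g₀₁ : x₀₁ ⟶ x₁} {g₁₂ : x₁₂ ⟶ x₂} {g₀₂ : x₀₂ ⟶ x₂} {p : x₀₂ ⟶ x₀₁}
    {q : x₀₂ ⟶ x₁₂} (h₀₁ : faithful j₀₁) (h₁₂ : faithful j₁₂) (h₀₂ : faithful j₀₂)
    (hp : faithful p) (ρ : j₀₂ ≅ p ≫ j₀₁) (τ : g₀₂ ⟶ q ≫ g₁₂) (σ : q ≫ j₁₂ ≅ p ≫ g₀₁)
    (Z : FinCover x₀) :
    (push (fn g₀₂)).obj ((R.pullF j₀₂ h₀₂).obj Z) ⟶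
      (push (fn g₁₂)).obj ((R.pullF j₁₂ h₁₂).obj
        ((push (fn g₀₁)).obj ((R.pullF j₀₁ h₀₁).obj Z))) :=
  NatTrans.app (R.spanCell h₀₁ h₁₂ h₀₂ hp ρ τ σ) Z

/-- The triple at `x` is split into a nested triple: the outer one lives at `q x`, the inner one at
`p x`, and `σ` supplies the morphism connecting `j₁₂ (q x)` with `g₀₁ (p x)`. Every coherence
statement on the unfurling is deduced from this formula. -/
lemma el_comp_spanCell {x₀ x₁ x₂ x₀₁ x₁₂ x₀₂ : FinGrpd.{u}} {j₀₁ : x₀₁ ⟶ x₀} {j₁₂ : x₁₂ ⟶ x₁}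
    {j₀₂ : x₀₂ ⟶ x₀} {g₀₁ : x₀₁ ⟶ x₁} {g₁₂ : x₁₂ ⟶ x₂} {g₀₂ : x₀₂ ⟶ x₂} {p : x₀₂ ⟶ x₀₁}
    {q : x₀₂ ⟶ x₁₂} (h₀₁ : faithful j₀₁) (h₁₂ : faithful j₁₂) (h₀₂ : faithful j₀₂)
    (hp : faithful p) (ρ : j₀₂ ≅ p ≫ j₀₁) (τ : g₀₂ ⟶ q ≫ g₁₂) (σ : q ≫ j₁₂ ≅ p ≫ g₀₁)
    {Z : FinCover x₀} {x : x₀₂.carrier} {h : x₂.carrier} (m : h ⟶ (fn g₀₂).obj x)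
    (ζ : pt ((fn j₀₂).obj x) ⟶ Z) :
    el (R.adjF j₀₂ h₀₂) (fn g₀₂) m ζ ≫ R.spanCellApp h₀₁ h₁₂ h₀₂ hp ρ τ σ Z =
      el (R.adjF j₁₂ h₁₂) (x := (fn q).obj x) (fn g₁₂) (m ≫ FinGrpd.at τ x)
        (el (R.adjF j₀₁ h₀₁) (x := (fn p).obj x) (fn g₀₁) (FinGrpd.at σ.hom x)
          (ptMap (γ := (fn j₀₁).obj ((fn p).obj x)) (FinGrpd.at ρ.inv x) ≫ ζ)) := by
  let B := (R.pullF j₀₁ h₀₁).obj Z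
  -- The component unfolds to three substantial factors separated by identities, which come from
  -- associators and from the strict coherence isomorphisms of `psi`.
  let A := (R.pullF p hp).obj B
  have e : R.spanCellApp h₀₁ h₁₂ h₀₂ hp ρ τ σ Z =
      (push (fn g₀₂)).map (R.pullCompApp hp h₀₁ h₀₂ ρ Z) ≫
      (pushSplit τ A ≫ 𝟙 ((push (fn g₁₂)).obj ((push (fn q)).obj A))) ≫
      𝟙 ((push (fn g₁₂)).obj ((push (fn q)).obj A)) ≫
      (𝟙 ((push (fn g₁₂)).obj ((push (fn q)).obj A)) ≫
      (push (fn g₁₂)).map (R.baseChangeApp hp h₁₂ σ B) ≫ 𝟙 _) ≫ 𝟙 _ := rfl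
  simp only [Category.id_comp, Category.comp_id] at e
  rw [e, ← Category.assoc, ← Category.assoc, el, pel_comp_map, adjPt_comp_pullComp,
    pel_comp_pushSplit, pel_comp_map]
  refine congrArg (pel (fn g₁₂) _) ((R.el_comp_baseChange hp h₁₂ σ (𝟙 _) _).trans ?_)
  rw [(fn j₁₂).map_id, Category.id_comp]
  rfl

end RightAdjointChoice

end

end GlobalBurnside

namespace GlobalBurnside

open FinCover FinGrpd

noncomputable section

/-! ### Components of normal functors to groupoids -/

namespace FinGrpd

variable {a b c : FinGrpd.{u}}

lemma at_naturality {f g : a ⟶ b} (σ : f ⟶ g) {x y : a.carrier} (k : x ⟶ y) :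
    (fn f).map k ≫ FinGrpd.at σ y = FinGrpd.at σ x ≫ (fn g).map k :=
  NatTrans.naturality (F := fn f) (G := fn g) σ k

lemma at_hom_inv {f g : a ⟶ b} (σ : f ≅ g) (x : a.carrier) :
    FinGrpd.at σ.hom x ≫ FinGrpd.at σ.inv x = 𝟙 _ :=
  congrArg (fun τ : f ⟶ f => FinGrpd.at τ x) σ.hom_inv_id

lemma at_inv_hom {f g : a ⟶ b} (σ : f ≅ g) (x : a.carrier) :
    FinGrpd.at σ.inv x ≫ FinGrpd.at σ.hom x = 𝟙 _ :=
  congrArg (fun τ : g ⟶ g => FinGrpd.at τ x) σ.inv_hom_id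

lemma at_inv {f g : a ⟶ b} (σ : f ≅ g) (x : a.carrier) :
    FinGrpd.at σ.inv x = inv (FinGrpd.at σ.hom x) :=
  (IsIso.inv_eq_of_hom_inv_id (at_hom_inv σ x)).symm

variable {P : Type} [Preorder P] (X : NormalFunctor P FinGrpd.{u})

lemma at_cell_refl_left {i j : P} (h : i ≤ j) (x : (X.obj i).carrier) :
    FinGrpd.at (X.cell (le_refl i) h) x ≫
      (fn (X.map h)).map (FinGrpd.at (eqToHom (X.map_refl i)) x) = 𝟙 _ := by
  have := congrArg (fun τ : X.map h ⟶ X.map h => FinGrpd.at τ x) (X.cell_refl_left h)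
  exact (congrArg _ (Category.comp_id _)).symm.trans this

lemma at_cocycle {i j k l : P} (hij : i ≤ j) (hjk : j ≤ k) (hkl : k ≤ l) (x : (X.obj i).carrier) :
    FinGrpd.at (X.cell (hij.trans hjk) hkl) x ≫
        (fn (X.map hkl)).map (FinGrpd.at (X.cell hij hjk) x) =
      FinGrpd.at (X.cell hij (hjk.trans hkl)) x ≫
        FinGrpd.at (X.cell hjk hkl) ((fn (X.map hij)).obj x) := by
  have := congrArg (fun τ : _ ⟶ X.map hij ≫ X.map hjk ≫ X.map hkl => FinGrpd.at τ x)
    (X.cocycle hij hjk hkl)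
  exact (congrArg _ (Category.comp_id _)).symm.trans this

lemma at_squareIso {P : Type} [Preorder P] (X : NormalFunctor (TwArr P) FinGrpd.{u}) {i k l j : P}
    (hik : i ≤ k) (hkl : k ≤ l) (hlj : l ≤ j) (x : (X.obj ⟨i, j, _⟩).carrier) :
    FinGrpd.at (X.squareIso hik hkl hlj).hom x =
      inv (FinGrpd.at (X.cell (TwArr.le_fwd hik (hkl.trans hlj)) (TwArr.le_bwd hkl hlj)) x) ≫
        FinGrpd.at (X.cell (TwArr.le_bwd (hik.trans hkl) hlj) (TwArr.le_fwd hik hkl)) x := by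
  have := X.cell_isIso (TwArr.le_fwd hik (hkl.trans hlj)) (TwArr.le_bwd hkl hlj)
  refine Eq.trans ?_ (congrArg (· ≫ _) (at_inv (asIso (X.cell (TwArr.le_fwd hik (hkl.trans hlj))
    (TwArr.le_bwd hkl hlj))) x))
  rfl

/-- The functor from the one-point groupoid determined by an object. -/
def pointHom (x : a.carrier) : point.{u} ⟶ a := (Functor.const (Discrete PUnit.{u + 1})).obj x

/-- The isomorphism of functors from the one-point groupoid determined by a morphism. -/
def pointIso {f g : point.{u} ⟶ a}
    (m : (fn f).obj (⟨⟨⟩⟩ : Discrete PUnit.{u + 1}) ⟶ (fn g).obj (⟨⟨⟩⟩ : Discrete PUnit.{u + 1})) :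
    f ≅ g :=
  Discrete.natIso (F := fn f) (G := fn g) fun _ => asIso m

lemma hom_ext_point {f g : point.{u} ⟶ a} {σ τ : f ⟶ g}
    (h : FinGrpd.at σ (⟨⟨⟩⟩ : Discrete PUnit.{u + 1}) =
      FinGrpd.at τ (⟨⟨⟩⟩ : Discrete PUnit.{u + 1})) : σ = τ :=
  NatTrans.ext (funext fun _ => h)

section Pullback

variable {a b c d : FinGrpd.{u}} {g : a ⟶ b} {j : a ⟶ c} {i : b ⟶ d} {f : c ⟶ d}
  {σ : g ≫ i ≅ j ≫ f} (hσ : IsHomotopyPullback g j i f σ)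

include hσ

/-- The universal property is only ever used for the one-point test groupoid, where it speaks of
objects and morphisms. -/
lemma exists_of_isHomotopyPullback (x : b.carrier) (y : c.carrier)
    (θ : (fn i).obj x ⟶ (fn f).obj y) :
    ∃ (z : a.carrier) (β : (fn g).obj z ⟶ x) (γ : (fn j).obj z ⟶ y),
      (fn i).map β ≫ θ = FinGrpd.at σ.hom z ≫ (fn f).map γ := by
  obtain ⟨z, β, γ, e⟩ := hσ.essSurj point (pointHom x) (pointHom y) (pointIso θ)
  refine ⟨(fn z).obj ⟨⟨⟩⟩, FinGrpd.at β.hom ⟨⟨⟩⟩, FinGrpd.at γ.hom ⟨⟨⟩⟩, ?_⟩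
  have := congrArg (fun τ : _ ⟶ pointHom y ≫ f => FinGrpd.at τ (⟨⟨⟩⟩ : Discrete PUnit)) e
  refine this.trans ?_
  exact (Category.id_comp _).trans (congrArg _ (Category.id_comp _))

lemma existsUnique_of_isHomotopyPullback (z z' : a.carrier) (β : (fn g).obj z ⟶ (fn g).obj z')
    (γ : (fn j).obj z ⟶ (fn j).obj z')
    (e : (fn i).map β ≫ FinGrpd.at σ.hom z' = FinGrpd.at σ.hom z ≫ (fn f).map γ) :
    ∃! φ : z ⟶ z', (fn g).map φ = β ∧ (fn j).map φ = γ := by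
  obtain ⟨φ, ⟨h₁, h₂⟩, h₃⟩ := hσ.full_faithful point (pointHom z) (pointHom z')
    (pointIso (f := pointHom z ≫ g) (g := pointHom z' ≫ g) β)
    (pointIso (f := pointHom z ≫ j) (g := pointHom z' ≫ j) γ) (by
      refine hom_ext_point ?_
      refine (congrArg ((fn i).map β ≫ ·) ((Category.id_comp _).trans (Category.comp_id _))).trans
        (e.trans ?_)
      exact ((Category.id_comp _).trans (congrArg _ (Category.id_comp _))).symm)
  refine ⟨FinGrpd.at φ.hom ⟨⟨⟩⟩, ⟨congrArg (fun τ => FinGrpd.at τ (⟨⟨⟩⟩ : Discrete PUnit)) h₁,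
    congrArg (fun τ => FinGrpd.at τ (⟨⟨⟩⟩ : Discrete PUnit)) h₂⟩, ?_⟩
  rintro ψ ⟨k₁, k₂⟩
  have := h₃ (pointIso (f := pointHom z) (g := pointHom z') ψ)
    ⟨hom_ext_point k₁, hom_ext_point k₂⟩
  exact congrArg (fun τ : _ ≅ _ => FinGrpd.at τ.hom (⟨⟨⟩⟩ : Discrete PUnit)) this

end Pullback

end FinGrpd

instance {G : FinGrpd.{u}} {x y : G.carrier} (m : x ⟶ y) : IsIso (ptMap m) :=
  ⟨⟨ptMap (inv m), by rw [← ptMap_comp, IsIso.hom_inv_id, ptMap_id],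
    by rw [← ptMap_comp, IsIso.inv_hom_id, ptMap_id]⟩⟩

namespace RightAdjointChoice

variable (R : RightAdjointChoice psi.{u} faithful)

/-! ### Beck–Chevalley -/

/-- The Beck–Chevalley condition, checked as a bijection on points. A nested triple has an outer
object of `x₁₂`, an inner object of `x₀₁` and a morphism comparing their images in `x₁`; this is an
object of the homotopy pullback. Essential surjectivity onto it gives surjectivity on points, full
faithfulness gives injectivity. -/
lemma spanCell_isIso {x₀ x₁ x₂ x₀₁ x₁₂ x₀₂ : FinGrpd.{u}} {j₀₁ : x₀₁ ⟶ x₀} {j₁₂ : x₁₂ ⟶ x₁}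
    {j₀₂ : x₀₂ ⟶ x₀} {g₀₁ : x₀₁ ⟶ x₁} {g₁₂ : x₁₂ ⟶ x₂} {g₀₂ : x₀₂ ⟶ x₂} {p : x₀₂ ⟶ x₀₁}
    {q : x₀₂ ⟶ x₁₂} (h₀₁ : faithful j₀₁) (h₁₂ : faithful j₁₂) (h₀₂ : faithful j₀₂)
    (hp : faithful p) (ρ : j₀₂ ≅ p ≫ j₀₁) (τ : g₀₂ ⟶ q ≫ g₁₂) (σ : q ≫ j₁₂ ≅ p ≫ g₀₁)
    (hσ : IsHomotopyPullback q p j₁₂ g₀₁ σ) :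
    IsIso (R.spanCell h₀₁ h₁₂ h₀₂ hp ρ τ σ) := by
  have key (Z : FinCover x₀) : IsIso (R.spanCellApp h₀₁ h₁₂ h₀₂ hp ρ τ σ Z) := by
    refine isIso_of_bijective _ fun γ => ⟨?_, ?_⟩
    · intro ξ ξ' e
      obtain ⟨w, m, ζ, rfl⟩ := el_surjective (R.adjF j₀₂ h₀₂) (fn g₀₂) ξ
      obtain ⟨w', m', ζ', rfl⟩ := el_surjective (R.adjF j₀₂ h₀₂) (fn g₀₂) ξ'
      replace e := (R.el_comp_spanCell h₀₁ h₁₂ h₀₂ hp ρ τ σ m ζ).symm.trans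
        (e.trans (R.el_comp_spanCell h₀₁ h₁₂ h₀₂ hp ρ τ σ m' ζ'))
      obtain ⟨k, hk, e⟩ := (el_eq_iff _).1 e
      rw [ptMap_comp_el] at e
      obtain ⟨l, hl, e⟩ := (el_eq_iff _).1 e
      -- The relation between the inner triples runs backwards, from `p w'` to `p w`, which explains
      -- the inverse of `l`.
      obtain ⟨φ, ⟨h₁, h₂⟩, -⟩ := existsUnique_of_isHomotopyPullback hσ w w' k (inv l) (by
        rw [Functor.map_inv, IsIso.eq_comp_inv]
        exact hl)
      refine (el_eq_iff _).2 ⟨φ, ?_, ?_⟩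
      · rw [← h₁] at hk
        have n := at_naturality τ φ
        change _ = _ ≫ (fn g₁₂).map ((fn q).map φ) at n
        rw [Category.assoc, ← n, ← Category.assoc] at hk
        exact (cancel_mono _).1 hk
      · have n := at_naturality ρ.inv φ
        change (fn j₀₁).map ((fn p).map φ) ≫ _ = _ at n
        rw [h₂] at n
        rw [← cancel_epi (ptMap (γ := (fn j₀₁).obj ((fn p).obj w)) (FinGrpd.at ρ.inv w)),
          ← Category.assoc, ← ptMap_comp, ← n, ptMap_comp, Category.assoc, ← e,
          ← Category.assoc, ← ptMap_comp, ← Functor.map_comp, IsIso.inv_hom_id,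
          (fn j₀₁).map_id, ptMap_id, Category.id_comp]
    · intro ξ
      obtain ⟨y, m, ξ, rfl⟩ := el_surjective (R.adjF j₁₂ h₁₂) (fn g₁₂) ξ
      obtain ⟨x, n, ζ, rfl⟩ := el_surjective (R.adjF j₀₁ h₀₁) (fn g₀₁) ξ
      obtain ⟨w, β, γ, e⟩ := exists_of_isHomotopyPullback hσ y x n
      -- The preimage is obtained by transporting `m` along `β : q w ⟶ y` and `ζ` along `γ : p w ⟶
      -- x`.
      refine ⟨el (R.adjF j₀₂ h₀₂) (fn g₀₂) (m ≫ (fn g₁₂).map (inv β) ≫ inv (FinGrpd.at τ w))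
        (ptMap (FinGrpd.at ρ.hom w ≫ (fn j₀₁).map γ) ≫ ζ), ?_⟩
      refine (R.el_comp_spanCell h₀₁ h₁₂ h₀₂ hp ρ τ σ _ _).trans ?_
      refine (el_eq_iff _).2 ⟨β, ?_, ?_⟩
      · rw [Category.assoc, Category.assoc, Category.assoc]
        have : inv (FinGrpd.at τ w) ≫ FinGrpd.at τ w ≫ (fn g₁₂).map β = (fn g₁₂).map β :=
          IsIso.inv_hom_id_assoc _ _
        rw [this, ← Functor.map_comp, IsIso.inv_hom_id, (fn g₁₂).map_id, Category.comp_id]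
      · rw [ptMap_comp_el, eq_comm]
        refine (el_eq_iff _).2 ⟨γ, e.symm, ?_⟩
        rw [← Category.assoc, ← ptMap_comp, ← Category.assoc]
        exact congrArg (ptMap · ≫ ζ) ((congrArg (· ≫ (fn j₀₁).map γ) (at_inv_hom ρ w)).trans
          (Category.id_comp ((fn j₀₁).map γ))).symm
  -- The `2`-cells of `CatCop` are natural transformations, so an inverse in the functor category is
  -- an inverse in `CatCop`.
  have : IsIso (C := FinCover x₀ ⥤ FinCover x₂)
      (X := R.spanF j₀₂ h₀₂ g₀₂) (Y := R.spanF j₀₁ h₀₁ g₀₁ ⋙ R.spanF j₁₂ h₁₂ g₁₂)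
      (R.spanCell h₀₁ h₁₂ h₀₂ hp ρ τ σ) :=
    @NatIso.isIso_of_isIso_app _ _ _ _ _ _ _ key
  exact ⟨⟨inv (C := FinCover x₀ ⥤ FinCover x₂) (X := R.spanF j₀₂ h₀₂ g₀₂)
    (Y := R.spanF j₀₁ h₀₁ g₀₁ ⋙ R.spanF j₁₂ h₁₂ g₁₂) (R.spanCell h₀₁ h₁₂ h₀₂ hp ρ τ σ),
    this.hom_inv_id, this.inv_hom_id⟩⟩

end RightAdjointChoice

end

end GlobalBurnside

namespace GlobalBurnside

open FinCover FinGrpd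

noncomputable section

lemma CatCop.Fun.ext' {C D : CatCop.{v, u}} {F G : C ⟶ D} (h : Fun.functor F = Fun.functor G) :
    F = G := by
  obtain ⟨F, hF⟩ := F
  obtain ⟨G, hG⟩ := G
  obtain rfl : F = G := h
  rfl

lemma CatCop.eqToHom_app {C D : CatCop.{v, u}} {F G : C ⟶ D} (h : F = G) (X : C.carrier) :
    NatTrans.app (eqToHom h) X = eqToHom (congrArg (fun F => (Fun.functor F).obj X) h) := by
  subst h
  rfl

namespace RightAdjointChoice

variable (R : RightAdjointChoice psi.{u} faithful)

/-! ### The unfurling -/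

/-- The `1`-cell attached to a span. -/
abbrev span {x a b : FinGrpd.{u}} (j : x ⟶ a) (hj : faithful j) (g : x ⟶ b) : hF a ⟶ hF b :=
  R.pull j hj ≫ psi.map g

/-- The normalization of the chosen adjunctions is used here; it makes the unfurling strictly
unitary. The legs are arbitrary `1`-cells equal to identities, since in a diagram they are only
propositionally identities. -/
lemma span_id {a : FinGrpd.{u}} {j g : a ⟶ a} (hj : faithful j) (e : j = 𝟙 a) (e' : g = 𝟙 a) :
    R.span j hj g = 𝟙 (hF a) := by
  subst e e'
  have h₁ : R.pull (𝟙 a) hj = 𝟙 (hF a) := congrArg RightAdjoint.right (R.adjoint_id a hj)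
  have h₂ : psi.map (𝟙 a) = 𝟙 (hF a) := CatCop.Fun.ext' (push_id (G := a))
  rw [span, h₁, h₂]
  rfl

/-- For the normalized adjunction the counit is an identity, so the transport along `span_id` agrees
with it and evaluates triples. -/
lemma el_comp_eqToHom {a : FinGrpd.{u}} {j g : a ⟶ a} (hj : faithful j) (e : j = 𝟙 a)
    (e' : g = 𝟙 a) {Z : FinCover a} {x h : a.carrier} (m : h ⟶ (fn g).obj x)
    (ζ : pt ((fn j).obj x) ⟶ Z) :
    el (R.adjF j hj) (fn g) m ζ ≫ NatTrans.app (eqToHom (R.span_id hj e e')) Z =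
      ptMap (m ≫ FinGrpd.at (eqToHom (e'.trans e.symm)) x) ≫ ζ := by
  subst e e'
  have key (S : RightAdjoint (psi.map (𝟙 a))) (hS : S = idRightAdjoint psi a)
      (E : S.right ≫ psi.map (𝟙 a) = 𝟙 (hF a)) :
      el (CatCop.adjunction S.adj) (x := x) (𝟭 a.carrier) m ζ ≫ NatTrans.app (eqToHom E) Z =
        ptMap m ≫ ζ := by
    subst hS
    refine Eq.trans ?_ (pel_adjPt_comp_counit (CatCop.adjunction
      (idRightAdjoint psi a).adj) (x := x) m ζ)
    refine congrArg (el (CatCop.adjunction (idRightAdjoint psi a).adj) (x := x)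
      (𝟭 a.carrier) m ζ ≫ ·) ?_
    refine (CatCop.eqToHom_app E Z).trans ?_
    exact (Category.id_comp (𝟙 Z)).symm
  refine (key _ (R.adjoint_id a hj) _).trans (congrArg (ptMap · ≫ ζ) ?_)
  exact (Category.comp_id m).symm

variable {P : Type} [Preorder P] (X : NormalFunctor (TwArr P) FinGrpd.{u})
  (hX : ∀ {i l j : P} (hil : i ≤ l) (hlj : l ≤ j), faithful (X.map (TwArr.le_bwd hil hlj)))

/-- The unfurling of a diagram indexed by a twisted arrow category. -/
def unfurl : NormalData P CatCop.{u, u + 1} where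
  obj i := hF (X.obj ⟨i, i, le_refl i⟩)
  map {i j} h := R.span _ (hX (le_refl i) h) (X.map (TwArr.le_fwd h (le_refl j)))
  cell {i j k} hij hjk :=
    haveI := X.cell_isIso (TwArr.le_bwd hij hjk) (TwArr.le_bwd (le_refl i) hij)
    R.spanCell (hX (le_refl i) hij) (hX (le_refl j) hjk) (hX (le_refl i) (hij.trans hjk))
      (hX hij hjk) (asIso (X.cell (TwArr.le_bwd hij hjk) (TwArr.le_bwd (le_refl i) hij)))
      (X.cell (TwArr.le_fwd hij hjk) (TwArr.le_fwd hjk (le_refl k)))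
      (X.squareIso hij (le_refl j) hjk)

/-- The backward legs of the diagram. -/
abbrev bwd {i j : P} (h : i ≤ j) : X.obj ⟨i, j, h⟩ ⟶ X.obj ⟨i, i, le_refl i⟩ :=
  X.map (TwArr.le_bwd (le_refl i) h)

/-- The forward legs of the diagram. -/
abbrev fwd {i j : P} (h : i ≤ j) : X.obj ⟨i, j, h⟩ ⟶ X.obj ⟨j, j, le_refl j⟩ :=
  X.map (TwArr.le_fwd h (le_refl j))

/-- The points of the values of the unfurling. -/
def unfurlEl {i j : P} (h : i ≤ j) {Z : FinCover (X.obj ⟨i, i, le_refl i⟩)}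
    {x : (X.obj ⟨i, j, h⟩).carrier} {γ : (X.obj ⟨j, j, le_refl j⟩).carrier}
    (m : γ ⟶ (fn (fwd X h)).obj x) (ζ : pt ((fn (bwd X h)).obj x) ⟶ Z) :
    pt γ ⟶ (push (fn (fwd X h))).obj ((R.pullF _ (hX (le_refl i) h)).obj Z) :=
  el (R.adjF _ (hX (le_refl i) h)) (fn (fwd X h)) m ζ

/-- The components of the cells of the unfurling. -/
def unfurlApp {i j k : P} (hij : i ≤ j) (hjk : j ≤ k) (Z : FinCover (X.obj ⟨i, i, le_refl i⟩)) :
    (push (fn (fwd X (hij.trans hjk)))).obj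
        ((R.pullF _ (hX (le_refl i) (hij.trans hjk))).obj Z) ⟶
      (push (fn (fwd X hjk))).obj ((R.pullF _ (hX (le_refl j) hjk)).obj
        ((push (fn (fwd X hij))).obj ((R.pullF _ (hX (le_refl i) hij)).obj Z))) :=
  NatTrans.app ((R.unfurl X hX).cell hij hjk) Z

/-- This is `el_comp_spanCell` with the cell of the square expanded into the two structure cells
along the diagonal, the form in which the cocycle law of `X` applies. -/
lemma unfurlEl_comp_unfurlApp {i j k : P} (hij : i ≤ j) (hjk : j ≤ k)
    {Z : FinCover (X.obj ⟨i, i, le_refl i⟩)} {x : (X.obj ⟨i, k, hij.trans hjk⟩).carrier}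
    {γ : (X.obj ⟨k, k, le_refl k⟩).carrier} (m : γ ⟶ (fn (fwd X (hij.trans hjk))).obj x)
    (ζ : pt ((fn (bwd X (hij.trans hjk))).obj x) ⟶ Z) :
    R.unfurlEl X hX (hij.trans hjk) m ζ ≫ R.unfurlApp X hX hij hjk Z =
      R.unfurlEl X hX hjk (x := (fn (X.map (TwArr.le_fwd hij hjk))).obj x)
        (m ≫ FinGrpd.at (X.cell (TwArr.le_fwd hij hjk) (TwArr.le_fwd hjk (le_refl k))) x)
        (R.unfurlEl X hX hij (x := (fn (X.map (TwArr.le_bwd hij hjk))).obj x)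
          (inv (FinGrpd.at (X.cell (TwArr.le_fwd hij hjk) (TwArr.le_bwd (le_refl j) hjk)) x) ≫
            FinGrpd.at (X.cell (TwArr.le_bwd hij hjk) (TwArr.le_fwd hij (le_refl j))) x)
          (ptMap (γ := (fn (bwd X hij)).obj ((fn (X.map (TwArr.le_bwd hij hjk))).obj x))
            (inv (FinGrpd.at (X.cell (TwArr.le_bwd hij hjk) (TwArr.le_bwd (le_refl i) hij)) x))
              ≫ ζ)) := by
  have := X.cell_isIso (TwArr.le_bwd hij hjk) (TwArr.le_bwd (le_refl i) hij)
  refine (R.el_comp_spanCell (hX (le_refl i) hij) (hX (le_refl j) hjk)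
    (hX (le_refl i) (hij.trans hjk)) (hX hij hjk) _ _ _ m ζ).trans ?_
  rw [unfurlEl, unfurlEl, at_squareIso, at_inv]
  rfl

lemma unfurl_map_refl (i : P) : (R.unfurl X hX).map (le_refl i) = 𝟙 _ :=
  R.span_id _ (X.map_refl _) (X.map_refl _)

/-- The component of the identification of the unfurling on a degenerate edge. -/
def unfurlIdApp (i : P) (Z : FinCover (X.obj ⟨i, i, le_refl i⟩)) :
    (push (fn (fwd X (le_refl i)))).obj ((R.pullF _ (hX (le_refl i) (le_refl i))).obj Z) ⟶ Z :=
  NatTrans.app (eqToHom (R.unfurl_map_refl X hX i)) Z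

lemma unfurlEl_comp_unfurlIdApp (i : P) {Z : FinCover (X.obj ⟨i, i, le_refl i⟩)}
    {x γ : (X.obj ⟨i, i, le_refl i⟩).carrier} (m : γ ⟶ (fn (fwd X (le_refl i))).obj x)
    (ζ : pt ((fn (bwd X (le_refl i))).obj x) ⟶ Z) :
    R.unfurlEl X hX (le_refl i) m ζ ≫ R.unfurlIdApp X hX i Z = ptMap m ≫ ζ := by
  refine (R.el_comp_eqToHom _ (X.map_refl _) (X.map_refl _) m ζ).trans ?_
  exact congrArg (ptMap · ≫ ζ) (Category.comp_id m)

lemma unfurl_cell_refl_left {i j : P} (h : i ≤ j) :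
    (R.unfurl X hX).cell (le_refl i) h ≫
      eqToHom (R.unfurl_map_refl X hX i) ▷ (R.unfurl X hX).map h ≫
        (λ_ ((R.unfurl X hX).map h)).hom = 𝟙 _ := by
  refine NatTrans.ext (funext fun (Z : FinCover (X.obj ⟨i, i, le_refl i⟩)) => ?_)
  have e : R.unfurlApp X hX (le_refl i) h Z ≫ (push (fn (fwd X h))).map
      ((R.pullF _ (hX (le_refl i) h)).map (R.unfurlIdApp X hX i Z)) = 𝟙 _ := by
    refine hom_ext_pt' @fun γ ξ => ?_
    obtain ⟨x, m, ζ, rfl⟩ := el_surjective (R.adjF _ (hX (le_refl i) h)) (fn (fwd X h)) ξ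
    rw [← Category.assoc]
    refine (congrArg (· ≫ _) (R.unfurlEl_comp_unfurlApp X hX (le_refl i) h m ζ)).trans ?_
    refine (el_comp_map _ _ _ _ _).trans ?_
    rw [R.unfurlEl_comp_unfurlIdApp, Category.comp_id]
    have h₁ := at_cell_refl_left X (TwArr.le_fwd h (le_refl j)) x
    have h₂ := at_cell_refl_left X (TwArr.le_bwd (le_refl i) h) x
    -- The normality comparison of `X` at `x` relates the two triples; the two conditions are the
    -- unit laws of `X` for the forward and the backward leg.
    refine (el_eq_iff (R.adjF _ (hX (le_refl i) h))).2
      ⟨FinGrpd.at (eqToHom (X.map_refl _)) x, ?_, ?_⟩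
    · rw [Category.assoc]
      exact (congrArg (m ≫ ·) h₁).trans (Category.comp_id m)
    · rw [← Category.assoc, ← ptMap_comp, Category.assoc]
      refine congrArg (ptMap · ≫ ζ) ?_
      refine Eq.trans ?_ (congrArg (_ ≫ ·) (IsIso.hom_inv_id _)).symm
      rw [Category.comp_id]
      exact IsIso.eq_inv_of_hom_inv_id h₂
  exact (congrArg (_ ≫ ·) (Category.comp_id _)).trans e

lemma unfurl_cell_refl_right {i j : P} (h : i ≤ j) :
    (R.unfurl X hX).cell h (le_refl j) ≫
      (R.unfurl X hX).map h ◁ eqToHom (R.unfurl_map_refl X hX j) ≫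
        (ρ_ ((R.unfurl X hX).map h)).hom = 𝟙 _ := by
  refine NatTrans.ext (funext fun (Z : FinCover (X.obj ⟨i, i, le_refl i⟩)) => ?_)
  have e : R.unfurlApp X hX h (le_refl j) Z ≫ R.unfurlIdApp X hX j ((push (fn (fwd X h))).obj
      ((R.pullF _ (hX (le_refl i) h)).obj Z)) = 𝟙 _ := by
    refine hom_ext_pt' @fun γ ξ => ?_
    obtain ⟨x, m, ζ, rfl⟩ := el_surjective (R.adjF _ (hX (le_refl i) h)) (fn (fwd X h)) ξ
    rw [← Category.assoc]
    refine (congrArg (· ≫ _) (R.unfurlEl_comp_unfurlApp X hX h (le_refl j) m ζ)).trans ?_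
    refine (R.unfurlEl_comp_unfurlIdApp X hX j _ _).trans ?_
    refine (ptMap_comp_el _ _ _ _ _).trans ?_
    rw [Category.comp_id]
    have h₁ := at_cell_refl_left X (TwArr.le_fwd h (le_refl j)) x
    have h₂ := at_cell_refl_left X (TwArr.le_bwd (le_refl i) h) x
    refine (el_eq_iff (R.adjF _ (hX (le_refl i) h))).2
      ⟨FinGrpd.at (eqToHom (X.map_refl _)) x, ?_, ?_⟩
    · rw [Category.assoc, Category.assoc, Category.assoc]
      refine (congrArg (m ≫ ·) ((IsIso.hom_inv_id_assoc _ _).trans ?_)).trans (Category.comp_id m)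
      exact h₁
    · exact congrArg (ptMap · ≫ ζ) (IsIso.eq_inv_of_hom_inv_id h₂)
  exact (congrArg (_ ≫ ·) (Category.comp_id _)).trans e

/-- This and the next two lemmas isolate the cancellations behind the cocycle law: each of them
solves a hypothesis for one morphism and substitutes it. In an abstract groupoid they are free of
the dependent objects of the application. -/
lemma _root_.GlobalBurnside.groupoid_aux₁ {C : Type*} [Category C] [IsGroupoid C]
    {a b c d e f g : C} {u : a ⟶ b} {K : b ⟶ c} {l : a ⟶ d} {v : d ⟶ c} {x : a ⟶ e} {y : e ⟶ f}
    {w : d ⟶ f} {z : e ⟶ g} {p : a ⟶ g} (h₁ : u ≫ K = l ≫ v) (h₂ : x ≫ y = l ≫ w)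
    (h₃ : x ≫ z = p) :
    K ≫ (inv v ≫ w) ≫ inv y ≫ z = inv u ≫ p := by
  have e₁ : K = inv u ≫ l ≫ v := by rw [← h₁, IsIso.inv_hom_id_assoc]
  have e₂ : w = inv l ≫ x ≫ y := by rw [h₂, IsIso.inv_hom_id_assoc]
  rw [e₁, e₂, ← h₃]
  simp

lemma _root_.GlobalBurnside.groupoid_aux₂ {C : Type*} [Category C] [IsGroupoid C]
    {a b c d e f g : C} {u : a ⟶ b} {K : b ⟶ c} {s : a ⟶ d} {r : d ⟶ c} {M : b ⟶ e} {n : a ⟶ f}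
    {t : f ⟶ e} {h : C} {D : g ⟶ h} {w : f ⟶ h}
    {s' : a ⟶ g} (h₁ : u ≫ K = s ≫ r) (h₂ : u ≫ M = n ≫ t) (h₃ : s' ≫ D = n ≫ w) :
    inv r ≫ (inv s ≫ s') ≫ D = (inv K ≫ M) ≫ inv t ≫ w := by
  have e₁ : K = inv u ≫ s ≫ r := by rw [← h₁, IsIso.inv_hom_id_assoc]
  have e₂ : M = inv u ≫ n ≫ t := by rw [← h₂, IsIso.inv_hom_id_assoc]
  rw [e₁, e₂, Category.assoc, h₃]
  simp

lemma _root_.GlobalBurnside.groupoid_aux₃ {C : Type*} [Category C] [IsGroupoid C]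
    {a b c d : C} {u : a ⟶ b} {M : b ⟶ c} {s : a ⟶ d} {r : d ⟶ c} (h : u ≫ M = s ≫ r) :
    (M ≫ inv r) ≫ inv s = inv u := by
  have e₁ : M = inv u ≫ s ≫ r := by rw [← h, IsIso.inv_hom_id_assoc]
  rw [e₁]
  simp

/-- Both sides send a triple to a threefold nested triple. Comparing these asks for one morphism in
each of the groupoids at `k → l`, `j → k` and `i → j`, and all three are built from structure cells
of `X`. The conditions on them are instances of the cocycle law of `X` along chains of twisted
arrows starting at `i → l`. -/
lemma unfurl_cocycle {i j k l : P} (hij : i ≤ j) (hjk : j ≤ k) (hkl : k ≤ l) :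
    (R.unfurl X hX).cell (hij.trans hjk) hkl ≫
        (R.unfurl X hX).cell hij hjk ▷ (R.unfurl X hX).map hkl ≫ (α_ _ _ _).hom =
      (R.unfurl X hX).cell hij (hjk.trans hkl) ≫
        (R.unfurl X hX).map hij ◁ (R.unfurl X hX).cell hjk hkl := by
  refine NatTrans.ext (funext fun (Z : FinCover (X.obj ⟨i, i, le_refl i⟩)) => ?_)
  have e : R.unfurlApp X hX (hij.trans hjk) hkl Z ≫
      (push (fn (fwd X hkl))).map ((R.pullF _ (hX (le_refl k) hkl)).map
        (R.unfurlApp X hX hij hjk Z)) =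
    R.unfurlApp X hX hij (hjk.trans hkl) Z ≫ R.unfurlApp X hX hjk hkl
      ((push (fn (fwd X hij))).obj ((R.pullF _ (hX (le_refl i) hij)).obj Z)) := by
    refine hom_ext_pt' @fun γ ξ => ?_
    obtain ⟨x, m, ζ, rfl⟩ := el_surjective
      (R.adjF _ (hX (le_refl i) (hij.trans (hjk.trans hkl))))
      (fn (fwd X (hij.trans (hjk.trans hkl)))) ξ
    rw [← Category.assoc, ← Category.assoc]
    refine (congrArg (· ≫ _) (R.unfurlEl_comp_unfurlApp X hX (hij.trans hjk) hkl m ζ)).trans ?_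
    refine Eq.trans ?_ (congrArg (· ≫ _)
      (R.unfurlEl_comp_unfurlApp X hX hij (hjk.trans hkl) m ζ)).symm
    refine (el_comp_map _ _ _ _ _).trans ?_
    rw [R.unfurlEl_comp_unfurlApp]
    refine Eq.trans ?_ (R.unfurlEl_comp_unfurlApp X hX hjk hkl _ _).symm
    refine (el_eq_iff (R.adjF _ (hX (le_refl k) hkl))).2
      ⟨FinGrpd.at (X.cell (TwArr.le_fwd hij (hjk.trans hkl)) (TwArr.le_fwd hjk hkl)) x, ?_, ?_⟩
    · rw [Category.assoc, Category.assoc]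
      exact congrArg (m ≫ ·) (at_cocycle X (TwArr.le_fwd hij (hjk.trans hkl))
        (TwArr.le_fwd hjk hkl) (TwArr.le_fwd hkl (le_refl l)) x)
    · refine (ptMap_comp_el _ _ _ _ _).trans ?_
      refine (el_eq_iff (R.adjF _ (hX (le_refl j) hjk))).2
        ⟨inv (FinGrpd.at (X.cell (TwArr.le_fwd hij (hjk.trans hkl)) (TwArr.le_bwd hjk hkl)) x) ≫
          FinGrpd.at (X.cell (TwArr.le_bwd (hij.trans hjk) hkl) (TwArr.le_fwd hij hjk)) x, ?_, ?_⟩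
      · rw [Functor.map_comp, Functor.map_inv, Category.assoc]
        refine (groupoid_aux₁ (at_cocycle X (TwArr.le_fwd hij (hjk.trans hkl))
          (TwArr.le_fwd hjk hkl) (TwArr.le_bwd (le_refl k) hkl) x)
          (at_cocycle X (TwArr.le_fwd hij (hjk.trans hkl)) (TwArr.le_bwd hjk hkl)
            (TwArr.le_fwd hjk (le_refl k)) x)
          (at_cocycle X (TwArr.le_bwd (hij.trans hjk) hkl) (TwArr.le_fwd hij hjk)
            (TwArr.le_fwd hjk (le_refl k)) x)).trans ?_
        exact (Category.assoc _ _ _).symm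
      · refine ((ptMap_comp_el _ _ _ _ _).trans ?_).symm
        refine ((ptMap_comp_el _ _ _ _ _).trans ?_).symm
        refine ((el_eq_iff (R.adjF _ (hX (le_refl i) hij))).2
          ⟨FinGrpd.at (X.cell (TwArr.le_bwd (hij.trans hjk) hkl) (TwArr.le_bwd hij hjk)) x,
            ?_, ?_⟩).symm
        · rw [Functor.map_comp, Functor.map_inv, Category.assoc]
          exact groupoid_aux₂ (at_cocycle X (TwArr.le_fwd hij (hjk.trans hkl))
            (TwArr.le_bwd hjk hkl) (TwArr.le_bwd (le_refl j) hjk) x)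
            (at_cocycle X (TwArr.le_bwd (hij.trans hjk) hkl) (TwArr.le_fwd hij hjk)
              (TwArr.le_bwd (le_refl j) hjk) x)
            (at_cocycle X (TwArr.le_bwd (hij.trans hjk) hkl) (TwArr.le_bwd hij hjk)
              (TwArr.le_fwd hij (le_refl j)) x)
        · rw [← Category.assoc, ← Category.assoc, ← ptMap_comp, ← ptMap_comp]
          refine congrArg (ptMap · ≫ ζ) ?_
          exact groupoid_aux₃ (at_cocycle X (TwArr.le_bwd (hij.trans hjk) hkl)
            (TwArr.le_bwd hij hjk) (TwArr.le_bwd (le_refl i) hij) x)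
  exact (congrArg (_ ≫ ·) (Category.comp_id _)).trans e

/-- The unfurling as a normal functor. -/
def unfurlNormal (h : ∀ {i k l j : P} (hik : i ≤ k) (hkl : k ≤ l) (hlj : l ≤ j),
    IsHomotopyPullback (X.map (TwArr.le_fwd hik (hkl.trans hlj)))
      (X.map (TwArr.le_bwd (hik.trans hkl) hlj)) (X.map (TwArr.le_bwd hkl hlj))
      (X.map (TwArr.le_fwd hik hkl)) (X.squareIso hik hkl hlj)) :
    NormalFunctor P CatCop.{u, u + 1} where
  toNormalData := R.unfurl X hX
  map_refl := R.unfurl_map_refl X hX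
  cell_refl_left := R.unfurl_cell_refl_left X hX
  cell_refl_right := R.unfurl_cell_refl_right X hX
  cocycle := R.unfurl_cocycle X hX
  cell_isIso {i j k} hij hjk := by
    have := X.cell_isIso (TwArr.le_bwd hij hjk) (TwArr.le_bwd (le_refl i) hij)
    exact R.spanCell_isIso _ _ _ _ _ _ _ (h hij (le_refl j) hjk)

end RightAdjointChoice

lemma NormalFunctor.ext_data {P : Type} [Preorder P] {B : Type u} [Bicategory.{w, v} B]
    {X Y : NormalFunctor P B} (h : X.toNormalData = Y.toNormalData) : X = Y := by
  cases X; cases Y; cases h; rfl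

/-- The functor `Ψ`. -/
def unfurlMap (R : RightAdjointChoice psi.{u} faithful) :
    effBurnside.{u + 2} FinGrpd.{u} anyFunctor faithful ⟶ duskinNerve CatCop.{u, u + 1} where
  app n := ↾ fun (s : AeffSimplex.{u + 2} FinGrpd.{u} anyFunctor faithful n.unop.len) =>
    R.unfurlNormal s.toFunctor s.egressive s.isPullback
  naturality _ _ _ := rfl

theorem isUnfurling_unfurlMap (R : RightAdjointChoice psi.{u} faithful) :
    IsUnfurling R (unfurlMap R) := fun _ _ => rfl

/-- The remaining fields of a normal functor are propositions, so prescribing the data on every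
simplex determines the map. -/
theorem IsUnfurling.eq_unfurlMap {R : RightAdjointChoice psi.{u} faithful}
    {Ψ : effBurnside.{u + 2} FinGrpd.{u} anyFunctor faithful ⟶ duskinNerve CatCop.{u, u + 1}}
    (h : IsUnfurling R Ψ) : Ψ = unfurlMap R := by
  ext n s
  exact NormalFunctor.ext_data (h n s)

end

end GlobalBurnside

namespace GlobalBurnside

open FinCover FinGrpd Limits

noncomputable section

/-! ### Symmetric monoidal functors between cores of categories of covers -/

/-- A symmetric monoidal functor between the cores of the categories of covers. -/
abbrev SymFun (G H : FinGrpd.{u}) := (hF G).core ⟶ (hF H).core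

namespace SymFun

variable {G H : FinGrpd.{u}} (F F' : SymFun G H)

/-- The functor of groupoids underlying a symmetric monoidal functor. -/
def fctr : Core (FinCover G) ⥤ Core (FinCover H) := SymMonCat.Fun.functor F

/-- The value on objects. -/
def ob (Z : FinCover G) : FinCover H := (F.fctr.obj ⟨Z⟩).of

variable {Z Z' Z'' A A' B B' C : FinCover G}

/-- The value on isomorphisms. -/
def map (φ : Z ≅ Z') : F.ob Z ⟶ F.ob Z' := (F.fctr.map (⟨φ⟩ : CoreHom ⟨Z⟩ ⟨Z'⟩)).iso.hom

instance (φ : Z ≅ Z') : IsIso (F.map φ) := Iso.isIso_hom _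

lemma map_refl (Z : FinCover G) : F.map (Iso.refl Z) = 𝟙 _ :=
  congrArg (fun f : F.fctr.obj ⟨Z⟩ ⟶ F.fctr.obj ⟨Z⟩ => f.iso.hom) (F.fctr.map_id ⟨Z⟩)

lemma map_trans (φ : Z ≅ Z') (ψ : Z' ≅ Z'') : F.map (φ ≪≫ ψ) = F.map φ ≫ F.map ψ :=
  congrArg (fun f : F.fctr.obj ⟨Z⟩ ⟶ F.fctr.obj ⟨Z''⟩ => f.iso.hom)
    (F.fctr.map_comp (⟨φ⟩ : CoreHom ⟨Z⟩ ⟨Z'⟩) (⟨ψ⟩ : CoreHom ⟨Z'⟩ ⟨Z''⟩))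

attribute [local instance] CatCop.monoidal CatCop.symmetric

/-- The tensorator. -/
def mu (A B : FinCover G) : F.ob A ⨿ F.ob B ⟶ F.ob (A ⨿ B) :=
  (CoreHom.iso (Functor.LaxMonoidal.μ (SymMonCat.Fun.functor F) (⟨A⟩ : Core (FinCover G))
    (⟨B⟩ : Core (FinCover G)))).hom

instance (A B : FinCover G) : IsIso (F.mu A B) := Iso.isIso_hom _

lemma mu_natural (φ : A ≅ A') (ψ : B ≅ B') :
    coprod.map (F.map φ) (F.map ψ) ≫ F.mu A' B' = F.mu A B ≫ F.map (coprod.mapIso φ ψ) :=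
  congrArg (fun f => (CoreHom.iso f).hom) (Functor.LaxMonoidal.μ_natural
    (SymMonCat.Fun.functor F) (⟨φ⟩ : CoreHom (⟨A⟩ : Core (FinCover G)) ⟨A'⟩)
    (⟨ψ⟩ : CoreHom (⟨B⟩ : Core (FinCover G)) ⟨B'⟩))

lemma mu_associator (A B C : FinCover G) :
    coprod.map (F.mu A B) (𝟙 (F.ob C)) ≫ F.mu (A ⨿ B) C ≫ F.map (coprod.associator A B C) =
      (coprod.associator _ _ _).hom ≫ coprod.map (𝟙 (F.ob A)) (F.mu B C) ≫ F.mu A (B ⨿ C) :=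
  congrArg (fun f => (CoreHom.iso f).hom) (Functor.LaxMonoidal.associativity
    (SymMonCat.Fun.functor F) (⟨A⟩ : Core (FinCover G)) (⟨B⟩ : Core (FinCover G))
    (⟨C⟩ : Core (FinCover G)))

lemma mu_braiding (A B : FinCover G) :
    F.mu A B ≫ F.map (coprod.braiding A B) =
      (coprod.braiding (F.ob A) (F.ob B)).hom ≫ F.mu B A :=
  congrArg (fun f => (CoreHom.iso f).hom) (Functor.LaxBraided.braided
    (F := SymMonCat.Fun.functor F) (⟨A⟩ : Core (FinCover G)) (⟨B⟩ : Core (FinCover G)))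

/-- The value on the empty cover is empty. -/
def isInitialOb (h : IsInitial Z) : IsInitial (F.ob Z) :=
  let e₁ : (⊥_ FinCover H) ≅ F.ob (⊥_ FinCover G) :=
    CoreHom.iso (Functor.Monoidal.εIso (SymMonCat.Fun.functor F)).hom
  let e₂ : F.ob (⊥_ FinCover G) ≅ F.ob Z := asIso (F.map (initialIsInitial.uniqueUpToIso h))
  initialIsInitial.ofIso (e₁ ≪≫ e₂)

/-- The first inclusion. -/
def inl (A B : FinCover G) : F.ob A ⟶ F.ob (A ⨿ B) := coprod.inl ≫ F.mu A B

/-- The second inclusion. -/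
def inr (A B : FinCover G) : F.ob B ⟶ F.ob (A ⨿ B) := coprod.inr ≫ F.mu A B

lemma isSumOnPoints_inl_inr (A B : FinCover G) : IsSumOnPoints (F.inl A B) (F.inr A B) := by
  have := (isSumOnPoints_of_isColimit (coprodIsCoprod (F.ob A) (F.ob B))).comp_iso
    (F.mu A B)
  exact this

lemma inl_map (φ : A ≅ A') (ψ : B ≅ B') :
    F.inl A B ≫ F.map (coprod.mapIso φ ψ) = F.map φ ≫ F.inl A' B' := by
  rw [inl, inl, Category.assoc, ← mu_natural, coprod.inl_map_assoc]

/-- Of the coherence axioms of `F`, this one and `inr_braiding` are what turns `inl` into a functor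
on inclusions of summands: the first governs composition, the second the passage to the other
summand. -/
lemma inl_associator (A B C : FinCover G) :
    F.inl A B ≫ F.inl (A ⨿ B) C ≫ F.map (coprod.associator A B C) = F.inl A (B ⨿ C) := by
  have := congrArg (coprod.inl ≫ coprod.inl ≫ ·) (F.mu_associator A B C)
  simp only [coprod.inl_map_assoc, coprod.associator_hom, coprod.inl_desc_assoc,
    Category.id_comp] at this
  rw [inl, inl, inl, Category.assoc, Category.assoc]
  exact this

lemma inr_braiding (A B : FinCover G) :
    F.inr A B ≫ F.map (coprod.braiding A B) = F.inl B A := by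
  have := congrArg (coprod.inr ≫ ·) (F.mu_braiding A B)
  simp only [coprod.braiding_hom, coprod.inr_desc_assoc] at this
  rw [inl, inr, Category.assoc]
  exact this

/-- The component of a monoidal transformation. -/
def app {F F' : SymFun G H} (δ : F ⟶ F') (Z : FinCover G) : F.ob Z ⟶ F'.ob Z :=
  (CoreHom.iso (NatTrans.app (SymMonCat.Trans.natTrans δ) (⟨Z⟩ : Core (FinCover G)))).hom

variable {F F'}

instance (δ : F ⟶ F') (Z : FinCover G) : IsIso (app δ Z) := Iso.isIso_hom _

lemma map_app (δ : F ⟶ F') (φ : Z ≅ Z') : F.map φ ≫ app δ Z' = app δ Z ≫ F'.map φ :=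
  congrArg (fun f => (CoreHom.iso f).hom)
    (NatTrans.naturality (SymMonCat.Trans.natTrans δ)
      (⟨φ⟩ : CoreHom (⟨Z⟩ : Core (FinCover G)) ⟨Z'⟩))

lemma mu_app (δ : F ⟶ F') (A B : FinCover G) :
    F.mu A B ≫ app δ (A ⨿ B) = coprod.map (app δ A) (app δ B) ≫ F'.mu A B :=
  congrArg (fun f => (CoreHom.iso f).hom)
    (NatTrans.IsMonoidal.tensor (τ := SymMonCat.Trans.natTrans δ)
      (⟨A⟩ : Core (FinCover G)) (⟨B⟩ : Core (FinCover G)))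

lemma inl_app (δ : F ⟶ F') (A B : FinCover G) :
    F.inl A B ≫ app δ (A ⨿ B) = app δ A ≫ F'.inl A B := by
  rw [inl, inl, Category.assoc, mu_app, coprod.inl_map_assoc]

lemma hom_ext {δ δ' : F ⟶ F'} (h : ∀ Z, app δ Z = app δ' Z) : δ = δ' :=
  SymMonCat.Trans.ext (NatTrans.ext (funext fun Z => CategoryTheory.Core.hom_ext (h Z.of)))

/-- A monoidal transformation from its components. -/
lemma exists_hom (φ : ∀ Z, F.ob Z ≅ F'.ob Z)
    (h₁ : ∀ {Z Z' : FinCover G} (e : Z ≅ Z'), F.map e ≫ (φ Z').hom = (φ Z).hom ≫ F'.map e)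
    (h₂ : ∀ A B, F.inl A B ≫ (φ (A ⨿ B)).hom = (φ A).hom ≫ F'.inl A B)
    (h₃ : ∀ A B, F.inr A B ≫ (φ (A ⨿ B)).hom = (φ B).hom ≫ F'.inr A B) :
    ∃ δ : F ⟶ F', ∀ Z, app δ Z = (φ Z).hom :=
  ⟨{ natTrans :=
      { app := fun (Z : Core (FinCover G)) => (⟨φ Z.of⟩ : CoreHom (F.fctr.obj Z) (F'.fctr.obj Z))
        naturality := fun Z Z' f => CategoryTheory.Core.hom_ext (h₁ f.iso) }
     isMonoidal :=
      { unit := CatCop.core_hom_ext_initial _ _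
        tensor := fun A B => CategoryTheory.Core.hom_ext (by
          change F.mu A.of B.of ≫ (φ (A.of ⨿ B.of)).hom =
            coprod.map (φ A.of).hom (φ B.of).hom ≫ F'.mu A.of B.of
          apply coprod.hom_ext
          · rw [coprod.inl_map_assoc]
            exact (Category.assoc _ _ _).symm.trans (h₂ _ _)
          · rw [coprod.inr_map_assoc]
            exact (Category.assoc _ _ _).symm.trans (h₃ _ _)) } :
      SymMonCat.Trans F F' }, fun _ => rfl⟩

end SymFun

end

end GlobalBurnside

namespace GlobalBurnside

open FinCover FinGrpd Limits

noncomputable section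

namespace FinCover

variable {G : FinGrpd.{u}}

/-! ### Complements of points -/

/-- The full subgroupoid of objects which do not receive a morphism from `a`. -/
def complementGrpd (X : FinGrpd.{u}) (a : X.carrier) : FinGrpd.{u} where
  carrier := ObjectProperty.FullSubcategory fun z : X.carrier => IsEmpty (a ⟶ z)
  isGroupoid := ⟨fun {x y} f => by
    have : IsIso f.hom := inferInstance
    exact ⟨⟨⟨inv f.hom⟩, by ext; simp, by ext; simp⟩⟩⟩
  finite_obj := Finite.of_injective (fun x => x.obj) fun x y h => by cases x; cases y; congr
  finite_hom x y := Finite.of_injective (fun f : x ⟶ y => f.hom) fun f g h => by ext; exact h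

/-- The complement of a component. -/
def complementObj (Z : FinCover G) (a : Z.total.carrier) : FinCover G where
  total := complementGrpd Z.total a
  proj := ObjectProperty.ι _ ⋙ Z.proj
  thin x y := ⟨fun f g => by
    have := Z.thin
    have e : f.hom = g.hom := Subsingleton.elim _ _
    exact ObjectProperty.hom_ext _ e⟩

/-- The inclusion of the complement. -/
def complementCell (Z : FinCover G) (a : Z.total.carrier) : OneCell (complementObj Z a) Z where
  functor := ObjectProperty.ι _
  cell := Iso.refl _

/-- The isomorphism class of `a` in the thin total groupoid is contractible, so it contributes
exactly a one-point cover, and the objects outside of it contribute the complement. -/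
lemma isSumOnPoints_complement {Z : FinCover G} {γ : G.carrier} (a : Z.total.carrier)
    (m : γ ⟶ Z.proj.obj a) : IsSumOnPoints (ptHom a m) (homMk (complementCell Z a)) := by
  have key {δ : G.carrier} (b : (complementObj Z a).total.carrier)
      (n : δ ⟶ (complementObj Z a).proj.obj b) :
      ptHom b n ≫ homMk (complementCell Z a) =
        ptHom (A := Z) (ObjectProperty.FullSubcategory.obj b) n :=
    (ptHom_comp_homMk _ _ _).trans (congrArg (ptHom _) (Category.comp_id _))
  intro δ
  constructor
  · rintro (ξ | ξ) (η | η) h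
    · obtain ⟨k, rfl⟩ := ptMap_surjective ξ
      obtain ⟨l, rfl⟩ := ptMap_surjective η
      simp only [Sum.elim_inl, ptMap_comp_ptHom] at h
      have := ptHom_injective h
      rw [(cancel_mono _).1 this]
    · obtain ⟨k, rfl⟩ := ptMap_surjective ξ
      obtain ⟨b, n, rfl⟩ := ptHom_surjective η
      simp only [Sum.elim_inl, Sum.elim_inr, ptMap_comp_ptHom, key] at h
      obtain ⟨l, -⟩ := ptHom_eq_iff.1 h
      exact (b.property.false l).elim
    · obtain ⟨k, rfl⟩ := ptMap_surjective η
      obtain ⟨b, n, rfl⟩ := ptHom_surjective ξ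
      simp only [Sum.elim_inl, Sum.elim_inr, ptMap_comp_ptHom, key] at h
      obtain ⟨l, -⟩ := ptHom_eq_iff.1 h
      exact (b.property.false (inv l)).elim
    · obtain ⟨b, n, rfl⟩ := ptHom_surjective ξ
      obtain ⟨b', n', rfl⟩ := ptHom_surjective η
      simp only [Sum.elim_inr, key] at h
      obtain ⟨l, hl⟩ := ptHom_eq_iff.1 h
      exact congrArg _ (ptHom_eq_iff.2 ⟨ObjectProperty.homMk l, hl⟩)
  · intro ξ
    obtain ⟨b, n, rfl⟩ := ptHom_surjective ξ
    by_cases h : IsEmpty (a ⟶ b)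
    · exact ⟨Sum.inr (ptHom (A := complementObj Z a) ⟨b, h⟩ n), key _ _⟩
    · obtain ⟨l⟩ := not_isEmpty_iff.1 h
      refine ⟨Sum.inl (ptMap (n ≫ Z.proj.map (inv l) ≫ inv m)), ?_⟩
      simp only [Sum.elim_inl, ptMap_comp_ptHom]
      exact ptHom_eq_iff.2 ⟨l, by simp⟩

lemma card_complement_lt (Z : FinCover G) (a : Z.total.carrier) :
    Nat.card (complementObj Z a).total.carrier < Nat.card Z.total.carrier := by
  refine lt_of_le_of_lt (Nat.card_le_card_of_injective
    (fun x : (complementObj Z a).total.carrier =>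
      (⟨ObjectProperty.FullSubcategory.obj x, ObjectProperty.FullSubcategory.property x⟩ :
        { z : Z.total.carrier // IsEmpty (a ⟶ z) })) ?_)
    (Finite.card_subtype_lt (x := a) (not_isEmpty_iff.2 ⟨𝟙 a⟩))
  rintro ⟨x, hx⟩ ⟨y, hy⟩ h
  cases h
  rfl

/-- The morphism `j` is the inclusion of a summand. -/
def Complemented {A Z : FinCover G} (j : A ⟶ Z) : Prop :=
  ∃ (B : FinCover G) (e : A ⨿ B ≅ Z), coprod.inl ≫ e.hom = j

lemma exists_complement {Z : FinCover G} {γ : G.carrier} (ζ : pt γ ⟶ Z) :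
    ∃ (B : FinCover G) (e : pt γ ⨿ B ≅ Z), coprod.inl ≫ e.hom = ζ ∧
      Nat.card B.total.carrier < Nat.card Z.total.carrier := by
  obtain ⟨a, m, rfl⟩ := ptHom_surjective ζ
  refine ⟨complementObj Z a, (coprodIsCoprod _ _).coconePointUniqueUpToIso
    (isSumOnPoints_complement a m).isColimit, ?_, card_complement_lt Z a⟩
  exact (coprodIsCoprod _ _).comp_coconePointUniqueUpToIso_hom _ ⟨WalkingPair.left⟩

lemma complemented_pt {Z : FinCover G} {γ : G.carrier} (ζ : pt γ ⟶ Z) : Complemented ζ :=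
  let ⟨B, e, h, _⟩ := exists_complement ζ
  ⟨B, e, h⟩

/-- Induction on the number of components of a cover. -/
theorem induction_pt {P : FinCover G → Prop} (h₀ : ∀ Z, IsInitial Z → P Z)
    (h₁ : ∀ (γ : G.carrier) (B Z : FinCover G) (_ : pt γ ⨿ B ≅ Z), P B → P Z) (Z : FinCover G) :
    P Z := by
  induction hn : Nat.card Z.total.carrier using Nat.strong_induction_on generalizing Z with
  | _ n ih =>
    by_cases h : ∀ γ, IsEmpty (pt γ ⟶ Z)
    · exact h₀ Z (isInitialOfIsEmpty h)
    · simp only [not_forall, not_isEmpty_iff] at h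
      obtain ⟨γ, ⟨ζ⟩⟩ := h
      obtain ⟨B, e, -, hB⟩ := exists_complement ζ
      exact h₁ γ B Z e (ih _ (hn ▸ hB) B rfl)

lemma isSumOnPoints_iso {A B Z : FinCover G} (e : A ⨿ B ≅ Z) :
    IsSumOnPoints (coprod.inl ≫ e.hom) (coprod.inr ≫ e.hom) :=
  (isSumOnPoints_of_isColimit (coprodIsCoprod A B)).comp_iso e.hom

lemma IsSumOnPoints.injective_right {A B Z : FinCover G} {i : A ⟶ Z} {j : B ⟶ Z}
    (h : IsSumOnPoints i j) (γ : G.carrier) : Function.Injective fun ξ : pt γ ⟶ B => ξ ≫ j :=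
  fun ξ η e => Sum.inr_injective ((h γ).1 (a₁ := Sum.inr ξ) (a₂ := Sum.inr η) e)

lemma IsSumOnPoints.exists_lift {A B B' Z : FinCover G} {i : A ⟶ Z} {j : B ⟶ Z} {j' : B' ⟶ Z}
    (h : IsSumOnPoints i j) (h' : IsSumOnPoints i j') : ∃ b : B ⟶ B', b ≫ j' = j := by
  refine exists_lift_of_mono j j' h'.injective_right fun {γ} ξ => ?_
  obtain ⟨η | η, e⟩ := (h' γ).2 (ξ ≫ j)
  · cases (h γ).1 (a₁ := Sum.inl η) (a₂ := Sum.inr ξ) e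
  · exact ⟨η, e⟩

lemma IsSumOnPoints.hom_ext_right {A B B' Z : FinCover G} {i : A ⟶ Z} {j : B ⟶ Z}
    (h : IsSumOnPoints i j) {b b' : B' ⟶ B} (e : b ≫ j = b' ≫ j) : b = b' :=
  hom_ext_pt' @fun γ ξ => h.injective_right γ (by simp [e])

/-- Complements of summands are unique, as for sets: their points are the points of `Z` not lying in
`A`. The well-definedness of `inc` rests on this. -/
lemma exists_complement_iso {A B B' Z : FinCover G} {e : A ⨿ B ≅ Z} {e' : A ⨿ B' ≅ Z}
    (h : coprod.inl ≫ e.hom = coprod.inl ≫ e'.hom) :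
    ∃ b : B ≅ B', coprod.mapIso (Iso.refl A) b ≪≫ e' = e := by
  have s := isSumOnPoints_iso e
  have s' := isSumOnPoints_iso e'
  rw [← h] at s'
  obtain ⟨b, hb⟩ := s.exists_lift s'
  obtain ⟨b', hb'⟩ := s'.exists_lift s
  refine ⟨⟨b, b', s.hom_ext_right (by simp [hb, hb']), s'.hom_ext_right (by simp [hb, hb'])⟩, ?_⟩
  ext1
  apply coprod.hom_ext
  · simp [h]
  · simp [hb]

end FinCover

namespace SymFun

variable {G H : FinGrpd.{u}} (F : SymFun G H) {A A' B Z Z' W : FinCover G}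

/-! ### Functoriality for inclusions of summands -/

/-- The value on the inclusion of a summand. -/
def inc {j : A ⟶ Z} (hj : Complemented j) : F.ob A ⟶ F.ob Z :=
  F.inl A hj.choose ≫ F.map hj.choose_spec.choose

/-- Two complements differ by an isomorphism which leaves `A` fixed, and `inl` is natural for such
isomorphisms. Hence the complement chosen in `inc` is irrelevant. -/
lemma inc_eq {j : A ⟶ Z} (hj : Complemented j) (e : A ⨿ B ≅ Z) (he : coprod.inl ≫ e.hom = j) :
    F.inc hj = F.inl A B ≫ F.map e := by
  obtain ⟨b, hb⟩ := exists_complement_iso (he.trans hj.choose_spec.choose_spec.symm)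
  rw [inc, ← hb, map_trans, ← Category.assoc, inl_map, map_refl, Category.id_comp]

lemma inc_comp_map {j : A ⟶ Z} (hj : Complemented j) (φ : Z ≅ Z')
    (h : Complemented (j ≫ φ.hom)) : F.inc hj ≫ F.map φ = F.inc h := by
  rw [inc, F.inc_eq h (hj.choose_spec.choose ≪≫ φ) (by
    rw [Iso.trans_hom, ← Category.assoc, hj.choose_spec.choose_spec]), map_trans, Category.assoc]

lemma map_comp_inc {j : A ⟶ Z} (hj : Complemented j) (φ : A' ≅ A)
    (h : Complemented (φ.hom ≫ j)) : F.map φ ≫ F.inc hj = F.inc h := by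
  rw [inc, F.inc_eq h (coprod.mapIso φ (Iso.refl _) ≪≫ hj.choose_spec.choose) (by
    rw [Iso.trans_hom, ← Category.assoc, coprod.mapIso_hom, coprod.inl_map, Category.assoc,
      hj.choose_spec.choose_spec]), map_trans, ← Category.assoc, ← Category.assoc, inl_map]

lemma inc_inl (h : Complemented (coprod.inl : A ⟶ A ⨿ B)) : F.inc h = F.inl A B := by
  rw [F.inc_eq h (Iso.refl _) (Category.comp_id _), map_refl, Category.comp_id]

lemma inc_inr (h : Complemented (coprod.inr : B ⟶ A ⨿ B)) : F.inc h = F.inr A B := by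
  have e : coprod.braiding A B ≪≫ coprod.braiding B A = Iso.refl _ := by
    ext1; apply coprod.hom_ext <;> simp [coprod.inl_desc, coprod.inr_desc]
  rw [F.inc_eq h (coprod.braiding B A) (by simp [coprod.inl_desc]), ← inr_braiding, Category.assoc, ← map_trans, e,
    map_refl, Category.comp_id]

/-- If `B` complements `A` in `Z` and `C` complements `Z` in `W`, then `B ⨿ C` complements `A` in
`W`; the associativity coherence of `F` does the rest. -/
lemma inc_comp_inc {j : A ⟶ Z} (hj : Complemented j) {k : Z ⟶ W} (hk : Complemented k)
    (h : Complemented (j ≫ k)) : F.inc hj ≫ F.inc hk = F.inc h := by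
  obtain ⟨B, e, he⟩ := id hj
  obtain ⟨C, e', he'⟩ := id hk
  rw [F.inc_eq hj e he, F.inc_eq hk e' he',
    F.inc_eq h ((coprod.associator A B C).symm ≪≫ coprod.mapIso e (Iso.refl C) ≪≫ e')
      (by simp [he', coprod.associator_inv, coprod.inl_desc, reassoc_of% he]), ← F.inl_associator, Category.assoc, Category.assoc,
    Category.assoc, ← map_trans, Iso.self_symm_id_assoc, map_trans, ← Category.assoc (F.inl _ C),
    inl_map, Category.assoc]

variable {F} in
lemma inc_comp_app {F' : SymFun G H} (δ : F ⟶ F') {j : A ⟶ Z} (hj : Complemented j) :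
    F.inc hj ≫ app δ Z = app δ A ≫ F'.inc hj := by
  rw [inc, Category.assoc, map_app, ← Category.assoc, inl_app, Category.assoc, inc]

lemma isSumOnPoints_inc (e : A ⨿ B ≅ Z) (h₁ : Complemented (coprod.inl ≫ e.hom))
    (h₂ : Complemented (coprod.inr ≫ e.hom)) : IsSumOnPoints (F.inc h₁) (F.inc h₂) := by
  have k₁ : Complemented (coprod.inl : A ⟶ A ⨿ B) := ⟨B, Iso.refl _, Category.comp_id _⟩
  have k₂ : Complemented (coprod.inr : B ⟶ A ⨿ B) := ⟨A, coprod.braiding B A, by simp [coprod.inl_desc]⟩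
  rw [← F.inc_comp_map k₁ e, ← F.inc_comp_map k₂ e, inc_inl, inc_inr]
  exact (F.isSumOnPoints_inl_inr A B).comp_iso _

lemma complemented_inr (e : A ⨿ B ≅ Z) : Complemented (coprod.inr ≫ e.hom) :=
  ⟨A, coprod.braiding B A ≪≫ e, by simp [coprod.inl_desc]⟩

/-- The value on a point. -/
def incPt {γ : G.carrier} (ζ : pt γ ⟶ Z) : F.ob (pt γ) ⟶ F.ob Z := F.inc (complemented_pt ζ)

/-- The isomorphism of one-point covers attached to a morphism. -/
def ptIso {γ γ' : G.carrier} (m : γ ⟶ γ') : pt γ ≅ pt γ' := asIso (ptMap m)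

lemma map_ptIso_comp_incPt {γ γ' : G.carrier} (m : γ ⟶ γ') (ζ : pt γ' ⟶ Z) :
    F.map (ptIso m) ≫ F.incPt ζ = F.incPt (ptMap m ≫ ζ) := F.map_comp_inc _ _ _

lemma incPt_comp_map {γ : G.carrier} (ζ : pt γ ⟶ Z) (φ : Z ≅ Z') :
    F.incPt ζ ≫ F.map φ = F.incPt (ζ ≫ φ.hom) := F.inc_comp_map _ _ _

lemma incPt_comp_inl {γ : G.carrier} (ζ : pt γ ⟶ A) :
    F.incPt ζ ≫ F.inl A B = F.incPt (ζ ≫ coprod.inl) := by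
  rw [← F.inc_inl ⟨B, Iso.refl _, Category.comp_id _⟩]
  exact F.inc_comp_inc _ _ _

lemma incPt_comp_inr {γ : G.carrier} (ζ : pt γ ⟶ B) :
    F.incPt ζ ≫ F.inr A B = F.incPt (ζ ≫ coprod.inr) := by
  rw [← F.inc_inr ⟨A, coprod.braiding B A, by simp [coprod.inl_desc]⟩]
  exact F.inc_comp_inc _ _ _

variable {F} in
lemma incPt_comp_app {F' : SymFun G H} (δ : F ⟶ F') {γ : G.carrier} (ζ : pt γ ⟶ Z) :
    F.incPt ζ ≫ app δ Z = app δ (pt γ) ≫ F'.incPt ζ := inc_comp_app δ _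

/-- Every point of `F Z` comes from a point of `Z`. -/
lemma exists_incPt (Z : FinCover G) {h : H.carrier} (ξ : pt h ⟶ F.ob Z) :
    ∃ (γ : G.carrier) (ζ : pt γ ⟶ Z) (η : pt h ⟶ F.ob (pt γ)), η ≫ F.incPt ζ = ξ := by
  induction Z using induction_pt with
  | h₀ Z hZ => exact ((isEmpty_pt_of_isInitial (F.isInitialOb hZ) h).false ξ).elim
  | h₁ γ B Z e ih =>
    obtain ⟨η | η, rfl⟩ := (F.isSumOnPoints_inc e (complemented_pt _) (complemented_inr e) h).2 ξ
    · exact ⟨γ, _, η, rfl⟩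
    · obtain ⟨γ', ζ, η, rfl⟩ := ih η
      exact ⟨γ', ζ ≫ coprod.inr ≫ e.hom, η, by
        rw [Sum.elim_inr, Category.assoc]
        exact congrArg (η ≫ ·) (F.inc_comp_inc _ _ _).symm⟩

/-- By functoriality the morphism is idempotent, and as the inclusion of a summand it is injective
on points. -/
lemma incPt_id (γ : G.carrier) : F.incPt (𝟙 (pt γ)) = 𝟙 _ := by
  obtain ⟨B, e, he⟩ := complemented_pt (𝟙 (pt γ))
  have h : IsSumOnPoints (F.incPt (coprod.inl ≫ e.hom)) (F.inc (complemented_inr e)) :=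
    F.isSumOnPoints_inc e (complemented_pt _) (complemented_inr e)
  have h'' : F.incPt (𝟙 (pt γ)) ≫ F.incPt (𝟙 (pt γ)) = F.incPt (𝟙 (pt γ)) :=
    (F.inc_comp_inc _ _ (by rw [Category.comp_id]; exact complemented_pt _)).trans
      (by rw [incPt]; congr 1; rw [Category.comp_id])
  rw [he] at h
  refine hom_ext_pt' @fun δ ξ => Sum.inl_injective ((h δ).1
    (a₁ := Sum.inl (ξ ≫ F.incPt (𝟙 (pt γ)))) (a₂ := Sum.inl (ξ ≫ 𝟙 _)) ?_)
  simp [h'']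

lemma hom_ext_incPt {W : FinCover H} {φ ψ : F.ob Z ⟶ W}
    (h : ∀ {γ : G.carrier} (ζ : pt γ ⟶ Z), F.incPt ζ ≫ φ = F.incPt ζ ≫ ψ) : φ = ψ :=
  hom_ext_pt' @fun _ ξ => by
    obtain ⟨γ, ζ, η, rfl⟩ := F.exists_incPt Z ξ
    rw [Category.assoc, h, Category.assoc]

variable {F} in
/-- Monoidal transformations which agree on points are equal. -/
lemma hom_ext_pt {F' : SymFun G H} {δ δ' : F ⟶ F'}
    (h : ∀ γ : G.carrier, app δ (pt γ) = app δ' (pt γ)) : δ = δ' :=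
  hom_ext fun Z => F.hom_ext_incPt fun {γ} ζ => by
    rw [incPt_comp_app, incPt_comp_app, h]

/-- `F Z` is the colimit of the values on the points of `Z`. -/
lemma exists_descPt (Z : FinCover G) {W : FinCover H}
    (φ : ∀ {γ : G.carrier} (_ : pt γ ⟶ Z), F.ob (pt γ) ⟶ W)
    (hφ : ∀ {γ γ' : G.carrier} (m : γ ⟶ γ') (ζ : pt γ' ⟶ Z),
      F.map (ptIso m) ≫ φ ζ = φ (ptMap m ≫ ζ)) :
    ∃ d : F.ob Z ⟶ W, ∀ {γ : G.carrier} (ζ : pt γ ⟶ Z), F.incPt ζ ≫ d = φ ζ := by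
  induction Z using induction_pt with
  | h₀ Z hZ =>
    exact ⟨(F.isInitialOb hZ).to W, fun ζ => ((isEmpty_pt_of_isInitial hZ _).false ζ).elim⟩
  | h₁ γ B Z e ih =>
    obtain ⟨d, hd⟩ := ih (fun ζ => φ (ζ ≫ coprod.inr ≫ e.hom)) (fun m ζ => by
      rw [hφ, Category.assoc])
    have c := (F.isSumOnPoints_inc e (complemented_pt _) (complemented_inr e)).isColimit
    obtain ⟨l, hl₁, hl₂⟩ : ∃ l : F.ob Z ⟶ W, F.inc (complemented_pt _) ≫ l =
        φ (coprod.inl ≫ e.hom) ∧ F.inc (complemented_inr e) ≫ l = d :=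
      ⟨c.desc (BinaryCofan.mk (φ (coprod.inl ≫ e.hom)) d), c.fac _ ⟨WalkingPair.left⟩,
        c.fac _ ⟨WalkingPair.right⟩⟩
    -- A point of `Z` lies either in the split-off point, where the hypothesis `hφ` gives its value,
    -- or in the complement, where the induction hypothesis does.
    refine ⟨l, fun {δ} ζ => ?_⟩
    obtain ⟨η | η, rfl⟩ := (isSumOnPoints_iso e δ).2 ζ
    · obtain ⟨m, rfl⟩ := ptMap_surjective η
      rw [Sum.elim_inl, ← hφ, ← map_ptIso_comp_incPt, Category.assoc]
      exact congrArg _ hl₁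
    · have : F.incPt (η ≫ coprod.inr ≫ e.hom) = F.incPt η ≫ F.inc (complemented_inr e) :=
        (F.inc_comp_inc _ _ _).symm
      rw [Sum.elim_inr, this, Category.assoc, ← hd]
      exact congrArg _ hl₂

variable {F} in
/-- A natural isomorphism on points extends to a monoidal transformation. -/
theorem exists_extension {F' : SymFun G H} (δ : ∀ γ : G.carrier, F.ob (pt γ) ≅ F'.ob (pt γ))
    (hδ : ∀ {γ γ' : G.carrier} (m : γ ⟶ γ'),
      F.map (ptIso m) ≫ (δ γ').hom = (δ γ).hom ≫ F'.map (ptIso m)) :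
    ∃ d : F ⟶ F', ∀ γ, app d (pt γ) = (δ γ).hom := by
  have hδ' {γ γ' : G.carrier} (m : γ ⟶ γ') :
      F'.map (ptIso m) ≫ (δ γ').inv = (δ γ).inv ≫ F.map (ptIso m) := by
    rw [Iso.comp_inv_eq, Category.assoc, hδ, Iso.inv_hom_id_assoc]
  choose a ha using fun Z => F.exists_descPt Z (fun {γ} ζ => (δ γ).hom ≫ F'.incPt ζ)
    (fun m ζ => by rw [← Category.assoc, hδ, Category.assoc, map_ptIso_comp_incPt])
  choose b hb using fun Z => F'.exists_descPt Z (fun {γ} ζ => (δ γ).inv ≫ F.incPt ζ)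
    (fun m ζ => by rw [← Category.assoc, hδ', Category.assoc, map_ptIso_comp_incPt])
  obtain ⟨d, hd⟩ := exists_hom (F := F) (F' := F')
    (fun Z => ⟨a Z, b Z, F.hom_ext_incPt fun ζ => by rw [← Category.assoc, ha, Category.assoc, hb]; simp,
      F'.hom_ext_incPt fun ζ => by rw [← Category.assoc, hb, Category.assoc, ha]; simp⟩)
    (fun e => F.hom_ext_incPt fun ζ => by
      rw [← Category.assoc, incPt_comp_map, ha, ← Category.assoc, ha, Category.assoc,
        incPt_comp_map])
    (fun A B => F.hom_ext_incPt fun ζ => by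
      rw [← Category.assoc, incPt_comp_inl, ha, ← Category.assoc, ha, Category.assoc,
        incPt_comp_inl])
    (fun A B => F.hom_ext_incPt fun ζ => by
      rw [← Category.assoc, incPt_comp_inr, ha, ← Category.assoc, ha, Category.assoc,
        incPt_comp_inr])
  refine ⟨d, fun γ => (hd _).trans ?_⟩
  -- The component at a one-point cover is recovered at its identity point, for which `incPt` is the
  -- identity.
  have h := ha (pt γ) (𝟙 _)
  rwa [incPt_id, incPt_id, Category.id_comp, Category.comp_id] at h

end SymFun

end

end GlobalBurnside

namespace GlobalBurnside

open FinCover FinGrpd Limits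

noncomputable section

/-! ### Spans and equivalences of spans -/

/-- A quasi-inverse of `g` produces the `1`-cell to the corner together with `β`, and then full
faithfulness of `f` produces `γ` from the required identity. Essential surjectivity of `f` plays no
role. -/
lemma FinGrpd.isHomotopyPullback_of_isEquivalence {a b c d : FinGrpd.{u}} {g : a ⟶ b} {j : a ⟶ c}
    {i : b ⟶ d} {f : c ⟶ d} (σ : g ≫ i ≅ j ≫ f) (hg : (fn g).IsEquivalence)
    (hf : (fn f).Full) (hf' : (fn f).Faithful) : IsHomotopyPullback g j i f σ where
  essSurj s x y θ := by
    let e := (fn g).asEquivalence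
    let z : s ⟶ a := fn x ⋙ e.inverse
    let β : z ≫ g ≅ x := Functor.isoWhiskerLeft (fn x) e.counitIso ≪≫ Functor.rightUnitor (fn x)
    let κ : (z ≫ j) ≫ f ≅ y ≫ f :=
      α_ _ _ _ ≪≫ whiskerLeftIso z σ.symm ≪≫ (α_ _ _ _).symm ≪≫ whiskerRightIso β i ≪≫ θ
    let γ : z ≫ j ≅ y := (((Functor.FullyFaithful.ofFullyFaithful (fn f)).whiskeringRight
      s.carrier)).preimageIso (X := fn (z ≫ j)) (Y := fn y) κ
    have hγ : γ.hom ▷ f = κ.hom :=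
      (((Functor.FullyFaithful.ofFullyFaithful (fn f)).whiskeringRight s.carrier)).map_preimage
        (X := fn (z ≫ j)) (Y := fn y) κ.hom
    refine ⟨z, β, γ, ?_⟩
    rw [hγ]
    simp [κ]
  full_faithful s z z' β γ e := by
    let F := (Functor.FullyFaithful.ofFullyFaithful (fn g)).whiskeringRight s.carrier
    let φ : z ≅ z' := F.preimageIso (X := fn z) (Y := fn z') β
    have h₁ : φ.hom ▷ g = β.hom := F.map_preimage (X := fn z) (Y := fn z') β.hom
    refine ⟨φ, ⟨h₁, ?_⟩, fun ψ hψ => Iso.ext (F.map_injective (X := fn z) (Y := fn z')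
      (hψ.1.trans h₁.symm))⟩
    refine ((Functor.FullyFaithful.ofFullyFaithful (fn f)).whiskeringRight s.carrier).map_injective
      (X := fn (z ≫ j)) (Y := fn (z' ≫ j)) ?_
    change (φ.hom ▷ j) ▷ f = γ.hom ▷ f
    rw [← h₁] at e
    rw [← cancel_epi ((α_ z g i).hom ≫ z ◁ σ.hom ≫ (α_ z j f).inv)]
    refine Eq.trans ?_ (e.trans ?_)
    · simp only [Category.assoc]
      rw [← associator_inv_naturality_left, whisker_exchange_assoc,
        associator_naturality_left_assoc]
    · simp only [Category.assoc]

lemma faithful_id (G : FinGrpd.{u}) : faithful (𝟙 G) := ⟨fun h => h⟩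

/-- A span of finite groupoids with faithful backward leg. -/
structure FSpan (G H : FinGrpd.{u}) where
  X : FinGrpd.{u}
  f : X ⟶ G
  hf : faithful f
  g : X ⟶ H

namespace FSpan

variable {G H : FinGrpd.{u}}

/-- An equivalence of spans. -/
structure Equiv (v w : FSpan G H) where
  a : v.X ⟶ w.X
  isEquivalence : (fn a).IsEquivalence
  α : v.f ≅ a ≫ w.f
  β : v.g ≅ a ≫ w.g

/-- The identity. -/
def Equiv.id (v : FSpan G H) : Equiv v v where
  a := 𝟙 _
  isEquivalence := inferInstanceAs (𝟭 v.X.carrier).IsEquivalence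
  α := (λ_ _).symm
  β := (λ_ _).symm

variable (R : RightAdjointChoice psi.{u} faithful) (v w : FSpan G H)

/-- The coproduct-preserving functor attached to a span. -/
abbrev functor : hF G ⟶ hF H := R.span v.f v.hf v.g

/-- The symmetric monoidal functor attached to a span. -/
def sym : SymFun G H := CatCop.coreMap (v.functor R)

/-- The points of the values of the functor attached to a span. -/
def pEl {Z : FinCover G} {x : v.X.carrier} {h : H.carrier} (m : h ⟶ (fn v.g).obj x)
    (ζ : pt ((fn v.f).obj x) ⟶ Z) : pt h ⟶ (v.sym R).ob Z := el (R.adjF v.f v.hf) (fn v.g) m ζ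

lemma pEl_surjective {Z : FinCover G} {h : H.carrier} (φ : pt h ⟶ (v.sym R).ob Z) :
    ∃ (x : v.X.carrier) (m : h ⟶ (fn v.g).obj x) (ζ : pt ((fn v.f).obj x) ⟶ Z),
      v.pEl R m ζ = φ := el_surjective (R.adjF v.f v.hf) (fn v.g) φ

variable {v w R}

lemma pEl_eq_iff {Z : FinCover G} {x x' : v.X.carrier} {h : H.carrier} {m : h ⟶ (fn v.g).obj x}
    {m' : h ⟶ (fn v.g).obj x'} {ζ : pt ((fn v.f).obj x) ⟶ Z} {ζ' : pt ((fn v.f).obj x') ⟶ Z} :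
    v.pEl R m ζ = v.pEl R m' ζ' ↔ ∃ k : x ⟶ x', m ≫ (fn v.g).map k = m' ∧
      ptMap ((fn v.f).map k) ≫ ζ' = ζ := el_eq_iff (R.adjF v.f v.hf)

lemma ptMap_comp_pEl {Z : FinCover G} {x : v.X.carrier} {h h' : H.carrier} (k : h' ⟶ h)
    (m : h ⟶ (fn v.g).obj x) (ζ : pt ((fn v.f).obj x) ⟶ Z) :
    ptMap k ≫ v.pEl R m ζ = v.pEl R (k ≫ m) ζ := ptMap_comp_el _ _ _ _ _

lemma pEl_comp_map {Z Z' : FinCover G} {x : v.X.carrier} {h : H.carrier}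
    (m : h ⟶ (fn v.g).obj x) (ζ : pt ((fn v.f).obj x) ⟶ Z) (φ : Z ≅ Z') :
    v.pEl R m ζ ≫ (v.sym R).map φ = v.pEl R m (ζ ≫ φ.hom) :=
  el_comp_map (R.adjF v.f v.hf) (fn v.g) m ζ φ.hom

variable (R)

/-- The square comparing the backward legs. -/
def Equiv.squareIso (e : Equiv v w) : e.a ≫ w.f ≅ v.f ≫ 𝟙 G := e.α.symm ≪≫ (ρ_ v.f).symm

/-- The `2`-cell attached to an equivalence of spans. -/
def Equiv.cell (e : Equiv v w) : v.functor R ⟶ w.functor R :=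
  -- An equivalence from `v` to `w` is read as a `2`-simplex whose first edge is the identity span
  -- of `G`, whose second edge is `w` and whose composite is `v`; the identity span is then removed.
  R.spanCell (j₀₁ := 𝟙 G) (g₀₁ := 𝟙 G) (j₁₂ := w.f) (g₁₂ := w.g) (j₀₂ := v.f) (g₀₂ := v.g)
      (p := v.f) (q := e.a) (faithful_id G) w.hf v.hf v.hf (ρ_ v.f).symm e.β.hom e.squareIso ≫
    eqToHom (R.span_id (faithful_id G) rfl rfl) ▷ w.functor R ≫ (λ_ (w.functor R)).hom

instance (e : Equiv v w) : IsIso (e.cell R) := by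
  have := R.spanCell_isIso (j₀₁ := 𝟙 G) (g₀₁ := 𝟙 G) (j₁₂ := w.f) (g₁₂ := w.g) (j₀₂ := v.f)
    (g₀₂ := v.g) (p := v.f) (q := e.a) (faithful_id G) w.hf v.hf v.hf (ρ_ v.f).symm e.β.hom e.squareIso
    (isHomotopyPullback_of_isEquivalence _ e.isEquivalence
      (inferInstanceAs (𝟭 G.carrier).Full) (inferInstanceAs (𝟭 G.carrier).Faithful))
  exact IsIso.comp_isIso' this (whiskerRightIso (eqToIso (R.span_id (faithful_id G) rfl rfl))
    (w.functor R) ≪≫ λ_ (w.functor R)).isIso_hom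

/-- The monoidal transformation attached to an equivalence of spans. -/
def Equiv.trans (e : Equiv v w) : v.sym R ⟶ w.sym R := CatCop.coreMap₂ (asIso (e.cell R))

lemma pEl_comp_trans (e : Equiv v w) {Z : FinCover G} {x : v.X.carrier} {h : H.carrier}
    (m : h ⟶ (fn v.g).obj x) (ζ : pt ((fn v.f).obj x) ⟶ Z) :
    v.pEl R m ζ ≫ SymFun.app (e.trans R) Z =
      w.pEl R (x := (fn e.a).obj x) (m ≫ FinGrpd.at e.β.hom x)
        (ptMap (γ := (fn w.f).obj ((fn e.a).obj x)) (FinGrpd.at e.α.inv x) ≫ ζ) := by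
  have h₁ : SymFun.app (e.trans R) Z = R.spanCellApp (j₀₁ := 𝟙 G) (g₀₁ := 𝟙 G) (j₁₂ := w.f)
      (g₁₂ := w.g) (j₀₂ := v.f) (g₀₂ := v.g) (p := v.f) (q := e.a) (faithful_id G) w.hf v.hf v.hf
      (ρ_ v.f).symm e.β.hom e.squareIso Z ≫
      (push (fn w.g)).map ((R.pullF w.f w.hf).map
        (NatTrans.app (eqToHom (R.span_id (j := 𝟙 G) (g := 𝟙 G) (faithful_id G) rfl rfl)) Z)) :=
    congrArg (_ ≫ ·) (Category.comp_id _)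
  refine (congrArg (v.pEl R m ζ ≫ ·) h₁).trans ((Category.assoc _ _ _).symm.trans ?_)
  refine (congrArg (· ≫ _) (R.el_comp_spanCell _ _ _ _ _ _ _ m ζ)).trans ?_
  refine (el_comp_map _ _ _ _ _).trans ?_
  refine congrArg (w.pEl R (x := (fn e.a).obj x) (m ≫ FinGrpd.at e.β.hom x)) ?_
  refine (R.el_comp_eqToHom _ rfl rfl _ _).trans ?_
  rw [← Category.assoc, ← ptMap_comp]
  refine congrArg (ptMap · ≫ ζ) ?_
  exact (Category.comp_id _).trans ((Category.comp_id _).trans (Category.comp_id _))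

variable {R}

/-- By the co-Yoneda argument the functor of a span is generated by the tautological triples with
identity morphism and identity point: any triple over a one-point cover arises from one of these by
restriction and functoriality, and one-point covers suffice. -/
lemma hom_ext_pEl {F : SymFun G H} {δ δ' : v.sym R ⟶ F}
    (h : ∀ x : v.X.carrier, v.pEl R (x := x) (𝟙 _) (𝟙 _) ≫ SymFun.app δ (pt _) =
      v.pEl R (x := x) (𝟙 _) (𝟙 _) ≫ SymFun.app δ' (pt _)) : δ = δ' := by
  refine SymFun.hom_ext_pt fun γ => hom_ext_pt' @fun h' ξ => ?_
  obtain ⟨x, m, ζ, rfl⟩ := v.pEl_surjective R ξ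
  obtain ⟨n, rfl⟩ := ptMap_surjective ζ
  have e : v.pEl R m (ptMap n) =
      ptMap m ≫ v.pEl R (𝟙 _) (𝟙 _) ≫ (v.sym R).map (SymFun.ptIso n) := by
    rw [pEl_comp_map, ptMap_comp_pEl, Category.comp_id, Category.id_comp]
    rfl
  simp only [e, Category.assoc, SymFun.map_app]
  rw [reassoc_of% h]

/-- Comparing the values at the tautological triples yields a morphism `k x` for each `x`. Its
naturality may be tested after applying the faithful functor `w.f`, where it follows from the
naturality of the cells `α`. -/
lemma trans_eq_iff {e e' : Equiv v w} : e.trans R = e'.trans R ↔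
    ∃ m : e.a ≅ e'.a, ∀ x, FinGrpd.at e.β.hom x ≫ (fn w.g).map (FinGrpd.at m.hom x) =
        FinGrpd.at e'.β.hom x ∧
      FinGrpd.at e.α.hom x ≫ (fn w.f).map (FinGrpd.at m.hom x) = FinGrpd.at e'.α.hom x := by
  have key (x : v.X.carrier) : v.pEl R (x := x) (𝟙 _) (𝟙 _) ≫ SymFun.app (e.trans R) (pt _) =
      v.pEl R (x := x) (𝟙 _) (𝟙 _) ≫ SymFun.app (e'.trans R) (pt _) ↔
      ∃ k : (fn e.a).obj x ⟶ (fn e'.a).obj x, FinGrpd.at e.β.hom x ≫ (fn w.g).map k =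
        FinGrpd.at e'.β.hom x ∧
      FinGrpd.at e.α.hom x ≫ (fn w.f).map k = FinGrpd.at e'.α.hom x := by
    rw [pEl_comp_trans, pEl_comp_trans, pEl_eq_iff]
    refine exists_congr fun k => ?_
    rw [Category.id_comp, Category.id_comp, Category.comp_id, Category.comp_id, ← ptMap_comp]
    refine and_congr Iff.rfl ?_
    have h : FinGrpd.at e.α.hom x ≫ (fn w.f).map k = FinGrpd.at e'.α.hom x ↔
        (fn w.f).map k ≫ FinGrpd.at e'.α.inv x = FinGrpd.at e.α.inv x := by
      rw [at_inv, at_inv, IsIso.comp_inv_eq, IsIso.eq_inv_comp]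
    rw [h]
    exact ⟨fun h => ptMap_injective h, fun h => congrArg ptMap h⟩
  constructor
  · intro h
    choose k hk using fun x => (key x).1 (by rw [h])
    refine ⟨NatIso.ofComponents (F := fn e.a) (G := fn e'.a) (fun x => asIso (k x))
      fun {x y} u => w.hf.map_injective ?_, hk⟩
    have h₁ := at_naturality e.α.hom u
    have h₂ := at_naturality e'.α.hom u
    change _ = _ ≫ (fn w.f).map ((fn e.a).map u) at h₁
    change _ = _ ≫ (fn w.f).map ((fn e'.a).map u) at h₂
    change (fn w.f).map ((fn e.a).map u ≫ k y) = (fn w.f).map (k x ≫ (fn e'.a).map u)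
    rw [← cancel_epi (FinGrpd.at e.α.hom x), (fn w.f).map_comp, (fn w.f).map_comp,
      reassoc_of% (hk x).2, ← h₂, ← (hk y).2, reassoc_of% h₁]
  · rintro ⟨m, hm⟩
    exact hom_ext_pEl fun x => (key x).2 ⟨_, hm x⟩

end FSpan

end

end GlobalBurnside

/-! ### Symmetric monoidal functors and transformations come from spans and their equivalences. -/

namespace GlobalBurnside

open FinCover FinGrpd Limits

noncomputable section

namespace FSpan

variable {G H : FinGrpd.{u}} {R : RightAdjointChoice psi.{u} faithful} {v w z : FSpan G H}

lemma Equiv.trans_id (v : FSpan G H) : (Equiv.id v).trans R = 𝟙 _ := by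
  refine hom_ext_pEl fun x => ?_
  refine (pEl_comp_trans R (Equiv.id v) _ _).trans (Eq.trans ?_ (Category.comp_id _).symm)
  refine congrArg₂ (fun m ζ => v.pEl R (x := x) m ζ) (Category.comp_id (𝟙 _)) ?_
  exact (congrArg (· ≫ 𝟙 _) (ptMap_id ((fn v.f).obj x))).trans (Category.comp_id _)

/-- Composition of equivalences of spans. -/
def Equiv.comp (e : Equiv v w) (e' : Equiv w z) : Equiv v z where
  a := e.a ≫ e'.a
  isEquivalence :=
    haveI := e.isEquivalence
    haveI := e'.isEquivalence
    inferInstanceAs (fn e.a ⋙ fn e'.a).IsEquivalence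
  α := e.α ≪≫ whiskerLeftIso e.a e'.α ≪≫ (α_ _ _ _).symm
  β := e.β ≪≫ whiskerLeftIso e.a e'.β ≪≫ (α_ _ _ _).symm

lemma Equiv.at_comp_α (e : Equiv v w) (e' : Equiv w z) (x : v.X.carrier) :
    FinGrpd.at (e.comp e').α.hom x =
      FinGrpd.at e.α.hom x ≫ FinGrpd.at e'.α.hom ((fn e.a).obj x) :=
  congrArg (_ ≫ ·) (Category.comp_id _)

lemma Equiv.at_comp_α_inv (e : Equiv v w) (e' : Equiv w z) (x : v.X.carrier) :
    FinGrpd.at (e.comp e').α.inv x =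
      FinGrpd.at e'.α.inv ((fn e.a).obj x) ≫ FinGrpd.at e.α.inv x :=
  congrArg (· ≫ _) (Category.id_comp _)

lemma Equiv.at_comp_β (e : Equiv v w) (e' : Equiv w z) (x : v.X.carrier) :
    FinGrpd.at (e.comp e').β.hom x =
      FinGrpd.at e.β.hom x ≫ FinGrpd.at e'.β.hom ((fn e.a).obj x) :=
  congrArg (_ ≫ ·) (Category.comp_id _)

lemma Equiv.trans_comp (e : Equiv v w) (e' : Equiv w z) :
    (e.comp e').trans R = e.trans R ≫ e'.trans R := by
  refine hom_ext_pEl fun x => ?_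
  have h : v.pEl R (x := x) (𝟙 _) (𝟙 _) ≫ SymFun.app (e.trans R) (pt _) ≫
      SymFun.app (e'.trans R) (pt _) = z.pEl R (x := (fn e'.a).obj ((fn e.a).obj x))
      ((𝟙 _ ≫ FinGrpd.at e.β.hom x) ≫ FinGrpd.at e'.β.hom ((fn e.a).obj x))
      (ptMap (γ := (fn z.f).obj ((fn e'.a).obj ((fn e.a).obj x)))
        (FinGrpd.at e'.α.inv ((fn e.a).obj x)) ≫
        ptMap (γ := (fn w.f).obj ((fn e.a).obj x)) (FinGrpd.at e.α.inv x) ≫ 𝟙 _) := by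
    rw [← Category.assoc, pEl_comp_trans, pEl_comp_trans]
  refine (pEl_comp_trans R (e.comp e') _ _).trans (Eq.trans ?_ h.symm)
  refine congrArg₂ (fun m ζ => z.pEl R (x := (fn e'.a).obj ((fn e.a).obj x)) m ζ)
    ((congrArg (𝟙 _ ≫ ·) (e.at_comp_β e' x)).trans (Category.assoc _ _ _).symm) ?_
  refine (congrArg (ptMap · ≫ 𝟙 _) (e.at_comp_α_inv e' x)).trans ?_
  exact (congrArg (· ≫ 𝟙 _) (ptMap_comp (FinGrpd.at e'.α.inv ((fn e.a).obj x))
    (FinGrpd.at e.α.inv x))).trans (Category.assoc _ _ _)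

/-- The canonical points of the functor attached to a span. -/
abbrev gen (R : RightAdjointChoice psi.{u} faithful) (v : FSpan G H) (x : v.X.carrier) :
    pt ((fn v.g).obj x) ⟶ (v.sym R).ob (pt ((fn v.f).obj x)) := v.pEl R (x := x) (𝟙 _) (𝟙 _)

lemma gen_comp_map {γ : G.carrier} {x : v.X.carrier} (n : (fn v.f).obj x ⟶ γ) :
    v.gen R x ≫ (v.sym R).map (SymFun.ptIso n) = v.pEl R (𝟙 _) (ptMap n) := by
  rw [pEl_comp_map, Category.id_comp]
  rfl

lemma pEl_ptMap {γ : G.carrier} {h : H.carrier} {x : v.X.carrier} (m : h ⟶ (fn v.g).obj x)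
    (n : (fn v.f).obj x ⟶ γ) :
    v.pEl R m (ptMap n) = ptMap m ≫ v.gen R x ≫ (v.sym R).map (SymFun.ptIso n) := by
  rw [gen_comp_map, ptMap_comp_pEl, Category.comp_id]

lemma gen_map {x y : v.X.carrier} (k : x ⟶ y) :
    v.gen R x ≫ (v.sym R).map (SymFun.ptIso ((fn v.f).map k)) =
      ptMap ((fn v.g).map k) ≫ v.gen R y := by
  rw [gen_comp_map, ptMap_comp_pEl, pEl_eq_iff]
  exact ⟨k, by simp, by simp⟩

section Full

variable (δ : v.sym R ⟶ w.sym R)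

/-- Every monoidal transformation between the functors attached to spans comes from an equivalence
of spans. -/
theorem exists_trans_eq : ∃ e : Equiv v w, e.trans R = δ := by
  -- The value of `δ` at the tautological triple of `x` is a triple of `w`. Its object, its morphism
  -- and its point will be the value at `x` of the equivalence, of the cell `β` and of the inverse
  -- of the cell `α`.
  have h (x : v.X.carrier) : ∃ (y : w.X.carrier) (m : (fn v.g).obj x ⟶ (fn w.g).obj y)
      (n : (fn w.f).obj y ⟶ (fn v.f).obj x),
      v.gen R x ≫ SymFun.app δ (pt _) = w.pEl R m (ptMap n) := by
    obtain ⟨y, m, ζ, h⟩ := w.pEl_surjective R (v.gen R x ≫ SymFun.app δ (pt _))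
    obtain ⟨n, rfl⟩ := ptMap_surjective ζ
    exact ⟨y, m, n, h.symm⟩
  choose a β α h using h
  have hδ {γ : G.carrier} {c : H.carrier} {x : v.X.carrier} (m : c ⟶ (fn v.g).obj x)
      (n : (fn v.f).obj x ⟶ γ) :
      v.pEl R m (ptMap n) ≫ SymFun.app δ (pt γ) = w.pEl R (m ≫ β x) (ptMap (α x ≫ n)) := by
    rw [pEl_ptMap, Category.assoc, Category.assoc, SymFun.map_app, reassoc_of% h, pEl_comp_map,
      ptMap_comp_pEl, ptMap_comp]
    rfl
  have hk {x y : v.X.carrier} (k : x ⟶ y) : ∃ l : a x ⟶ a y,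
      β x ≫ (fn w.g).map l = (fn v.g).map k ≫ β y ∧
        (fn w.f).map l ≫ α y = α x ≫ (fn v.f).map k := by
    have e := congrArg (· ≫ SymFun.app δ (pt _)) (gen_map (R := R) k)
    rw [Category.assoc, SymFun.map_app, reassoc_of% h, Category.assoc, h, pEl_comp_map,
      ptMap_comp_pEl, pEl_eq_iff] at e
    obtain ⟨l, h₁, h₂⟩ := e
    refine ⟨l, h₁, ptMap_injective ?_⟩
    rw [ptMap_comp, h₂, ptMap_comp]
    rfl
  choose l hl hl' using @hk
  -- Since `w.f` is faithful, the morphisms chosen in `w.X` are determined by their images in `G`;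
  -- this makes the choices functorial.
  have inj {x : v.X.carrier} {y : w.X.carrier} {k k' : y ⟶ a x}
      (e : (fn w.f).map k ≫ α x = (fn w.f).map k' ≫ α x) : k = k' :=
    w.hf.map_injective ((cancel_mono (α x)).1 e)
  let A : v.X.carrier ⥤ w.X.carrier :=
    { obj := a
      map := fun k => l k
      map_id := fun x => inj (by rw [hl']; simp)
      map_comp := fun k k' => inj (by rw [hl', Functor.map_comp, Functor.map_comp, Category.assoc,
        hl', reassoc_of% hl']) }
  let A' : v.X ⟶ w.X := A
  have faith : A.Faithful := ⟨fun {x y k k'} e => v.hf.map_injective (by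
    have h₁ := hl' k
    have e : l k = l k' := e
    rw [e, hl'] at h₁
    exact ((cancel_epi _).1 h₁).symm)⟩
  have inj_δ {γ : G.carrier} {c : H.carrier} {ξ ξ' : pt c ⟶ (v.sym R).ob (pt γ)}
      (e : ξ ≫ SymFun.app δ (pt γ) = ξ' ≫ SymFun.app δ (pt γ)) : ξ = ξ' := (cancel_mono _).1 e
  -- A morphism `k` from the image of `x` to the image of `y` identifies the images under `δ` of a
  -- triple at `x` and a triple at `y`. As `δ` is injective on points, the triples themselves agree,
  -- which gives a morphism `x ⟶ y`.
  have full : A.Full := ⟨fun {x y} k => by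
    have e : v.gen R x = v.pEl R (β x ≫ (fn w.g).map k ≫ inv (β y))
        (ptMap (inv (α y) ≫ inv ((fn w.f).map k) ≫ α x)) := inj_δ (by
      rw [h, hδ, pEl_eq_iff]
      refine ⟨k, by simp, ?_⟩
      rw [← ptMap_comp]
      exact congrArg ptMap (by simp))
    obtain ⟨k', -, h'⟩ := pEl_eq_iff.1 e
    rw [← ptMap_comp, ← ptMap_id] at h'
    have h'' := ptMap_injective h'
    refine ⟨k', inj ?_⟩
    change (fn w.f).map (l k') ≫ α y = _
    rw [hl']
    have : (fn v.f).map k' = inv (inv (α y) ≫ inv ((fn w.f).map k) ≫ α x) :=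
      IsIso.eq_inv_of_inv_hom_id h''
    rw [this]
    simp⟩
  -- The preimage under `δ` of the tautological triple at `y` is a triple at some `x`, whose image
  -- is therefore isomorphic to `y`.
  have ess : A.EssSurj := ⟨fun y => by
    obtain ⟨ξ, hξ⟩ : ∃ ξ : pt ((fn w.g).obj y) ⟶ (v.sym R).ob (pt ((fn w.f).obj y)),
        ξ ≫ SymFun.app δ (pt _) = w.gen R y :=
      ⟨w.gen R y ≫ inv (SymFun.app δ (pt _)), by simp⟩
    obtain ⟨x, m, ζ, rfl⟩ := v.pEl_surjective R ξ
    obtain ⟨n, rfl⟩ := ptMap_surjective ζ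
    rw [hδ, pEl_eq_iff] at hξ
    obtain ⟨k, -⟩ := hξ
    exact ⟨x, ⟨asIso k⟩⟩⟩
  refine ⟨⟨A', ⟨faith, full, ess⟩, NatIso.ofComponents (F := fn v.f) (G := A ⋙ fn w.f) (fun x => asIso (inv (α x)))
    (fun {x y} k => ?_), NatIso.ofComponents (F := fn v.g) (G := A ⋙ fn w.g)
      (fun x => asIso (β x)) (fun {x y} k => (hl k).symm)⟩, ?_⟩
  · change (fn v.f).map k ≫ inv (α y) = inv (α x) ≫ (fn w.f).map (l k)
    rw [IsIso.comp_inv_eq, Category.assoc, hl', IsIso.inv_hom_id_assoc]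
  · refine hom_ext_pEl fun x => ?_
    rw [h, pEl_comp_trans, Category.id_comp, Category.comp_id]
    refine congrArg (w.pEl R (β x) ∘ ptMap) ?_
    rw [at_inv]
    exact IsIso.inv_inv (f := α x)

end Full

section EssSurj

variable (F : SymFun G H)

/-- The points of the values of a symmetric monoidal functor on one-point covers. -/
structure Elt where
  base : G.carrier
  elt : (F.ob (pt base)).total.carrier

namespace Elt

variable {F}

/-- The canonical point. -/
def pnt (t : Elt F) : pt ((F.ob (pt t.base)).proj.obj t.elt) ⟶ F.ob (pt t.base) :=
  ptHom t.elt (𝟙 _)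

/-- Morphisms of points. -/
@[ext]
structure Hom (t t' : Elt F) where
  hom : t.base ⟶ t'.base
  val : (F.ob (pt t.base)).proj.obj t.elt ⟶ (F.ob (pt t'.base)).proj.obj t'.elt
  w : t.pnt ≫ F.map (SymFun.ptIso hom) = ptMap val ≫ t'.pnt

lemma map_ptIso_id (γ : G.carrier) : F.map (SymFun.ptIso (𝟙 γ)) = 𝟙 _ := by
  have : SymFun.ptIso (𝟙 γ) = Iso.refl _ := Iso.ext (ptMap_id γ)
  rw [this, SymFun.map_refl]

lemma map_ptIso_comp {γ γ' γ'' : G.carrier} (m : γ ⟶ γ') (n : γ' ⟶ γ'') :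
    F.map (SymFun.ptIso (m ≫ n)) = F.map (SymFun.ptIso m) ≫ F.map (SymFun.ptIso n) := by
  have : SymFun.ptIso (m ≫ n) = SymFun.ptIso m ≪≫ SymFun.ptIso n := Iso.ext (ptMap_comp m n)
  rw [this, SymFun.map_trans]

instance : Category (Elt F) where
  Hom := Hom
  id t := ⟨𝟙 _, 𝟙 _, by rw [map_ptIso_id, ptMap_id, Category.comp_id, Category.id_comp]⟩
  comp f g := ⟨f.hom ≫ g.hom, f.val ≫ g.val, by
    rw [map_ptIso_comp, reassoc_of% f.w, g.w, ptMap_comp, Category.assoc]⟩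
  id_comp f := Hom.ext (Category.id_comp _) (Category.id_comp _)
  comp_id f := Hom.ext (Category.comp_id _) (Category.comp_id _)
  assoc f g h := Hom.ext (Category.assoc _ _ _) (Category.assoc _ _ _)

/-- This is the faithfulness of the projection to `G`: the condition `w` determines `val`, because
covers have thin total groupoids. -/
lemma Hom.val_eq {t t' : Elt F} {f g : Hom t t'} (h : f.hom = g.hom) : f = g := by
  refine Hom.ext h ?_
  have e : ptMap f.val ≫ t'.pnt = ptMap g.val ≫ t'.pnt := by rw [← f.w, ← g.w, h]
  rw [pnt, ptMap_comp_ptHom, ptMap_comp_ptHom, Category.comp_id, Category.comp_id] at e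
  exact ptHom_injective e

variable (F) in
/-- The groupoid of points of the values of a symmetric monoidal functor. -/
def grpd : FinGrpd.{u} where
  carrier := Elt F
  isGroupoid := ⟨fun {t t'} f => by
    have e : t'.pnt ≫ F.map (SymFun.ptIso (inv (Hom.hom f))) =
        ptMap (inv (Hom.val f)) ≫ t.pnt := by
      rw [← cancel_epi (ptMap (Hom.val f)), ← reassoc_of% Hom.w f, ← map_ptIso_comp,
        IsIso.hom_inv_id, map_ptIso_id, ← reassoc_of% ptMap_comp, IsIso.hom_inv_id, ptMap_id,
        Category.comp_id, Category.id_comp]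
    exact ⟨⟨inv (Hom.hom f), inv (Hom.val f), e⟩, Hom.val_eq (IsIso.hom_inv_id (Hom.hom f)),
      Hom.val_eq (IsIso.inv_hom_id (Hom.hom f))⟩⟩
  finite_obj := Finite.of_injective
    (fun t : Elt F => (⟨t.base, t.elt⟩ : Σ γ, (F.ob (pt γ)).total.carrier)) fun t t' h => by
      cases t; cases t'; cases h; rfl
  finite_hom t t' := Finite.of_injective (fun f : Hom t t' => f.hom) fun _ _ h => Hom.val_eq h

end Elt

/-- The span attached to a symmetric monoidal functor. -/
def ofSym : FSpan G H where
  X := Elt.grpd F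
  f := ({ obj := Elt.base, map := Elt.Hom.hom } : Elt F ⥤ G.carrier)
  hf := ⟨fun {_ _} _ _ h => Elt.Hom.val_eq h⟩
  g := ({ obj := fun t => (F.ob (pt t.base)).proj.obj t.elt, map := Elt.Hom.val } :
    Elt F ⥤ H.carrier)

section

variable (R) {F} {γ : G.carrier} {h : H.carrier}

/-- The points of the values on points of the functor attached to `ofSym F`. -/
def ofEl (t : Elt F) (m : h ⟶ (F.ob (pt t.base)).proj.obj t.elt) (n : t.base ⟶ γ) :
    pt h ⟶ ((ofSym F).sym R).ob (pt γ) := (ofSym F).pEl R (x := t) m (ptMap n)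

lemma ofEl_surjective (ξ : pt h ⟶ ((ofSym F).sym R).ob (pt γ)) :
    ∃ (t : Elt F) (m : h ⟶ (F.ob (pt t.base)).proj.obj t.elt) (n : t.base ⟶ γ),
      ofEl R t m n = ξ := by
  obtain ⟨t, m, ζ, rfl⟩ := (ofSym F).pEl_surjective R ξ
  obtain ⟨n, rfl⟩ := ptMap_surjective ζ
  exact ⟨t, m, n, rfl⟩

variable {R}

lemma ofEl_eq_iff {t t' : Elt F} {m : h ⟶ (F.ob (pt t.base)).proj.obj t.elt} {n : t.base ⟶ γ}
    {m' : h ⟶ (F.ob (pt t'.base)).proj.obj t'.elt} {n' : t'.base ⟶ γ} :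
    ofEl R t m n = ofEl R t' m' n' ↔ ∃ k : Elt.Hom t t', m ≫ k.val = m' ∧ k.hom ≫ n' = n := by
  refine pEl_eq_iff.trans (exists_congr fun k => and_congr Iff.rfl ?_)
  have e := ptMap_comp (Elt.Hom.hom k) n'
  exact ⟨fun h => ptMap_injective (e.trans h), fun h => e.symm.trans (congrArg ptMap h)⟩

lemma ptMap_comp_ofEl {h' : H.carrier} (k : h' ⟶ h) (t : Elt F)
    (m : h ⟶ (F.ob (pt t.base)).proj.obj t.elt) (n : t.base ⟶ γ) :
    ptMap k ≫ ofEl R t m n = ofEl R t (k ≫ m) n := ptMap_comp_pEl _ _ _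

lemma ofEl_comp_map {γ' : G.carrier} (t : Elt F)
    (m : h ⟶ (F.ob (pt t.base)).proj.obj t.elt) (n : t.base ⟶ γ) (k : γ ⟶ γ') :
    ofEl R t m n ≫ ((ofSym F).sym R).map (SymFun.ptIso k) = ofEl R t m (n ≫ k) :=
  (pEl_comp_map _ _ _).trans (congrArg ((ofSym F).pEl R (x := t) m) (ptMap_comp _ _).symm)

/-- The point of `F` attached to a point of the functor attached to `ofSym F`. -/
def Elt.val (t : Elt F) (m : h ⟶ (F.ob (pt t.base)).proj.obj t.elt) (n : t.base ⟶ γ) :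
    pt h ⟶ F.ob (pt γ) := ptMap m ≫ t.pnt ≫ F.map (SymFun.ptIso n)

/-- The criterion is literally the one of `ofEl_eq_iff`. Therefore triples of the span `ofSym F` and
points of `F` on one-point covers are identified by the same relation. -/
lemma Elt.val_eq_iff {t t' : Elt F} {m : h ⟶ (F.ob (pt t.base)).proj.obj t.elt} {n : t.base ⟶ γ}
    {m' : h ⟶ (F.ob (pt t'.base)).proj.obj t'.elt} {n' : t'.base ⟶ γ} :
    t.val m n = t'.val m' n' ↔ ∃ k : Elt.Hom t t', m ≫ k.val = m' ∧ k.hom ≫ n' = n := by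
  constructor
  · intro e
    rw [val, val] at e
    -- Both components are forced by the two required equations.
    refine ⟨⟨n ≫ inv n', inv m ≫ m', ?_⟩, by simp, by simp⟩
    rw [Elt.map_ptIso_comp, ← cancel_epi (ptMap m), reassoc_of% e, ← Elt.map_ptIso_comp,
      IsIso.hom_inv_id, Elt.map_ptIso_id, Category.comp_id, ← reassoc_of% ptMap_comp,
      IsIso.hom_inv_id_assoc]
  · rintro ⟨k, rfl, rfl⟩
    rw [val, val, Elt.map_ptIso_comp, reassoc_of% k.w, ptMap_comp, Category.assoc]

end

/-- Every symmetric monoidal functor comes from a span. -/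
theorem exists_sym_hom : Nonempty ((ofSym F).sym R ⟶ F) := by
  have key (γ : G.carrier) : ∃ d : ((ofSym F).sym R).ob (pt γ) ⟶ F.ob (pt γ),
      ∀ (t : Elt F) {h : H.carrier} (m : h ⟶ (F.ob (pt t.base)).proj.obj t.elt) (n : t.base ⟶ γ),
        ofEl R t m n ≫ d = t.val m n := by
    -- Each tautological point is represented by a triple, sent to its value and then glued. The
    -- result does not depend on the representatives, by `Elt.val_eq_iff`.
    choose t m n ht using fun a => ofEl_surjective R (F := F) (γ := γ)
      (ptHom a (𝟙 ((((ofSym F).sym R).ob (pt γ)).proj.obj a)))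
    obtain ⟨d, hd⟩ := exists_desc (fun a => (t a).val (m a) (n a)) (fun {a a'} k => by
      have e := ptHom_naturality k
      rw [← ht, ← ht, ptMap_comp_ofEl, ofEl_eq_iff, ← Elt.val_eq_iff] at e
      rw [← e, Elt.val, Elt.val, ptMap_comp, Category.assoc])
    refine ⟨d, fun t' h m' n' => ?_⟩
    obtain ⟨a, l, e⟩ := ptHom_surjective (ofEl R t' m' n')
    rw [ptHom_eq, ← ht a, ptMap_comp_ofEl] at e
    have e' := Elt.val_eq_iff.2 (ofEl_eq_iff.1 e)
    rw [← e, ← e', ← ptMap_comp_ofEl, Category.assoc, ht a, hd, Elt.val, Elt.val, ptMap_comp,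
      Category.assoc]
  choose d hd using key
  have bij (γ : G.carrier) : IsIso (d γ) := by
    refine isIso_of_bijective _ fun h => ⟨fun ξ ξ' e => ?_, fun ξ => ?_⟩
    · obtain ⟨t, m, n, rfl⟩ := ofEl_surjective R ξ
      obtain ⟨t', m', n', rfl⟩ := ofEl_surjective R ξ'
      exact ofEl_eq_iff.2 (Elt.val_eq_iff.1 ((hd γ t m n).symm.trans (e.trans (hd γ t' m' n'))))
    · obtain ⟨b, m, rfl⟩ := ptHom_surjective ξ
      -- Every object `b` of the total groupoid of `F (pt γ)` is itself an object of the
      -- Grothendieck construction.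
      refine ⟨ofEl R ⟨γ, b⟩ m (𝟙 γ), (hd γ ⟨γ, b⟩ m (𝟙 γ)).trans ?_⟩
      rw [Elt.val, Elt.map_ptIso_id, Category.comp_id, Elt.pnt, ptMap_comp_ptHom,
        Category.comp_id]
  obtain ⟨δ, -⟩ := SymFun.exists_extension (F := (ofSym F).sym R) (F' := F)
    (fun γ => asIso (d γ)) (fun {γ γ'} k => hom_ext_pt' @fun h ξ => by
      obtain ⟨t, m, n, rfl⟩ := ofEl_surjective R ξ
      rw [← Category.assoc, ofEl_comp_map, asIso_hom, asIso_hom, hd, ← Category.assoc, hd, Elt.val,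
        Elt.val, Elt.map_ptIso_comp, Category.assoc, Category.assoc])
  exact ⟨δ⟩

end EssSurj

end FSpan

end

end GlobalBurnside

namespace GlobalBurnside

open FinCover FinGrpd Limits

noncomputable section

/-! ### Chains of invertible `2`-cells -/

open MonoidalCategory in
/-- A simplicial homotopy from a compatible family of maps. -/
def homotopyMk {X Y : SSet.{u}} {f g : X ⟶ Y}
    (T : ∀ {n : SimplexCategory}, (n ⟶ ⦋1⦌) → X.obj (op n) → Y.obj (op n))
    (hT : ∀ {m n : SimplexCategory} (θ : m ⟶ n) (s : n ⟶ ⦋1⦌) (x : X.obj (op n)),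
      T (θ ≫ s) (X.map θ.op x) = Y.map θ.op (T s x))
    (h₀ : ∀ {n : SimplexCategory} (s : n ⟶ ⦋1⦌) (x : X.obj (op n)),
      (∀ i, s.toOrderHom i = 0) → T s x = f.app (op n) x)
    (h₁ : ∀ {n : SimplexCategory} (s : n ⟶ ⦋1⦌) (x : X.obj (op n)),
      (∀ i, s.toOrderHom i = 1) → T s x = g.app (op n) x) : SSet.Homotopy f g :=
  SSet.RelativeMorphism.Homotopy.mk
    (h := { app := fun n => ↾ fun x => T (SSet.stdSimplex.objEquiv x.2) x.1
            naturality := fun n m θ => by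
              ext x
              exact hT θ.unop _ _ })
    (h₀ := by ext n x; exact h₀ _ _ fun _ => rfl)
    (h₁ := by ext n x; exact h₁ _ _ fun _ => rfl)
    (rel := by ext n ⟨⟨x, hx⟩, _⟩; exact hx.elim)

/-- A chain of `n` composable invertible `2`-cells. -/
structure Chain {B : Type u} [Bicategory.{w, v} B] (C D : B) (n : ℕ) : Type (max w v u) where
  obj : Fin (n + 1) → (C ⟶ D)
  map : ∀ {i j : Fin (n + 1)}, i ≤ j → (obj i ⟶ obj j)
  map_refl : ∀ i, map (le_refl i) = 𝟙 _
  map_comp : ∀ {i j k : Fin (n + 1)} (hij : i ≤ j) (hjk : j ≤ k),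
    map (hij.trans hjk) = map hij ≫ map hjk
  isIso : ∀ {i j : Fin (n + 1)} (h : i ≤ j), IsIso (map h)

namespace Chain

variable {B : Type u} [Bicategory.{w, v} B] {C D : B} {m n : ℕ}

lemma ext_map {X Y : Chain C D n} (h : X.obj = Y.obj)
    (h' : ∀ {i j : Fin (n + 1)} (hij : i ≤ j), X.map hij ≫ eqToHom (congrFun h j) =
      eqToHom (congrFun h i) ≫ Y.map hij) : X = Y := by
  obtain ⟨o, a, _, _, _⟩ := X
  obtain ⟨o', a', _, _, _⟩ := Y
  obtain rfl : o = o' := h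
  have : @a = @a' := by
    funext i j hij
    simpa using h' hij
  subst this
  rfl

/-- Restriction of chains. -/
def comap (θ : Fin (m + 1) →o Fin (n + 1)) (X : Chain C D n) : Chain C D m where
  obj i := X.obj (θ i)
  map h := X.map (θ.monotone h)
  map_refl i := X.map_refl (θ i)
  map_comp hij hjk := X.map_comp (θ.monotone hij) (θ.monotone hjk)
  isIso h := X.isIso (θ.monotone h)

variable (C D) in
/-- The simplicial set of chains. -/
def nerve : SSet.{max w v u} where
  obj n := Chain C D n.unop.len
  map θ := ↾ fun X => X.comap θ.unop.toOrderHom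
  map_id _ := rfl
  map_comp _ _ := rfl

end Chain

instance {G H : FinGrpd.{u}} {F F' : SymFun G H} (δ : F ⟶ F') : IsIso δ :=
  SymMonCat.Trans.isIso _ fun _ => IsIso.of_groupoid (C := Core (FinCover H)) _

lemma conj_comp {C : Type u} [Category.{v} C] {a a' b b' c c' : C} (p : a' ⟶ a) (f : a ⟶ b)
    (q : b' ⟶ b) [IsIso q] (g : b ⟶ c) (r : c ⟶ c') :
    p ≫ (f ≫ g) ≫ r = (p ≫ f ≫ inv q) ≫ q ≫ g ≫ r := by
  simp

lemma comp_inv_id {C : Type u} [Category.{v} C] {a b c : C} (p : a ⟶ b) (f : b ⟶ c) :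
    p ≫ f = p ≫ f ≫ inv (𝟙 c) := by
  simp

lemma comp_inv_id' {C : Type u} [Category.{v} C] {b c : C} (f : b ⟶ c) :
    f = 𝟙 b ≫ f ≫ inv (𝟙 c) := by
  simp

/-! ### Chains of equivalences of spans -/

section

variable {G H : FinGrpd.{u}}

/-- A span, with further choices of its backward leg. -/
structure Vert (G H : FinGrpd.{u}) (n : ℕ) (i : Fin (n + 1)) where
  X : FinGrpd.{u}
  -- In a simplex of the mapping space the apex at `i → ⊤` has a separate `1`-cell to the constant
  -- vertex `G` for every arrow `k → l` with `i ≤ k`. All of them are recorded, with `κ` comparing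
  -- them to the one for `i → i`.
  f : ∀ {k l : Fin (n + 1)}, i ≤ k → k ≤ l → (X ⟶ G)
  hf : faithful (f (le_refl i) (le_refl i))
  g : X ⟶ H
  κ : ∀ {k l : Fin (n + 1)} (hik : i ≤ k) (hkl : k ≤ l),
    f hik hkl ≅ f (le_refl i) (le_refl i)
  κ_refl : κ (le_refl i) (le_refl i) = Iso.refl _

namespace Vert

variable {m n : ℕ}

/-- The underlying span. -/
abbrev sp {i : Fin (n + 1)} (V : Vert G H n i) : FSpan G H := ⟨V.X, V.f le_rfl le_rfl, V.hf, V.g⟩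

/-- The constant choice. -/
def const (v : FSpan G H) {i : Fin (n + 1)} : Vert G H n i where
  X := v.X
  f _ _ := v.f
  hf := v.hf
  g := v.g
  κ _ _ := Iso.refl _
  κ_refl := rfl

/-- Restriction. -/
def comap (θ : Fin (m + 1) →o Fin (n + 1)) {i : Fin (m + 1)} (V : Vert G H n (θ i)) :
    Vert G H m i where
  X := V.X
  f hik hkl := V.f (θ.monotone hik) (θ.monotone hkl)
  hf := V.hf
  g := V.g
  κ hik hkl := V.κ (θ.monotone hik) (θ.monotone hkl)
  κ_refl := V.κ_refl

end Vert

variable (R : RightAdjointChoice psi.{u} faithful)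

/-- A chain of composable equivalences of spans. -/
structure SpanChain (G H : FinGrpd.{u}) (n : ℕ) : Type (u + 2) where
  vert : ∀ i : Fin (n + 1), Vert G H n i
  edge : ∀ {i j : Fin (n + 1)}, i ≤ j → (vert i).sp.Equiv (vert j).sp
  edge_refl : ∀ i, edge (le_refl i) = .id _
  -- Composition is only imposed on the induced transformations. By `Equiv.trans_eq_comp_iff` this
  -- amounts to the existence of a comparison cell, which is no extra datum since faithfulness of
  -- the backward leg makes it unique.
  edge_comp : ∀ {i j k : Fin (n + 1)} (hij : i ≤ j) (hjk : j ≤ k),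
    (edge (hij.trans hjk)).trans R = (edge hij).trans R ≫ (edge hjk).trans R

namespace SpanChain

variable {R} {m n : ℕ}

/-- Restriction. -/
def comap (θ : Fin (m + 1) →o Fin (n + 1)) (X : SpanChain R G H n) : SpanChain R G H m where
  vert i := (X.vert (θ i)).comap θ
  edge h := X.edge (θ.monotone h)
  edge_refl i := X.edge_refl (θ i)
  edge_comp hij hjk := X.edge_comp (θ.monotone hij) (θ.monotone hjk)

variable (R G H) in
/-- The simplicial set of chains of equivalences of spans. -/
def nerve : SSet.{u + 2} where
  obj n := SpanChain R G H n.unop.len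
  map θ := ↾ fun X => X.comap θ.unop.toOrderHom
  map_id _ := rfl
  map_comp _ _ := rfl

/-- The associated chain of symmetric monoidal functors. -/
def toChain (X : SpanChain R G H n) : Chain (hF G).core (hF H).core n where
  obj i := (X.vert i).sp.sym R
  map h := (X.edge h).trans R
  map_refl i := by rw [X.edge_refl, FSpan.Equiv.trans_id]
  map_comp := X.edge_comp
  isIso _ := inferInstance

variable (R G H) in
/-- The map to chains of symmetric monoidal functors. -/
def toChainMap : nerve G H R ⟶ Chain.nerve (hF G).core (hF H).core where
  app n := ↾ fun (X : SpanChain R G H n.unop.len) => X.toChain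
  naturality _ _ _ := rfl

end SpanChain

-- Chains of spans are strictly unitary, so the lift of an identity transformation has to be the
-- identity equivalence on the nose. The case distinction is over the equality of the two spans,
-- whence the heterogeneous equalities.
variable (G H) in
lemma exists_lift : ∃ lift : ∀ (v w : FSpan G H), (v.sym R ⟶ w.sym R) → v.Equiv w,
    (∀ v w δ, (lift v w δ).trans R = δ) ∧ ∀ v, lift v v (𝟙 _) = .id v := by
  have key : ∀ (v w : FSpan G H) (δ : v.sym R ⟶ w.sym R), ∃ e : v.Equiv w, e.trans R = δ ∧
      ∀ h : v = w, HEq δ (𝟙 (v.sym R)) → HEq e (FSpan.Equiv.id v) := by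
    intro v w δ
    by_cases h : ∃ _ : v = w, HEq δ (𝟙 (v.sym R))
    · obtain ⟨rfl, h⟩ := h
      obtain rfl := eq_of_heq h
      exact ⟨.id v, FSpan.Equiv.trans_id v, fun _ _ => HEq.rfl⟩
    · obtain ⟨e, he⟩ := FSpan.exists_trans_eq δ
      exact ⟨e, he, fun h₁ h₂ => (h ⟨h₁, h₂⟩).elim⟩
  choose lift h₁ h₂ using key
  exact ⟨lift, h₁, fun v => eq_of_heq (h₂ v v _ rfl HEq.rfl)⟩

/-- The map from chains of equivalences of spans to chains of symmetric monoidal functors is a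
homotopy equivalence. -/
theorem isHomotopyEquivalence_toChainMap :
    IsHomotopyEquivalence (SpanChain.toChainMap G H R) := by
  obtain ⟨lift, hl, hl'⟩ := exists_lift G H R
  -- The homotopy inverse replaces each functor by a span representing it and lifts the
  -- transformations after conjugation with the comparisons `u`.
  choose pick u using fun F : SymFun G H =>
    (⟨FSpan.ofSym F, FSpan.exists_sym_hom F⟩ : ∃ v : FSpan G H, Nonempty (v.sym R ⟶ F))
  replace u := fun F => (u F).some
  let back {n : ℕ} (X : Chain (hF G).core (hF H).core n) : SpanChain R G H n :=
    { vert := fun i => .const (pick (X.obj i))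
      edge := fun {i j} h => lift (pick (X.obj i)) (pick (X.obj j))
        (u (X.obj i) ≫ X.map h ≫ inv (u (X.obj j)))
      edge_refl := fun i => by
        rw [X.map_refl, Category.id_comp, IsIso.hom_inv_id]
        exact hl' _
      edge_comp := fun {i j k} hij hjk => by
        refine (hl _ _ _).trans (Eq.trans ?_ (congrArg₂ (· ≫ ·) (hl _ _ _) (hl _ _ _)).symm)
        rw [X.map_comp hij hjk]
        have : IsIso (u (X.obj j)) := inferInstanceAs (IsIso (C := SymFun G H) (u (X.obj j)))
        exact @conj_comp _ _ _ _ _ _ _ _ _ _ _ this _ _ }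
  let g : Chain.nerve (hF G).core (hF H).core ⟶ SpanChain.nerve G H R :=
    { app := fun n => ↾ fun (X : Chain (hF G).core (hF H).core n.unop.len) => back X
      naturality := fun _ _ _ => rfl }
  -- the homotopy for spans
  let sel {n : ℕ} {i : Fin (n + 1)} (b : Fin 2) (V : Vert G H n i) : Vert G H n i :=
    match b with
    | 0 => .const (pick (V.sp.sym R))
    | 1 => V
  let selHom {n : ℕ} {i : Fin (n + 1)} (b : Fin 2) (V : Vert G H n i) :
      (sel b V).sp.sym R ⟶ V.sp.sym R :=
    match b with
    | 0 => u (V.sp.sym R)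
    | 1 => 𝟙 _
  let selEdge {n : ℕ} {i j : Fin (n + 1)} (b b' : Fin 2) (V : Vert G H n i) (W : Vert G H n j)
      (e : V.sp.Equiv W.sp) : (sel b V).sp.Equiv (sel b' W).sp :=
    match b, b' with
    | 0, 0 => lift (pick (V.sp.sym R)) (pick (W.sp.sym R)) (u _ ≫ e.trans R ≫ inv (u _))
    | 0, 1 => lift (pick (V.sp.sym R)) W.sp (u _ ≫ e.trans R)
    | 1, 0 => lift V.sp (pick (W.sp.sym R)) (e.trans R ≫ inv (u _))
    | 1, 1 => e
  have hsel {n : ℕ} {i j : Fin (n + 1)} (b b' : Fin 2) (V : Vert G H n i) (W : Vert G H n j)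
      (e : V.sp.Equiv W.sp) : (selEdge b b' V W e).trans R =
        selHom b V ≫ e.trans R ≫ inv (selHom b' W) := by
    match b, b' with
    | 0, 0 => exact hl _ _ _
    | 0, 1 => exact (hl _ _ _).trans (comp_inv_id _ _)
    | 1, 0 => exact (hl _ _ _).trans (Category.id_comp _).symm
    | 1, 1 => exact comp_inv_id' _
  have hsel' {n : ℕ} {i : Fin (n + 1)} (b : Fin 2) (V : Vert G H n i) :
      selEdge b b V V (.id _) = .id _ := by
    match b with
    | 0 =>
      refine Eq.trans ?_ (hl' (pick (V.sp.sym R)))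
      refine congrArg (lift _ _) ?_
      rw [FSpan.Equiv.trans_id, Category.id_comp, IsIso.hom_inv_id]
    | 1 => rfl
  -- Vertices sent to `0` by `s` carry the new span, those sent to `1` the old one. Edges within the
  -- `1` part are left unchanged, so that this end of the homotopy is strictly the identity.
  let T {n : SimplexCategory} (s : n ⟶ ⦋1⦌) (X : SpanChain R G H n.len) : SpanChain R G H n.len :=
    { vert := fun i => sel (s.toOrderHom i) (X.vert i)
      edge := fun {i j} h => selEdge (s.toOrderHom i) (s.toOrderHom j) (X.vert i) (X.vert j)
        (X.edge h)
      edge_refl := fun i => by rw [X.edge_refl]; exact hsel' _ _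
      edge_comp := fun {i j k} hij hjk => by
        rw [hsel, hsel, hsel, X.edge_comp hij hjk]
        exact conj_comp _ _ _ _ _ }
  have extS {n : ℕ} {X Y : SpanChain R G H n} (h : X.vert = Y.vert)
      (h' : ∀ {i j : Fin (n + 1)} (hij : i ≤ j), HEq (X.edge hij) (Y.edge hij)) : X = Y := by
    obtain ⟨o, a, _, _⟩ := X
    obtain ⟨o', a', _, _⟩ := Y
    obtain rfl : o = o' := h
    have : @a = @a' := by
      funext i j hij
      exact eq_of_heq (h' hij)
    subst this
    rfl
  -- the homotopy for functors
  let ob (b : Fin 2) (F : SymFun G H) : SymFun G H :=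
    match b with
    | 0 => (pick F).sym R
    | 1 => F
  let obHom (b : Fin 2) (F : SymFun G H) : ob b F ⟶ F :=
    match b with
    | 0 => u F
    | 1 => 𝟙 _
  let T' {n : SimplexCategory} (s : n ⟶ ⦋1⦌) (X : Chain (hF G).core (hF H).core n.len) :
      Chain (hF G).core (hF H).core n.len :=
    { obj := fun i => ob (s.toOrderHom i) (X.obj i)
      map := fun {i j} h => obHom (s.toOrderHom i) (X.obj i) ≫ X.map h ≫
        inv (obHom (s.toOrderHom j) (X.obj j))
      map_refl := fun i => by rw [X.map_refl, Category.id_comp, IsIso.hom_inv_id]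
      map_comp := fun {i j k} hij hjk => by
        rw [X.map_comp hij hjk]
        exact conj_comp _ _ _ _ _
      isIso := fun _ => inferInstance }
  refine ⟨g, ⟨homotopyMk (fun s X => T s X) (fun θ s X => ?_) (fun {n} s X hs => ?_)
    (fun {n} s X hs => ?_)⟩, ⟨homotopyMk (fun s X => T' s X) (fun _ _ _ => rfl)
      (fun {n} s X hs => ?_) (fun {n} s X hs => ?_)⟩⟩
  · refine extS (X := T (θ ≫ s) (SpanChain.comap θ.toOrderHom X))
      (Y := (T s X).comap θ.toOrderHom) (funext fun i => ?_) (fun {i j} hij => ?_)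
    · change sel (s.toOrderHom (θ.toOrderHom i)) ((X.vert (θ.toOrderHom i)).comap θ.toOrderHom) =
        (sel (s.toOrderHom (θ.toOrderHom i)) (X.vert (θ.toOrderHom i))).comap θ.toOrderHom
      match s.toOrderHom (θ.toOrderHom i) with
      | 0 => rfl
      | 1 => rfl
    · change HEq (selEdge (s.toOrderHom (θ.toOrderHom i)) (s.toOrderHom (θ.toOrderHom j))
          ((X.vert (θ.toOrderHom i)).comap θ.toOrderHom)
          ((X.vert (θ.toOrderHom j)).comap θ.toOrderHom) (X.edge (θ.toOrderHom.monotone hij)))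
        (selEdge (s.toOrderHom (θ.toOrderHom i)) (s.toOrderHom (θ.toOrderHom j))
          (X.vert (θ.toOrderHom i)) (X.vert (θ.toOrderHom j))
          (X.edge (θ.toOrderHom.monotone hij)))
      match s.toOrderHom (θ.toOrderHom i), s.toOrderHom (θ.toOrderHom j) with
      | 0, 0 => exact HEq.rfl
      | 0, 1 => exact HEq.rfl
      | 1, 0 => exact HEq.rfl
      | 1, 1 => exact HEq.rfl
  · refine extS (X := T s X) (Y := back X.toChain) (funext fun i => ?_) (fun {i j} hij => ?_)
    · change sel (s.toOrderHom i) _ = _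
      rw [hs]
      rfl
    · change HEq (selEdge (s.toOrderHom i) (s.toOrderHom j) _ _ _) _
      rw [hs, hs]
      exact HEq.rfl
  · refine extS (X := T s X) (Y := X) (funext fun i => ?_) (fun {i j} hij => ?_)
    · change sel (s.toOrderHom i) _ = _
      rw [hs]
    · change HEq (selEdge (s.toOrderHom i) (s.toOrderHom j) _ _ _) _
      rw [hs, hs]
  · have e (b b' : Fin 2) (hb : b = 0) (hb' : b' = 0) (F F' : SymFun G H) (δ : F ⟶ F')
        (h₁ : ob b F = (pick F).sym R) (h₂ : ob b' F' = (pick F').sym R) :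
        (obHom b F ≫ δ ≫ inv (obHom b' F')) ≫ eqToHom h₂ =
          eqToHom h₁ ≫ u F ≫ δ ≫ inv (u F') := by
      subst hb hb'
      exact (Category.comp_id _).trans (Category.id_comp _).symm
    refine Chain.ext_map (X := T' s X) (Y := (back X).toChain) (funext fun i => ?_)
      (fun {i j} hij => ?_)
    · change ob (s.toOrderHom i) _ = _
      rw [hs]
      rfl
    · exact (e _ _ (hs i) (hs j) _ _ _ _ _).trans (congrArg (_ ≫ ·) (hl _ _ _).symm)
  · have e (b b' : Fin 2) (hb : b = 1) (hb' : b' = 1) (F F' : SymFun G H) (δ : F ⟶ F')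
        (h₁ : ob b F = F) (h₂ : ob b' F' = F') :
        (obHom b F ≫ δ ≫ inv (obHom b' F')) ≫ eqToHom h₂ = eqToHom h₁ ≫ δ := by
      subst hb hb'
      exact (Category.comp_id _).trans (congrArg (𝟙 F ≫ ·)
        ((Category.id_comp _).symm.trans (comp_inv_id' δ).symm))
    refine Chain.ext_map (X := T' s X) (Y := X) (funext fun i => ?_) (fun {i j} hij => ?_)
    · change ob (s.toOrderHom i) _ = _
      rw [hs]
    · exact e _ _ (hs i) (hs j) _ _ _ _ _

end

end

end GlobalBurnside

namespace GlobalBurnside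
open FinCover FinGrpd Limits

noncomputable section

/-! ### Normal functors on collages -/

lemma NormalFunctor.ext_heq {P : Type} [Preorder P] {B : Type u} [Bicategory.{w, v} B]
    {X Y : NormalFunctor P B} (ho : ∀ i, X.obj i = Y.obj i)
    (hm : ∀ {i j : P} (h : i ≤ j), HEq (X.map h) (Y.map h))
    (hc : ∀ {i j k : P} (h : i ≤ j) (h' : j ≤ k), HEq (X.cell h h') (Y.cell h h')) : X = Y := by
  obtain ⟨⟨o, m, c⟩, _, _, _, _, _⟩ := X
  obtain ⟨⟨o', m', c'⟩, _, _, _, _, _⟩ := Y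
  obtain rfl : o = o' := funext ho
  obtain rfl : @m = @m' := by
    funext i j h
    exact eq_of_heq (hm h)
  obtain rfl : @c = @c' := by
    funext i j k h h'
    exact eq_of_heq (hc h h')
  rfl

lemma NormalFunctor.comap_congr {P Q : Type} [Preorder P] [Preorder Q] {B : Type u}
    [Bicategory.{w, v} B] {f g : P →o Q} (X : NormalFunctor Q B) (h : ∀ i, f i = g i) :
    X.comap f = X.comap g := by
  rw [OrderHom.ext f g (funext h)]

/-- The constant normal functor. -/
def NormalFunctor.const (P : Type) [Preorder P] {B : Type u} [Bicategory.{w, v} B] (C : B) :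
    NormalFunctor P B where
  obj _ := C
  map _ := 𝟙 C
  cell _ _ := (λ_ _).inv
  map_refl _ := rfl
  cell_refl_left _ := by simp
  cell_refl_right _ := by simp
  cocycle _ _ _ := by simp
  cell_isIso _ _ := inferInstance

/-- Strict unitarity fixes the only `1`-cell, and the unit law then fixes the only `2`-cell. So
vertices of a Duskin nerve are just objects. -/
lemma NormalFunctor.eq_const {P : Type} [Preorder P] [Unique P] {B : Type u} [Bicategory.{w, v} B]
    (X : NormalFunctor P B) : X = .const P (X.obj default) := by
  have key : ∀ (f : X.obj default ⟶ X.obj default) (hf : f = 𝟙 _) (c : f ⟶ f ≫ f),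
      c ≫ eqToHom hf ▷ f ≫ (λ_ f).hom = 𝟙 f → HEq c (λ_ (𝟙 (X.obj default))).inv := by
    intro f hf c hc
    subst hf
    refine heq_of_eq ?_
    rw [← cancel_mono (λ_ (𝟙 (X.obj default))).hom, Iso.inv_hom_id]
    simpa using hc
  refine ext_heq (fun i => ?_) (fun {i j} h => ?_) (fun {i j k} h h' => ?_)
  · obtain rfl := Unique.eq_default i
    rfl
  · obtain rfl := Unique.eq_default i
    obtain rfl := Unique.eq_default j
    exact heq_of_eq (X.map_refl _)
  · obtain rfl := Unique.eq_default i
    obtain rfl := Unique.eq_default j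
    obtain rfl := Unique.eq_default k
    exact key _ (X.map_refl _) _ (X.cell_refl_left _)

/-- A relation between preorders that is compatible with the orders. -/
structure BiRel (P Q : Type) [Preorder P] [Preorder Q] where
  rel : P → Q → Prop
  left : ∀ {p p' : P} {q : Q}, p ≤ p' → rel p' q → rel p q
  right : ∀ {p : P} {q q' : Q}, rel p q → q ≤ q' → rel p q'

/-- The disjoint union of two preorders with further relations from the first to the second. -/
inductive Collage {P Q : Type} [Preorder P] [Preorder Q] (M : BiRel P Q) : Type where
  | inl (p : P)
  | inr (q : Q)

namespace Collage

variable {P Q : Type} [Preorder P] [Preorder Q] {M : BiRel P Q}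

instance : Preorder (Collage M) where
  le i j := match i, j with
    | inl p, inl p' => p ≤ p'
    | inl p, inr q => M.rel p q
    | inr _, inl _ => False
    | inr q, inr q' => q ≤ q'
  le_refl i := match i with
    | inl p => le_refl p
    | inr q => le_refl q
  le_trans i j k h h' := match i, j, k, h, h' with
    | inl _, inl _, inl _, h, h' => le_trans (α := P) h h'
    | inl _, inl _, inr _, h, h' => M.left h h'
    | inl _, inr _, inr _, h, h' => M.right h h'
    | inr _, inr _, inr _, h, h' => le_trans (α := Q) h h'

variable (M) in
/-- The first inclusion. -/
def inlHom : P →o Collage M where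
  toFun := inl
  monotone' _ _ h := h

variable (M) in
/-- The second inclusion. -/
def inrHom : Q →o Collage M where
  toFun := inr
  monotone' _ _ h := h

variable {B : Type u} [Bicategory.{w, v} B]

/-- The data extending normal functors on `P` and `Q` to the collage. -/
@[ext]
structure Ext (M : BiRel P Q) (F : NormalFunctor P B) (G : NormalFunctor Q B) where
  map : ∀ {p q}, M.rel p q → (F.obj p ⟶ G.obj q)
  cellL : ∀ {p p' q} (h : p ≤ p') (h' : M.rel p' q), map (M.left h h') ⟶ F.map h ≫ map h'
  cellR : ∀ {p q q'} (h : M.rel p q) (h' : q ≤ q'), map (M.right h h') ⟶ map h ≫ G.map h'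
  refl_left : ∀ {p q} (h : M.rel p q),
    cellL (le_refl p) h ≫ eqToHom (F.map_refl p) ▷ map h ≫ (λ_ (map h)).hom = 𝟙 (map h)
  refl_right : ∀ {p q} (h : M.rel p q),
    cellR h (le_refl q) ≫ map h ◁ eqToHom (G.map_refl q) ≫ (ρ_ (map h)).hom = 𝟙 (map h)
  cocycle₁ : ∀ {i j k l} (hij : i ≤ j) (hjk : j ≤ k) (hkl : M.rel k l),
    cellL (hij.trans hjk) hkl ≫ F.cell hij hjk ▷ map hkl ≫ (α_ _ _ _).hom =
      cellL hij (M.left hjk hkl) ≫ F.map hij ◁ cellL hjk hkl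
  cocycle₂ : ∀ {i j k l} (hij : i ≤ j) (hjk : M.rel j k) (hkl : k ≤ l),
    cellR (M.left hij hjk) hkl ≫ cellL hij hjk ▷ G.map hkl ≫ (α_ _ _ _).hom =
      cellL hij (M.right hjk hkl) ≫ F.map hij ◁ cellR hjk hkl
  cocycle₃ : ∀ {i j k l} (hij : M.rel i j) (hjk : j ≤ k) (hkl : k ≤ l),
    cellR (M.right hij hjk) hkl ≫ cellR hij hjk ▷ G.map hkl ≫ (α_ _ _ _).hom =
      cellR hij (hjk.trans hkl) ≫ map hij ◁ G.cell hjk hkl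
  isIsoL : ∀ {p p' q} (h : p ≤ p') (h' : M.rel p' q), IsIso (cellL h h')
  isIsoR : ∀ {p q q'} (h : M.rel p q) (h' : q ≤ q'), IsIso (cellR h h')

variable {F : NormalFunctor P B} {G : NormalFunctor Q B}

/-- The objects of the normal functor on the collage. -/
def Ext.joinObj (F : NormalFunctor P B) (G : NormalFunctor Q B) (i : Collage M) : B :=
  match i with
  | inl p => F.obj p
  | inr q => G.obj q

/-- The `1`-cells of the normal functor on the collage. -/
def Ext.joinMap (d : Ext M F G) : ∀ {i j : Collage M}, i ≤ j →
    (joinObj F G i ⟶ joinObj F G j) := fun {i j} h => match i, j, h with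
  | inl _, inl _, h => F.map h
  | inl _, inr _, h => d.map h
  | inr _, inr _, h => G.map h

/-- The `2`-cells of the normal functor on the collage. -/
def Ext.joinCell (d : Ext M F G) : ∀ {i j k : Collage M} (h : i ≤ j) (h' : j ≤ k),
    d.joinMap (h.trans h') ⟶ d.joinMap h ≫ d.joinMap h' :=
  fun {i j k} h h' => match i, j, k, h, h' with
  | inl _, inl _, inl _, h, h' => F.cell h h'
  | inl _, inl _, inr _, h, h' => d.cellL h h'
  | inl _, inr _, inr _, h, h' => d.cellR h h'
  | inr _, inr _, inr _, h, h' => G.cell h h'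

/-- The normal functor on the collage. -/
def Ext.join (d : Ext M F G) : NormalFunctor (Collage M) B where
  obj := joinObj F G
  map := d.joinMap
  cell := d.joinCell
  map_refl i := match i with
    | inl p => F.map_refl p
    | inr p => G.map_refl p
  cell_refl_left {i j} h := match i, j, h with
    | inl _, inl _, h => F.cell_refl_left h
    | inl _, inr _, h => d.refl_left h
    | inr _, inr _, h => G.cell_refl_left h
  cell_refl_right {i j} h := match i, j, h with
    | inl _, inl _, h => F.cell_refl_right h
    | inl _, inr _, h => d.refl_right h
    | inr _, inr _, h => G.cell_refl_right h
  cocycle {i j k l} h h' h'' := match i, j, k, l, h, h', h'' with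
    | inl _, inl _, inl _, inl _, h, h', h'' => F.cocycle h h' h''
    | inl _, inl _, inl _, inr _, h, h', h'' => d.cocycle₁ h h' h''
    | inl _, inl _, inr _, inr _, h, h', h'' => d.cocycle₂ h h' h''
    | inl _, inr _, inr _, inr _, h, h', h'' => d.cocycle₃ h h' h''
    | inr _, inr _, inr _, inr _, h, h', h'' => G.cocycle h h' h''
  cell_isIso {i j k} h h' := match i, j, k, h, h' with
    | inl _, inl _, inl _, h, h' => F.cell_isIso h h'
    | inl _, inl _, inr _, h, h' => d.isIsoL h h'
    | inl _, inr _, inr _, h, h' => d.isIsoR h h'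
    | inr _, inr _, inr _, h, h' => G.cell_isIso h h'

/-- The restriction of a normal functor on the collage. -/
def Ext.rest (W : NormalFunctor (Collage M) B) :
    Ext M (W.comap (inlHom M)) (W.comap (inrHom M)) where
  map {p q} h := W.map (i := inl p) (j := inr q) h
  cellL {p p' q} h h' := W.cell (i := inl p) (j := inl p') (k := inr q) h h'
  cellR {p q q'} h h' := W.cell (i := inl p) (j := inr q) (k := inr q') h h'
  refl_left {p q} h := W.cell_refl_left (i := inl p) (j := inr q) h
  refl_right {p q} h := W.cell_refl_right (i := inl p) (j := inr q) h
  cocycle₁ {i j k l} h h' h'' :=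
    W.cocycle (i := inl i) (j := inl j) (k := inl k) (l := inr l) h h' h''
  cocycle₂ {i j k l} h h' h'' :=
    W.cocycle (i := inl i) (j := inl j) (k := inr k) (l := inr l) h h' h''
  cocycle₃ {i j k l} h h' h'' :=
    W.cocycle (i := inl i) (j := inr j) (k := inr k) (l := inr l) h h' h''
  isIsoL {p p' q} h h' := W.cell_isIso (i := inl p) (j := inl p') (k := inr q) h h'
  isIsoR {p q q'} h h' := W.cell_isIso (i := inl p) (j := inr q) (k := inr q') h h'

lemma Ext.join_rest (W : NormalFunctor (Collage M) B) : (rest W).join = W :=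
  NormalFunctor.ext_heq
    (fun i => match i with
      | inl _ => rfl
      | inr _ => rfl)
    (fun {i j} h => match i, j, h with
      | inl _, inl _, _ => HEq.rfl
      | inl _, inr _, _ => HEq.rfl
      | inr _, inr _, _ => HEq.rfl)
    (fun {i j k} h h' => match i, j, k, h, h' with
      | inl _, inl _, inl _, _, _ => HEq.rfl
      | inl _, inl _, inr _, _, _ => HEq.rfl
      | inl _, inr _, inr _, _, _ => HEq.rfl
      | inr _, inr _, inr _, _, _ => HEq.rfl)

/-- The equalities of the restrictions are eliminated here once and for all; later the data between
the two parts have definitionally constant boundaries. -/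
lemma Ext.exists_join (W : NormalFunctor (Collage M) B) (hF : W.comap (inlHom M) = F)
    (hG : W.comap (inrHom M) = G) : ∃ d : Ext M F G, d.join = W := by
  subst hF hG
  exact ⟨rest W, join_rest W⟩

/-- Functoriality of the collage. -/
def mapHom {P' Q' : Type} [Preorder P'] [Preorder Q'] {M' : BiRel P' Q'} (f : P →o P')
    (g : Q →o Q') (h : ∀ {p q}, M.rel p q → M'.rel (f p) (g q)) : Collage M →o Collage M' where
  toFun i := match i with
    | inl p => inl (f p)
    | inr q => inr (g q)
  monotone' {i j} hij := match i, j, hij with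
    | inl _, inl _, hij => f.monotone hij
    | inl _, inr _, hij => h hij
    | inr _, inr _, hij => g.monotone hij

end Collage

/-! ### Mapping spaces of Duskin nerves -/

/-- The total relation. -/
def BiRel.top (P Q : Type) [Preorder P] [Preorder Q] : BiRel P Q := ⟨fun _ _ => True, fun _ h => h, fun h _ => h⟩

/-- The preorder obtained from `[n]` by adding a top element. -/
abbrev Cone (n : ℕ) : Type := Collage (BiRel.top (Fin (n + 1)) Unit)

namespace Cone

open Collage

/-- The inclusion of the cone on `[n]` in `[n + 1]`. -/
def emb (n : ℕ) : Cone n ↪o Fin (n + 1 + 1) where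
  toFun i := match i with
    | inl p => p.castSucc
    | inr _ => Fin.last _
  inj' i j h := match i, j, h with
    | inl _, inl _, h => congrArg _ (Fin.castSucc_injective _ h)
    | inl _, inr _, h => ((Fin.castSucc_lt_last _).ne h).elim
    | inr _, inl _, h => ((Fin.castSucc_lt_last _).ne h.symm).elim
    | inr _, inr _, h => congrArg _ (Subsingleton.elim _ _)
  map_rel_iff' {i j} := match i, j with
    | inl _, inl _ => Fin.castSucc_le_castSucc_iff
    | inl _, inr _ => iff_of_true (Fin.le_last _) trivial
    | inr _, inl _ => iff_of_false (not_le.2 (Fin.castSucc_lt_last _)) id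
    | inr p, inr q => iff_of_true le_rfl (Subsingleton.elim p q).le

lemma emb_surjective (n : ℕ) : Function.Surjective (emb n) := fun i => by
  induction i using Fin.lastCases with
  | last => exact ⟨inr (), rfl⟩
  | cast i => exact ⟨inl i, rfl⟩

/-- The cone on `[n]` is isomorphic to `[n + 1]`. -/
def iso (n : ℕ) : Cone n ≃o Fin (n + 1 + 1) := RelIso.ofSurjective (emb n) (emb_surjective n)

end Cone

/-- Normal functors on isomorphic preorders agree. -/
lemma NormalFunctor.comap_symm_comap {P Q : Type} [Preorder P] [Preorder Q] {B : Type u}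
    [Bicategory.{w, v} B] (e : P ≃o Q) (X : NormalFunctor Q B) :
    (X.comap (e : P →o Q)).comap (e.symm : Q →o P) = X := by
  have : ((e : P →o Q)).comp (e.symm : Q →o P) = OrderHom.id :=
    OrderHom.ext _ _ (funext e.apply_symm_apply)
  exact congrArg (fun f => X.comap f) this

lemma NormalFunctor.comap_comap_symm {P Q : Type} [Preorder P] [Preorder Q] {B : Type u}
    [Bicategory.{w, v} B] (e : P ≃o Q) (X : NormalFunctor P B) :
    (X.comap (e.symm : Q →o P)).comap (e : P →o Q) = X := comap_symm_comap e.symm X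

section

variable {B : Type u} [Bicategory.{w, v} B] {C D : B}

lemma unit_left_cell {f g : C ⟶ D} (c : f ⟶ 𝟙 C ≫ g) :
    c ≫ eqToHom (rfl : 𝟙 C = 𝟙 C) ▷ g ≫ (λ_ g).hom = c ≫ (λ_ g).hom := by simp

lemma unit_right_cell {f g : C ⟶ D} (c : f ⟶ g ≫ 𝟙 D) :
    c ≫ g ◁ eqToHom (rfl : 𝟙 D = 𝟙 D) ≫ (ρ_ g).hom = c ≫ (ρ_ g).hom := by simp

/-- Over a constant diagram the cocycle law becomes plain composition once the unitors have been
absorbed into the cells. -/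
lemma unit_cocycle_iff {f g h : C ⟶ D} (c : f ⟶ 𝟙 C ≫ g) (c' : g ⟶ 𝟙 C ≫ h)
    (c'' : f ⟶ 𝟙 C ≫ h) :
    c'' ≫ (λ_ (𝟙 C)).inv ▷ h ≫ (α_ _ _ _).hom = c ≫ 𝟙 C ◁ c' ↔
      c'' ≫ (λ_ h).hom = (c ≫ (λ_ g).hom) ≫ c' ≫ (λ_ h).hom := by
  rw [← cancel_mono (𝟙 C ◁ (λ_ h).hom ≫ (λ_ h).hom)]
  simp

end

namespace Chain

variable {B : Type u} [Bicategory.{w, v} B] {C D : B} {m n : ℕ}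

/-- The extension data attached to a chain. -/
def toExt (X : Chain C D n) :
    Collage.Ext (BiRel.top (Fin (n + 1)) Unit) (.const _ C) (.const _ D) where
  map {p q} _ := X.obj p
  cellL h _ := X.map h ≫ (λ_ _).inv
  cellR _ _ := (ρ_ _).inv
  refl_left {p q} h := (unit_left_cell (X.map (le_refl p) ≫ (λ_ (X.obj p)).inv)).trans
    (by simp [X.map_refl]; rfl)
  refl_right {p q} h := (unit_right_cell (ρ_ (X.obj p)).inv).trans (by simp; rfl)
  cocycle₁ {i j k l} hij hjk hkl := (unit_cocycle_iff (X.map hij ≫ (λ_ (X.obj j)).inv)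
    (X.map hjk ≫ (λ_ (X.obj k)).inv) (X.map (hij.trans hjk) ≫ (λ_ (X.obj k)).inv)).2
      (by simp [X.map_comp hij hjk])
  cocycle₂ {i j k l} hij hjk hkl := by
    change (ρ_ (X.obj i)).inv ≫ (X.map hij ≫ (λ_ _).inv) ▷ (𝟙 D) ≫ (α_ _ _ _).hom =
      (X.map hij ≫ (λ_ _).inv) ≫ 𝟙 C ◁ (ρ_ (X.obj j)).inv
    simp
  cocycle₃ {i j k l} hij hjk hkl := by
    change (ρ_ (X.obj i)).inv ≫ (ρ_ (X.obj i)).inv ▷ (𝟙 D) ≫ (α_ _ _ _).hom =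
      (ρ_ (X.obj i)).inv ≫ X.obj i ◁ (λ_ (𝟙 D)).inv
    simp [unitors_inv_equal]
  isIsoL {p p' q} h _ := by
    have := X.isIso h
    exact inferInstanceAs (IsIso (X.map h ≫ (λ_ (X.obj p')).inv))
  isIsoR {p q q'} h h' := inferInstanceAs (IsIso (ρ_ (X.obj p)).inv)

/-- The normal functor on the cone attached to a chain. -/
def toNormal (X : Chain C D n) : NormalFunctor (Cone n) B := X.toExt.join

/-- With both ends constant, the cells `cellL` are invertible `2`-cells up to a unitor, and the unit
law leaves no choice for `cellR`. -/
lemma exists_toExt (d : Collage.Ext (BiRel.top (Fin (n + 1)) Unit)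
    (NormalFunctor.const _ C) (NormalFunctor.const _ D)) : ∃ X : Chain C D n, X.toExt = d := by
  let g (p : Fin (n + 1)) : C ⟶ D := d.map (p := p) (q := ()) trivial
  let c {i j : Fin (n + 1)} (h : i ≤ j) : g i ⟶ 𝟙 C ≫ g j := d.cellL (q := ()) h trivial
  refine ⟨{ obj := g
            map := fun {i j} h => c h ≫ (λ_ _).hom
            map_refl := fun i => ?_
            map_comp := fun {i j k} hij hjk => ?_
            isIso := fun {i j} h => ?_ }, Collage.Ext.ext ?_ ?_ ?_⟩
  · exact (unit_left_cell (c (le_refl i))).symm.trans (d.refl_left (p := i) (q := ()) trivial)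
  · exact (unit_cocycle_iff (c hij) (c hjk) (c (hij.trans hjk))).1
      (d.cocycle₁ (l := ()) hij hjk trivial)
  · have : IsIso (c h) := d.isIsoL (q := ()) h trivial
    infer_instance
  · rfl
  · refine heq_of_eq ?_
    funext p p' q h h'
    change (c h ≫ (λ_ (g p')).hom) ≫ (λ_ (g p')).inv = c h
    simp
  · refine heq_of_eq ?_
    funext p q q' h h'
    have := (unit_right_cell (d.cellR (p := p) (q := ()) (q' := ()) trivial (le_refl _))).symm.trans
      (d.refl_right (p := p) (q := ()) trivial)
    exact ((Iso.comp_hom_eq_id (ρ_ (g p))).1 this).symm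

lemma exists_toNormal (W : NormalFunctor (Cone n) B)
    (h : W.comap (Collage.inlHom _) = .const _ C) (h' : W.comap (Collage.inrHom _) = .const _ D) :
    ∃ X : Chain C D n, X.toNormal = W := by
  obtain ⟨d, rfl⟩ := Collage.Ext.exists_join W h h'
  obtain ⟨X, rfl⟩ := exists_toExt d
  exact ⟨X, rfl⟩

lemma toNormal_injective : Function.Injective (toNormal (C := C) (D := D) (n := n)) := by
  intro X Y h
  have ho (i : Fin (n + 1)) : X.obj i = Y.obj i :=
    eq_of_heq (congr_arg_heq (fun Z : NormalFunctor (Cone n) B =>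
      Z.map (i := .inl i) (j := .inr ()) trivial) h)
  have hm {i j : Fin (n + 1)} (hij : i ≤ j) :
      HEq (X.map hij ≫ (λ_ _).inv) (Y.map hij ≫ (λ_ _).inv) :=
    congr_arg_heq (fun Z : NormalFunctor (Cone n) B =>
      Z.cell (i := .inl i) (j := .inl j) (k := .inr ()) hij trivial) h
  clear h
  obtain ⟨o, m, _, _, _⟩ := X
  obtain ⟨o', m', _, _, _⟩ := Y
  obtain rfl : o = o' := funext ho
  have : @m = @m' := by
    funext i j hij
    exact (cancel_mono _).1 (eq_of_heq (hm hij))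
  subst this
  rfl

lemma toNormal_comap (θ : Fin (m + 1) →o Fin (n + 1)) (X : Chain C D n) :
    (X.comap θ).toNormal = X.toNormal.comap
      (Collage.mapHom θ OrderHom.id fun _ => trivial) :=
  NormalFunctor.ext_heq
    (fun i => match i with
      | .inl _ => rfl
      | .inr _ => rfl)
    (fun {i j} h => match i, j, h with
      | .inl _, .inl _, _ => HEq.rfl
      | .inl _, .inr _, _ => HEq.rfl
      | .inr _, .inr _, _ => HEq.rfl)
    (fun {i j k} h h' => match i, j, k, h, h' with
      | .inl _, .inl _, .inl _, _, _ => HEq.rfl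
      | .inl _, .inl _, .inr _, _, _ => HEq.rfl
      | .inl _, .inr _, .inr _, _, _ => HEq.rfl
      | .inr _, .inr _, .inr _, _, _ => HEq.rfl)

end Chain

/-- The vertex of the Duskin nerve given by an object. -/
def duskinPoint {B : Type u} [Bicategory.{w, v} B] (C : B) : (duskinNerve B) _⦋0⦌ :=
  NormalFunctor.const (Fin 1) C

lemma Cone.iso_joinLast {m n : SimplexCategory} (θ : m ⟶ n) :
    ((joinLast θ).toOrderHom).comp (Cone.iso m.len : Cone m.len →o Fin (m.len + 1 + 1)) =
      (Cone.iso n.len : Cone n.len →o Fin (n.len + 1 + 1)).comp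
        (Collage.mapHom θ.toOrderHom OrderHom.id fun _ => trivial) :=
  OrderHom.ext _ _ (funext fun i => match i with
    | .inl _ => joinLast_castSucc θ _
    | .inr _ => joinLast_last θ)

section

variable {B : Type u} [Bicategory.{w, v} B] {C D : B}

/-- The simplex of the mapping space attached to a normal functor on the cone. -/
def coneSimplex {n : SimplexCategoryᵒᵖ} (W : NormalFunctor (Cone n.unop.len) B)
    (h : W.comap (Collage.inlHom _) = .const _ C)
    (h' : W.comap (Collage.inrHom _) = .const _ D) :
    (homRight (duskinNerve B) (duskinPoint C) (duskinPoint D)).obj n :=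
  ⟨W.comap ((Cone.iso n.unop.len).symm : Fin (n.unop.len + 1 + 1) →o Cone n.unop.len), by
    exact (W.comap_congr
      (f := ((Cone.iso n.unop.len).symm : Fin (n.unop.len + 1 + 1) →o Cone n.unop.len).comp
        (initFace n.unop).toOrderHom) (g := Collage.inlHom _)
      fun i => (Cone.iso n.unop.len).symm_apply_apply (.inl i)).trans h, by
    exact (W.comap_congr
      (f := ((Cone.iso n.unop.len).symm : Fin (n.unop.len + 1 + 1) →o Cone n.unop.len).comp
        (lastVertex n.unop).toOrderHom)
      (g := (Collage.inrHom _).comp (⟨fun _ => (), fun _ _ _ => le_rfl⟩ : Fin 1 →o Unit))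
      fun i => (Cone.iso n.unop.len).symm_apply_apply (.inr ())).trans
        (congrArg (fun Z => Z.comap
          (⟨fun _ => (), fun _ _ _ => le_rfl⟩ : Fin 1 →o Unit)) h')⟩

variable (C D) in
/-- The comparison map from chains to the mapping space of the Duskin nerve. -/
def chainToHomRight :
    Chain.nerve C D ⟶ homRight (duskinNerve B) (duskinPoint C) (duskinPoint D) where
  app n := ↾ fun (X : Chain C D n.unop.len) => coneSimplex X.toNormal rfl rfl
  naturality n m θ := by
    ext (X : Chain C D n.unop.len)
    refine Subtype.ext ?_
    refine (congrArg (NormalFunctor.comap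
      ((Cone.iso m.unop.len).symm : Fin (m.unop.len + 1 + 1) →o Cone m.unop.len))
      (Chain.toNormal_comap θ.unop.toOrderHom X)).trans ?_
    refine X.toNormal.comap_congr
      (f := (Collage.mapHom θ.unop.toOrderHom OrderHom.id fun _ => trivial).comp
        ((Cone.iso m.unop.len).symm : Fin (m.unop.len + 1 + 1) →o Cone m.unop.len))
      (g := ((Cone.iso n.unop.len).symm : Fin (n.unop.len + 1 + 1) →o Cone n.unop.len).comp
        (joinLast θ.unop).toOrderHom) fun i => ?_
    have := congrArg (fun f : Cone m.unop.len →o Fin (n.unop.len + 1 + 1) =>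
      f ((Cone.iso m.unop.len).symm i)) (Cone.iso_joinLast θ.unop)
    have e := (congrArg (joinLast θ.unop).toOrderHom
      ((Cone.iso m.unop.len).apply_symm_apply i)).symm.trans this
    exact ((OrderIso.symm_apply_eq (Cone.iso n.unop.len)).2 e).symm

/-- Viewing `[n + 1]` as the cone on `[n]`, the two conditions in the definition of the mapping
space say that both parts of the collage carry constant functors. -/
lemma chainToHomRight_bijective (n : SimplexCategoryᵒᵖ) :
    Function.Bijective ((chainToHomRight C D).app n) := by
  constructor
  · intro X Y h
    have e := congrArg (fun Z => NormalFunctor.comap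
      (Cone.iso n.unop.len : Cone n.unop.len →o Fin (n.unop.len + 1 + 1)) Z.1) h
    exact Chain.toNormal_injective ((NormalFunctor.comap_comap_symm _ _).symm.trans
      (e.trans (NormalFunctor.comap_comap_symm _ _)))
  · rintro ⟨Z, h, h'⟩
    obtain ⟨X, hX⟩ := Chain.exists_toNormal (C := C) (D := D)
      (NormalFunctor.comap (Cone.iso n.unop.len : Cone n.unop.len →o Fin (n.unop.len + 1 + 1)) Z)
      h (congrArg (NormalFunctor.comap
        (⟨fun _ => 0, fun _ _ _ => le_rfl⟩ : Unit →o Fin 1)) h')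
    refine ⟨X, Subtype.ext ?_⟩
    change X.toNormal.comap _ = Z
    rw [hX]
    exact NormalFunctor.comap_symm_comap _ _

end
end
end GlobalBurnside

namespace GlobalBurnside
open FinCover FinGrpd Limits

noncomputable section

/-! ### Coherence of families of triangles over a base -/

section Triangles

variable {B : Type u} [Bicategory.{w, v} B] {X Y Z W G : B}

/-- Cells compatible with triangles over `G` are determined after whiskering with the leg `k`. If
that whiskering is injective, as for faithful legs, the cocycle law for the cells follows from the
associativity of pasting triangles; the unit laws below are obtained in the same way. -/
lemma triangle_cocycle {f : X ⟶ G} {g : Y ⟶ G} {h : Z ⟶ G} {k : W ⟶ G} {a : X ⟶ Y} {b : Y ⟶ Z}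
    {c : Z ⟶ W} {ab : X ⟶ Z} {bc : Y ⟶ W} {abc : X ⟶ W} (s : f ⟶ a ≫ g) (t : g ⟶ b ≫ h)
    (r : h ⟶ c ≫ k) (st : f ⟶ ab ≫ h) (tr : g ⟶ bc ≫ k) (str : f ⟶ abc ≫ k) [IsIso str]
    (m₁ : ab ⟶ a ≫ b) (m₂ : abc ⟶ ab ≫ c) (m₃ : abc ⟶ a ≫ bc) (m₄ : bc ⟶ b ≫ c)
    (h₁ : st ≫ m₁ ▷ h ≫ (α_ _ _ _).hom = s ≫ a ◁ t)
    (h₂ : str ≫ m₂ ▷ k ≫ (α_ _ _ _).hom = st ≫ ab ◁ r)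
    (h₃ : str ≫ m₃ ▷ k ≫ (α_ _ _ _).hom = s ≫ a ◁ tr)
    (h₄ : tr ≫ m₄ ▷ k ≫ (α_ _ _ _).hom = t ≫ b ◁ r)
    (inj : ∀ {p q : X ⟶ W} (σ τ : p ⟶ q), σ ▷ k = τ ▷ k → σ = τ) :
    m₂ ≫ m₁ ▷ c ≫ (α_ _ _ _).hom = m₃ ≫ a ◁ m₄ := by
  apply inj
  rw [← cancel_epi str, ← cancel_mono ((α_ a (b ≫ c) k).hom ≫ a ◁ (α_ b c k).hom)]
  calc _ = (str ≫ m₂ ▷ k ≫ (α_ _ _ _).hom) ≫ m₁ ▷ (c ≫ k) ≫ (α_ _ _ _).hom := by simp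
    _ = (st ≫ m₁ ▷ h ≫ (α_ _ _ _).hom) ≫ a ◁ b ◁ r := by
      rw [h₂]
      simp only [Category.assoc]
      rw [whisker_exchange_assoc]
      simp
    _ = s ≫ a ◁ (t ≫ b ◁ r) := by rw [h₁]; simp
    _ = (s ≫ a ◁ tr) ≫ a ◁ (m₄ ▷ k ≫ (α_ _ _ _).hom) := by rw [← h₄]; simp
    _ = _ := by rw [← h₃]; simp

lemma triangle_refl_left {f : X ⟶ G} {g : Y ⟶ G} {a : X ⟶ X} {b : X ⟶ Y} (ha : a = 𝟙 X)
    (s : f ⟶ a ≫ f) (hs : s ≫ eqToHom ha ▷ f ≫ (λ_ f).hom = 𝟙 f) (t : f ⟶ b ≫ g) [IsIso t]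
    (m : b ⟶ a ≫ b) (h : t ≫ m ▷ g ≫ (α_ _ _ _).hom = s ≫ a ◁ t)
    (inj : ∀ {p q : X ⟶ Y} (σ τ : p ⟶ q), σ ▷ g = τ ▷ g → σ = τ) :
    m ≫ eqToHom ha ▷ b ≫ (λ_ b).hom = 𝟙 b := by
  subst ha
  apply inj
  rw [← cancel_epi t]
  have := congrArg (· ≫ (λ_ (b ≫ g)).hom) h
  simp only [Category.assoc, leftUnitor_comp, id_whiskerLeft] at this hs ⊢
  simp only [eqToHom_refl, id_whiskerRight, Category.id_comp] at hs
  simp at this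
  simp [this, reassoc_of% hs]

lemma triangle_refl_right {f : X ⟶ G} {g : Y ⟶ G} {a : X ⟶ Y} {b : Y ⟶ Y} (hb : b = 𝟙 Y)
    (t : g ⟶ b ≫ g) (ht : t ≫ eqToHom hb ▷ g ≫ (λ_ g).hom = 𝟙 g) (s : f ⟶ a ≫ g) [IsIso s]
    (m : a ⟶ a ≫ b) (h : s ≫ m ▷ g ≫ (α_ _ _ _).hom = s ≫ a ◁ t)
    (inj : ∀ {p q : X ⟶ Y} (σ τ : p ⟶ q), σ ▷ g = τ ▷ g → σ = τ) :
    m ≫ a ◁ eqToHom hb ≫ (ρ_ a).hom = 𝟙 a := by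
  subst hb
  apply inj
  rw [← cancel_epi s]
  have := congrArg (· ≫ a ◁ (λ_ g).hom) h
  simp only [eqToHom_refl, id_whiskerRight, Category.id_comp] at ht
  simp only [Category.assoc, ← whiskerLeft_comp, ht] at this
  simp at this
  simp [this]

lemma triangle_eq {f : X ⟶ G} {h : Z ⟶ G} {p : X ⟶ Z} {a : X ⟶ Y} {b : Y ⟶ Z} (st : f ⟶ p ≫ h) [IsIso st]
    (m m' : p ⟶ a ≫ b) (e : st ≫ m ▷ h ≫ (α_ _ _ _).hom = st ≫ m' ▷ h ≫ (α_ _ _ _).hom)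
    (inj : ∀ {p q : X ⟶ Z} (σ τ : p ⟶ q), σ ▷ h = τ ▷ h → σ = τ) : m = m' :=
  inj _ _ ((cancel_mono (α_ a b h).hom).1 ((cancel_epi _).1 e))

/-- The various backward legs are conjugate, via `κ`, to the normalized ones. The `twist` lemmas
record that conjugation preserves the unit and cocycle laws. -/
lemma twist_refl {f f' : X ⟶ G} (κ : f ≅ f') {a : X ⟶ X} (ha : a = 𝟙 X) (c : f' ⟶ a ≫ f')
    (hc : c ≫ eqToHom ha ▷ f' ≫ (λ_ f').hom = 𝟙 f') :
    (κ.hom ≫ c ≫ a ◁ κ.inv) ≫ eqToHom ha ▷ f ≫ (λ_ f).hom = 𝟙 f := by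
  subst ha
  simp only [eqToHom_refl, id_whiskerRight, Category.id_comp] at hc ⊢
  simp [reassoc_of% hc]

lemma twist_cocycle {f f' : X ⟶ G} (κ₁ : f ≅ f') {g g' : Y ⟶ G} (κ₂ : g ≅ g') {h h' : Z ⟶ G}
    (κ₃ : h ≅ h') {a : X ⟶ Y} {b : Y ⟶ Z} {ab : X ⟶ Z} (m : ab ⟶ a ≫ b) (s : f' ⟶ a ≫ g')
    (t : g' ⟶ b ≫ h') (st : f' ⟶ ab ≫ h') (e : st ≫ m ▷ h' ≫ (α_ _ _ _).hom = s ≫ a ◁ t) :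
    (κ₁.hom ≫ st ≫ ab ◁ κ₃.inv) ≫ m ▷ h ≫ (α_ _ _ _).hom =
      (κ₁.hom ≫ s ≫ a ◁ κ₂.inv) ≫ a ◁ (κ₂.hom ≫ t ≫ b ◁ κ₃.inv) := by
  have : (κ₁.hom ≫ st ≫ ab ◁ κ₃.inv) ≫ m ▷ h ≫ (α_ _ _ _).hom =
      κ₁.hom ≫ (st ≫ m ▷ h' ≫ (α_ _ _ _).hom) ≫ a ◁ b ◁ κ₃.inv := by
    simp only [Category.assoc]
    rw [whisker_exchange_assoc]
    simp
  rw [this, e]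
  simp

lemma twist_refl_right {f f' : X ⟶ G} (κ : f ≅ f') :
    (κ.hom ≫ κ.inv ≫ (ρ_ f).inv) ≫ f ◁ eqToHom (rfl : 𝟙 G = 𝟙 G) ≫ (ρ_ f).hom = 𝟙 f := by
  simp

lemma twist_cocycle_mid {f₁ f₂ f' : X ⟶ G} (κ₁ : f₁ ≅ f') (κ₂ : f₂ ≅ f') {g₁ g₂ g' : Y ⟶ G}
    (l₁ : g₁ ≅ g') (l₂ : g₂ ≅ g') {a : X ⟶ Y} (s : f' ⟶ a ≫ g') :
    (κ₂.hom ≫ κ₁.inv ≫ (ρ_ _).inv) ≫ (κ₁.hom ≫ s ≫ a ◁ l₁.inv) ▷ 𝟙 G ≫ (α_ _ _ _).hom =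
      (κ₂.hom ≫ s ≫ a ◁ l₂.inv) ≫ a ◁ (l₂.hom ≫ l₁.inv ≫ (ρ_ _).inv) := by
  simp

lemma twist_cocycle_right {f₁ f₂ f₃ f' : X ⟶ G} (κ₁ : f₁ ≅ f') (κ₂ : f₂ ≅ f') (κ₃ : f₃ ≅ f') :
    (κ₃.hom ≫ κ₂.inv ≫ (ρ_ _).inv) ≫ (κ₂.hom ≫ κ₁.inv ≫ (ρ_ _).inv) ▷ 𝟙 G ≫ (α_ _ _ _).hom =
      (κ₃.hom ≫ κ₁.inv ≫ (ρ_ _).inv) ≫ f₁ ◁ (λ_ (𝟙 G)).inv := by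
  simp [unitors_inv_equal]

end Triangles

/-! ### Faithful functors and homotopy pullbacks -/

lemma faithful_whiskerRight_injective {X Y G : FinGrpd.{u}} {f : Y ⟶ G} (hf : faithful f)
    {p q : X ⟶ Y} (σ τ : p ⟶ q) (h : σ ▷ f = τ ▷ f) : σ = τ :=
  NatTrans.ext (funext fun x => Functor.Faithful.map_injective (F := fn f) (self := hf)
    (congrArg (fun μ : p ≫ f ⟶ q ≫ f => FinGrpd.at μ x) h))

/-- Equivalences are stable under base change. Applied with `f` an identity of the constant vertex
`G`, this is how the pullback condition on simplices produces equivalences between the apexes. -/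
lemma isEquivalence_of_isHomotopyPullback {a b c d : FinGrpd.{u}} {g : a ⟶ b} {j : a ⟶ c}
    {i : b ⟶ d} {f : c ⟶ d} {σ : g ≫ i ≅ j ≫ f} (hσ : IsHomotopyPullback g j i f σ)
    (hf : (fn f).IsEquivalence) : (fn g).IsEquivalence where
  faithful := ⟨fun {z z' φ φ'} h => by
    have n (ψ : z ⟶ z') := at_naturality σ.hom ψ
    have e : (fn j).map φ = (fn j).map φ' := by
      refine (fn f).map_injective ?_
      have h₁ := n φ
      have h₂ := n φ'
      change (fn i).map ((fn g).map φ) ≫ _ = _ ≫ (fn f).map ((fn j).map φ) at h₁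
      change (fn i).map ((fn g).map φ') ≫ _ = _ ≫ (fn f).map ((fn j).map φ') at h₂
      rw [h, h₂] at h₁
      exact ((cancel_epi _).1 h₁).symm
    exact (existsUnique_of_isHomotopyPullback hσ z z' _ _ (n φ')).unique ⟨h, e⟩ ⟨rfl, rfl⟩⟩
  full := ⟨fun {z z'} β => by
    obtain ⟨γ, hγ⟩ := (fn f).map_surjective (X := (fn j).obj z) (Y := (fn j).obj z')
      (inv (FinGrpd.at σ.hom z) ≫ (fn i).map β ≫ FinGrpd.at σ.hom z')
    obtain ⟨φ, ⟨h, -⟩, -⟩ := existsUnique_of_isHomotopyPullback hσ z z' β γ (by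
      rw [hγ, IsIso.hom_inv_id_assoc])
    exact ⟨φ, h⟩⟩
  essSurj := ⟨fun x => by
    obtain ⟨z, β, -, -⟩ := exists_of_isHomotopyPullback hσ x ((fn f).objPreimage ((fn i).obj x))
      ((fn f).objObjPreimageIso _).inv
    exact ⟨z, ⟨asIso β⟩⟩⟩

namespace FSpan

variable {G H : FinGrpd.{u}} {v w z : FSpan G H} (R : RightAdjointChoice psi.{u} faithful)

/-- This converts the composition law of transformations into the comparison cell required in a
simplex of the Burnside category, with its compatibility with both legs. -/
lemma Equiv.trans_eq_comp_iff (e : Equiv v w) (e' : Equiv w z) (e'' : Equiv v z) :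
    e''.trans R = e.trans R ≫ e'.trans R ↔ ∃ m : e''.a ≅ e.a ≫ e'.a,
      e''.α.hom ≫ m.hom ▷ z.f ≫ (α_ _ _ _).hom = e.α.hom ≫ e.a ◁ e'.α.hom ∧
      e''.β.hom ≫ m.hom ▷ z.g ≫ (α_ _ _ _).hom = e.β.hom ≫ e.a ◁ e'.β.hom := by
  rw [← Equiv.trans_comp, trans_eq_iff]
  refine exists_congr fun m => ⟨fun h => ⟨NatTrans.ext (funext fun x => ?_),
    NatTrans.ext (funext fun x => ?_)⟩, fun h x => ⟨?_, ?_⟩⟩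
  · exact (congrArg (_ ≫ ·) (Category.comp_id _)).trans
      ((h x).2.trans (Equiv.at_comp_α e e' x))
  · exact (congrArg (_ ≫ ·) (Category.comp_id _)).trans
      ((h x).1.trans (Equiv.at_comp_β e e' x))
  · exact ((congrArg (_ ≫ ·) (Category.comp_id _)).symm.trans
      (congrArg (fun μ : v.g ⟶ e.a ≫ e'.a ≫ z.g => FinGrpd.at μ x) h.2)).trans
        (Equiv.at_comp_β e e' x).symm
  · exact ((congrArg (_ ≫ ·) (Category.comp_id _)).symm.trans
      (congrArg (fun μ : v.f ⟶ e.a ≫ e'.a ≫ z.f => FinGrpd.at μ x) h.1)).trans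
        (Equiv.at_comp_α e e' x).symm

lemma Equiv.eq_id_iff (e : Equiv v v) : e = .id v ↔ ∃ ha : e.a = 𝟙 v.X,
    e.α.hom ≫ eqToHom ha ▷ v.f ≫ (λ_ v.f).hom = 𝟙 v.f ∧
    e.β.hom ≫ eqToHom ha ▷ v.g ≫ (λ_ v.g).hom = 𝟙 v.g := by
  constructor
  · rintro rfl
    exact ⟨rfl, (unit_left_cell (λ_ v.f).inv).trans (Iso.inv_hom_id _),
      (unit_left_cell (λ_ v.g).inv).trans (Iso.inv_hom_id _)⟩
  · obtain ⟨a, ea, α, β⟩ := e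
    rintro ⟨ha, h₁, h₂⟩
    change a = 𝟙 _ at ha
    subst ha
    simp only [eqToHom_refl, id_whiskerRight, Category.id_comp] at h₁ h₂
    have e₁ : α = (λ_ v.f).symm := Iso.ext ((Iso.comp_hom_eq_id _).1 h₁)
    have e₂ : β = (λ_ v.g).symm := Iso.ext ((Iso.comp_hom_eq_id _).1 h₂)
    subst e₁ e₂
    rfl

end FSpan
end
end GlobalBurnside

namespace GlobalBurnside
open FinCover FinGrpd Limits

noncomputable section

/-! ### The twisted arrow poset of a cone -/

/-- The empty relation. -/
def BiRel.bot (P Q : Type) [Preorder P] [Preorder Q] : BiRel P Q :=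
  ⟨fun _ _ => False, fun _ h => h, fun h _ => h⟩

/-- The elements of the twisted arrow poset of `[n + 1]` that are constant or do not involve the
last vertex. -/
abbrev TwBase (n : ℕ) : Type := Collage (BiRel.bot (TwArr (Fin (n + 1))) Unit)

/-- The order relation between `i → ⊤` and the other elements of the twisted arrow poset. -/
def armRel (n : ℕ) : BiRel (Fin (n + 1)) (TwBase n) where
  rel i q := match q with
    | .inl t => i ≤ t.src
    | .inr _ => True
  left {_ _ q} h h' := match q, h' with
    | .inl _, h' => le_trans (α := Fin (n + 1)) h h'
    | .inr _, _ => trivial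
  right {_ q q'} h h' := match q, q', h, h' with
    | .inl _, .inl _, h, h' => le_trans (α := Fin (n + 1)) h h'.1
    | .inr _, .inr _, _, _ => trivial

/-- The twisted arrow poset of `[n + 1]`, sorted by the occurrences of the last vertex. -/
abbrev TwCone (n : ℕ) : Type := Collage (armRel n)

namespace TwCone

variable {n : ℕ}

/-- The element `i → ⊤`. -/
abbrev arm (i : Fin (n + 1)) : TwCone n := .inl i
/-- The element `k → l`. -/
abbrev base (t : TwArr (Fin (n + 1))) : TwCone n := .inr (.inl t)
/-- The element `⊤ → ⊤`. -/
abbrev tip : TwCone n := .inr (.inr ())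

/-- The inclusion in the twisted arrow poset. -/
def toTw (i : TwCone n) : TwArr (Fin (n + 1 + 1)) := match i with
  | .inl i => ⟨i.castSucc, Fin.last _, Fin.le_last _⟩
  | .inr (.inl t) => ⟨t.src.castSucc, t.tgt.castSucc, Fin.castSucc_le_castSucc_iff.2 t.le⟩
  | .inr (.inr _) => ⟨Fin.last _, Fin.last _, le_rfl⟩

lemma not_last_le_castSucc (i : Fin (n + 1)) : ¬ Fin.last (n + 1) ≤ i.castSucc :=
  not_le.2 (Fin.castSucc_lt_last _)

/-- The comparison with the twisted arrow poset. -/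
def emb (n : ℕ) : TwCone n ↪o TwArr (Fin (n + 1 + 1)) where
  toFun := toTw
  inj' i j h := by
    have h₁ := congrArg TwArr.src h
    have h₂ := congrArg TwArr.tgt h
    match i, j, h₁, h₂ with
    | .inl _, .inl _, h₁, _ => exact congrArg _ (Fin.castSucc_injective _ h₁)
    | .inr (.inl _), .inr (.inl _), h₁, h₂ =>
      exact congrArg base (TwArr.ext (Fin.castSucc_injective _ h₁) (Fin.castSucc_injective _ h₂))
    | .inr (.inr _), .inr (.inr _), _, _ => rfl
    | .inl _, .inr (.inl _), _, h₂ => exact ((Fin.castSucc_lt_last _).ne h₂.symm).elim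
    | .inl _, .inr (.inr _), h₁, _ => exact ((Fin.castSucc_lt_last _).ne h₁).elim
    | .inr (.inl _), .inl _, _, h₂ => exact ((Fin.castSucc_lt_last _).ne h₂).elim
    | .inr (.inl _), .inr (.inr _), _, h₂ => exact ((Fin.castSucc_lt_last _).ne h₂).elim
    | .inr (.inr _), .inl _, h₁, _ => exact ((Fin.castSucc_lt_last _).ne h₁.symm).elim
    | .inr (.inr _), .inr (.inl _), h₁, _ => exact ((Fin.castSucc_lt_last _).ne h₁.symm).elim
  map_rel_iff' {i j} := match i, j with
    | .inl _, .inl _ => ⟨fun h => Fin.castSucc_le_castSucc_iff.1 h.1,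
        fun h => ⟨Fin.castSucc_le_castSucc_iff.2 h, le_rfl⟩⟩
    | .inr (.inl _), .inr (.inl _) =>
      ⟨fun h => ⟨Fin.castSucc_le_castSucc_iff.1 h.1, Fin.castSucc_le_castSucc_iff.1 h.2⟩,
        fun h => ⟨Fin.castSucc_le_castSucc_iff.2 h.1, Fin.castSucc_le_castSucc_iff.2 h.2⟩⟩
    | .inr (.inr _), .inr (.inr _) => ⟨fun _ => trivial, fun _ => ⟨le_rfl, le_rfl⟩⟩
    | .inl _, .inr (.inl _) => ⟨fun h => Fin.castSucc_le_castSucc_iff.1 h.1,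
        fun h => ⟨Fin.castSucc_le_castSucc_iff.2 h, Fin.le_last _⟩⟩
    | .inl _, .inr (.inr _) => ⟨fun _ => trivial, fun _ => ⟨Fin.le_last _, le_rfl⟩⟩
    | .inr (.inl _), .inl _ => ⟨fun h => not_last_le_castSucc _ h.2, False.elim⟩
    | .inr (.inl _), .inr (.inr _) => ⟨fun h => not_last_le_castSucc _ h.2, False.elim⟩
    | .inr (.inr _), .inl _ => ⟨fun h => not_last_le_castSucc _ h.1, False.elim⟩
    | .inr (.inr _), .inr (.inl _) => ⟨fun h => not_last_le_castSucc _ h.1, False.elim⟩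

lemma emb_surjective (n : ℕ) : Function.Surjective (emb n) := by
  rintro ⟨i, j, h⟩
  induction j using Fin.lastCases with
  | last =>
    induction i using Fin.lastCases with
    | last => exact ⟨tip, rfl⟩
    | cast i => exact ⟨arm i, rfl⟩
  | cast j =>
    induction i using Fin.lastCases with
    | last => exact (not_last_le_castSucc _ h).elim
    | cast i => exact ⟨base ⟨i, j, Fin.castSucc_le_castSucc_iff.1 h⟩, rfl⟩

/-- The comparison isomorphism with the twisted arrow poset. -/
def iso (n : ℕ) : TwCone n ≃o TwArr (Fin (n + 1 + 1)) :=
  RelIso.ofSurjective (emb n) (emb_surjective n)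

/-- Functoriality. -/
def map {m n : ℕ} (θ : Fin (m + 1) →o Fin (n + 1)) : TwCone m →o TwCone n :=
  Collage.mapHom θ (Collage.mapHom (TwArr.mapHom θ) OrderHom.id id) fun {_ q} h => match q, h with
    | .inl _, h => θ.monotone h
    | .inr _, _ => trivial

lemma iso_joinLast {m n : SimplexCategory} (θ : m ⟶ n) (i : TwCone m.len) :
    TwArr.mapHom (joinLast θ).toOrderHom (iso m.len i) = iso n.len (map θ.toOrderHom i) :=
  match i with
  | .inl _ => TwArr.ext (joinLast_castSucc θ _) (joinLast_last θ)
  | .inr (.inl _) => TwArr.ext (joinLast_castSucc θ _) (joinLast_castSucc θ _)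
  | .inr (.inr _) => TwArr.ext (joinLast_last θ) (joinLast_last θ)

end TwCone

/-! ### The simplex attached to a chain of equivalences of spans -/

section

variable {B : Type u} [Bicategory.{w, v} B]

/-- The normal functor which is constant on both parts. -/
def twBaseNormal (n : ℕ) (G H : B) : NormalFunctor (TwBase n) B :=
  Collage.Ext.join (F := .const _ G) (G := .const _ H)
    { map := fun h => h.elim
      cellL := fun _ h => h.elim
      cellR := fun h => h.elim
      refl_left := fun h => h.elim
      refl_right := fun h => h.elim
      cocycle₁ := fun _ _ h => h.elim
      cocycle₂ := fun _ h => h.elim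
      cocycle₃ := fun h => h.elim
      isIsoL := fun _ h => h.elim
      isIsoR := fun h => h.elim }

lemma eq_twBaseNormal {n : ℕ} {G H : B} (W : NormalFunctor (TwBase n) B)
    (h : W.comap (Collage.inlHom _) = .const _ G) (h' : W.comap (Collage.inrHom _) = .const _ H) :
    W = twBaseNormal n G H := by
  obtain ⟨d, rfl⟩ := Collage.Ext.exists_join W h h'
  obtain ⟨m, c, c', _, _, _, _, _, _, _⟩ := d
  obtain rfl : @m = fun {_ _} h => h.elim := by
    funext p q h
    exact h.elim
  obtain rfl : @c = fun {_ _ _} _ h => h.elim := by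
    funext p p' q h h'
    exact h'.elim
  obtain rfl : @c' = fun {_ _ _} h => h.elim := by
    funext p q q' h
    exact h.elim
  rfl

end

namespace SpanChain

variable {G H : FinGrpd.{u}} {R : RightAdjointChoice psi.{u} faithful} {m n : ℕ}
  (X : SpanChain R G H n)

lemma exists_cell {i j k : Fin (n + 1)} (hij : i ≤ j) (hjk : j ≤ k) :
    ∃ m : (X.edge (hij.trans hjk)).a ≅ (X.edge hij).a ≫ (X.edge hjk).a,
      (X.edge (hij.trans hjk)).α.hom ≫ m.hom ▷ (X.vert k).sp.f ≫ (α_ _ _ _).hom =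
        (X.edge hij).α.hom ≫ (X.edge hij).a ◁ (X.edge hjk).α.hom ∧
      (X.edge (hij.trans hjk)).β.hom ≫ m.hom ▷ (X.vert k).sp.g ≫ (α_ _ _ _).hom =
        (X.edge hij).β.hom ≫ (X.edge hij).a ◁ (X.edge hjk).β.hom :=
  (FSpan.Equiv.trans_eq_comp_iff R (X.edge hij) (X.edge hjk) (X.edge (hij.trans hjk))).1
    (X.edge_comp hij hjk)

/-- The comparison of the composites of the equivalences. -/
def cell {i j k : Fin (n + 1)} (hij : i ≤ j) (hjk : j ≤ k) :
    (X.edge (hij.trans hjk)).a ≅ (X.edge hij).a ≫ (X.edge hjk).a := (X.exists_cell hij hjk).choose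

lemma cell_α {i j k : Fin (n + 1)} (hij : i ≤ j) (hjk : j ≤ k) :
    (X.edge (hij.trans hjk)).α.hom ≫ (X.cell hij hjk).hom ▷ (X.vert k).sp.f ≫ (α_ _ _ _).hom =
      (X.edge hij).α.hom ≫ (X.edge hij).a ◁ (X.edge hjk).α.hom :=
  (X.exists_cell hij hjk).choose_spec.1

lemma cell_β {i j k : Fin (n + 1)} (hij : i ≤ j) (hjk : j ≤ k) :
    (X.edge (hij.trans hjk)).β.hom ≫ (X.cell hij hjk).hom ▷ (X.vert k).sp.g ≫ (α_ _ _ _).hom =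
      (X.edge hij).β.hom ≫ (X.edge hij).a ◁ (X.edge hjk).β.hom :=
  (X.exists_cell hij hjk).choose_spec.2

/-- The normal functor of equivalences. -/
def armNormal : NormalFunctor (Fin (n + 1)) FinGrpd.{u} where
  obj i := (X.vert i).X
  map h := (X.edge h).a
  cell hij hjk := (X.cell hij hjk).hom
  map_refl i := ((FSpan.Equiv.eq_id_iff _).1 (X.edge_refl i)).choose
  -- The comparison cells were merely chosen, but their unit and cocycle laws hold because they can
  -- be tested after whiskering with the faithful backward legs.
  cell_refl_left {i j} h :=
    triangle_refl_left _ _ ((FSpan.Equiv.eq_id_iff _).1 (X.edge_refl i)).choose_spec.1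
      (X.edge h).α.hom (X.cell (le_refl i) h).hom (X.cell_α (le_refl i) h)
      (faithful_whiskerRight_injective (X.vert j).hf)
  cell_refl_right {i j} h :=
    triangle_refl_right _ _ ((FSpan.Equiv.eq_id_iff _).1 (X.edge_refl j)).choose_spec.1
      (X.edge h).α.hom (X.cell h (le_refl j)).hom (X.cell_α h (le_refl j))
      (faithful_whiskerRight_injective (X.vert j).hf)
  cocycle {i j k l} hij hjk hkl :=
    triangle_cocycle (X.edge hij).α.hom (X.edge hjk).α.hom (X.edge hkl).α.hom
      (X.edge (hij.trans hjk)).α.hom (X.edge (hjk.trans hkl)).α.hom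
      (X.edge (hij.trans (hjk.trans hkl))).α.hom _ _ _ _ (X.cell_α hij hjk)
      (X.cell_α (hij.trans hjk) hkl) (X.cell_α hij (hjk.trans hkl)) (X.cell_α hjk hkl)
      (faithful_whiskerRight_injective (X.vert l).hf)
  cell_isIso _ _ := inferInstance

/-- The legs of the spans. -/
def armExt : Collage.Ext (armRel n) X.armNormal (twBaseNormal n G H) where
  map {i q} h := match q, h with
    | .inl t, h => (X.vert i).f h t.le
    | .inr _, _ => (X.vert i).g
  cellL {i j q} h h' := match q, h' with
    | .inl t, h' => ((X.vert i).κ (h.trans h') t.le).hom ≫ (X.edge h).α.hom ≫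
        (X.edge h).a ◁ ((X.vert j).κ h' t.le).inv
    | .inr _, _ => (X.edge h).β.hom
  cellR {i q q'} h h' := match q, q', h, h' with
    | .inl t, .inl t', h, h' => ((X.vert i).κ (le_trans h h'.1) t'.le).hom ≫
        ((X.vert i).κ h t.le).inv ≫ (ρ_ _).inv
    | .inr _, .inr _, _, _ => (ρ_ _).inv
  refl_left {i q} h := match q, h with
    | .inl t, h => twist_refl ((X.vert i).κ h t.le) _ _
        ((FSpan.Equiv.eq_id_iff _).1 (X.edge_refl i)).choose_spec.1
    | .inr _, _ => ((FSpan.Equiv.eq_id_iff _).1 (X.edge_refl i)).choose_spec.2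
  refl_right {i q} h := match q, h with
    | .inl t, h => twist_refl_right ((X.vert i).κ h t.le)
    | .inr _, _ => (unit_right_cell (ρ_ _).inv).trans (Iso.inv_hom_id _)
  cocycle₁ {i j k q} hij hjk hkl := match q, hkl with
    | .inl t, h => twist_cocycle ((X.vert i).κ (hij.trans (hjk.trans h)) t.le)
        ((X.vert j).κ (hjk.trans h) t.le) ((X.vert k).κ h t.le) (X.cell hij hjk).hom
        (X.edge hij).α.hom (X.edge hjk).α.hom (X.edge (hij.trans hjk)).α.hom (X.cell_α hij hjk)
    | .inr _, _ => X.cell_β hij hjk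
  cocycle₂ {i j q q'} hij hjq hqq' := match q, q', hjq, hqq' with
    | .inl t, .inl t', h, h' => twist_cocycle_mid ((X.vert i).κ (hij.trans h) t.le)
        ((X.vert i).κ (hij.trans (le_trans h h'.1)) t'.le) ((X.vert j).κ h t.le)
        ((X.vert j).κ (le_trans h h'.1) t'.le) (X.edge hij).α.hom
    | .inr _, .inr _, _, _ => by
      change (ρ_ (X.vert i).g).inv ≫ (X.edge hij).β.hom ▷ 𝟙 H ≫ (α_ _ _ _).hom =
        (X.edge hij).β.hom ≫ (X.edge hij).a ◁ (ρ_ (X.vert j).g).inv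
      simp
  cocycle₃ {i q q' q''} h₁ h₂ h₃ := match q, q', q'', h₁, h₂, h₃ with
    | .inl t, .inl t', .inl t'', h₁, h₂, h₃ =>
      twist_cocycle_right ((X.vert i).κ h₁ t.le) ((X.vert i).κ (le_trans h₁ h₂.1) t'.le)
        ((X.vert i).κ (le_trans h₁ (le_trans h₂.1 h₃.1)) t''.le)
    | .inr _, .inr _, .inr _, _, _, _ => by
      change (ρ_ (X.vert i).g).inv ≫ (ρ_ (X.vert i).g).inv ▷ 𝟙 H ≫ (α_ _ _ _).hom =
        (ρ_ (X.vert i).g).inv ≫ (X.vert i).g ◁ (λ_ (𝟙 H)).inv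
      simp [unitors_inv_equal]
  isIsoL {i j q} h h' := match q, h' with
    | .inl t, h' => inferInstanceAs (IsIso (((X.vert i).κ (h.trans h') t.le).hom ≫
        (X.edge h).α.hom ≫ (X.edge h).a ◁ ((X.vert j).κ h' t.le).inv))
    | .inr _, _ => inferInstanceAs (IsIso (X.edge h).β.hom)
  isIsoR {i q q'} h h' := match q, q', h, h' with
    | .inl t, .inl t', h, h' => inferInstanceAs (IsIso (
        ((X.vert i).κ (le_trans h h'.1) t'.le).hom ≫ ((X.vert i).κ h t.le).inv ≫ (ρ_ _).inv))
    | .inr _, .inr _, _, _ => inferInstanceAs (IsIso (ρ_ (X.vert i).g).inv)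

/-- The normal functor attached to a chain of equivalences of spans. -/
def toNormal : NormalFunctor (TwCone n) FinGrpd.{u} := X.armExt.join

/-- The chosen comparison cells depend only on the edges involved, so the choice commutes strictly
with restriction. -/
lemma toNormal_comap (θ : Fin (m + 1) →o Fin (n + 1)) :
    (X.comap θ).toNormal = X.toNormal.comap (TwCone.map θ) :=
  NormalFunctor.ext_heq
    (fun i => match i with
      | .inl _ => rfl
      | .inr (.inl _) => rfl
      | .inr (.inr _) => rfl)
    (fun {i j} h => match i, j, h with
      | .inl _, .inl _, _ => HEq.rfl
      | .inl _, .inr (.inl _), _ => HEq.rfl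
      | .inl _, .inr (.inr _), _ => HEq.rfl
      | .inr (.inl _), .inr (.inl _), _ => HEq.rfl
      | .inr (.inr _), .inr (.inr _), _ => HEq.rfl)
    (fun {i j k} h h' => match i, j, k, h, h' with
      | .inl _, .inl _, .inl _, _, _ => HEq.rfl
      | .inl _, .inl _, .inr (.inl _), _, _ => HEq.rfl
      | .inl _, .inl _, .inr (.inr _), _, _ => HEq.rfl
      | .inl _, .inr (.inl _), .inr (.inl _), _, _ => HEq.rfl
      | .inl _, .inr (.inr _), .inr (.inr _), _, _ => HEq.rfl
      | .inr (.inl _), .inr (.inl _), .inr (.inl _), _, _ => HEq.rfl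
      | .inr (.inr _), .inr (.inr _), .inr (.inr _), _, _ => HEq.rfl)

end SpanChain
end
end GlobalBurnside

namespace GlobalBurnside
open FinCover FinGrpd Limits

noncomputable section

/-! ### Recovering a chain of spans from a normal functor -/

namespace ArmExt

section

variable {B : Type u} [Bicategory.{w, v} B] {n : ℕ} {G H : B} {F : NormalFunctor (Fin (n + 1)) B}
  (d : Collage.Ext (armRel n) F (twBaseNormal n G H))

/-- The backward leg. -/
def leg {i : Fin (n + 1)} {t : TwArr (Fin (n + 1))} (h : i ≤ t.src) : F.obj i ⟶ G :=
  d.map (q := .inl t) h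

/-- The forward leg. -/
def fwdLeg (i : Fin (n + 1)) : F.obj i ⟶ H := d.map (p := i) (q := .inr ()) trivial

/-- The comparison of backward legs. -/
def legCell {i : Fin (n + 1)} {t t' : TwArr (Fin (n + 1))} (h : i ≤ t.src) (ht : t ≤ t') :
    leg d (le_trans h ht.1) ⟶ leg d h :=
  d.cellR (q := .inl t) (q' := .inl t') h ht ≫ (ρ_ (leg d h)).hom

instance {i : Fin (n + 1)} {t t' : TwArr (Fin (n + 1))} (h : i ≤ t.src) (ht : t ≤ t') :
    IsIso (legCell d h ht) := by
  have : IsIso (d.cellR (q := .inl t) (q' := .inl t') h ht) := d.isIsoR _ _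
  exact (asIso (d.cellR (q := .inl t) (q' := .inl t') h ht) ≪≫ ρ_ (leg d h)).isIso_hom

lemma comp_runit {f f' f'' : F.obj i ⟶ G} (a : f'' ⟶ f' ≫ 𝟙 G) (b : f' ⟶ f ≫ 𝟙 G)
    (c : f'' ⟶ f ≫ 𝟙 G)
    (h : a ≫ b ▷ 𝟙 G ≫ (α_ _ _ _).hom = c ≫ f ◁ (λ_ (𝟙 G)).inv) :
    (a ≫ (ρ_ f').hom) ≫ b ≫ (ρ_ f).hom = c ≫ (ρ_ f).hom := by
  have := congrArg (· ≫ f ◁ (λ_ (𝟙 G)).hom ≫ (ρ_ f).hom) h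
  simpa [unitors_equal] using this

lemma legCell_comp {i : Fin (n + 1)} {t t' t'' : TwArr (Fin (n + 1))} (h : i ≤ t.src)
    (ht : t ≤ t') (ht' : t' ≤ t'') :
    legCell d (le_trans h ht.1) ht' ≫ legCell d h ht = legCell d h (ht.trans ht') :=
  comp_runit _ _ _ (d.cocycle₃ (j := .inl t) (k := .inl t') (l := .inl t'') h ht ht')

/-- The triangle filled by the equivalences. -/
def tri {i j : Fin (n + 1)} {t : TwArr (Fin (n + 1))} (h : i ≤ j) (h' : j ≤ t.src) :
    leg d (h.trans h') ⟶ F.map h ≫ leg d h' :=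
  d.cellL (q := .inl t) h h'

instance {i j : Fin (n + 1)} {t : TwArr (Fin (n + 1))} (h : i ≤ j) (h' : j ≤ t.src) :
    IsIso (tri d h h') := d.isIsoL _ _

lemma whisker_runit {X Y : B} {a : X ⟶ Y} {f f' : X ⟶ G} {g g' : Y ⟶ G} (c : f' ⟶ f ≫ 𝟙 G)
    (s : f ⟶ a ≫ g) (s' : f' ⟶ a ≫ g') (c' : g' ⟶ g ≫ 𝟙 G)
    (h : c ≫ s ▷ 𝟙 G ≫ (α_ _ _ _).hom = s' ≫ a ◁ c') :
    (c ≫ (ρ_ f).hom) ≫ s = s' ≫ a ◁ (c' ≫ (ρ_ g).hom) := by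
  have := congrArg (· ≫ a ◁ (ρ_ g).hom) h
  simpa using this

lemma legCell_comp_tri {i j : Fin (n + 1)} {t t' : TwArr (Fin (n + 1))} (h : i ≤ j)
    (h' : j ≤ t.src) (ht : t ≤ t') :
    legCell d (h.trans h') ht ≫ tri d h h' =
      tri d h (le_trans h' ht.1) ≫ F.map h ◁ legCell d h' ht :=
  whisker_runit _ _ _ _ (d.cocycle₂ (k := .inl t) (l := .inl t') h h' ht)

/-- The comparison with the normalized backward leg. -/
def kappa {i k l : Fin (n + 1)} (hik : i ≤ k) (hkl : k ≤ l) :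
    leg d (t := ⟨k, l, hkl⟩) hik ≅ leg d (t := ⟨i, i, le_refl i⟩) (le_refl i) :=
  -- The arrows `k → l` and `i → i` are in general not comparable, so the comparison passes through
  -- `i → l`, which lies below both.
  asIso (legCell d (t := ⟨i, l, hik.trans hkl⟩) (t' := ⟨k, l, hkl⟩) (le_refl i) ⟨hik, le_rfl⟩) ≪≫
    (asIso (legCell d (t := ⟨i, l, hik.trans hkl⟩) (t' := ⟨i, i, le_refl i⟩) (le_refl i)
      ⟨le_rfl, hik.trans hkl⟩)).symm

lemma kappa_refl (i : Fin (n + 1)) : kappa d (le_refl i) (le_refl i) = Iso.refl _ := by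
  ext
  simp [kappa]

/-- Every instance of `kappa` and `legCell` here can be expressed through the lowest arrow `i →
t.tgt`. Consequently `kappa` trivializes the whole system of backward legs of a given apex. -/
lemma kappa_comp {i : Fin (n + 1)} {t t' : TwArr (Fin (n + 1))} (h : i ≤ t.src) (ht : t ≤ t') :
    (kappa d (le_trans h ht.1) t'.le).hom ≫ (kappa d h t.le).inv = legCell d h ht := by
  have e₁ := legCell_comp d (i := i) (t := ⟨i, t.tgt, h.trans t.le⟩)
    (t' := ⟨i, t'.tgt, (le_trans h ht.1).trans t'.le⟩) (t'' := t') (le_refl i) ⟨le_rfl, ht.2⟩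
    ⟨le_trans h ht.1, le_rfl⟩
  have e₂ := legCell_comp d (i := i) (t := ⟨i, t.tgt, h.trans t.le⟩)
    (t' := ⟨i, t'.tgt, (le_trans h ht.1).trans t'.le⟩) (t'' := ⟨i, i, le_refl i⟩) (le_refl i)
    ⟨le_rfl, ht.2⟩ ⟨le_rfl, (le_trans h ht.1).trans t'.le⟩
  have e₃ := legCell_comp d (i := i) (t := ⟨i, t.tgt, h.trans t.le⟩) (t' := t) (t'' := t')
    (le_refl i) ⟨h, le_rfl⟩ ht
  simp only [kappa, Iso.trans_hom, Iso.trans_inv, asIso_hom, Iso.symm_hom, Iso.symm_inv,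
    asIso_inv, Category.assoc]
  rw [← e₂, Category.assoc, IsIso.inv_hom_id_assoc, reassoc_of% e₁, IsIso.comp_inv_eq]
  exact e₃.symm

/-- The normalized triangle. -/
def triIso {i j : Fin (n + 1)} (h : i ≤ j) :
    leg d (t := ⟨i, i, le_refl i⟩) (le_refl i) ≅
      F.map h ≫ leg d (t := ⟨j, j, le_refl j⟩) (le_refl j) :=
  (kappa d h (le_refl j)).symm ≪≫ asIso (tri d (t := ⟨j, j, le_refl j⟩) h (le_refl j))

/-- The triangle of forward legs. -/
def fwdIso {i j : Fin (n + 1)} (h : i ≤ j) : fwdLeg d i ≅ F.map h ≫ fwdLeg d j :=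
  have : IsIso (d.cellL (p := i) (p' := j) (q := .inr ()) h trivial) := d.isIsoL _ _
  @asIso _ _ _ _ (d.cellL (p := i) (p' := j) (q := .inr ()) h trivial) this

/-- The triangles over all arrows `t` are recovered from the single normalized one, so that no
information is lost in passing to an equivalence of spans. -/
lemma kappa_comp_tri {i j : Fin (n + 1)} {t : TwArr (Fin (n + 1))} (h : i ≤ j) (h' : j ≤ t.src) :
    (kappa d (h.trans h') t.le).hom ≫ ((kappa d h (le_refl j)).inv ≫
      tri d (t := ⟨j, j, le_refl j⟩) h (le_refl j)) ≫ F.map h ◁ (kappa d h' t.le).inv =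
      tri d h h' := by
  let s : TwArr (Fin (n + 1)) := ⟨j, t.tgt, h'.trans t.le⟩
  have hs : s ≤ t := ⟨h', le_rfl⟩
  have hs' : s ≤ ⟨j, j, le_refl j⟩ := ⟨le_rfl, h'.trans t.le⟩
  have e₁ := kappa_comp d (i := i) (t := s) h hs
  have e₂ := kappa_comp d (i := i) (t := s) h hs'
  have e₃ : (kappa d h' t.le).inv =
    legCell d (le_refl j) hs' ≫ inv (legCell d (le_refl j) hs) := rfl
  have e₄ : (kappa d (h.trans h') t.le).hom ≫ (kappa d h (le_refl j)).inv =
      legCell d h hs ≫ inv (legCell d h hs') := by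
    rw [← e₁, IsIso.eq_comp_inv, ← e₂]
    simp
  rw [e₃, Category.assoc, reassoc_of% e₄, whiskerLeft_comp, ← Category.assoc (tri d _ _),
    ← legCell_comp_tri d h (le_refl j) hs', Category.assoc, IsIso.inv_hom_id_assoc,
    ← Category.assoc, legCell_comp_tri d h (le_refl j) hs, Category.assoc, ← whiskerLeft_comp,
    IsIso.hom_inv_id, whiskerLeft_id, Category.comp_id]

lemma triIso_cell {i j k : Fin (n + 1)} (hij : i ≤ j) (hjk : j ≤ k) :
    (triIso d (hij.trans hjk)).hom ≫ F.cell hij hjk ▷ leg d (t := ⟨k, k, le_refl k⟩) (le_refl k) ≫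
      (α_ _ _ _).hom = (triIso d hij).hom ≫ F.map hij ◁ (triIso d hjk).hom := by
  have e := d.cocycle₁ (l := .inl ⟨k, k, le_refl k⟩) hij hjk (le_refl k)
  change tri d (t := ⟨k, k, le_refl k⟩) (hij.trans hjk) (le_refl k) ≫ F.cell hij hjk ▷
      leg d (t := ⟨k, k, le_refl k⟩) (le_refl k) ≫ (α_ _ _ _).hom =
    tri d (t := ⟨k, k, le_refl k⟩) hij hjk ≫ F.map hij ◁
      tri d (t := ⟨k, k, le_refl k⟩) hjk (le_refl k) at e
  have e' := kappa_comp_tri d (t := ⟨k, k, le_refl k⟩) hij hjk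
  simp only [triIso, Iso.trans_hom, Iso.symm_hom, asIso_hom, Category.assoc]
  rw [e, ← e']
  simp

lemma triIso_refl (i : Fin (n + 1)) : (triIso d (le_refl i)).hom ≫
    eqToHom (F.map_refl i) ▷ leg d (t := ⟨i, i, le_refl i⟩) (le_refl i) ≫ (λ_ _).hom = 𝟙 _ := by
  have := d.refl_left (q := .inl ⟨i, i, le_refl i⟩) (le_refl i)
  simp only [triIso, kappa_refl, Iso.trans_hom, Iso.symm_hom, asIso_hom, Iso.refl_inv,
    Category.id_comp]
  exact this

end

section

variable {G H : FinGrpd.{u}} {n : ℕ} {F : NormalFunctor (Fin (n + 1)) FinGrpd.{u}}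
  (d : Collage.Ext (armRel n) F (twBaseNormal n G H))
  (hd : ∀ i, faithful (leg d (t := ⟨i, i, le_refl i⟩) (le_refl i)))

/-- The span attached to a normal functor. -/
def toVert (i : Fin (n + 1)) : Vert G H n i where
  X := F.obj i
  f {k l} hik hkl := leg d (t := ⟨k, l, hkl⟩) hik
  hf := hd i
  g := fwdLeg d i
  κ hik hkl := kappa d hik hkl
  κ_refl := kappa_refl d i

/-- The equivalence of spans attached to a normal functor. -/
def toEdge {i j : Fin (n + 1)} (h : i ≤ j) (he : (fn (F.map h)).IsEquivalence) :
    (toVert d hd i).sp.Equiv (toVert d hd j).sp where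
  a := F.map h
  isEquivalence := he
  α := triIso d h
  β := fwdIso d h

lemma toEdge_refl (i : Fin (n + 1)) (he : (fn (F.map (le_refl i))).IsEquivalence) :
    toEdge d hd (le_refl i) he = .id _ :=
  (FSpan.Equiv.eq_id_iff _).2 ⟨F.map_refl i, triIso_refl d i,
    d.refl_left (p := i) (q := .inr ()) trivial⟩

lemma toEdge_comp (R : RightAdjointChoice psi.{u} faithful) {i j k : Fin (n + 1)} (hij : i ≤ j)
    (hjk : j ≤ k)
    (he : (fn (F.map hij)).IsEquivalence) (he' : (fn (F.map hjk)).IsEquivalence)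
    (he'' : (fn (F.map (hij.trans hjk))).IsEquivalence) :
    (toEdge d hd (hij.trans hjk) he'').trans R =
      (toEdge d hd hij he).trans R ≫ (toEdge d hd hjk he').trans R := by
  have := F.cell_isIso hij hjk
  exact (FSpan.Equiv.trans_eq_comp_iff R _ _ _).2 ⟨@asIso _ _ _ _ (F.cell hij hjk) this, triIso_cell d hij hjk,
    d.cocycle₁ (l := .inr ()) hij hjk trivial⟩

/-- The chain of equivalences of spans attached to a normal functor. -/
def toSpanChain (R : RightAdjointChoice psi.{u} faithful)
    (he : ∀ {i j : Fin (n + 1)} (h : i ≤ j), (fn (F.map h)).IsEquivalence) :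
    SpanChain R G H n where
  vert := toVert d hd
  edge h := toEdge d hd h (he h)
  edge_refl i := toEdge_refl d hd i _
  edge_comp hij hjk := toEdge_comp d hd R hij hjk _ _ _

variable (R : RightAdjointChoice psi.{u} faithful)
    (he : ∀ {i j : Fin (n + 1)} (h : i ≤ j), (fn (F.map h)).IsEquivalence)

/-- The only cells which are not visibly recovered are those between the apexes. The chosen one and
the given one fill the same triangle over a faithful leg, hence agree. -/
lemma toNormal_toSpanChain : (toSpanChain d hd R he).toNormal = d.join := by
  refine NormalFunctor.ext_heq
    (fun i => match i with
      | .inl _ => rfl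
      | .inr (.inl _) => rfl
      | .inr (.inr _) => rfl)
    (fun {i j} h => match i, j, h with
      | .inl _, .inl _, _ => HEq.rfl
      | .inl _, .inr (.inl _), _ => HEq.rfl
      | .inl _, .inr (.inr _), _ => HEq.rfl
      | .inr (.inl _), .inr (.inl _), _ => HEq.rfl
      | .inr (.inr _), .inr (.inr _), _ => HEq.rfl)
    (fun {i j k} h h' => ?_)
  match i, j, k, h, h' with
  | .inl i, .inl j, .inl k, h, h' =>
    refine heq_of_eq (triangle_eq (triIso d (le_trans h h')).hom
      ((toSpanChain d hd R he).cell h h').hom (F.cell h h') ?_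
      (faithful_whiskerRight_injective (hd k)))
    exact ((toSpanChain d hd R he).cell_α h h').trans (triIso_cell d h h').symm
  | .inl i, .inl j, .inr (.inl t), h, h' =>
    refine heq_of_eq (Eq.trans ?_ (kappa_comp_tri d (t := t) h h'))
    change (kappa d _ _).hom ≫ (triIso d h).hom ≫ F.map h ◁ (kappa d _ _).inv = _
    simp [triIso]
  | .inl i, .inl j, .inr (.inr _), h, h' => exact HEq.rfl
  | .inl i, .inr (.inl t), .inr (.inl t'), h, h' =>
    refine heq_of_eq ?_
    change (kappa d (le_trans h h'.1) t'.le).hom ≫ (kappa d h t.le).inv ≫ (ρ_ _).inv =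
      d.cellR (q := .inl t) (q' := .inl t') h h'
    rw [← Category.assoc, kappa_comp d h h']
    change (d.cellR (q := .inl t) (q' := .inl t') h h' ≫ (ρ_ (leg d h)).hom) ≫ (ρ_ (leg d h)).inv = _
    exact (Category.assoc _ _ _).trans ((congrArg (_ ≫ ·) (Iso.hom_inv_id _)).trans
      (Category.comp_id _))
  | .inl i, .inr (.inr _), .inr (.inr _), h, h' =>
    refine heq_of_eq ?_
    have := (unit_right_cell (d.cellR (p := i) (q := .inr ()) (q' := .inr ()) trivial
      (le_refl _))).symm.trans (d.refl_right (p := i) (q := .inr ()) trivial)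
    exact ((Iso.comp_hom_eq_id (ρ_ (fwdLeg d i))).1 this).symm
  | .inr (.inl _), .inr (.inl _), .inr (.inl _), _, _ => exact HEq.rfl
  | .inr (.inr _), .inr (.inr _), .inr (.inr _), _, _ => exact HEq.rfl

end

end ArmExt

namespace SpanChain

variable {G H : FinGrpd.{u}} {R : RightAdjointChoice psi.{u} faithful} {n : ℕ}

lemma ext_heq {X Y : SpanChain R G H n} (h : X.vert = Y.vert)
    (h' : ∀ {i j : Fin (n + 1)} (hij : i ≤ j), HEq (X.edge hij) (Y.edge hij)) : X = Y := by
  obtain ⟨o, a, _, _⟩ := X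
  obtain ⟨o', a', _, _⟩ := Y
  obtain rfl : o = o' := h
  have : @a = @a' := by
    funext i j hij
    exact eq_of_heq (h' hij)
  subst this
  rfl

lemma kappa_armExt (X : SpanChain R G H n) {i k l : Fin (n + 1)} (hik : i ≤ k) (hkl : k ≤ l) :
    ArmExt.kappa X.armExt hik hkl = (X.vert i).κ hik hkl := by
  have e₁ : ArmExt.legCell X.armExt (t := ⟨i, l, hik.trans hkl⟩) (t' := ⟨k, l, hkl⟩) (le_refl i)
      ⟨hik, le_rfl⟩ = ((X.vert i).κ hik hkl).hom ≫
        ((X.vert i).κ (le_refl i) (hik.trans hkl)).inv := by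
    change (((X.vert i).κ hik hkl).hom ≫
      ((X.vert i).κ (le_refl i) (hik.trans hkl)).inv ≫ (ρ_ _).inv) ≫ (ρ_ _).hom = _
    simp
  have e₂ : ArmExt.legCell X.armExt (t := ⟨i, l, hik.trans hkl⟩) (t' := ⟨i, i, le_refl i⟩)
      (le_refl i) ⟨le_rfl, hik.trans hkl⟩ = ((X.vert i).κ (le_refl i) (le_refl i)).hom ≫
        ((X.vert i).κ (le_refl i) (hik.trans hkl)).inv := by
    change (((X.vert i).κ (le_refl i) (le_refl i)).hom ≫
      ((X.vert i).κ (le_refl i) (hik.trans hkl)).inv ≫ (ρ_ _).inv) ≫ (ρ_ _).hom = _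
    simp
  ext1
  refine (IsIso.comp_inv_eq _).2 ?_
  refine e₁.trans ?_
  refine Eq.trans ?_ (congrArg (((X.vert i).κ hik hkl).hom ≫ ·) e₂).symm
  rw [(X.vert i).κ_refl]
  exact congrArg (_ ≫ ·) (Category.id_comp _).symm

lemma toSpanChain_armExt (X : SpanChain R G H n) :
    ArmExt.toSpanChain X.armExt (fun i => (X.vert i).hf) R (fun h => (X.edge h).isEquivalence) =
      X := by
  refine ext_heq (funext fun i => ?_) (fun {i j} hij => heq_of_eq ?_)
  · have e : @ArmExt.kappa _ _ _ _ _ _ X.armExt i = @(X.vert i).κ := by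
      funext k l hik hkl
      exact kappa_armExt X hik hkl
    have key : ∀ (κ κ' : ∀ {k l : Fin (n + 1)} (hik : i ≤ k) (hkl : k ≤ l),
        (X.vert i).f hik hkl ≅ (X.vert i).f (le_refl i) (le_refl i)) (h h'), @κ = @κ' →
        (⟨(X.vert i).X, (X.vert i).f, (X.vert i).hf, (X.vert i).g, κ, h⟩ : Vert G H n i) =
          ⟨(X.vert i).X, (X.vert i).f, (X.vert i).hf, (X.vert i).g, κ', h'⟩ := by
      rintro κ κ' h h' e
      subst e
      rfl
    exact key _ _ _ _ e
  · have e : ArmExt.triIso X.armExt hij = (X.edge hij).α := by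
      ext1
      change (ArmExt.kappa X.armExt hij (le_refl j)).inv ≫
        ((X.vert i).κ hij (le_refl j)).hom ≫ (X.edge hij).α.hom ≫
        (X.edge hij).a ◁ ((X.vert j).κ (le_refl j) (le_refl j)).inv = _
      rw [kappa_armExt, (X.vert j).κ_refl]
      exact (Iso.inv_hom_id_assoc _ _).trans
        ((congrArg ((X.edge hij).α.hom ≫ ·) (whiskerLeft_id _ _)).trans (Category.comp_id _))
    have e' : ArmExt.fwdIso X.armExt hij = (X.edge hij).β := by
      ext1
      rfl
    exact congrArg₂ (FSpan.Equiv.mk (X.edge hij).a (X.edge hij).isEquivalence) e e'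

/-- A retraction is given by restricting to the two parts and applying `toSpanChain`. The dependent
pair keeps the functor on the apexes and the legs together while they are transported. -/
lemma toNormal_injective : Function.Injective (toNormal (R := R) (G := G) (H := H) (n := n)) := by
  intro X Y h
  have e : (⟨X.armNormal, X.armExt⟩ : Σ F : NormalFunctor (Fin (n + 1)) FinGrpd.{u},
      Collage.Ext (armRel n) F (twBaseNormal n G H)) = ⟨Y.armNormal, Y.armExt⟩ :=
    eq_of_heq (congr_arg_heq (fun W : NormalFunctor (TwCone n) FinGrpd.{u} =>
      (⟨W.comap (Collage.inlHom _), Collage.Ext.rest W⟩ :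
        Σ F : NormalFunctor (Fin (n + 1)) FinGrpd.{u},
          Collage.Ext (armRel n) F (W.comap (Collage.inrHom _)))) h)
  rw [← toSpanChain_armExt X, ← toSpanChain_armExt Y]
  have key : ∀ (p q : Σ F : NormalFunctor (Fin (n + 1)) FinGrpd.{u},
      Collage.Ext (armRel n) F (twBaseNormal n G H)) (h h' k k'), p = q →
      ArmExt.toSpanChain p.2 h R k = ArmExt.toSpanChain q.2 h' R k' := by
    rintro p q h h' k k' rfl
    rfl
  exact key _ _ _ _ _ _ e

end SpanChain
end
end GlobalBurnside

namespace GlobalBurnside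
open FinCover FinGrpd Limits

noncomputable section

/-! ### Mapping spaces of the effective Burnside category -/

instance isEquivalence_id (G : FinGrpd.{u}) : (fn (𝟙 G)).IsEquivalence :=
  inferInstanceAs (𝟭 G.carrier).IsEquivalence

lemma isHomotopyPullback_of_fwd {P : Type} [Preorder P]
    (Z : NormalFunctor (TwArr P) FinGrpd.{u}) {i k l j : P} (hik : i ≤ k) (hkl : k ≤ l)
    (hlj : l ≤ j) (h₁ : (fn (Z.map (TwArr.le_fwd hik (hkl.trans hlj)))).IsEquivalence)
    (h₂ : (fn (Z.map (TwArr.le_fwd hik hkl))).IsEquivalence) :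
    IsHomotopyPullback _ _ _ _ (Z.squareIso hik hkl hlj) :=
  isHomotopyPullback_of_isEquivalence _ h₁ h₂.full h₂.faithful

lemma isHomotopyPullback_of_bwd {P : Type} [Preorder P]
    (Z : NormalFunctor (TwArr P) FinGrpd.{u}) {i k l j : P} (hik : i ≤ k) (hkl : k ≤ l)
    (hlj : l ≤ j) (h₁ : (fn (Z.map (TwArr.le_bwd (hik.trans hkl) hlj))).IsEquivalence)
    (h₂ : (fn (Z.map (TwArr.le_bwd hkl hlj))).IsEquivalence) :
    IsHomotopyPullback _ _ _ _ (Z.squareIso hik hkl hlj) :=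
  (isHomotopyPullback_of_isEquivalence (Z.squareIso hik hkl hlj).symm h₁ h₂.full h₂.faithful).symm

/-- The vertex given by a finite groupoid. -/
def effPoint (G : FinGrpd.{u}) :
    (effBurnside.{u + 2} FinGrpd.{u} anyFunctor faithful) _⦋0⦌ :=
  { toFunctor := .const _ G
    ingressive := fun _ _ => trivial
    egressive := fun _ _ => faithful_id G
    isPullback := fun _ _ _ => isHomotopyPullback_of_fwd _ _ _ _ (isEquivalence_id G)
      (isEquivalence_id G) : AeffSimplex.{u + 2} FinGrpd.{u} anyFunctor faithful 0 }

lemma faithful_of_isEquivalence {a b : FinGrpd.{u}} {f : a ⟶ b} (h : (fn f).IsEquivalence) :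
    faithful f := h.faithful

lemma faithful_of_iso {a b : FinGrpd.{u}} {f g : a ⟶ b} (e : f ≅ g) (h : faithful g) :
    faithful f := ⟨fun {x y k k'} hk => h.map_injective (by
      have n (q : x ⟶ y) := at_naturality e.hom q
      have h₁ := n k
      change (fn f).map k = (fn f).map k' at hk
      rw [hk, n k'] at h₁
      exact ((cancel_epi _).1 h₁).symm)⟩

namespace SpanChain

variable {G H : FinGrpd.{u}} {R : RightAdjointChoice psi.{u} faithful} {n : ℕ}
  (X : SpanChain R G H n)

/-- Forward maps not ending at `⊤ → ⊤` are edges of the chain or identities of `G`; only those into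
`H` can fail to be equivalences, unless they are the identity at the tip. -/
lemma toNormal_fwd {a b : TwCone n} (h : a ≤ b)
    (h₁ : (TwCone.iso n a).tgt = (TwCone.iso n b).tgt)
    (h₂ : (TwCone.iso n b).src ≠ Fin.last _) : (fn (X.toNormal.map h)).IsEquivalence :=
  match a, b, h, h₁, h₂ with
  | .inl _, .inl _, h, _, _ => (X.edge h).isEquivalence
  | .inl _, .inr (.inl _), _, h₁, _ => ((Fin.castSucc_lt_last _).ne h₁.symm).elim
  | .inl _, .inr (.inr _), _, _, h₂ => (h₂ rfl).elim
  | .inr (.inl _), .inr (.inl _), _, _, _ => isEquivalence_id G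
  | .inr (.inr _), .inr (.inr _), _, _, _ => isEquivalence_id H

lemma toNormal_bwd {a b : TwCone n} (h : a ≤ b)
    (h₁ : (TwCone.iso n a).src = (TwCone.iso n b).src) : faithful (X.toNormal.map h) :=
  match a, b, h, h₁ with
  | .inl _, .inl _, h, _ => faithful_of_isEquivalence (X.edge h).isEquivalence
  | .inl i, .inr (.inl t), h, _ => faithful_of_iso ((X.vert i).κ h t.le) (X.vert i).hf
  | .inl _, .inr (.inr _), _, h₁ => ((Fin.castSucc_lt_last _).ne h₁).elim
  | .inr (.inl _), .inr (.inl _), _, _ => faithful_id G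
  | .inr (.inr _), .inr (.inr _), _, _ => faithful_id H

/-- The simplex of the effective Burnside category attached to a chain of equivalences of spans. -/
def toSimplex : AeffSimplex.{u + 2} FinGrpd.{u} anyFunctor faithful (n + 1) where
  toFunctor := X.toNormal.comap ((TwCone.iso n).symm : TwArr (Fin (n + 1 + 1)) →o TwCone n)
  ingressive _ _ := trivial
  egressive hil hlj := X.toNormal_bwd _ (by
    rw [OrderHomClass.coe_coe, OrderIso.apply_symm_apply,
      OrderIso.apply_symm_apply])
  isPullback {i k l j} hik hkl hlj := by
    -- If `k` is the last vertex, both backward sides of the square are identities; otherwise both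
    -- forward sides are equivalences.
    by_cases hk : k = Fin.last _
    · obtain rfl : l = Fin.last _ := le_antisymm (Fin.le_last _) (hk ▸ hkl)
      obtain rfl : j = Fin.last _ := le_antisymm (Fin.le_last _) hlj
      refine isHomotopyPullback_of_bwd _ _ _ _ ?_ ?_
      · rw [NormalFunctor.map_refl]
        exact isEquivalence_id _
      · rw [NormalFunctor.map_refl]
        exact isEquivalence_id _
    · refine isHomotopyPullback_of_fwd _ _ _ _ (X.toNormal_fwd _ ?_ ?_) (X.toNormal_fwd _ ?_ ?_)
      · rw [OrderHomClass.coe_coe, OrderIso.apply_symm_apply,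
          OrderIso.apply_symm_apply]
      · rw [OrderHomClass.coe_coe, OrderIso.apply_symm_apply]
        exact hk
      · rw [OrderHomClass.coe_coe, OrderIso.apply_symm_apply,
          OrderIso.apply_symm_apply]
      · rw [OrderHomClass.coe_coe, OrderIso.apply_symm_apply]
        exact hk

end SpanChain

section

variable (G H : FinGrpd.{u}) (R : RightAdjointChoice psi.{u} faithful)

/-- The comparison map from chains of equivalences of spans to the mapping space of the effective
Burnside category. -/
def spanChainToHomRight : SpanChain.nerve G H R ⟶
    homRight (effBurnside.{u + 2} FinGrpd.{u} anyFunctor faithful) (effPoint G) (effPoint H) where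
  app n := ↾ fun (X : SpanChain R G H n.unop.len) => ⟨X.toSimplex,
    AeffSimplex.ext (X.toNormal.comap_congr
      (f := ((TwCone.iso n.unop.len).symm : TwArr (Fin (n.unop.len + 1 + 1)) →o TwCone n.unop.len).comp
        (TwArr.mapHom (initFace n.unop).toOrderHom))
      (g := (Collage.inrHom _).comp (Collage.inlHom _))
      fun t => (TwCone.iso n.unop.len).symm_apply_apply (TwCone.base t)),
    AeffSimplex.ext (X.toNormal.comap_congr
      (f := ((TwCone.iso n.unop.len).symm : TwArr (Fin (n.unop.len + 1 + 1)) →o TwCone n.unop.len).comp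
        (TwArr.mapHom (lastVertex n.unop).toOrderHom))
      (g := ((Collage.inrHom _).comp (Collage.inrHom _)).comp
        (⟨fun _ => (), fun _ _ _ => le_rfl⟩ : TwArr (Fin 1) →o Unit))
      fun t => (TwCone.iso n.unop.len).symm_apply_apply TwCone.tip)⟩
  naturality n m θ := by
    ext (X : SpanChain R G H n.unop.len)
    refine Subtype.ext (AeffSimplex.ext ?_)
    refine (congrArg (NormalFunctor.comap
      ((TwCone.iso m.unop.len).symm : TwArr (Fin (m.unop.len + 1 + 1)) →o TwCone m.unop.len))
      (X.toNormal_comap θ.unop.toOrderHom)).trans ?_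
    refine X.toNormal.comap_congr
      (f := (TwCone.map θ.unop.toOrderHom).comp
        ((TwCone.iso m.unop.len).symm : TwArr (Fin (m.unop.len + 1 + 1)) →o TwCone m.unop.len))
      (g := ((TwCone.iso n.unop.len).symm :
        TwArr (Fin (n.unop.len + 1 + 1)) →o TwCone n.unop.len).comp
        (TwArr.mapHom (joinLast θ.unop).toOrderHom)) fun i => ?_
    have := TwCone.iso_joinLast θ.unop ((TwCone.iso m.unop.len).symm i)
    have e := (congrArg (TwArr.mapHom (joinLast θ.unop).toOrderHom)
      ((TwCone.iso m.unop.len).apply_symm_apply i)).symm.trans this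
    exact ((OrderIso.symm_apply_eq (TwCone.iso n.unop.len)).2 e).symm

/-- The defining conditions of the mapping space make the diagram constant away from the arrows `i →
⊤`. For surjectivity, the squares over `j → j` have an identity as bottom side, so the pullback
condition makes the maps between the apexes equivalences. -/
lemma spanChainToHomRight_bijective (n : SimplexCategoryᵒᵖ) :
    Function.Bijective ((spanChainToHomRight G H R).app n) := by
  constructor
  · intro X Y h
    have e := congrArg (fun Z => NormalFunctor.comap
      (TwCone.iso n.unop.len : TwCone n.unop.len →o TwArr (Fin (n.unop.len + 1 + 1)))
        (AeffSimplex.toFunctor Z.1)) h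
    exact SpanChain.toNormal_injective ((NormalFunctor.comap_comap_symm _ _).symm.trans
      (e.trans (NormalFunctor.comap_comap_symm _ _)))
  · rintro ⟨(Z : AeffSimplex.{u + 2} FinGrpd.{u} anyFunctor faithful (n.unop.len + 1)), h, h'⟩
    let W := Z.toFunctor.comap
      (TwCone.iso n.unop.len : TwCone n.unop.len →o TwArr (Fin (n.unop.len + 1 + 1)))
    have hW : W.comap (Collage.inrHom _) = twBaseNormal n.unop.len G H :=
      eq_twBaseNormal _ (congrArg AeffSimplex.toFunctor h)
        (congrArg (fun Y => NormalFunctor.comap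
          (⟨fun _ => ⟨0, 0, le_rfl⟩, fun _ _ _ => le_rfl⟩ : Unit →o TwArr (Fin 1))
          (AeffSimplex.toFunctor Y)) h')
    obtain ⟨d, hd⟩ := Collage.Ext.exists_join W rfl hW
    have h₁ : ∀ i : Fin (n.unop.len + 1), faithful (W.map (i := TwCone.arm i)
        (j := TwCone.base ⟨i, i, le_rfl⟩) (le_refl i)) := fun i =>
      Z.egressive (i := i.castSucc) (l := i.castSucc) (j := Fin.last _) le_rfl (Fin.le_last _)
    have h₂ : ∀ (t t' : TwArr (Fin (n.unop.len + 1))) (h : t ≤ t'),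
        (fn (W.map (i := TwCone.base t) (j := TwCone.base t') h)).IsEquivalence := by
      rw [← hd]
      exact fun _ _ _ => isEquivalence_id G
    have h₃ : ∀ {i j : Fin (n.unop.len + 1)} (h : i ≤ j),
        (fn (W.map (i := TwCone.arm i) (j := TwCone.arm j) h)).IsEquivalence := fun {i j} h =>
      isEquivalence_of_isHomotopyPullback (Z.isPullback (i := i.castSucc) (k := j.castSucc)
        (l := j.castSucc) (j := Fin.last _) (Fin.castSucc_le_castSucc_iff.2 h) le_rfl
        (Fin.le_last _)) (h₂ ⟨i, j, h⟩ ⟨j, j, le_rfl⟩ ⟨h, le_rfl⟩)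
    rw [← hd] at h₁
    refine ⟨ArmExt.toSpanChain d h₁ R h₃, Subtype.ext (AeffSimplex.ext ?_)⟩
    refine (congrArg (NormalFunctor.comap
      ((TwCone.iso n.unop.len).symm : TwArr (Fin (n.unop.len + 1 + 1)) →o TwCone n.unop.len))
      ((ArmExt.toNormal_toSpanChain d h₁ R h₃).trans hd)).trans ?_
    exact NormalFunctor.comap_symm_comap _ _

end
end
end GlobalBurnside

namespace GlobalBurnside
open FinCover FinGrpd Limits

noncomputable section

/-! ### The unfurling on mapping spaces -/

/-- The comparison of the twisted arrow poset of a cone with its sorted version. -/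
def TwCone.ofCone (n : ℕ) : TwArr (Cone n) →o TwCone n where
  toFun a := match a with
    | ⟨.inl i, .inl j, h⟩ => .base ⟨i, j, h⟩
    | ⟨.inl i, .inr _, _⟩ => .arm i
    | ⟨.inr _, .inr _, _⟩ => .tip
  monotone' {a b} h := match a, b, h with
    | ⟨.inl _, .inl _, _⟩, ⟨.inl _, .inl _, _⟩, h => h
    | ⟨.inl _, .inr _, _⟩, ⟨.inl _, .inl _, _⟩, h => h.1
    | ⟨.inl _, .inr _, _⟩, ⟨.inl _, .inr _, _⟩, h => h.1
    | ⟨.inl _, .inr _, _⟩, ⟨.inr _, .inr _, _⟩, _ => trivial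
    | ⟨.inr _, .inr _, _⟩, ⟨.inr _, .inr _, _⟩, _ => le_rfl

lemma TwCone.iso_ofCone {n : ℕ} (a : TwArr (Cone n)) : TwCone.iso n (TwCone.ofCone n a) =
    TwArr.mapHom (Cone.iso n : Cone n →o Fin (n + 1 + 1)) a :=
  match a with
  | ⟨.inl _, .inl _, _⟩ => rfl
  | ⟨.inl _, .inr _, _⟩ => rfl
  | ⟨.inr _, .inr _, _⟩ => rfl

lemma Chain.heq_aux {B : Type u} [Bicategory.{w, v} B] {C D : B} {f f' g g' : C ⟶ D}
    (hf : f = f') (hg : g = g') {m : C ⟶ C} (hm : m = 𝟙 C) {a : f ⟶ g} {c : f' ⟶ m ≫ g'}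
    (h : HEq (a ≫ (λ_ g).inv) c) :
    a ≫ eqToHom hg = eqToHom hf ≫ c ≫ eqToHom hm ▷ g' ≫ (λ_ g').hom := by
  subst hf hg hm
  obtain rfl := eq_of_heq h
  simp

/-- A simplex condition on a diagram indexed by a twisted arrow category. -/
structure IsUnfurlable {P : Type} [Preorder P] (S : NormalFunctor (TwArr P) FinGrpd.{u}) :
    Prop where
  egressive : ∀ {i l j : P} (hil : i ≤ l) (hlj : l ≤ j), faithful (S.map (TwArr.le_bwd hil hlj))
  isPullback : ∀ {i k l j : P} (hik : i ≤ k) (hkl : k ≤ l) (hlj : l ≤ j),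
    IsHomotopyPullback (S.map (TwArr.le_fwd hik (hkl.trans hlj)))
      (S.map (TwArr.le_bwd (hik.trans hkl) hlj)) (S.map (TwArr.le_bwd hkl hlj))
      (S.map (TwArr.le_fwd hik hkl)) (S.squareIso hik hkl hlj)

/-- The unfurling, followed by the core. -/
def RightAdjointChoice.unfurlCore (R : RightAdjointChoice psi.{u} faithful) {P : Type} [Preorder P]
    (S : NormalFunctor (TwArr P) FinGrpd.{u}) (hS : IsUnfurlable S) :
    NormalFunctor P SymMonCat.{u, u + 1} :=
  CatCop.coreNormal (R.unfurlNormal S hS.egressive hS.isPullback)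

lemma RightAdjointChoice.unfurlCore_congr (R : RightAdjointChoice psi.{u} faithful) {P : Type}
    [Preorder P] {S S' : NormalFunctor (TwArr P) FinGrpd.{u}} (hS : IsUnfurlable S) (h : S = S') :
    ∃ hS' : IsUnfurlable S', R.unfurlCore S hS = R.unfurlCore S' hS' := by
  subst h
  exact ⟨hS, rfl⟩

lemma isUnfurlable_const (P : Type) [Preorder P] (G : FinGrpd.{u}) :
    IsUnfurlable (.const (TwArr P) G) where
  egressive _ _ := faithful_id G
  isPullback _ _ _ := isHomotopyPullback_of_fwd _ _ _ _ (isEquivalence_id G) (isEquivalence_id G)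

/-- A constant diagram is restricted from the one-element preorder, where normality leaves no
freedom, and the unfurling commutes strictly with restriction. -/
lemma RightAdjointChoice.unfurlCore_const (R : RightAdjointChoice psi.{u} faithful) {P : Type}
    [Preorder P] (G : FinGrpd.{u}) :
    R.unfurlCore (.const (TwArr P) G) (isUnfurlable_const P G) = .const P (hF G).core :=
  congrArg (fun Z => NormalFunctor.comap (⟨fun _ => (), fun _ _ _ => le_rfl⟩ : P →o Unit) Z)
    (NormalFunctor.eq_const (R.unfurlCore (.const (TwArr Unit) G) (isUnfurlable_const Unit G)))

namespace SpanChain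

variable {G H : FinGrpd.{u}} {R : RightAdjointChoice psi.{u} faithful} {n : ℕ}
  (X : SpanChain R G H n) (hS : IsUnfurlable (X.toNormal.comap (TwCone.ofCone n)))

lemma _root_.GlobalBurnside.groupoid_aux₄ {C : Type*} [Category C] [IsGroupoid C]
    {a b c d e : C} (k₁ : a ⟶ b) (al : b ⟶ c) (al' : c ⟶ b) (k₄ : d ⟶ c) (k₄' : c ⟶ d)
    (k₂ : b ⟶ e) (h : al ≫ al' = 𝟙 _) (h' : k₄' ≫ k₄ = 𝟙 _) :
    (inv (k₁ ≫ al ≫ k₄') ≫ k₁ ≫ k₂ ≫ 𝟙 e) ≫ inv (𝟙 b ≫ k₂ ≫ 𝟙 e) = k₄ ≫ al' := by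
  obtain rfl : al' = inv al := (IsIso.inv_eq_of_hom_inv_id h).symm
  obtain rfl : k₄ = inv k₄' := (IsIso.inv_eq_of_hom_inv_id h').symm
  simp

/-- In the backward part of the cell formula the auxiliary legs of the source apex cancel, leaving
the cell of the equivalence up to the comparison at the target apex. -/
lemma at_α_aux {V W : FSpan G H} (e : V.Equiv W) {f₁ f₂ : V.X ⟶ G} {g₁ : W.X ⟶ G}
    (κ₁ : f₁ ≅ V.f) (κ₂ : f₂ ≅ V.f) (κ₃ : V.f ≅ V.f) (h₃ : κ₃ = Iso.refl _)
    (κ₄ : g₁ ≅ W.f) (A : f₁ ⟶ e.a ≫ g₁) (hA : A = κ₁.hom ≫ e.α.hom ≫ e.a ◁ κ₄.inv)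
    (B : f₁ ⟶ f₂ ≫ 𝟙 G) (hB : B = κ₁.hom ≫ κ₂.inv ≫ (ρ_ _).inv)
    (C : V.f ⟶ f₂ ≫ 𝟙 G) (hC : C = κ₃.hom ≫ κ₂.inv ≫ (ρ_ _).inv) (x : V.X.carrier) :
    (inv (FinGrpd.at A x) ≫ FinGrpd.at B x) ≫ inv (FinGrpd.at C x) =
      FinGrpd.at κ₄.hom ((fn e.a).obj x) ≫ FinGrpd.at e.α.inv x := by
  subst h₃ hA hB hC
  exact groupoid_aux₄ (FinGrpd.at κ₁.hom x) (FinGrpd.at e.α.hom x) (FinGrpd.at e.α.inv x)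
    (FinGrpd.at κ₄.hom ((fn e.a).obj x)) (FinGrpd.at κ₄.inv ((fn e.a).obj x))
    (FinGrpd.at κ₂.inv x) (at_hom_inv e.α x) (at_inv_hom κ₄ _)

/-- The diagram indexed by the twisted arrow poset of the cone. -/
abbrev twNormal : NormalFunctor (TwArr (Cone n)) FinGrpd.{u} := X.toNormal.comap (TwCone.ofCone n)

variable (hS : IsUnfurlable X.twNormal)

lemma unfurl_map_base {i j : Fin (n + 1)} (h : i ≤ j) :
    (R.unfurl X.twNormal hS.egressive).map (i := Collage.inl i) (j := .inl j) h = 𝟙 (hF G) :=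
  R.span_id (faithful_id G) rfl rfl

lemma el_comp_unfurlApp {i j : Fin (n + 1)} (h : i ≤ j) {Z : FinCover G}
    {x : (X.vert i).X.carrier} {y : H.carrier} (m : y ⟶ (fn (X.vert i).sp.g).obj x)
    (ζ : pt ((fn (X.vert i).sp.f).obj x) ⟶ Z) :
    (X.vert i).sp.pEl R m ζ ≫
      R.unfurlApp X.twNormal hS.egressive (i := Collage.inl i) (j := .inl j) (k := .inr ())
        h trivial Z ≫
      (push (fn (X.vert j).g)).map ((R.pullF _ (X.vert j).hf).map
        (NatTrans.app (eqToHom (X.unfurl_map_base hS h)) Z)) =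
    (X.vert j).sp.pEl R (x := (fn (X.edge h).a).obj x) (m ≫ FinGrpd.at (X.edge h).β.hom x)
      (ptMap (γ := (fn (X.vert j).sp.f).obj ((fn (X.edge h).a).obj x))
        (FinGrpd.at (X.edge h).α.inv x) ≫ ζ) := by
  refine (Category.assoc _ _ _).symm.trans ?_
  refine (congrArg (· ≫ _) (R.unfurlEl_comp_unfurlApp X.twNormal hS.egressive
    (i := Collage.inl i) (j := .inl j) (k := .inr ()) h trivial m ζ)).trans ?_
  refine (el_comp_map _ _ _ _ _).trans ?_
  refine congrArg (el (R.adjF (X.vert j).sp.f (X.vert j).hf) (fn (X.vert j).g)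
    (x := (fn (X.edge h).a).obj x) (m ≫ FinGrpd.at (X.edge h).β.hom x)) ?_
  refine (R.el_comp_eqToHom (faithful_id G) rfl rfl _ _).trans ?_
  refine (Category.assoc _ _ _).symm.trans (congrArg (· ≫ ζ) ?_)
  refine (ptMap_comp _ _).symm.trans (congrArg ptMap ?_)
  refine (congrArg (· ≫ _) (Category.comp_id _)).trans ?_
  refine (at_α_aux (X.edge h) ((X.vert i).κ h (le_refl j)) ((X.vert i).κ (le_refl i) h)
    ((X.vert i).κ (le_refl i) (le_refl i)) (X.vert i).κ_refl ((X.vert j).κ (le_refl j) (le_refl j))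
    _ rfl _ rfl _ rfl x).trans ?_
  rw [(X.vert j).κ_refl]
  exact Category.id_comp _

lemma unfurlCore_map_base {i j : Fin (n + 1)} (h : i ≤ j) :
    (R.unfurlCore X.twNormal hS).map (i := Collage.inl i) (j := .inl j) h = 𝟙 (hF G).core :=
  (congrArg CatCop.coreMap (X.unfurl_map_base hS h)).trans (CatCop.coreMap_id _)

/-- The cell for `i ≤ j ≤ ⊤` belongs to a `2`-simplex whose first edge is an identity span, which is
also how the transformation of an equivalence was defined. The `2`-simplices differ by the auxiliary
legs, so the cells are compared on tautological triples. -/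
lemma unfurlCore_cell {i j : Fin (n + 1)} (h : i ≤ j) :
    (show (X.vert i).sp.sym R ⟶ 𝟙 (hF G).core ≫ (X.vert j).sp.sym R from
      (R.unfurlCore X.twNormal hS).cell (i := Collage.inl i) (j := .inl j) (k := .inr ()) h
        trivial ≫ eqToHom (X.unfurlCore_map_base hS h) ▷ (X.vert j).sp.sym R) ≫
      (λ_ ((X.vert j).sp.sym R)).hom = (X.edge h).trans R := by
  refine FSpan.hom_ext_pEl fun x => ?_
  refine Eq.trans ?_ (FSpan.pEl_comp_trans R (X.edge h) _ _).symm
  refine Eq.trans ?_ (X.el_comp_unfurlApp hS h (𝟙 _) (𝟙 _))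
  refine congrArg ((X.vert i).sp.pEl R _ _ ≫ ·) ?_
  have e := CatCop.core_eqToHom_app (X.unfurl_map_base hS h) ⟨pt ((fn (X.vert i).sp.f).obj x)⟩
  refine (Category.comp_id _).trans ?_
  refine congrArg₂ (· ≫ ·) (Category.comp_id _) ?_
  exact congrArg (fun q => (push (fn (X.vert j).g)).map ((R.pullF _ (X.vert j).hf).map q)) e

/-- Both restrictions of the unfurling to the parts of the cone are constant, so it is the normal
functor of some chain, and only the `1`-cells and `2`-cells of that chain have to be compared. -/
lemma unfurlCore_twNormal : R.unfurlCore X.twNormal hS = X.toChain.toNormal := by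
  obtain ⟨Y, hY⟩ := Chain.exists_toNormal (C := (hF G).core) (D := (hF H).core)
    (R.unfurlCore X.twNormal hS) (R.unfurlCore_const (P := Fin (n + 1)) G)
    (R.unfurlCore_const (P := Unit) H)
  rw [← hY]
  refine congrArg Chain.toNormal ?_
  have ho (i : Fin (n + 1)) : Y.obj i = (X.vert i).sp.sym R :=
    eq_of_heq (congr_arg_heq (fun Z : NormalFunctor (Cone n) SymMonCat.{u, u + 1} =>
      Z.map (i := .inl i) (j := .inr ()) trivial) hY)
  refine Chain.ext_map (funext ho) fun {i j} hij => ?_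
  refine (Chain.heq_aux (ho i) (ho j) (X.unfurlCore_map_base hS hij)
    (c := (R.unfurlCore X.twNormal hS).cell (i := Collage.inl i) (j := .inl j) (k := .inr ()) hij
        trivial) (congr_arg_heq (fun Z : NormalFunctor (Cone n) SymMonCat.{u, u + 1} =>
      Z.cell (i := .inl i) (j := .inl j) (k := .inr ()) hij trivial) hY)).trans ?_
  refine congrArg (_ ≫ ·) ?_
  exact (Category.assoc _ _ _).symm.trans (X.unfurlCore_cell hS hij)

end SpanChain
end
end GlobalBurnside

namespace GlobalBurnside
open FinCover FinGrpd Limits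

noncomputable section

/-! ### Full faithfulness -/

lemma _root_.GlobalBurnside.AeffSimplex.isUnfurlable {n : ℕ}
    (s : AeffSimplex.{u + 2} FinGrpd.{u} anyFunctor faithful n) : IsUnfurlable s.toFunctor :=
  ⟨s.egressive, s.isPullback⟩

/-- The composite of the unfurling with the core. -/
def coreUnfurl (R : RightAdjointChoice psi.{u} faithful) :
    effBurnside.{u + 2} FinGrpd.{u} anyFunctor faithful ⟶ duskinNerve SymMonCat.{u, u + 1} :=
  unfurlMap R ≫ coreNerve

lemma SpanChain.unfurlCore_toSimplex {G H : FinGrpd.{u}} {R : RightAdjointChoice psi.{u} faithful}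
    {n : ℕ} (X : SpanChain R G H n) :
    R.unfurlCore X.toSimplex.toFunctor X.toSimplex.isUnfurlable =
      X.toChain.toNormal.comap ((Cone.iso n).symm : Fin (n + 1 + 1) →o Cone n) := by
  have h : X.toSimplex.toFunctor.comap
      (TwArr.mapHom (Cone.iso n : Cone n →o Fin (n + 1 + 1))) = X.twNormal :=
    X.toNormal.comap_congr (f := ((TwCone.iso n).symm : TwArr (Fin (n + 1 + 1)) →o TwCone n).comp
      (TwArr.mapHom (Cone.iso n : Cone n →o Fin (n + 1 + 1)))) (g := TwCone.ofCone n)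
      fun a => (OrderIso.symm_apply_eq (TwCone.iso n)).2 (TwCone.iso_ofCone a).symm
  have hX : IsUnfurlable (X.toSimplex.toFunctor.comap
      (TwArr.mapHom (Cone.iso n : Cone n →o Fin (n + 1 + 1)))) := by
    constructor
    · intro i l j hil hlj
      exact X.toSimplex.egressive ((Cone.iso n).monotone hil) ((Cone.iso n).monotone hlj)
    · intro i k l j hik hkl hlj
      exact X.toSimplex.isPullback ((Cone.iso n).monotone hik) ((Cone.iso n).monotone hkl)
        ((Cone.iso n).monotone hlj)
  obtain ⟨hS, e⟩ := R.unfurlCore_congr hX h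
  refine (NormalFunctor.comap_symm_comap (Cone.iso n) _).symm.trans ?_
  exact congrArg (NormalFunctor.comap _) (e.trans (X.unfurlCore_twNormal hS))

lemma coreUnfurl_effPoint (R : RightAdjointChoice psi.{u} faithful) (G : FinGrpd.{u}) :
    (coreUnfurl R).app _ (effPoint G) = duskinPoint (hF G).core := R.unfurlCore_const G

instance : Unique (TwArr (Fin 1)) where
  default := ⟨0, 0, le_rfl⟩
  uniq _ := TwArr.ext (Subsingleton.elim _ _) (Subsingleton.elim _ _)

lemma exists_eq_effPoint (x : (effBurnside.{u + 2} FinGrpd.{u} anyFunctor faithful) _⦋0⦌) :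
    ∃ G, x = effPoint G :=
  ⟨_, AeffSimplex.ext (NormalFunctor.eq_const (P := TwArr (Fin 1)) (AeffSimplex.toFunctor x))⟩

open MonoidalCategory in
/-- Composition of homotopies with maps. -/
def homotopyComp {K L K' L' : SSet.{u}} {f g : K ⟶ L} (H : SSet.Homotopy f g) (p : K' ⟶ K)
    (q : L ⟶ L') : SSet.Homotopy (p ≫ f ≫ q) (p ≫ g ≫ q) :=
  SSet.RelativeMorphism.Homotopy.mk
    (h := p ▷ _ ≫ H.h ≫ q)
    (h₀ := by
      ext n x
      exact congrArg (q.app n) (ConcreteCategory.congr_hom (NatTrans.congr_app H.h₀ n) (p.app n x)))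
    (h₁ := by
      ext n x
      exact congrArg (q.app n) (ConcreteCategory.congr_hom (NatTrans.congr_app H.h₁ n) (p.app n x)))
    (rel := by ext n ⟨⟨x, hx⟩, _⟩; exact hx.elim)

/-- Homotopy equivalences are invariant under isomorphisms. -/
lemma IsHomotopyEquivalence.of_iso {K L K' L' : SSet.{u}} {f : K ⟶ L} {f' : K' ⟶ L'} (r : K' ≅ K)
    (r' : L' ≅ L) (h : IsHomotopyEquivalence f') (e : r.hom ≫ f = f' ≫ r'.hom) :
    IsHomotopyEquivalence f := by
  obtain ⟨g, ⟨a⟩, ⟨b⟩⟩ := h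
  obtain rfl : f = r.inv ≫ f' ≫ r'.hom := by rw [← e, Iso.inv_hom_id_assoc]
  refine ⟨r'.inv ≫ g ≫ r.hom, ⟨?_⟩, ⟨?_⟩⟩
  · have := homotopyComp a r.inv r.hom
    simpa using this
  · have := homotopyComp b r'.inv r'.hom
    simpa using this

lemma isIso_of_bijective {K L : SSet.{u}} (f : K ⟶ L) (h : ∀ n, Function.Bijective (f.app n)) :
    IsIso f :=
  haveI : ∀ n, IsIso (f.app n) := fun n => (isIso_iff_bijective _).2 (h n)
  NatIso.isIso_of_isIso_app f

lemma isHomotopyEquivalence_homRightMap {X Y K L : SSet.{u}} {f : X ⟶ Y} {x y : X _⦋0⦌}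
    {x' y' : Y _⦋0⦌} (hx : f.app _ x = x') (hy : f.app _ y = y') {r : K ⟶ homRight X x y}
    {r' : L ⟶ homRight Y x' y'} (hr : ∀ n, Function.Bijective (r.app n))
    (hr' : ∀ n, Function.Bijective (r'.app n)) {φ : K ⟶ L} (hφ : IsHomotopyEquivalence φ)
    (h : ∀ n k, f.app _ (r.app n k).1 = (r'.app n (φ.app n k)).1) :
    IsHomotopyEquivalence (homRightMap f x y) := by
  subst hx hy
  have := isIso_of_bijective r hr
  have := isIso_of_bijective r' hr'
  refine hφ.of_iso (asIso r) (asIso r') ?_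
  ext n k
  exact Subtype.ext (h n k)

lemma homRightMap_bijective {X Y : SSet.{u}} (e : X ≅ Y) (x y : X _⦋0⦌) (n) :
    Function.Bijective ((homRightMap e.hom x y).app n) := by
  have he (n) : Function.Bijective (e.hom.app n) := (isIso_iff_bijective _).1 inferInstance
  constructor
  · intro a b h
    exact Subtype.ext ((he _).1 (congrArg Subtype.val h))
  · rintro ⟨b, h, h'⟩
    obtain ⟨a, rfl⟩ := (he _).2 b
    refine ⟨⟨a, (he _).1 ?_, (he _).1 ?_⟩, rfl⟩
    · rw [NatTrans.naturality_apply, h, NatTrans.naturality_apply]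
    · rw [NatTrans.naturality_apply, h']

lemma IsFullyFaithful.iso_comp {X Y Z : SSet.{u}} (e : X ≅ Y) {f : Y ⟶ Z} (h : IsFullyFaithful f) :
    IsFullyFaithful (e.hom ≫ f) := fun x y =>
  have := isIso_of_bijective _ (homRightMap_bijective e x y)
  (h (e.hom.app _ x) (e.hom.app _ y)).of_iso (asIso (homRightMap e.hom x y)).symm (Iso.refl _) (by
    have h : inv (homRightMap e.hom x y) ≫ homRightMap (e.hom ≫ f) x y =
        homRightMap f (e.hom.app _ x) (e.hom.app _ y) :=
      (IsIso.inv_comp_eq (homRightMap e.hom x y)).2 rfl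
    exact h.trans (Category.comp_id _).symm)

/-- After replacing the vertices by constant ones, the map on mapping spaces is conjugate, by the
two isomorphisms with simplicial sets of chains, to `SpanChain.toChainMap`. -/
theorem isFullyFaithful_coreUnfurl (R : RightAdjointChoice psi.{u} faithful) :
    IsFullyFaithful (coreUnfurl R) := by
  intro x y
  obtain ⟨G, rfl⟩ := exists_eq_effPoint x
  obtain ⟨H, rfl⟩ := exists_eq_effPoint y
  exact isHomotopyEquivalence_homRightMap (coreUnfurl_effPoint R G) (coreUnfurl_effPoint R H)
    (spanChainToHomRight_bijective G H R) chainToHomRight_bijective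
    (isHomotopyEquivalence_toChainMap R) fun _ X => X.unfurlCore_toSimplex

theorem isFullyFaithful_coreComp (R : RightAdjointChoice psi.{u} faithful) :
    IsFullyFaithful (coreComp (unfurlMap R)) :=
  IsFullyFaithful.iso_comp globalBurnsideOpIso (isFullyFaithful_coreUnfurl R)

end
end GlobalBurnside

namespace GlobalBurnside
open FinCover FinGrpd Limits

noncomputable section

/-! ### Invertible edges of Duskin nerves -/

/-- The indiscrete preorder on two elements. -/
inductive TwoPoint : Type where
  | fst
  | snd

instance : Preorder TwoPoint where
  le _ _ := True
  le_refl _ := trivial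
  le_trans _ _ _ _ _ := trivial

namespace TwoPoint

variable {B : Type u} [Bicategory.{w, v} B] {a b : B} (e : Bicategory.Equivalence a b)

/-- The objects of the diagram attached to an equivalence. -/
def ob (a b : B) (i : TwoPoint) : B := match i with
  | fst => a
  | snd => b

/-- The `1`-cells of the diagram attached to an equivalence. -/
def map (i j : TwoPoint) : ob a b i ⟶ ob a b j := match i, j with
  | fst, fst => 𝟙 a
  | fst, snd => e.hom
  | snd, fst => e.inv
  | snd, snd => 𝟙 b

/-- The `2`-cells of the diagram attached to an equivalence. -/
def cell (i j k : TwoPoint) : map e i k ≅ map e i j ≫ map e j k := match i, j, k with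
  | fst, fst, fst => (λ_ (𝟙 a)).symm
  | fst, fst, snd => (λ_ e.hom).symm
  | fst, snd, snd => (ρ_ e.hom).symm
  | fst, snd, fst => e.unit
  | snd, snd, snd => (λ_ (𝟙 b)).symm
  | snd, snd, fst => (λ_ e.inv).symm
  | snd, fst, fst => (ρ_ e.inv).symm
  | snd, fst, snd => e.counit.symm

/-- The cocycle law at the alternating quadruple starting with `fst` is a triangle identity of the
adjoint equivalence; `cocycle_aux'` is the other one. All other quadruples contain an identity. -/
lemma cocycle_aux {f : a ⟶ b} {g : b ⟶ a} (η : 𝟙 a ≅ f ≫ g) (θ : g ≫ f ≅ 𝟙 b)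
    (h : leftZigzag η.hom θ.hom = (λ_ f).hom ≫ (ρ_ f).inv) :
    (λ_ f).inv ≫ η.hom ▷ f ≫ (α_ f g f).hom = (ρ_ f).inv ≫ f ◁ θ.inv := by
  rw [leftZigzag, bicategoricalComp] at h
  rw [← cancel_mono (f ◁ θ.hom), ← cancel_epi (λ_ f).hom]
  simpa using h

lemma cocycle_aux' {f : a ⟶ b} {g : b ⟶ a} (η : 𝟙 a ≅ f ≫ g) (θ : g ≫ f ≅ 𝟙 b)
    (h : rightZigzag η.hom θ.hom = (ρ_ g).hom ≫ (λ_ g).inv) :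
    (λ_ g).inv ≫ θ.inv ▷ g ≫ (α_ g f g).hom = (ρ_ g).inv ≫ g ◁ η.hom := by
  rw [rightZigzag, bicategoricalComp] at h
  rw [← cancel_mono ((α_ g f g).inv ≫ θ.hom ▷ g), ← cancel_epi (ρ_ g).hom]
  simpa using h.symm

lemma unit_aux {c : B} : (λ_ (𝟙 c)).inv ≫ (ρ_ (𝟙 c)).hom = 𝟙 _ := by
  simp [unitors_inv_equal]

lemma cocycle_left {c d x : B} {f : c ⟶ d} {g : d ⟶ x} {h : c ⟶ x} (s : h ⟶ f ≫ g) :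
    s ≫ (λ_ f).inv ▷ g ≫ (α_ _ _ _).hom = (λ_ h).inv ≫ 𝟙 c ◁ s := by simp

lemma cocycle_mid {c d x : B} {f : c ⟶ d} {g : d ⟶ x} {h : c ⟶ x} (s : h ⟶ f ≫ g) :
    s ≫ (ρ_ f).inv ▷ g ≫ (α_ _ _ _).hom = s ≫ f ◁ (λ_ g).inv := by simp

lemma cocycle_right {c d : B} {f : c ⟶ d} {g : d ⟶ c} (s : 𝟙 c ⟶ f ≫ g) :
    (λ_ (𝟙 c)).inv ≫ s ▷ 𝟙 c ≫ (α_ _ _ _).hom = s ≫ f ◁ (ρ_ g).inv := by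
  simp [unitors_inv_equal]

/-- The diagram attached to an equivalence. -/
def normal : NormalFunctor TwoPoint B where
  obj := ob a b
  map {i j} _ := map e i j
  cell {i j k} _ _ := (cell e i j k).hom
  map_refl i := match i with
    | fst => rfl
    | snd => rfl
  cell_refl_left {i j} h := match i, j with
    | fst, fst => (unit_left_cell (λ_ (𝟙 a)).inv).trans (Iso.inv_hom_id _)
    | fst, snd => (unit_left_cell (λ_ e.hom).inv).trans (Iso.inv_hom_id _)
    | snd, fst => (unit_left_cell (λ_ e.inv).inv).trans (Iso.inv_hom_id _)
    | snd, snd => (unit_left_cell (λ_ (𝟙 b)).inv).trans (Iso.inv_hom_id _)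
  cell_refl_right {i j} h := match i, j with
    | fst, fst => (unit_right_cell (λ_ (𝟙 a)).inv).trans unit_aux
    | fst, snd => (unit_right_cell (ρ_ e.hom).inv).trans (Iso.inv_hom_id _)
    | snd, fst => (unit_right_cell (ρ_ e.inv).inv).trans (Iso.inv_hom_id _)
    | snd, snd => (unit_right_cell (λ_ (𝟙 b)).inv).trans unit_aux
  cocycle {i j k l} _ _ _ := match i, j, k, l with
    | fst, fst, fst, fst => cocycle_left _
    | fst, fst, fst, snd => cocycle_left _
    | fst, fst, snd, fst => cocycle_left _
    | fst, fst, snd, snd => cocycle_left _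
    | snd, snd, fst, fst => cocycle_left _
    | snd, snd, fst, snd => cocycle_left _
    | snd, snd, snd, fst => cocycle_left _
    | snd, snd, snd, snd => cocycle_left _
    | fst, snd, snd, fst => cocycle_mid _
    | fst, snd, snd, snd => cocycle_mid _
    | snd, fst, fst, fst => cocycle_mid _
    | snd, fst, fst, snd => cocycle_mid _
    | fst, snd, fst, fst => cocycle_right e.unit.hom
    | snd, fst, snd, snd => cocycle_right e.counit.inv
    | fst, snd, fst, snd => cocycle_aux _ _ e.left_triangle_hom
    | snd, fst, snd, fst => cocycle_aux' _ _ e.right_triangle_hom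
  cell_isIso _ _ := inferInstance

end TwoPoint

end
end GlobalBurnside

namespace GlobalBurnside
open FinCover FinGrpd Limits

noncomputable section

section

variable {B : Type u} [Bicategory.{w, v} B]

lemma NormalFunctor.comap_const {P Q : Type} [Preorder P] [Preorder Q] [Unique P]
    (X : NormalFunctor Q B) (f : P →o Q) : X.comap f = .const P (X.obj (f default)) :=
  NormalFunctor.eq_const _

/-- Maps to the indiscrete preorder. -/
def TwoPoint.hom {P : Type} [Preorder P] (f : P → TwoPoint) : P →o TwoPoint :=
  ⟨f, fun _ _ _ => trivial⟩

/-- The edge of the Duskin nerve attached to an equivalence. -/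
theorem exists_invStruct {a b : B} (e : Bicategory.Equivalence a b) :
    ∃ f : SSet.Edge (duskinPoint a) (duskinPoint b), Nonempty f.InvStruct := by
  -- The equivalence extends to a diagram on the indiscrete preorder with two elements. Every map
  -- into it is monotone, so both edges and both triangles of the invertibility structure are
  -- restrictions of `X`.
  let X := TwoPoint.normal e
  let s : Fin 2 → TwoPoint := ![.fst, .snd]
  let s' : Fin 2 → TwoPoint := ![.snd, .fst]
  have h (f : Fin 1 → TwoPoint) : X.comap (TwoPoint.hom f) = duskinPoint (X.obj (f 0)) :=
    X.comap_const (TwoPoint.hom f)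
  have d (f : Fin 3 → TwoPoint) (g : Fin 2 → TwoPoint) (i : Fin 3)
      (hg : ∀ k, f ((SimplexCategory.δ i).toOrderHom k) = g k) :
      (duskinNerve B).δ i (X.comap (TwoPoint.hom f) : (duskinNerve B) _⦋2⦌) =
        X.comap (TwoPoint.hom g) :=
    X.comap_congr (f := (TwoPoint.hom f).comp (SimplexCategory.δ i).toOrderHom)
      (g := TwoPoint.hom g) hg
  have c (p : TwoPoint) : X.comap (TwoPoint.hom (P := Fin 2) fun _ => p) =
      (SSet.Edge.id (duskinPoint (X.obj p))).edge :=
    congrArg (NormalFunctor.comap (SimplexCategory.σ (n := 0) 0).toOrderHom) (h fun _ => p)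
  let f : SSet.Edge (duskinPoint a) (duskinPoint b) :=
    .mk (X.comap (TwoPoint.hom s)) (X.comap_const (P := Fin 1) ((TwoPoint.hom s).comp (SimplexCategory.δ (1 : Fin 2)).toOrderHom))
      (X.comap_const (P := Fin 1) ((TwoPoint.hom s).comp (SimplexCategory.δ (0 : Fin 2)).toOrderHom))
  let g : SSet.Edge (duskinPoint b) (duskinPoint a) :=
    .mk (X.comap (TwoPoint.hom s')) (X.comap_const (P := Fin 1) ((TwoPoint.hom s').comp (SimplexCategory.δ (1 : Fin 2)).toOrderHom))
      (X.comap_const (P := Fin 1) ((TwoPoint.hom s').comp (SimplexCategory.δ (0 : Fin 2)).toOrderHom))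
  exact ⟨f, ⟨⟨g,
    .mk (X.comap (TwoPoint.hom ![.fst, .snd, .fst])) (d _ s _ (Fin.forall_fin_two.2 ⟨rfl, rfl⟩))
      (d _ s' _ (Fin.forall_fin_two.2 ⟨rfl, rfl⟩))
      ((d _ (fun _ => .fst) _ (Fin.forall_fin_two.2 ⟨rfl, rfl⟩)).trans (c .fst)),
    .mk (X.comap (TwoPoint.hom ![.snd, .fst, .snd])) (d _ s' _ (Fin.forall_fin_two.2 ⟨rfl, rfl⟩))
      (d _ s _ (Fin.forall_fin_two.2 ⟨rfl, rfl⟩))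
      ((d _ (fun _ => .snd) _ (Fin.forall_fin_two.2 ⟨rfl, rfl⟩)).trans (c .snd))⟩⟩⟩

end

/-- The functor underlying an edge of the Duskin nerve. -/
def edgeFunctor (f : (duskinNerve SymMonCat.{v, u}) _⦋1⦌) :
    ((NormalFunctor.toNormalData f).obj 0).carrier ⥤
      ((NormalFunctor.toNormalData f).obj 1).carrier :=
  SymMonCat.Fun.functor ((NormalFunctor.toNormalData f).map (Fin.zero_le (1 : Fin 2)))

/-- The natural isomorphism underlying a triangle of the Duskin nerve. -/
def triangleIso (Z : NormalFunctor (Fin 3) SymMonCat.{v, u}) :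
    SymMonCat.Fun.functor (Z.map (Fin.zero_le (Fin.last 2))) ≅
      SymMonCat.Fun.functor (Z.map (Fin.zero_le (1 : Fin 3))) ⋙
        SymMonCat.Fun.functor (Z.map (Fin.le_last (1 : Fin 3))) :=
  haveI := Z.cell_isIso (Fin.zero_le (1 : Fin 3)) (Fin.le_last (1 : Fin 3))
  { hom := SymMonCat.Trans.natTrans
      (Z.cell (Fin.zero_le (1 : Fin 3)) (Fin.le_last (1 : Fin 3)))
    inv := SymMonCat.Trans.natTrans
      (inv (Z.cell (Fin.zero_le (1 : Fin 3)) (Fin.le_last (1 : Fin 3))))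
    hom_inv_id := congrArg SymMonCat.Trans.natTrans (IsIso.hom_inv_id
      (Z.cell (Fin.zero_le (1 : Fin 3)) (Fin.le_last (1 : Fin 3))))
    inv_hom_id := congrArg SymMonCat.Trans.natTrans (IsIso.inv_hom_id
      (Z.cell (Fin.zero_le (1 : Fin 3)) (Fin.le_last (1 : Fin 3)))) }

lemma isEquivalence_of_triangle (Z : NormalFunctor (Fin 3) SymMonCat.{v, u})
    (x : (duskinNerve SymMonCat.{v, u}) _⦋0⦌)
    (h : (duskinNerve _).δ 1 (Z : (duskinNerve SymMonCat.{v, u}) _⦋2⦌) = (SSet.Edge.id x).edge) :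
    (SymMonCat.Fun.functor (Z.map (Fin.zero_le (1 : Fin 3))) ⋙
      SymMonCat.Fun.functor (Z.map (Fin.le_last (1 : Fin 3)))).IsEquivalence := by
  have h₁ : (edgeFunctor (SSet.Edge.id x).edge).IsEquivalence := by
    have e : edgeFunctor (SSet.Edge.id x).edge = 𝟭 _ :=
      congrArg SymMonCat.Fun.functor (NormalFunctor.map_refl x 0)
    rw [e]
    exact inferInstanceAs (𝟭 (vertexObj x).carrier).IsEquivalence
  rw [← h] at h₁
  exact @Functor.isEquivalence_of_iso _ _ _ _ _ _ (triangleIso Z) h₁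

/-- An invertible edge of the Duskin nerve is a symmetric monoidal equivalence. -/
theorem symMonEquivalent_of_invStruct {x y : (duskinNerve SymMonCat.{v, u}) _⦋0⦌}
    (f : SSet.Edge x y) (h : Nonempty f.InvStruct) :
    SymMonEquivalent (vertexObj x).carrier (vertexObj y).carrier := by
  obtain ⟨s⟩ := h
  have h₁ := isEquivalence_of_triangle s.homInvId.simplex x s.homInvId.d₁
  have h₂ := isEquivalence_of_triangle s.invHomId.simplex y s.invHomId.d₁
  -- The two triangles exhibit the composites in both orders as equivalences, and the properties of
  -- `f` are extracted one at a time. The faces are only propositionally equal to the edges, hence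
  -- the rewriting.
  have f₁ : (edgeFunctor f.edge).Faithful := by
    rw [← s.homInvId.d₂]
    exact @Functor.Faithful.of_comp _ _ _ _ _ _ _ _ h₁.faithful
  have g₁ : (edgeFunctor s.inv.edge).Faithful := by
    rw [← s.invHomId.d₂]
    exact @Functor.Faithful.of_comp _ _ _ _ _ _ _ _ h₂.faithful
  have f₂ : (edgeFunctor f.edge).EssSurj := by
    rw [← s.invHomId.d₀]
    exact ⟨fun z => by
      obtain ⟨w, ⟨e⟩⟩ := h₂.essSurj.mem_essImage z
      exact ⟨_, ⟨e⟩⟩⟩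
  have f₃ : (edgeFunctor f.edge).Full := by
    rw [← s.homInvId.d₂]
    rw [← s.homInvId.d₀] at g₁
    exact @Functor.Full.of_comp_faithful _ _ _ _ _ _ _ _ h₁.full g₁
  have key (E : (duskinNerve SymMonCat.{v, u}) _⦋1⦌) (hE : (edgeFunctor E).IsEquivalence)
      (hx : (duskinNerve _).δ 1 E = x) (hy : (duskinNerve _).δ 0 E = y) :
      SymMonEquivalent (vertexObj x).carrier (vertexObj y).carrier := by
    subst hx hy
    exact ⟨edgeFunctor E, hE, ⟨SymMonCat.Fun.braided
      ((NormalFunctor.toNormalData E).map (Fin.zero_le (1 : Fin 2)))⟩⟩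
  exact key f.edge { faithful := f₁, full := f₃, essSurj := f₂ } f.src_eq f.tgt_eq

end
end GlobalBurnside

/-! ### Symmetric monoidal equivalences. -/

namespace GlobalBurnside
open FinCover FinGrpd Limits

noncomputable section

lemma isMonoidal_inverseMonoidal {C D : Type*} [Category C] [MonoidalCategory C] [Category D]
    [MonoidalCategory D] (e : C ≌ D) [e.functor.Monoidal] :
    letI := e.inverseMonoidal
    e.IsMonoidal := by
  let _ := e.toAdjunction.rightAdjointLaxMonoidal
  have h : e.toAdjunction.IsMonoidal := inferInstance
  exact h

section SymMonEquivalent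

open MonoidalCategory Functor

variable {C : Type*} [Category C] [MonoidalCategory C] [SymmetricCategory C]
  {D : Type*} [Category D] [MonoidalCategory D] [SymmetricCategory D]
  {E : Type*} [Category E] [MonoidalCategory E] [SymmetricCategory E]

/-- The inverse of a symmetric monoidal equivalence is symmetric monoidal. -/
@[reducible]
def inverseBraided (e : C ≌ D) [e.functor.Braided] [e.inverse.Monoidal] [e.IsMonoidal] :
    e.inverse.Braided where
  braided X Y := e.functor.map_injective (by
    rw [← cancel_mono (e.counitIso.hom.app (Y ⊗ X)), map_comp, map_comp, Category.assoc,
      Category.assoc, e.functor_map_μ_inverse_comp_counitIso_hom_app_tensor]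
    have h := e.counitIso.hom.naturality (β_ X Y).hom
    have h' := map_braiding e.functor (e.inverse.obj X) (e.inverse.obj Y)
    simp only [Functor.comp_map, Functor.id_map] at h
    refine (congrArg (e.functor.map (LaxMonoidal.μ e.inverse X Y) ≫ ·) h).trans ?_
    rw [← Category.assoc, e.functor_map_μ_inverse_comp_counitIso_hom_app_tensor]
    refine Eq.trans ?_ (congrArg (· ≫ OplaxMonoidal.δ e.functor _ _ ≫
      (e.counitIso.hom.app Y ⊗ₘ e.counitIso.hom.app X)) h').symm
    rw [Category.assoc, Category.assoc, Category.assoc, Monoidal.μ_δ_assoc]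
    exact congrArg (OplaxMonoidal.δ e.functor _ _ ≫ ·)
      (BraidedCategory.braiding_naturality (e.counitIso.hom.app X) (e.counitIso.hom.app Y)))

lemma SymMonEquivalent.symm (h : SymMonEquivalent C D) : SymMonEquivalent D C := by
  obtain ⟨F, hF, ⟨hF'⟩⟩ := h
  let e := F.asEquivalence
  let _ : e.functor.Braided := hF'
  let _ : e.inverse.Monoidal := e.inverseMonoidal
  have : e.IsMonoidal := isMonoidal_inverseMonoidal e
  exact ⟨e.inverse, inferInstance, ⟨inverseBraided e⟩⟩

lemma SymMonEquivalent.trans (h : SymMonEquivalent C D) (h' : SymMonEquivalent D E) :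
    SymMonEquivalent C E := by
  obtain ⟨F, hF, ⟨hF'⟩⟩ := h
  obtain ⟨G, hG, ⟨hG'⟩⟩ := h'
  exact ⟨F ⋙ G, inferInstance, ⟨inferInstance⟩⟩

lemma SymMonEquivalent.pi {I : Type*} {C : I → Type*} [∀ i, Category (C i)]
    [∀ i, MonoidalCategory (C i)] [∀ i, SymmetricCategory (C i)] {D : I → Type*}
    [∀ i, Category (D i)] [∀ i, MonoidalCategory (D i)] [∀ i, SymmetricCategory (D i)]
    (h : ∀ i, SymMonEquivalent (C i) (D i)) : SymMonEquivalent (∀ i, C i) (∀ i, D i) := by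
  choose F hF hF' using h
  have hF' i := (hF' i).some
  refine ⟨Functor.pi F, ?_, ⟨inferInstance⟩⟩
  infer_instance

end SymMonEquivalent

/-- A symmetric monoidal equivalence is an equivalence in the `2`-category of symmetric monoidal
categories. -/
theorem exists_equivalence {C D : SymMonCat.{v, u}} (h : SymMonEquivalent C.carrier D.carrier) :
    Nonempty (Bicategory.Equivalence C D) := by
  obtain ⟨F, hF, ⟨hF'⟩⟩ := h
  let e := F.asEquivalence
  let _ : e.functor.Braided := hF'
  let _ : e.inverse.Monoidal := e.inverseMonoidal
  have : e.IsMonoidal := isMonoidal_inverseMonoidal e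
  let _ : e.inverse.Braided := inverseBraided e
  let f : C ⟶ D := { functor := e.functor : SymMonCat.Fun C D }
  let g : D ⟶ C := { functor := e.inverse : SymMonCat.Fun D C }
  have : NatTrans.IsMonoidal e.unitIso.hom := inferInstanceAs (NatTrans.IsMonoidal e.unit)
  have : NatTrans.IsMonoidal e.counitIso.hom := inferInstanceAs (NatTrans.IsMonoidal e.counit)
  let η : 𝟙 C ≅ f ≫ g := SymMonCat.Fun.mkIso (F := 𝟙 C) (G := f ≫ g) e.unitIso
  let θ : g ≫ f ≅ 𝟙 D := SymMonCat.Fun.mkIso (F := g ≫ f) (G := 𝟙 D) e.counitIso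
  exact ⟨Bicategory.Equivalence.mkOfAdjointifyCounit η θ⟩

end
end GlobalBurnside

/-! ### The essential image in terms of finite groupoids. -/

namespace GlobalBurnside
open FinCover FinGrpd Limits

noncomputable section

/-- The essential image of `core ∘ Ψ` consists of the symmetric monoidal categories equivalent to
some `core h𝔽_G`. -/
theorem inEssImage_coreComp_iff (R : RightAdjointChoice psi.{u} faithful)
    (T : (duskinNerve SymMonCat.{u, u + 1}) _⦋0⦌) :
    InEssImage (coreComp (unfurlMap R)) T ↔
      ∃ G : FinGrpd.{u}, SymMonEquivalent (vertexObj T).carrier (hF G).core.carrier := by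
  constructor
  · rintro ⟨x, f, hf⟩
    obtain ⟨G, hG⟩ := exists_eq_effPoint (globalBurnsideOpIso.{u}.hom.app _ x)
    have h := (symMonEquivalent_of_invStruct f hf).symm
    have e : (coreComp (unfurlMap R)).app _ x = duskinPoint (hF G).core :=
      (congrArg ((coreUnfurl R).app _) hG).trans (coreUnfurl_effPoint R G)
    rw [e] at h
    exact ⟨G, h⟩
  · rintro ⟨G, h⟩
    obtain ⟨e⟩ := exists_equivalence h.symm
    have hT : T = duskinPoint (vertexObj T) := NormalFunctor.eq_const (P := Fin 1) T
    obtain ⟨f, hf⟩ := exists_invStruct e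
    let x := globalBurnsideOpIso.{u}.inv.app _ (effPoint G)
    have hx : globalBurnsideOpIso.{u}.hom.app _ x = effPoint G :=
      congrArg (fun q => q.app _ (effPoint G)) globalBurnsideOpIso.{u}.inv_hom_id
    have e : (coreComp (unfurlMap R)).app _ x = duskinPoint (hF G).core :=
      (congrArg ((coreUnfurl R).app _) hx).trans (coreUnfurl_effPoint R G)
    refine ⟨x, ?_⟩
    rw [e, hT]
    exact ⟨f, hf⟩

end
end GlobalBurnside

/-! ### Symmetric monoidal functors to cores from coherent coprojections. -/

namespace GlobalBurnside
open FinCover FinGrpd Limits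

noncomputable section

section

open MonoidalCategory

variable {W : Type*} [Category W]

/-- A functor from a groupoid, regarded as a functor to the core of its target. -/
def toCore [IsGroupoid W] {C : Type*} [Category C] (F : W ⥤ C) : W ⥤ Core C where
  obj x := ⟨F.obj x⟩
  map f := ⟨F.mapIso (asIso f)⟩
  map_id x := CategoryTheory.Core.hom_ext (F.map_id x)
  map_comp f g := CategoryTheory.Core.hom_ext (F.map_comp f g)

variable [MonoidalCategory W] [SymmetricCategory W]

/-- A functor `F` to a category with finite coproducts together with natural coprojections
exhibiting `F (m ⊗ n)` as a coproduct of `F m` and `F n`, compatibly with the symmetric monoidal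
structure. -/
structure CoproductStructure {C : CatCop.{v, u}} (F : W ⥤ C.carrier) where
  inl : ∀ m n : W, F.obj m ⟶ F.obj (m ⊗ n)
  inr : ∀ m n : W, F.obj n ⟶ F.obj (m ⊗ n)
  isColimit : ∀ m n, Nonempty (IsColimit (BinaryCofan.mk (inl m n) (inr m n)))
  isInitial : Nonempty (IsInitial (F.obj (𝟙_ W)))
  inl_map : ∀ {m m' n n' : W} (f : m ⟶ m') (g : n ⟶ n'),
    inl m n ≫ F.map (f ⊗ₘ g) = F.map f ≫ inl m' n'
  inr_map : ∀ {m m' n n' : W} (f : m ⟶ m') (g : n ⟶ n'),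
    inr m n ≫ F.map (f ⊗ₘ g) = F.map g ≫ inr m' n'
  inl_inl : ∀ m n k, inl m n ≫ inl (m ⊗ n) k ≫ F.map (α_ m n k).hom = inl m (n ⊗ k)
  inr_inl : ∀ m n k,
    inr m n ≫ inl (m ⊗ n) k ≫ F.map (α_ m n k).hom = inl n k ≫ inr m (n ⊗ k)
  inr_assoc : ∀ m n k, inr (m ⊗ n) k ≫ F.map (α_ m n k).hom = inr n k ≫ inr m (n ⊗ k)
  inr_unit : ∀ n, inr (𝟙_ W) n ≫ F.map (λ_ n).hom = 𝟙 _
  inl_unit : ∀ n, inl n (𝟙_ W) ≫ F.map (ρ_ n).hom = 𝟙 _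
  inl_braiding : ∀ m n, inl m n ≫ F.map (β_ m n).hom = inr n m
  inr_braiding : ∀ m n, inr m n ≫ F.map (β_ m n).hom = inl n m

namespace CoproductStructure

variable {C : CatCop.{v, u}} {F : W ⥤ C.carrier} (s : CoproductStructure F)

/-- The comparison isomorphism from the chosen coproduct. -/
def tensorIso (m n : W) : F.obj m ⨿ F.obj n ≅ F.obj (m ⊗ n) :=
  (coprodIsCoprod _ _).coconePointUniqueUpToIso (s.isColimit m n).some

@[simp]
lemma inl_tensorIso (m n : W) : coprod.inl ≫ (s.tensorIso m n).hom = s.inl m n :=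
  (coprodIsCoprod _ _).comp_coconePointUniqueUpToIso_hom (s.isColimit m n).some ⟨.left⟩

@[simp]
lemma inr_tensorIso (m n : W) : coprod.inr ≫ (s.tensorIso m n).hom = s.inr m n :=
  (coprodIsCoprod _ _).comp_coconePointUniqueUpToIso_hom (s.isColimit m n).some ⟨.right⟩

@[simp]
lemma inl_tensorIso_assoc (m n : W) {X : C.carrier} (f : F.obj (m ⊗ n) ⟶ X) :
    coprod.inl ≫ (s.tensorIso m n).hom ≫ f = s.inl m n ≫ f := by
  rw [← Category.assoc, inl_tensorIso]

@[simp]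
lemma inr_tensorIso_assoc (m n : W) {X : C.carrier} (f : F.obj (m ⊗ n) ⟶ X) :
    coprod.inr ≫ (s.tensorIso m n).hom ≫ f = s.inr m n ≫ f := by
  rw [← Category.assoc, inr_tensorIso]

attribute [local instance] CatCop.monoidal CatCop.symmetric

variable [IsGroupoid W]

/-- The symmetric monoidal structure on the functor to the core. -/
def coreMonoidal : (toCore F).CoreMonoidal where
  εIso := CategoryTheory.Core.isoMk (initialIsInitial.uniqueUpToIso s.isInitial.some)
  μIso m n := CategoryTheory.Core.isoMk (s.tensorIso m n)
  μIso_hom_natural_left {m m'} f n := CategoryTheory.Core.hom_ext (by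
    change coprod.map (F.map f) (𝟙 _) ≫ (s.tensorIso m' n).hom =
      (s.tensorIso m n).hom ≫ F.map (f ▷ n)
    rw [← tensorHom_id]
    apply coprod.hom_ext <;> simp [-tensorHom_id, inl_map, inr_map])
  μIso_hom_natural_right {n n'} m f := CategoryTheory.Core.hom_ext (by
    change coprod.map (𝟙 _) (F.map f) ≫ (s.tensorIso m n').hom =
      (s.tensorIso m n).hom ≫ F.map (m ◁ f)
    rw [← id_tensorHom]
    apply coprod.hom_ext <;> simp [-id_tensorHom, inl_map, inr_map])
  associativity m n k := CategoryTheory.Core.hom_ext (by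
    change coprod.map (s.tensorIso m n).hom (𝟙 _) ≫ (s.tensorIso (m ⊗ n) k).hom ≫
        F.map (α_ m n k).hom = (coprod.associator _ _ _).hom ≫
          coprod.map (𝟙 _) (s.tensorIso n k).hom ≫ (s.tensorIso m (n ⊗ k)).hom
    refine coprod.hom_ext (coprod.hom_ext ?_ ?_) ?_ <;>
      simp [inl_inl, inr_inl, inr_assoc, coprod.inl_desc, coprod.inr_desc])
  left_unitality n := CategoryTheory.Core.hom_ext (by
    change (coprod.leftUnitor _).hom = coprod.map (initialIsInitial.uniqueUpToIso
      s.isInitial.some).hom (𝟙 _) ≫ (s.tensorIso (𝟙_ W) n).hom ≫ F.map (λ_ n).hom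
    refine coprod.hom_ext (initialIsInitial.hom_ext _ _) ?_
    simp [inr_unit, coprod.inr_desc])
  right_unitality n := CategoryTheory.Core.hom_ext (by
    change (coprod.rightUnitor _).hom = coprod.map (𝟙 _) (initialIsInitial.uniqueUpToIso
      s.isInitial.some).hom ≫ (s.tensorIso n (𝟙_ W)).hom ≫ F.map (ρ_ n).hom
    refine coprod.hom_ext ?_ (initialIsInitial.hom_ext _ _)
    simp [inl_unit, coprod.inl_desc])

/-- The symmetric monoidal structure on the functor to the core. -/
@[reducible]
def braided : (toCore F).Braided :=
  { s.coreMonoidal.toMonoidal with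
    braided m n := CategoryTheory.Core.hom_ext (by
      change (s.tensorIso m n).hom ≫ F.map (β_ m n).hom =
        (coprod.braiding _ _).hom ≫ (s.tensorIso n m).hom
      apply coprod.hom_ext <;>
        simp [inl_braiding, inr_braiding, coprod.inl_desc, coprod.inr_desc]) }

/-- An equivalence onto the core is a symmetric monoidal equivalence. -/
theorem symMonEquivalent {F : W ⥤ C.carrier} (s : CoproductStructure F)
    (h : (toCore F).IsEquivalence) :
    SymMonEquivalent W C.core.carrier :=
  ⟨toCore F, h, ⟨s.braided⟩⟩

end CoproductStructure

end

end
end GlobalBurnside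

/-! ### Covers given by finite families of objects. -/

namespace GlobalBurnside
open FinCover FinGrpd Limits

noncomputable section

namespace FinCover

section disc

variable {G : FinGrpd.{u}} {S : Type} [Finite S]

/-- The cover given by a finite family of objects. -/
def disc (c : S → G.carrier) : FinCover G where
  total :=
    { carrier := Discrete (ULift.{u} S)
      finite_obj := Finite.of_injective (fun s => s.as.down) fun _ _ h =>
        Discrete.ext (ULift.ext _ _ h) }
  proj := Discrete.functor fun s => c s.down
  thin _ _ := inferInstanceAs (Subsingleton (ULift (PLift _)))

/-- The point of the cover given by a family of objects attached to an index. -/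
def discPt (c : S → G.carrier) (s : S) : pt (c s) ⟶ disc c :=
  ptHom (A := disc c) (⟨⟨s⟩⟩ : Discrete (ULift.{u} S)) (𝟙 (c s))

variable {c : S → G.carrier} {A : FinCover G}

lemma discPt_surjective {γ : G.carrier} (ξ : pt γ ⟶ disc c) :
    ∃ (s : S) (m : γ ⟶ c s), ptMap m ≫ discPt c s = ξ := by
  obtain ⟨⟨⟨s⟩⟩, m, rfl⟩ := ptHom_surjective ξ
  exact ⟨s, m, (ptHom_eq (A := disc c) (⟨⟨s⟩⟩ : Discrete (ULift.{u} S)) m).symm⟩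

lemma discPt_eq_iff {γ : G.carrier} {s s' : S} {m : γ ⟶ c s} {m' : γ ⟶ c s'} :
    ptMap m ≫ discPt c s = ptMap m' ≫ discPt c s' ↔
      ∃ h : s = s', m ≫ eqToHom (congrArg c h) = m' := by
  have e (s : S) (m : γ ⟶ c s) : ptMap m ≫ discPt c s =
      ptHom (A := disc c) (⟨⟨s⟩⟩ : Discrete (ULift.{u} S)) m :=
    (ptHom_eq (A := disc c) (⟨⟨s⟩⟩ : Discrete (ULift.{u} S)) m).symm
  constructor
  · intro h
    rw [e, e] at h
    obtain ⟨k, hk⟩ := (ptHom_eq_iff (A := disc c)).1 h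
    obtain rfl : s = s' := congrArg ULift.down (Discrete.eq_of_hom k)
    refine ⟨rfl, Eq.trans ?_ hk⟩
    obtain rfl : k = 𝟙 _ := Subsingleton.elim (α := ULift (PLift _)) _ _
    exact congrArg (m ≫ ·) 
      ((disc c).proj.map_id (⟨⟨s⟩⟩ : Discrete (ULift.{u} S))).symm
  · rintro ⟨rfl, rfl⟩
    simp

lemma hom_ext_disc {φ ψ : disc c ⟶ A} (h : ∀ s, discPt c s ≫ φ = discPt c s ≫ ψ) : φ = ψ :=
  hom_ext_pt' fun ξ => by
    obtain ⟨s, m, rfl⟩ := discPt_surjective ξ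
    rw [Category.assoc, Category.assoc, h]

lemma exists_discDesc (φ : ∀ s, pt (c s) ⟶ A) : ∃ ψ : disc c ⟶ A, ∀ s, discPt c s ≫ ψ = φ s := by
  obtain ⟨ψ, hψ⟩ := exists_desc (A := disc c) (B := A) (fun a => φ a.as.down) (by
    intro a a' k
    obtain rfl : a = a' := Discrete.ext (Discrete.eq_of_hom k)
    obtain rfl : k = 𝟙 _ := Subsingleton.elim (α := ULift (PLift _)) _ _
    rw [(disc c).proj.map_id, ptMap_id]
    exact Category.id_comp _)
  exact ⟨ψ, fun s => hψ (⟨⟨s⟩⟩ : Discrete (ULift.{u} S))⟩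

/-- The morphism out of the cover given by a family of objects determined by points. -/
def discDesc (φ : ∀ s, pt (c s) ⟶ A) : disc c ⟶ A := (exists_discDesc φ).choose

@[simp]
lemma discPt_discDesc (φ : ∀ s, pt (c s) ⟶ A) (s : S) : discPt c s ≫ discDesc φ = φ s :=
  (exists_discDesc φ).choose_spec s

end disc

end FinCover

end
end GlobalBurnside

/-! ### Covers in terms of representatives of the isomorphism classes. -/

namespace GlobalBurnside
open FinCover FinGrpd Limits

noncomputable section

instance (H : Type u) [Group H] : IsGroupoid (Wreath H) where
  all_isIso {m n} α := ⟨(⟨(Wreath.Hom.perm α).symm,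
    fun i => (Wreath.Hom.elt α ((Wreath.Hom.perm α).symm i))⁻¹⟩ : Wreath.Hom n m),
    Wreath.hom_ext (fun i => (Wreath.Hom.perm α).symm_apply_apply i) (fun i => by
      change (Wreath.Hom.elt α ((Wreath.Hom.perm α).symm (Wreath.Hom.perm α i)))⁻¹ *
        Wreath.Hom.elt α i = 1
      simp),
    Wreath.hom_ext (fun i => (Wreath.Hom.perm α).apply_symm_apply i) (fun i => by
      change Wreath.Hom.elt α ((Wreath.Hom.perm α).symm i) *
        (Wreath.Hom.elt α ((Wreath.Hom.perm α).symm i))⁻¹ = 1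
      simp)⟩

/-- Representatives of the isomorphism classes of objects of `G`, together with identifications of
their automorphism groups. -/
structure Representatives (G : FinGrpd.{u}) {I : Type} (H : I → Type u) [∀ i, Group (H i)] where
  obj : I → G.carrier
  toAut : ∀ i, H i ≃ (obj i ⟶ obj i)
  toAut_one : ∀ i, toAut i 1 = 𝟙 _
  toAut_mul : ∀ i g h, toAut i (g * h) = toAut i h ≫ toAut i g
  eq_of_hom : ∀ {i j}, (obj i ⟶ obj j) → i = j
  exists_hom : ∀ x, ∃ i, Nonempty (x ⟶ obj i)

namespace Representatives

variable {G : FinGrpd.{u}} {I : Type} [Finite I] {H : I → Type u} [∀ i, Group (H i)]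
  (F : Representatives G H)

/-- The cover with `m i` points over the representative `i`. -/
def ob (m : I → ℕ) : FinCover G := disc fun s : Σ i, Fin (m i) => F.obj s.1

/-- The `k`-th point over the representative `i`. -/
def point {m : I → ℕ} (i : I) (k : Fin (m i)) : pt (F.obj i) ⟶ F.ob m :=
  discPt (fun s : Σ i, Fin (m i) => F.obj s.1) ⟨i, k⟩

variable {F} in
lemma point_surjective {m : I → ℕ} {γ : G.carrier} (ξ : pt γ ⟶ F.ob m) :
    ∃ (i : I) (k : Fin (m i)) (a : γ ⟶ F.obj i), ptMap a ≫ F.point i k = ξ := by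
  obtain ⟨⟨i, k⟩, a, rfl⟩ := discPt_surjective ξ
  exact ⟨i, k, a, rfl⟩

variable {F} in
lemma point_eq_iff {m : I → ℕ} {γ : G.carrier} {i : I} {k k' : Fin (m i)} {a a' : γ ⟶ F.obj i} :
    ptMap a ≫ F.point i k = ptMap a' ≫ F.point i k' ↔ k = k' ∧ a = a' := by
  refine discPt_eq_iff.trans ⟨fun ⟨h, h'⟩ => ⟨?_, ?_⟩, ?_⟩
  · exact eq_of_heq (Sigma.mk.inj h).2
  · rw [← h']
    exact (Category.comp_id a).symm
  · rintro ⟨rfl, rfl⟩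
    exact ⟨rfl, Category.comp_id a⟩

lemma hom_ext {m : I → ℕ} {A : FinCover G} {φ ψ : F.ob m ⟶ A}
    (h : ∀ i k, F.point i k ≫ φ = F.point i k ≫ ψ) : φ = ψ :=
  hom_ext_disc fun s => h s.1 s.2

/-- The morphism given by maps of index sets and automorphisms of the representatives. -/
def hom {m n : I → ℕ} (f : ∀ i, Fin (m i) → Fin (n i))
    (e : ∀ i, Fin (m i) → (F.obj i ⟶ F.obj i)) : F.ob m ⟶ F.ob n :=
  discDesc fun s => ptMap (e s.1 s.2) ≫ F.point s.1 (f s.1 s.2)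

@[simp]
lemma point_hom {m n : I → ℕ} (f : ∀ i, Fin (m i) → Fin (n i))
    (e : ∀ i, Fin (m i) → (F.obj i ⟶ F.obj i)) (i : I) (k : Fin (m i)) :
    F.point i k ≫ F.hom f e = ptMap (e i k) ≫ F.point i (f i k) :=
  discPt_discDesc (c := fun s : Σ i, Fin (m i) => F.obj s.1) _ ⟨i, k⟩

@[simp]
lemma point_hom_assoc {m n : I → ℕ} (f : ∀ i, Fin (m i) → Fin (n i))
    (e : ∀ i, Fin (m i) → (F.obj i ⟶ F.obj i)) (i : I) (k : Fin (m i)) {A : FinCover G}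
    (φ : F.ob n ⟶ A) :
    F.point i k ≫ F.hom f e ≫ φ = ptMap (e i k) ≫ F.point i (f i k) ≫ φ := by
  rw [← Category.assoc, point_hom, Category.assoc]

lemma hom_comp_hom {m n l : I → ℕ} (f : ∀ i, Fin (m i) → Fin (n i))
    (e : ∀ i, Fin (m i) → (F.obj i ⟶ F.obj i)) (f' : ∀ i, Fin (n i) → Fin (l i))
    (e' : ∀ i, Fin (n i) → (F.obj i ⟶ F.obj i)) :
    F.hom f e ≫ F.hom f' e' =
      F.hom (fun i k => f' i (f i k)) (fun i k => e i k ≫ e' i (f i k)) :=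
  F.hom_ext fun i k => by simp [ptMap_comp]

lemma hom_id (m : I → ℕ) : F.hom (m := m) (fun _ k => k) (fun _ _ => 𝟙 _) = 𝟙 _ :=
  F.hom_ext fun i k => by simp [ptMap_id]

variable {F} in
lemma hom_eq_iff {m n : I → ℕ} {f f' : ∀ i, Fin (m i) → Fin (n i)}
    {e e' : ∀ i, Fin (m i) → (F.obj i ⟶ F.obj i)} :
    F.hom f e = F.hom f' e' ↔ ∀ i k, f i k = f' i k ∧ e i k = e' i k := by
  constructor
  · intro h i k
    have := congrArg (F.point i k ≫ ·) h
    simp only [point_hom] at this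
    exact point_eq_iff.1 this
  · intro h
    refine F.hom_ext fun i k => ?_
    rw [point_hom, point_hom, (h i k).1, (h i k).2]

/-- A point over one representative can only be sent over an isomorphic representative, which is
then the same one. So a morphism decomposes into maps of index sets and automorphisms. -/
lemma exists_eq_hom {m n : I → ℕ} (φ : F.ob m ⟶ F.ob n) :
    ∃ (f : ∀ i, Fin (m i) → Fin (n i)) (e : ∀ i, Fin (m i) → (F.obj i ⟶ F.obj i)),
      φ = F.hom f e := by
  have h (i : I) (k : Fin (m i)) : ∃ (l : Fin (n i)) (a : F.obj i ⟶ F.obj i),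
      F.point i k ≫ φ = ptMap a ≫ F.point i l := by
    obtain ⟨j, l, a, h⟩ := point_surjective (F.point i k ≫ φ)
    obtain rfl := F.eq_of_hom a
    exact ⟨l, a, h.symm⟩
  choose f e h using h
  exact ⟨f, e, F.hom_ext fun i k => by rw [point_hom, h]⟩

lemma isSumOnPoints (m n : I → ℕ) :
    IsSumOnPoints (F.hom (m := m) (n := fun i => m i + n i) (fun _ k => Fin.castAdd _ k)
        (fun _ _ => 𝟙 _))
      (F.hom (m := n) (n := fun i => m i + n i) (fun _ k => Fin.natAdd _ k) (fun _ _ => 𝟙 _)) := by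
  intro γ
  constructor
  · rintro (ξ | ξ) (η | η) h
    all_goals
      obtain ⟨i, k, a, rfl⟩ := point_surjective ξ
      obtain ⟨j, l, b, rfl⟩ := point_surjective η
      obtain rfl := F.eq_of_hom (inv a ≫ b)
      simp only [Sum.elim_inl, Sum.elim_inr, Category.assoc, point_hom, ptMap_id,
        Category.id_comp, point_eq_iff] at h
    · rw [Fin.castAdd_injective _ _ h.1, h.2]
    · exact absurd (congrArg Fin.val h.1) (by simp; omega)
    · exact absurd (congrArg Fin.val h.1) (by simp; omega)
    · rw [Fin.natAdd_injective _ _ h.1, h.2]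
  · intro ξ
    obtain ⟨i, k, a, rfl⟩ := point_surjective ξ
    induction k using Fin.addCases with
    | left k => exact ⟨.inl (ptMap a ≫ F.point i k), by simp [ptMap_id]⟩
    | right k => exact ⟨.inr (ptMap a ≫ F.point i k), by simp [ptMap_id]⟩

open Wreath

/-- The functor sending a family of numbers to the cover with these numbers of points. -/
def functor : (∀ i, Wreath (H i)) ⥤ FinCover G where
  obj m := F.ob fun i => (m i).card
  map α := F.hom (fun i => Hom.perm (α i)) fun i k => F.toAut i (Hom.elt (α i) k)
  map_id m := (hom_eq_iff.2 fun i _ => ⟨rfl, F.toAut_one i⟩).trans (F.hom_id _)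
  map_comp α β := by
    rw [hom_comp_hom]
    exact hom_eq_iff.2 fun i _ => ⟨rfl, F.toAut_mul i _ _⟩

open MonoidalCategory

lemma hom_comp_functor_map {l : I → ℕ} {m n : ∀ i, Wreath (H i)}
    (f : ∀ i, Fin (l i) → Fin (m i).card) (α : m ⟶ n) :
    F.hom f (fun _ _ => 𝟙 _) ≫ F.functor.map α =
      F.hom (fun i k => Hom.perm (α i) (f i k))
        (fun i k => F.toAut i (Hom.elt (α i) (f i k))) := by
  refine (F.hom_comp_hom f (fun _ _ => 𝟙 _) (fun i => Hom.perm (α i))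
    fun i k => F.toAut i (Hom.elt (α i) k)).trans (hom_eq_iff.2 fun i k => ⟨rfl, ?_⟩)
  exact Category.id_comp _

lemma functor_map_comp_hom {l : I → ℕ} {m n : ∀ i, Wreath (H i)}
    (f : ∀ i, Fin (n i).card → Fin (l i)) (α : m ⟶ n) :
    F.functor.map α ≫ F.hom f (fun _ _ => 𝟙 _) =
      F.hom (fun i k => f i (Hom.perm (α i) k)) (fun i k => F.toAut i (Hom.elt (α i) k)) := by
  refine (F.hom_comp_hom (fun i => Hom.perm (α i)) (fun i k => F.toAut i (Hom.elt (α i) k)) f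
    fun _ _ => 𝟙 _).trans (hom_eq_iff.2 fun i k => ⟨rfl, ?_⟩)
  exact Category.comp_id _

lemma hom_comp_hom_one {l m n : I → ℕ} (f : ∀ i, Fin (l i) → Fin (m i))
    (g : ∀ i, Fin (m i) → Fin (n i)) :
    F.hom f (fun _ _ => 𝟙 _) ≫ F.hom g (fun _ _ => 𝟙 _) =
      F.hom (fun i k => g i (f i k)) (fun _ _ => 𝟙 _) :=
  (F.hom_comp_hom _ _ _ _).trans (hom_eq_iff.2 fun _ _ => ⟨rfl, Category.id_comp _⟩)

lemma hom_comp_hom_comp_functor_map {l l' : I → ℕ} {m n : ∀ i, Wreath (H i)}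
    (f : ∀ i, Fin (l i) → Fin (l' i)) (g : ∀ i, Fin (l' i) → Fin (m i).card) (α : m ⟶ n) :
    F.hom f (fun _ _ => 𝟙 _) ≫ F.hom g (fun _ _ => 𝟙 _) ≫ F.functor.map α =
      F.hom (fun i k => Hom.perm (α i) (g i (f i k)))
        (fun i k => F.toAut i (Hom.elt (α i) (g i (f i k)))) := by
  refine (Category.assoc _ _ _).symm.trans ((congrArg (· ≫ F.functor.map α)
    (F.hom_comp_hom_one f g)).trans ?_)
  exact F.hom_comp_functor_map (fun i k => g i (f i k)) α

/-- The coprojections of the covers with given numbers of points. -/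
def coproductStructure : CoproductStructure (C := hF G) F.functor where
  inl m n := F.hom (m := fun i => (m i).card) (n := fun i => (m i).card + (n i).card)
    (fun _ k => Fin.castAdd _ k) (fun _ _ => 𝟙 _)
  inr m n := F.hom (m := fun i => (n i).card) (n := fun i => (m i).card + (n i).card)
    (fun _ k => Fin.natAdd _ k) (fun _ _ => 𝟙 _)
  isColimit m n := ⟨(F.isSumOnPoints (fun i => (m i).card) fun i => (n i).card).isColimit⟩
  isInitial := ⟨isInitialOfIsEmpty fun γ => ⟨fun ξ => by
    obtain ⟨i, k, -⟩ := point_surjective (F := F) (m := fun _ => 0) ξ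
    exact k.elim0⟩⟩
  inl_map {m m' n n'} f g := by
    refine (F.hom_comp_functor_map (m := m ⊗ n) (n := m' ⊗ n') _ _).trans
      (Eq.trans ?_ (F.functor_map_comp_hom _ f).symm)
    exact hom_eq_iff.2 fun i k => ⟨blockSum_castAdd _ _ k, congrArg _ (Fin.append_left _ _ k)⟩
  inr_map {m m' n n'} f g := by
    refine (F.hom_comp_functor_map (m := m ⊗ n) (n := m' ⊗ n') _ _).trans
      (Eq.trans ?_ (F.functor_map_comp_hom _ g).symm)
    exact hom_eq_iff.2 fun i k => ⟨blockSum_natAdd _ _ k, congrArg _ (Fin.append_right _ _ k)⟩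
  inl_inl m n k := by
    refine (F.hom_comp_hom_comp_functor_map (m := (m ⊗ n) ⊗ k) (n := m ⊗ n ⊗ k)
      (l := fun i => (m i).card) (l' := fun i => (m i).card + (n i).card)
      (fun _ x => Fin.castAdd _ x) (fun _ x => Fin.castAdd _ x) (α_ m n k).hom).trans ?_
    exact hom_eq_iff.2 fun i x => ⟨finCongr_assoc₁ x, F.toAut_one i⟩
  inr_inl m n k := by
    refine (F.hom_comp_hom_comp_functor_map (m := (m ⊗ n) ⊗ k) (n := m ⊗ n ⊗ k)
      (l := fun i => (n i).card) (l' := fun i => (m i).card + (n i).card)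
      (fun _ x => Fin.natAdd _ x) (fun _ x => Fin.castAdd _ x) (α_ m n k).hom).trans
        (Eq.trans ?_ (F.hom_comp_hom_one _ _).symm)
    exact hom_eq_iff.2 fun i x => ⟨finCongr_assoc₂ x, F.toAut_one i⟩
  inr_assoc m n k := by
    refine (F.hom_comp_functor_map (m := (m ⊗ n) ⊗ k) (n := m ⊗ n ⊗ k)
      _ (α_ m n k).hom).trans (Eq.trans ?_ (F.hom_comp_hom_one _ _).symm)
    exact hom_eq_iff.2 fun i x => ⟨finCongr_assoc₃ x, F.toAut_one i⟩
  inr_unit n := by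
    refine (F.hom_comp_functor_map (m := 𝟙_ _ ⊗ n) (n := n) _ (λ_ n).hom).trans
      (Eq.trans ?_ (F.hom_id _))
    exact hom_eq_iff.2 fun i x => ⟨Fin.ext (Nat.zero_add _), F.toAut_one i⟩
  inl_unit n := by
    refine (F.hom_comp_functor_map (m := n ⊗ 𝟙_ _) (n := n) _ (ρ_ n).hom).trans
      (Eq.trans ?_ (F.hom_id _))
    exact hom_eq_iff.2 fun i x => ⟨rfl, F.toAut_one i⟩
  inl_braiding m n := by
    refine (F.hom_comp_functor_map (m := m ⊗ n) (n := n ⊗ m) _ (β_ m n).hom).trans ?_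
    exact hom_eq_iff.2 fun i x => ⟨blockSwap_castAdd _ _ x, F.toAut_one i⟩
  inr_braiding m n := by
    refine (F.hom_comp_functor_map (m := m ⊗ n) (n := n ⊗ m) (l := fun i => (n i).card)
      (fun _ x => Fin.natAdd _ x) (β_ m n).hom).trans ?_
    exact hom_eq_iff.2 fun i x => ⟨blockSwap_natAdd _ _ x, F.toAut_one i⟩

end Representatives

end
end GlobalBurnside

/-! ### The core of `h𝔽_G` as a product of permutative categories. -/

namespace GlobalBurnside
open FinCover FinGrpd Limits

noncomputable section

namespace Representatives

variable {G : FinGrpd.{u}} {I : Type} [Finite I] {H : I → Type u} [∀ i, Group (H i)]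
  (F : Representatives G H)

open MonoidalCategory Wreath

lemma exists_iso_pt (i : I) :
    ∃ m : ∀ i, Wreath (H i), Nonempty (pt (F.obj i) ≅ F.functor.obj m) := by
  classical
  -- One point over the representative `i` and none over the others.
  let c : I → ℕ := fun j => if j = i then 1 else 0
  have hc : 0 < c i := by simp [c]
  have : IsIso (F.point (m := c) i ⟨0, hc⟩) := FinCover.isIso_of_bijective _ fun γ => by
    constructor
    · intro ξ η h
      obtain ⟨a, rfl⟩ := ptMap_surjective ξ
      obtain ⟨b, rfl⟩ := ptMap_surjective η
      rw [(point_eq_iff.1 h).2]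
    · intro ξ
      obtain ⟨j, k, a, rfl⟩ := point_surjective ξ
      obtain rfl : j = i := by
        by_contra h
        have hk := k.2
        simp [c, h] at hk
      refine ⟨ptMap a, point_eq_iff.2 ⟨?_, rfl⟩⟩
      have hk := k.2
      simp only [c, if_true] at hk
      exact Fin.ext (by simp; omega)
  exact ⟨fun j => ⟨c j⟩, ⟨@asIso _ _ _ _ (F.point (m := c) i ⟨0, hc⟩) this⟩⟩

/-- Points are split off one at a time; each is isomorphic to the one-point cover at a
representative, and the functor turns tensor products into coproducts. -/
lemma exists_iso (Z : FinCover G) :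
    ∃ m : ∀ i, Wreath (H i), Nonempty (F.functor.obj m ≅ Z) := by
  induction Z using induction_pt with
  | h₀ Z hZ => exact ⟨𝟙_ _, ⟨F.coproductStructure.isInitial.some.uniqueUpToIso hZ⟩⟩
  | h₁ γ B Z e ih =>
    obtain ⟨m, ⟨e'⟩⟩ := ih
    obtain ⟨i, ⟨a⟩⟩ := F.exists_hom γ
    obtain ⟨l, ⟨e''⟩⟩ := F.exists_iso_pt i
    have : IsIso (ptMap a) := ⟨ptMap (inv a), by rw [← ptMap_comp, IsIso.hom_inv_id, ptMap_id],
      by rw [← ptMap_comp, IsIso.inv_hom_id, ptMap_id]⟩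
    exact ⟨l ⊗ m, ⟨(F.coproductStructure.tensorIso l m).symm ≪≫
      coprod.mapIso (e''.symm ≪≫ (asIso (ptMap a)).symm) e' ≪≫ e⟩⟩

theorem isEquivalence_toCore : (toCore F.functor).IsEquivalence where
  faithful := ⟨fun {m n α β} h => by
    have h' := (hom_eq_iff (F := F) (f := fun i => Hom.perm (α i)) (f' := fun i => Hom.perm (β i))
      (e := fun i k => F.toAut i (Hom.elt (α i) k))
      (e' := fun i k => F.toAut i (Hom.elt (β i) k))).1 (congrArg (fun q => q.iso.hom) h)
    exact funext fun i => Wreath.hom_ext (fun k => (h' i k).1)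
      fun k => (F.toAut i).injective (h' i k).2⟩
  full := ⟨fun {m n} φ => by
    -- The maps of index sets underlying an isomorphism and its inverse are mutually inverse, so
    -- they form permutations as required in the wreath product.
    obtain ⟨f, e, h⟩ := F.exists_eq_hom φ.iso.hom
    obtain ⟨f', e', h'⟩ := F.exists_eq_hom φ.iso.inv
    have h₁ := φ.iso.hom_inv_id
    have h₂ := φ.iso.inv_hom_id
    rw [h, h'] at h₁ h₂
    have h₃ := hom_eq_iff.1 (((F.hom_comp_hom f e f' e').symm.trans h₁).trans
      (F.hom_id fun i => (m i).card).symm)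
    have h₄ := hom_eq_iff.1 (((F.hom_comp_hom f' e' f e).symm.trans h₂).trans
      (F.hom_id fun i => (n i).card).symm)
    let α : m ⟶ n := fun i =>
      (⟨⟨f i, f' i, fun k => (h₃ i k).1, fun k => (h₄ i k).1⟩,
        fun k => (F.toAut i).symm (e i k)⟩ : Wreath.Hom (m i) (n i))
    refine ⟨α, CategoryTheory.Core.hom_ext (Eq.trans ?_ h.symm)⟩
    exact hom_eq_iff.2 fun i k => ⟨rfl, (F.toAut i).apply_symm_apply _⟩⟩
  essSurj := ⟨fun Z => by
    obtain ⟨m, ⟨e⟩⟩ := F.exists_iso Z.of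
    exact ⟨m, ⟨CategoryTheory.Core.isoMk e⟩⟩⟩

/-- The core of `h𝔽_G` is a product of the permutative categories of the automorphism groups of
representatives of the isomorphism classes of objects of `G`. -/
theorem symMonEquivalent (F : Representatives G H) :
    SymMonEquivalent (∀ i, Wreath (H i)) (hF G).core.carrier :=
  F.coproductStructure.symMonEquivalent F.isEquivalence_toCore

end Representatives

/-- The representative of `BH`. -/
def classifyingRepresentatives (H : Type u) [Group H] [Finite H] :
    Representatives (classifying H) (fun _ : Unit => H) where
  obj _ := (⟨⟩ : OneObj H)
  toAut _ := Equiv.refl H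
  toAut_one _ := rfl
  toAut_mul _ _ _ := rfl
  eq_of_hom _ := rfl
  exists_hom _ := ⟨(), ⟨(1 : H)⟩⟩

/-- The core of `h𝔽_{BH}` is the permutative category of `H`. -/
theorem symMonEquivalent_classifying (H : Type u) [Group H] [Finite H] :
    SymMonEquivalent (Wreath H) (hF (classifying H)).core.carrier := by
  refine SymMonEquivalent.trans ?_ (classifyingRepresentatives H).symMonEquivalent
  refine ⟨Functor.pi' fun _ => 𝟭 (Wreath H), ?_, ⟨inferInstance⟩⟩
  exact {
    faithful := ⟨fun h => congrFun h ()⟩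
    full := ⟨fun φ => ⟨φ (), rfl⟩⟩
    essSurj := ⟨fun m => ⟨m (), ⟨eqToIso rfl⟩⟩⟩ }

/-- Every finite groupoid has representatives of its isomorphism classes. -/
theorem exists_representatives (G : FinGrpd.{u}) :
    ∃ (n : ℕ) (H : Fin n → Type u) (_ : ∀ i, Group (H i)) (_ : ∀ i, Finite (H i)),
      Nonempty (Representatives G H) := by
  -- The number of factors is the number of isomorphism classes, and the groups are the automorphism
  -- groups of chosen representatives.
  let e := Finite.equivFin (_root_.Quotient (isIsomorphicSetoid G.carrier))
  let γ (i : Fin _) : G.carrier := (e.symm i).out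
  let θ (x : G.carrier) : Aut x ≃ (x ⟶ x) :=
    ⟨fun a => a.hom, fun a => asIso a, fun _ => Iso.ext rfl, fun _ => rfl⟩
  refine ⟨_, fun i => Aut (γ i), inferInstance, fun i => Finite.of_equiv _ (θ _).symm, ⟨{
    obj := γ
    toAut i := θ (γ i)
    toAut_one _ := rfl
    toAut_mul _ _ _ := rfl
    eq_of_hom {i j} f := e.symm.injective (Quotient.out_equiv_out.1 ⟨asIso f⟩)
    exists_hom x := ⟨e ⟦x⟧, ?_⟩ }⟩⟩
  have h : e.symm (e ⟦x⟧) = ⟦x⟧ := e.symm_apply_apply _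
  obtain ⟨f⟩ : IsIsomorphic x (γ (e ⟦x⟧)) := by
    refine Quotient.exact (s := isIsomorphicSetoid G.carrier) ?_
    rw [Quotient.out_eq, h]
  exact ⟨f.hom⟩

instance (H : Type u) [Group H] [Finite H] : IsGroupoid (OneObj H) := (classifying H).isGroupoid

/-- The disjoint union of the groupoids `BH_i`. -/
def sumClassifying {n : ℕ} (H : Fin n → Type u) [∀ i, Group (H i)] [∀ i, Finite (H i)] :
    FinGrpd.{u} where
  carrier := Σ i, OneObj (H i)
  isGroupoid := ⟨by
    rintro _ _ (@⟨i, x, y, f⟩)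
    exact inferInstanceAs (IsIso ((Sigma.incl (C := fun i => OneObj (H i)) i).map f))⟩
  finite_obj := Finite.of_injective (fun x => x.1) <| by
    rintro ⟨i, x⟩ ⟨j, y⟩ h
    obtain rfl : i = j := h
    rfl
  finite_hom := by
    rintro ⟨i, x⟩ ⟨j, y⟩
    by_cases h : i = j
    · subst h
      exact Finite.of_surjective (fun g : H i => Sigma.SigmaHom.mk (C := fun i => OneObj (H i)) (X := x) (Y := y) g)
        fun ⟨g⟩ => ⟨g, rfl⟩
    · have : IsEmpty ((⟨i, x⟩ : Σ i, OneObj (H i)) ⟶ ⟨j, y⟩) := ⟨fun ⟨_⟩ => h rfl⟩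
      infer_instance

/-- The representatives of the disjoint union of the groupoids `BH_i`. -/
def sumClassifyingRepresentatives {n : ℕ} (H : Fin n → Type u) [∀ i, Group (H i)]
    [∀ i, Finite (H i)] : Representatives (sumClassifying H) H where
  obj i := (⟨i, ⟨⟩⟩ : Σ i, OneObj (H i))
  toAut _ :=
    { toFun := fun g => Sigma.SigmaHom.mk (C := fun i => OneObj (H i)) (X := ⟨⟩) (Y := ⟨⟩) g
      invFun := fun ⟨g⟩ => g
      left_inv := fun _ => rfl
      right_inv := fun ⟨_⟩ => rfl }
  toAut_one _ := rfl
  toAut_mul _ _ _ := rfl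
  eq_of_hom := fun ⟨_⟩ => rfl
  exists_hom := fun ⟨i, _⟩ => ⟨i, ⟨𝟙 (⟨i, ⟨⟩⟩ : Σ i, OneObj (H i))⟩⟩

end
end GlobalBurnside

namespace GlobalBurnside

/-- The categories equivalent to the core of some `h𝔽_G` are the ones equivalent to a finite
product of permutative categories of finite groups. -/
theorem exists_symMonEquivalent_iff (T : Type*) [Category T] [MonoidalCategory T]
    [SymmetricCategory T] :
    (∃ G : FinGrpd.{u}, SymMonEquivalent T (hF G).core.carrier) ↔
      ∃ (n : ℕ) (H : Fin n → Type u) (_ : ∀ i, Group (H i)) (_ : ∀ i, Finite (H i)),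
        SymMonEquivalent T (∀ i, Wreath (H i)) := by
  constructor
  · rintro ⟨G, h⟩
    obtain ⟨n, H, hH, hH', ⟨F⟩⟩ := exists_representatives G
    exact ⟨n, H, hH, hH', h.trans F.symMonEquivalent.symm⟩
  · rintro ⟨n, H, hH, hH', h⟩
    exact ⟨sumClassifying H, h.trans (sumClassifyingRepresentatives H).symMonEquivalent⟩

/-- The categories equivalent to the core of some `h𝔽_G` are the ones equivalent to a finite
product of cores of `h𝔽_{BH}` for finite groups `H`. -/
theorem exists_symMonEquivalent_iff_classifying (T : Type*) [Category T] [MonoidalCategory T]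
    [SymmetricCategory T] :
    (∃ G : FinGrpd.{u}, SymMonEquivalent T (hF G).core.carrier) ↔
      ∃ (n : ℕ) (H : Fin n → Type u) (_ : ∀ i, Group (H i)) (_ : ∀ i, Finite (H i)),
        SymMonEquivalent T (∀ i, (hF (classifying (H i))).core.carrier) := by
  rw [exists_symMonEquivalent_iff]
  refine exists_congr fun n => exists_congr fun H => exists_congr fun _ => exists_congr fun _ => ?_
  have h := SymMonEquivalent.pi fun i => symMonEquivalent_classifying (H i)
  exact ⟨fun h' => h'.trans h, fun h' => h'.trans h.symm⟩

end GlobalBurnside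

/-! ### The main theorem. -/

theorem mainTheorem4 :
    Nonempty (RightAdjointChoice psi.{u} faithful) ∧
    ∀ R : RightAdjointChoice psi.{u} faithful,
      (∃! Ψ : effBurnside.{u + 2} FinGrpd.{u} anyFunctor faithful ⟶
          duskinNerve CatCop.{u, u + 1}, IsUnfurling R Ψ) ∧
      ∀ Ψ : effBurnside.{u + 2} FinGrpd.{u} anyFunctor faithful ⟶ duskinNerve CatCop.{u, u + 1},
        IsUnfurling R Ψ →
          IsFullyFaithful (coreComp Ψ) ∧
          (∀ T : (duskinNerve SymMonCat.{u, u + 1}) _⦋0⦌,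
            (InEssImage (coreComp Ψ) T ↔
              ∃ (n : ℕ) (H : Fin n → Type u) (_ : ∀ i, Group (H i)) (_ : ∀ i, Finite (H i)),
                SymMonEquivalent (vertexObj T).carrier
                  (∀ i, (hF (classifying (H i))).core.carrier)) ∧
            (InEssImage (coreComp Ψ) T ↔
              ∃ (n : ℕ) (H : Fin n → Type u) (_ : ∀ i, Group (H i)) (_ : ∀ i, Finite (H i)),
                SymMonEquivalent (vertexObj T).carrier (∀ i, Wreath (H i)))) ∧
          ∀ (H : Type u) [Group H] [Finite H],
            SymMonEquivalent (Wreath H) (hF (classifying H)).core.carrier := by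
  refine ⟨nonempty_rightAdjointChoice, fun R => ⟨⟨unfurlMap R, isUnfurling_unfurlMap R,
    fun _ h => h.eq_unfurlMap⟩, fun Ψ hΨ => ?_⟩⟩
  -- By uniqueness it is enough to treat the constructed functor.
  obtain rfl := hΨ.eq_unfurlMap
  exact ⟨isFullyFaithful_coreComp R, fun T => ⟨(inEssImage_coreComp_iff R T).trans
    (exists_symMonEquivalent_iff_classifying _), (inEssImage_coreComp_iff R T).trans
      (exists_symMonEquivalent_iff _)⟩, fun H => symMonEquivalent_classifying H⟩
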